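/- **Setting.** Let $\mathcal H$ be a complex Hilbert space and $K_0$ a self-adjoint operator on it with $\langle\psi,K_0\psi\rangle\ge c\|\psi\|^2$ on its domain for some $c>0$. For $r\ge0$ let $\mathcal H^r=D(K_0^r)$ with norm $\|\psi\|_r=\|K_0^r\psi\|$, let $\mathcal H^{-r}$ be the dual of $\mathcal H^r$, and $\mathcal H^{\infty}=\bigcap_r\mathcal H^r$. For every $m\in\mathbb R$ let $\mathcal A_m$ be a linear subspace of $\bigcap_{s\in\mathbb R}\mathcal L(\mathcal H^s,\mathcal H^{s-m})$ such that: (i) $K_0^m\in\mathcal A_m$ for all $m\in\mathbb R$; (ii) $\mathcal A_m$ is a Fréchet space for a countable family of seminorms, continuously embedded in $\bigcap_s\mathcal L(\mathcal H^s,\mathcal H^{s-m})$, and $\mathcal A_{m'}\subseteq\mathcal A_m$ continuously for $m'\le m$; (iii) the product maps $\mathcal A_m\times\mathcal A_n$ continuously into $\mathcal A_{m+n}$; (iv) the commutator maps $\mathcal A_m\times\mathcal A_n$ continuously into $\mathcal A_{m+n-1}$; (v) if an operator $A$ can be written, for every $N>0$, as $A=A^{(N)}+S^{(N)}$ with $A^{(N)}\in\mathcal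 A_m$ and $S^{(N)}\in\bigcap_\kappa\mathcal L(\mathcal H^\kappa,\mathcal H^{\kappa+N})$, then $A\in\mathcal A_m$; (vi) $A\in\mathcal A_m$ implies $A^*\in\mathcal A_m$. For a Fréchet space $\mathcal F$, $C_b^\infty(\mathbb R^k,\mathcal F)$ denotes the smooth maps for which every seminorm of every partial derivative is bounded; $C_b^\infty(\mathbb T^n,\mathcal F)$, with $\mathbb T=\mathbb R/2\pi\mathbb Z$, denotes the smooth maps on the torus. Let $K=(K_1,\dots,K_d)$ be self-adjoint operators, $K_j\ge 0$, $K_j\in\mathcal A_1$, with $[K_i,K_j]=0$ for all $i,j$, such that for all $m$ and all $A\in\mathcal A_m$ the map $\tau\mapsto e^{i\tau\cdot K}Ae^{-i\tau\cdot K}$ belongs to $C_b^\infty(\mathbb R^d,\mathcal A_m)$. Assume that the joint spectrum of $K$ is contained in $\mathbb N^d+\lambda$ for some $\lambda\in\mathbb R^d$ with $\lambda_j\ge0$, and that $K_0=H_0:=\nu\cdot K=\sum_j\nu_jK_j$ for some $\nu\in\mathbb R^d$ with $\nu_j>0$. Write $\nu=\sum_{j=1}^{\tilde d}\tilde\nu_j\mathbf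 v_j$ with $\tilde d\le d$, $\mathbf v_j\in\mathbb Z^d$, and $\tilde\nu\in\mathbb R^{\tilde d}$ with components linearly independent over $\mathbb Q$. **Theorem.** Let $\rho<1$, $\omega\in\mathbb R^n$, and let $W\in C^\infty_b(\mathbb T^n,\mathcal A_\rho)$ be such that $W(\theta)$ is symmetric for every $\theta\in\mathbb T^n$. Assume that $(\tilde\nu,\omega)$ is Diophantine: there are $\gamma>0$ and $\kappa\in\mathbb R$ such that $$|\omega\cdot k+\tilde\nu\cdot\ell|\ge\frac{\gamma}{(|\ell|+|k|)^\kappa}\qquad\text{for all }0\ne(k,\ell)\in\mathbb Z^{n+\tilde d}.$$ Then $H(t)=\nu\cdot K+W(\omega t)$ generates a unique propagator $\mathcal U(t,s)$, $t,s\in\mathbb R$. That is, there is a unique family of unitary operators on $\mathcal H$ with $\mathcal U(s,s)=1$ and $\mathcal U(t,s)\,\mathcal U(s,r)=\mathcal U(t,r)$, with $\mathcal U(t,s)\in\mathcal L(\mathcal H^r)$ and $(t,s)\mapsto\mathcal U(t,s)$ strongly continuous on $\mathcal H^r$ for all $r\in\mathbb R$, such that for $\psi\in\mathcal H^\infty$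 the curve $\psi(t)=\mathcal U(t,s)\psi$ is differentiable in every $\mathcal H^r$ and solves $i\dot\psi(t)=H(t)\psi(t)$. Moreover, for every $r>0$ and every $\epsilon>0$ there is $C_{r,\epsilon}>0$ such that $$\|\mathcal U(t,s)\psi\|_r\le C_{r,\epsilon}\,\langle t-s\rangle^{\epsilon}\,\|\psi\|_r\qquad\text{for all }t,s\in\mathbb R,\ \psi\in\mathcal H^r,\qquad \langle t\rangle:=\sqrt{1+t^2}.$$ -/

import Mathlib

open Filter Topology

noncomputable section

namespace SobolevGrowth

variable {H : Type*} [NormedAddCommGroup H] [InnerProductSpace ℂ H] [CompleteSpace H]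

/-! ### The reference operator and its scale of Hilbert spaces -/

/-- A self-adjoint operator `K₀` with `⟨ψ, K₀ ψ⟩ ≥ c ‖ψ‖²` for some `c > 0`. -/
structure IsPositiveSelfAdjoint (K₀ : H →ₗ.[ℂ] H) : Prop where
  isSelfAdjoint : IsSelfAdjoint K₀
  coercive : ∃ c : ℝ, 0 < c ∧
    ∀ ψ : K₀.domain, c * ‖(ψ : H)‖ ^ 2 ≤ (inner ℂ (ψ : H) (K₀ ψ)).re

/-- The bounded operator `K₀⁻¹`: the operator `T` with `T ψ ∈ D(K₀)` and `K₀ (T ψ) = ψ` for all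
`ψ`. For a positive self-adjoint `K₀` it exists and is unique. -/
def boundedInverse (K₀ : H →ₗ.[ℂ] H) : H →L[ℂ] H :=
  Classical.epsilon fun T : H →L[ℂ] H => ∀ ψ : H, (T ψ, ψ) ∈ K₀.graph

/-- The real power `K₀ ^ r` as an unbounded operator. For `r < 0` it is the bounded operator
`(K₀⁻¹) ^ (-r)` of the continuous functional calculus; for `r ≥ 0` it is the inverse of
`(K₀⁻¹) ^ r`, with domain the range of `(K₀⁻¹) ^ r`. -/
def kpow (K₀ : H →ₗ.[ℂ] H) (r : ℝ) : H →ₗ.[ℂ] H :=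
  if 0 ≤ r then
    ((boundedInverse K₀ ^ r : H →L[ℂ] H).toLinearMap.toPMap ⊤).inverse
  else (boundedInverse K₀ ^ (-r) : H →L[ℂ] H).toLinearMap.toPMap ⊤

open Classical in
/-- `K₀ ^ r ψ`, as a total function of `ψ` (with value `0` outside of the domain). -/
def kpowApply (K₀ : H →ₗ.[ℂ] H) (r : ℝ) (ψ : H) : H :=
  if h : ψ ∈ (kpow K₀ r).domain then kpow K₀ r ⟨ψ, h⟩ else 0

/-- The norm `‖ψ‖_r = ‖K₀ ^ r ψ‖`. For `r ≥ 0` the space `ℋ^r` is the domain of `K₀ ^ r` with this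
norm; for `r < 0` the domain is `H`, and `ℋ^r` (the dual of `ℋ^(-r)`) is its completion. -/
def sobolevNorm (K₀ : H →ₗ.[ℂ] H) (r : ℝ) (ψ : H) : ℝ := ‖kpowApply K₀ r ψ‖

/-- The space `ℋ^∞`, the intersection of all the `ℋ^r`. -/
def smoothVectors (K₀ : H →ₗ.[ℂ] H) : Submodule ℂ H := ⨅ r : ℝ, (kpow K₀ r).domain

/-! ### Graded algebras of operators

An element of `⋂ₛ ℒ(ℋ^s, ℋ^(s-m))` maps `ℋ^∞` to itself and is determined by its restriction to
`ℋ^∞`, which is dense in each `ℋ^s`; conversely a linear map `A` of `ℋ^∞` with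
`‖A ψ‖_(s-m) ≤ C_s ‖ψ‖_s` for all `s` extends to all `ℋ^s`. So these operators are
represented by linear endomorphisms of `ℋ^∞`. -/

/-- Linear endomorphisms of `ℋ^∞`. -/
abbrev SmoothEnd (K₀ : H →ₗ.[ℂ] H) : Type _ := Module.End ℂ (smoothVectors K₀)

/-- `a` is the restriction to `ℋ^∞` of the unbounded operator `L`, which is defined there. -/
def IsRestriction {K₀ : H →ₗ.[ℂ] H} (a : SmoothEnd K₀) (L : H →ₗ.[ℂ] H) : Prop :=
  ∀ ψ : smoothVectors K₀, ((ψ : H), (a ψ : H)) ∈ L.graph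

/-- `a` is symmetric with respect to the scalar product of `H`. -/
def IsSymmetricOp {K₀ : H →ₗ.[ℂ] H} (a : SmoothEnd K₀) : Prop :=
  ∀ u v : smoothVectors K₀, inner ℂ (a u : H) (v : H) = inner ℂ (u : H) (a v : H)

/-- `a` extends to an operator in `ℒ(ℋ^κ, ℋ^(κ+N))` for all real `κ`. -/
def IsSmoothing {K₀ : H →ₗ.[ℂ] H} (N : ℝ) (a : SmoothEnd K₀) : Prop :=
  ∀ κ : ℝ, ∃ C : ℝ, ∀ ψ : smoothVectors K₀,
    sobolevNorm K₀ (κ + N) (a ψ : H) ≤ C * sobolevNorm K₀ κ (ψ : H)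

/-- For every real `m` a linear space `𝒜_m` of operators on `ℋ^∞` with a countable family of
seminorms. -/
structure OperatorClasses (K₀ : H →ₗ.[ℂ] H) where
  /-- The space `𝒜_m` of operators of order `m`. -/
  cls : ℝ → Submodule ℂ (SmoothEnd K₀)
  /-- The seminorms of `𝒜_m`. -/
  seminorm : ∀ m : ℝ, ℕ → Seminorm ℂ (cls m)

namespace OperatorClasses

/-- The sum of the first `N` seminorms of `𝒜_m`. -/
def partialSum {K₀ : H →ₗ.[ℂ] H} (𝒜 : OperatorClasses K₀) (m : ℝ) (N : ℕ) (a : 𝒜.cls m) : ℝ :=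
  ∑ i ∈ Finset.range N, 𝒜.seminorm m i a

/-- `𝒜 = ⋃ₘ 𝒜_m` is a graded algebra and a graded Lie algebra of Fréchet spaces of operators on the
scale of `K₀`, containing the powers of `K₀`, closed under perturbation by smoothing operators and
under adjoints. Continuity of (bi)linear maps is written out in terms of the seminorms. -/
structure IsGradedLieAlgebra {K₀ : H →ₗ.[ℂ] H} (𝒜 : OperatorClasses K₀) : Prop where
  /-- `K₀ ^ m ∈ 𝒜_m`. -/
  pow_mem : ∀ m : ℝ, ∃ a ∈ 𝒜.cls m, IsRestriction a (kpow K₀ m)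
  /-- `𝒜_m` is complete. -/
  complete : ∀ (m : ℝ) (u : ℕ → 𝒜.cls m),
    (∀ (j : ℕ) (ε : ℝ), 0 < ε →
      ∃ N : ℕ, ∀ k ≥ N, ∀ l ≥ N, 𝒜.seminorm m j (u k - u l) < ε) →
    ∃ a : 𝒜.cls m, ∀ j : ℕ, Tendsto (fun k => 𝒜.seminorm m j (u k - a)) atTop (𝓝 0)
  /-- `𝒜_m` is contained in `⋂ₛ ℒ(ℋ^s, ℋ^(s-m))`, with continuous embedding. -/
  embedding : ∀ m s : ℝ, ∃ (N : ℕ) (C : ℝ), ∀ (a : 𝒜.cls m) (ψ : smoothVectors K₀),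
    sobolevNorm K₀ (s - m) ((a : SmoothEnd K₀) ψ : H) ≤
      C * 𝒜.partialSum m N a * sobolevNorm K₀ s (ψ : H)
  /-- `𝒜_m'` is contained in `𝒜_m` for `m' ≤ m`, with continuous embedding. -/
  mono : ∀ m' m : ℝ, m' ≤ m → ∃ hle : 𝒜.cls m' ≤ 𝒜.cls m,
    ∀ j : ℕ, ∃ (N : ℕ) (C : ℝ), ∀ a : 𝒜.cls m',
      𝒜.seminorm m j ⟨a, hle a.2⟩ ≤ C * 𝒜.partialSum m' N a
  /-- The product is continuous from `𝒜_m × 𝒜_n` to `𝒜_(m+n)`. -/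
  mul : ∀ m n : ℝ,
    ∃ hmem : ∀ (a : 𝒜.cls m) (b : 𝒜.cls n), (a : SmoothEnd K₀) * b ∈ 𝒜.cls (m + n),
    ∀ j : ℕ, ∃ (N : ℕ) (C : ℝ), ∀ (a : 𝒜.cls m) (b : 𝒜.cls n),
      𝒜.seminorm (m + n) j ⟨(a : SmoothEnd K₀) * b, hmem a b⟩ ≤
        C * 𝒜.partialSum m N a * 𝒜.partialSum n N b
  /-- The commutator is continuous from `𝒜_m × 𝒜_n` to `𝒜_(m+n-1)`. -/
  commutator : ∀ m n : ℝ,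
    ∃ hmem : ∀ (a : 𝒜.cls m) (b : 𝒜.cls n),
      (a : SmoothEnd K₀) * b - (b : SmoothEnd K₀) * a ∈ 𝒜.cls (m + n - 1),
    ∀ j : ℕ, ∃ (N : ℕ) (C : ℝ), ∀ (a : 𝒜.cls m) (b : 𝒜.cls n),
      𝒜.seminorm (m + n - 1) j ⟨(a : SmoothEnd K₀) * b - (b : SmoothEnd K₀) * a, hmem a b⟩ ≤
        C * 𝒜.partialSum m N a * 𝒜.partialSum n N b
  /-- An operator that is, for every `N > 0`, an element of `𝒜_m` up to an `N`-smoothing operator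
  belongs to `𝒜_m`. (Such an operator maps `ℋ^∞` to `ℋ^∞`.) -/
  smoothing_closed : ∀ (m : ℝ) (a : SmoothEnd K₀),
    (∀ N : ℝ, 0 < N → ∃ b ∈ 𝒜.cls m, ∃ S : SmoothEnd K₀, IsSmoothing N S ∧ a = b + S) →
    a ∈ 𝒜.cls m
  /-- The adjoint of an element of `𝒜_m` belongs to `𝒜_m`. -/
  adjoint_mem : ∀ (m : ℝ), ∀ a ∈ 𝒜.cls m, ∃ b ∈ 𝒜.cls m, ∀ u v : smoothVectors K₀,
    inner ℂ (u : H) (a v : H) = inner ℂ (b u : H) (v : H)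

end OperatorClasses

/-! ### Bounded smooth maps into a Fréchet space -/

/-- The class `C_b^∞(ℝ^k, F)`, for a space `F` with the seminorms `p j`: partial derivatives `D α`
of all orders exist and are continuous, and every seminorm of each of them is bounded. -/
def IsSmoothBounded {F : Type*} [AddCommGroup F] [Module ℂ F] (p : ℕ → Seminorm ℂ F) {k : ℕ}
    (f : (Fin k → ℝ) → F) : Prop :=
  ∃ D : (Fin k → ℕ) → (Fin k → ℝ) → F, D 0 = f ∧
    (∀ (α : Fin k → ℕ) (i : Fin k) (x : Fin k → ℝ) (j : ℕ),
      Tendsto (fun h : ℝ => p j (((h⁻¹ : ℝ) : ℂ) • (D α (x + Pi.single i h) - D α x) -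
        D (α + Pi.single i 1) x)) (𝓝[≠] 0) (𝓝 0)) ∧
    (∀ (α : Fin k → ℕ) (x : Fin k → ℝ) (j : ℕ),
      Tendsto (fun y => p j (D α y - D α x)) (𝓝 x) (𝓝 0)) ∧
    (∀ (α : Fin k → ℕ) (j : ℕ), ∃ C : ℝ, ∀ x : Fin k → ℝ, p j (D α x) ≤ C)

/-! ### Unitary groups, joint spectrum, propagators -/

/-- `G t = e^{itX}`: a strongly continuous one-parameter unitary group on `H` whose generator
extends the operator `iX` on `ℋ^∞`. -/
structure IsUnitaryGroup {K₀ : H →ₗ.[ℂ] H} (X : SmoothEnd K₀) (G : ℝ → H →L[ℂ] H) : Prop where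
  map_zero : G 0 = 1
  map_add : ∀ s t : ℝ, G (s + t) = G s * G t
  isometry : ∀ (t : ℝ) (ψ : H), ‖G t ψ‖ = ‖ψ‖
  continuous : ∀ ψ : H, Continuous fun t => G t ψ
  hasDerivAt : ∀ ψ : smoothVectors K₀,
    HasDerivAt (fun t => G t (ψ : H)) (Complex.I • (X ψ : H)) 0

/-- The unitary operator `e^{iX}`, for `X` essentially self-adjoint on `ℋ^∞` (so that the group is
unique). -/
def expI {K₀ : H →ₗ.[ℂ] H} (X : SmoothEnd K₀) : H →L[ℂ] H :=
  Classical.epsilon (IsUnitaryGroup X) 1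

/-- The linear combination `τ · k = ∑ⱼ τⱼ kⱼ`. -/
def dotOp {K₀ : H →ₗ.[ℂ] H} {d : ℕ} (τ : Fin d → ℝ) (k : Fin d → SmoothEnd K₀) : SmoothEnd K₀ :=
  ∑ j, (τ j : ℂ) • k j

/-- For every `a ∈ 𝒜_m` the map `τ ↦ e^{iτ·K} a e^{-iτ·K}` belongs to `C_b^∞(ℝ^d, 𝒜_m)`.
The identity `F τ = e^{iτ·K} a e^{-iτ·K}` is written as `F τ (e^{iτ·K} φ) = e^{iτ·K} (a φ)`. -/
def HasEgorovProperty {K₀ : H →ₗ.[ℂ] H} (𝒜 : OperatorClasses K₀) {d : ℕ}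
    (k : Fin d → SmoothEnd K₀) : Prop :=
  ∀ (m : ℝ), ∀ a ∈ 𝒜.cls m, ∃ F : (Fin d → ℝ) → 𝒜.cls m,
    IsSmoothBounded (𝒜.seminorm m) F ∧
    ∀ (τ : Fin d → ℝ) (φ ψ : smoothVectors K₀), (ψ : H) = expI (dotOp τ k) (φ : H) →
      ((F τ : SmoothEnd K₀) ψ : H) = expI (dotOp τ k) (a φ : H)

/-- The joint spectrum of commuting self-adjoint operators: the points `μ ∈ ℝ^d` for which there are
unit vectors that are approximate eigenvectors of all `K j` at once, with eigenvalues `μ j`. -/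
def jointSpectrum {d : ℕ} (K : Fin d → H →ₗ.[ℂ] H) : Set (Fin d → ℝ) :=
  {μ | ∀ ε : ℝ, 0 < ε → ∃ ψ : H, ‖ψ‖ = 1 ∧
    ∀ j, ∃ h : ψ ∈ (K j).domain, ‖K j ⟨ψ, h⟩ - (μ j : ℂ) • ψ‖ < ε}

/-- `U t s` is a propagator of `i ∂ₜψ = h(t) ψ` on the scale of `K₀`: a unitary evolution system
which belongs to `ℒ(ℋ^r)` for every real `r`, is strongly continuous on every `ℋ^r`, and such that
for `ψ ∈ ℋ^∞` the curve `t ↦ U t s ψ` is differentiable with respect to every norm `‖·‖_r` and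
solves the equation. -/
structure IsPropagator {K₀ : H →ₗ.[ℂ] H} (h : ℝ → SmoothEnd K₀) (U : ℝ → ℝ → H →L[ℂ] H) :
    Prop where
  refl : ∀ s : ℝ, U s s = 1
  comp : ∀ t s r : ℝ, U t s * U s r = U t r
  isometry : ∀ (t s : ℝ) (ψ : H), ‖U t s ψ‖ = ‖ψ‖
  mem : ∀ r t s : ℝ, ∀ ψ ∈ (kpow K₀ r).domain, U t s ψ ∈ (kpow K₀ r).domain
  bounded : ∀ r t s : ℝ, ∃ C : ℝ, ∀ ψ ∈ (kpow K₀ r).domain,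
    sobolevNorm K₀ r (U t s ψ) ≤ C * sobolevNorm K₀ r ψ
  continuous : ∀ r : ℝ, ∀ ψ ∈ (kpow K₀ r).domain,
    Continuous fun x : ℝ × ℝ => kpowApply K₀ r (U x.1 x.2 ψ)
  hasDerivAt : ∀ (r t s : ℝ) (ψ φ : smoothVectors K₀), (φ : H) = U t s (ψ : H) →
    HasDerivAt (fun t' => kpowApply K₀ r (U t' s (ψ : H)))
      (-Complex.I • kpowApply K₀ r (h t φ : H)) t

/-- The vector `(ν', ω)` is Diophantine. -/
def IsDiophantine {n e : ℕ} (ω : Fin n → ℝ) (ν' : Fin e → ℝ) : Prop :=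
  ∃ γ κ : ℝ, 0 < γ ∧ ∀ (k : Fin n → ℤ) (l : Fin e → ℤ), (k ≠ 0 ∨ l ≠ 0) →
    γ / ((∑ i, |(l i : ℝ)|) + ∑ i, |(k i : ℝ)|) ^ κ ≤
      |(∑ i, ω i * (k i : ℝ)) + ∑ i, ν' i * (l i : ℝ)|

end SobolevGrowth

end

noncomputable section
namespace SobolevGrowth
variable {H : Type*} [NormedAddCommGroup H] [InnerProductSpace ℂ H] [CompleteSpace H]

/-! ### The bounded inverse of the reference operator and its powers -/

section Inverse

variable {K₀ : H →ₗ.[ℂ] H}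

/-! Growth is controlled by an almost conserved energy. Let h = ν·K = K₀ and H = h + W. Suppose that
E(θ) is a smooth family on the torus with leading part K₀^(2R) for which ω·∂E + i[H, E] has order 0.
Along a solution the derivative of ⟨ψ, E(ωt)ψ⟩ is bounded by a multiple of ‖ψ‖², which is constant
by unitarity, so the energy grows at most linearly. The lower order part of E can be absorbed, so
Re⟨ψ, Eψ⟩ is comparable with ‖ψ‖_R² up to multiples of ‖ψ‖², and ‖ψ(t)‖_R² ≤ C(1 + |t - s|)‖ψ(s)‖_R²
(`IsTameFamily.norm_sq_evolution_le`). Interpolation with the conserved norm of H, by the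
Löwner–Heinz inequality (`norm_propagatorConj_interpolate`), turns this into growth with exponent
r/(2R) in ℋ^r, and R is arbitrary.

The family E comes from a normal form (`exists_normalForm`). If H = h + Z + V with Z constant and
commuting with h and V of order at most 1 - M, where M = 2R, then E = h^M works. In general a
solution X of ω·∂X + i[h, X] = Z' - V allows the exponential of ad X to replace V by Z' plus terms
whose order is lower by 1 - ρ, and finitely many rounds suffice. Since E has to be conserved only up
to order 0, the conjugation is purely algebraic: a truncated series of iterated commutators of
symbols (`exists_conjugation`), without unitary transformations or convergence questions.

The homological equation is solved by Fourier series (`IsSmoothAction.exists_homological`). The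
joint spectrum lies in ℕ^d + λ, so each exp(2πi K_j) is a scalar (`flow_two_pi`) and conjugation by
exp(iτ·K) is periodic in τ. Since ν = Σ ν'_i v_i with integer vectors v_i, conjugating V(θ) along
the directions v_i gives a function on a torus of dimension n + e, on which the equation is
constant-coefficient with frequency (ω, ν'). The Diophantine condition makes the small divisors
harmless. The Fourier analysis takes place in the Fréchet spaces 𝒜_m: coefficients are limits of
dyadic averages, and identities are tested on bounded functionals. The Egorov hypothesis concerns
one operator at a time; a Baire argument (`exists_uniform_bound`) makes it uniform.

Existence of the propagator uses only that H(t) is symmetric of order one, Lipschitz in t, with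
[K₀^r, H(t)] of order r (`IsTameFamily`). Regularization by spectral cutoffs of K₀ leaves bounded
equations with energy estimates uniform in the cutoff, and the solutions converge in every ℋ^r. -/

theorem inner_apply_eq_of_isSelfAdjoint {L : H →ₗ.[ℂ] H} (hL : IsSelfAdjoint L) (x y : L.domain) :
    inner ℂ (L x) (y : H) = inner ℂ (x : H) (L y) := by
  have h := LinearPMap.adjoint_isFormalAdjoint (T := L) hL.dense_domain
  rw [LinearPMap.isSelfAdjoint_def.1 hL] at h
  exact h x y

/-- Cauchy–Schwarz applied to coercivity. This lower bound is the source of injectivity, of closed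
range and of the boundedness of K₀⁻¹. -/
theorem IsPositiveSelfAdjoint.norm_le (hK₀ : IsPositiveSelfAdjoint K₀) :
    ∃ c : ℝ, 0 < c ∧ ∀ ψ : K₀.domain, c * ‖(ψ : H)‖ ≤ ‖K₀ ψ‖ := by
  obtain ⟨c, hc, h⟩ := hK₀.coercive
  refine ⟨c, hc, fun ψ => ?_⟩
  by_cases h0 : ‖(ψ : H)‖ = 0
  · rw [h0]; simp
  have hpos : 0 < ‖(ψ : H)‖ := lt_of_le_of_ne (norm_nonneg _) (Ne.symm h0)
  have h1 := (h ψ).trans ((Complex.re_le_norm _).trans (norm_inner_le_norm _ _))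
  nlinarith

/-- The lower bound makes K₀ injective and, as K₀ is closed, makes its range closed. A vector
orthogonal to the range lies in the kernel of the adjoint, that is of K₀ itself, so the range is
everything. -/
theorem exists_boundedInverse (hK₀ : IsPositiveSelfAdjoint K₀) :
    ∃ T : H →L[ℂ] H, ∀ ψ : H, (T ψ, ψ) ∈ K₀.graph := by
  obtain ⟨c, hc, hb⟩ := hK₀.norm_le
  have hsa := hK₀.isSelfAdjoint
  have hinj : Function.Injective K₀.toFun := by
    rw [← LinearMap.ker_eq_bot, LinearMap.ker_eq_bot']
    intro x hx
    have h1 := hb x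
    rw [show K₀ x = 0 from hx, norm_zero] at h1
    have : ‖(x : H)‖ = 0 := le_antisymm (by nlinarith [norm_nonneg (x : H)]) (norm_nonneg _)
    exact Subtype.ext (norm_eq_zero.1 this)
  have hclosed : IsClosed (LinearMap.range K₀.toFun : Set H) := by
    refine IsSeqClosed.isClosed ?_
    intro y z hy hz
    choose x hx using hy
    have hcau : CauchySeq fun n => ((x n : K₀.domain) : H) := by
      have hyc := hz.cauchySeq
      rw [Metric.cauchySeq_iff'] at hyc ⊢
      intro ε hε
      obtain ⟨N, hN⟩ := hyc (c * ε) (by positivity)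
      refine ⟨N, fun n hn => ?_⟩
      have h1 := hN n hn
      rw [dist_eq_norm, ← hx n, ← hx N, ← map_sub] at h1
      have h2 := hb (x n - x N)
      rw [dist_eq_norm]
      have h3 : c * ‖((x n : H) - x N)‖ < c * ε := lt_of_le_of_lt h2 h1
      exact lt_of_mul_lt_mul_left h3 hc.le
    obtain ⟨w, hw⟩ := cauchySeq_tendsto_of_complete hcau
    have hg : IsClosed (K₀.graph : Set (H × H)) := hsa.isClosed
    have hmem : (w, z) ∈ K₀.graph := by
      refine hg.mem_of_tendsto (hw.prodMk_nhds hz) (Eventually.of_forall fun n => ?_)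
      rw [← hx n]
      exact K₀.mem_graph (x n)
    obtain ⟨a, ha, hb'⟩ := (LinearPMap.mem_graph_iff _).1 hmem
    exact ⟨a, hb'⟩
  have hrange : LinearMap.range K₀.toFun = ⊤ := by
    have h1 : (LinearMap.range K₀.toFun)ᗮ = ⊥ := by
      rw [Submodule.eq_bot_iff]
      intro y hy
      have h2 : ∀ x : K₀.domain, inner ℂ (0 : H) (x : H) = inner ℂ y (K₀ x) := by
        intro x
        have h3 := (Submodule.mem_orthogonal _ _).1 hy (K₀ x) ⟨x, rfl⟩
        rw [inner_zero_left, ← inner_conj_symm, h3, map_zero]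
      have hy' : y ∈ K₀.adjoint.domain := LinearPMap.mem_adjoint_domain_of_exists _ ⟨0, h2⟩
      have h4 := LinearPMap.adjoint_apply_eq hsa.dense_domain ⟨y, hy'⟩ h2
      have h5 : (y, (0 : H)) ∈ K₀.adjoint.graph := by
        rw [← h4]
        exact K₀.adjoint.mem_graph ⟨y, hy'⟩
      rw [LinearPMap.isSelfAdjoint_def.1 hsa] at h5
      obtain ⟨a, ha, hb'⟩ := (LinearPMap.mem_graph_iff _).1 h5
      have h6 : a = 0 := hinj (by rw [map_zero]; exact hb')
      have h7 : (a : H) = y := ha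
      rw [← h7, h6]; rfl
    have h2 := Submodule.topologicalClosure_eq_top_iff.2 h1
    rwa [IsClosed.submodule_topologicalClosure_eq hclosed] at h2
  let e := LinearEquiv.ofBijective K₀.toFun ⟨hinj, LinearMap.range_eq_top.1 hrange⟩
  have he : ∀ ψ, K₀ (e.symm ψ) = ψ := fun ψ => e.apply_symm_apply ψ
  refine ⟨LinearMap.mkContinuous (K₀.domain.subtype ∘ₗ e.symm.toLinearMap) c⁻¹ fun ψ => ?_,
    fun ψ => ?_⟩
  · have h := hb (e.symm ψ)
    rw [he] at h
    rw [inv_mul_eq_div, le_div_iff₀ hc, mul_comm]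
    exact h
  · have := K₀.mem_graph (e.symm ψ)
    rwa [he] at this

variable (hK₀ : IsPositiveSelfAdjoint K₀)
include hK₀

theorem boundedInverse_mem_graph (ψ : H) : (boundedInverse K₀ ψ, ψ) ∈ K₀.graph :=
  Classical.epsilon_spec (p := fun T : H →L[ℂ] H => ∀ ψ : H, (T ψ, ψ) ∈ K₀.graph)
    (exists_boundedInverse hK₀) ψ

theorem boundedInverse_apply (x : K₀.domain) : boundedInverse K₀ (K₀ x) = x := by
  obtain ⟨c, hc, hb⟩ := hK₀.norm_le
  obtain ⟨a, ha, ha'⟩ := (LinearPMap.mem_graph_iff _).1 (boundedInverse_mem_graph hK₀ (K₀ x))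
  have h1 := hb (a - x)
  rw [K₀.map_sub, ha', sub_self, norm_zero] at h1
  have h2 : ‖((a - x : K₀.domain) : H)‖ = 0 :=
    le_antisymm (by nlinarith [norm_nonneg ((a - x : K₀.domain) : H)]) (norm_nonneg _)
  rw [norm_eq_zero, AddSubgroupClass.coe_sub, sub_eq_zero] at h2
  rw [← h2, ha]

theorem boundedInverse_isPositive : (boundedInverse K₀).IsPositive := by
  obtain ⟨c, hc, hb⟩ := hK₀.coercive
  rw [ContinuousLinearMap.isPositive_iff]
  refine ⟨fun φ ψ => ?_, fun ψ => ?_⟩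
  · obtain ⟨a, ha, ha'⟩ := (LinearPMap.mem_graph_iff _).1 (boundedInverse_mem_graph hK₀ φ)
    obtain ⟨b, hb, hb'⟩ := (LinearPMap.mem_graph_iff _).1 (boundedInverse_mem_graph hK₀ ψ)
    have := inner_apply_eq_of_isSelfAdjoint hK₀.isSelfAdjoint a b
    dsimp only at ha ha' hb hb'
    simp only [ContinuousLinearMap.coe_coe]
    rw [← ha, ← hb, ← ha', ← hb', this]
  · obtain ⟨a, ha, ha'⟩ := (LinearPMap.mem_graph_iff _).1 (boundedInverse_mem_graph hK₀ ψ)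
    have h1 := inner_apply_eq_of_isSelfAdjoint hK₀.isSelfAdjoint a a
    have h2 := hb a
    dsimp only at ha ha'
    rw [← ha, ← ha', RCLike.nonneg_iff]
    refine ⟨le_trans (by positivity) h2, ?_⟩
    have h3 : inner ℂ (a : H) (K₀ a) = starRingEnd ℂ (inner ℂ (a : H) (K₀ a)) := by
      rw [inner_conj_symm, h1]
    exact RCLike.conj_eq_iff_im.1 h3.symm

theorem boundedInverse_nonneg : 0 ≤ boundedInverse K₀ :=
  (ContinuousLinearMap.nonneg_iff_isPositive _).2 (boundedInverse_isPositive hK₀)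

theorem boundedInverse_injective {ψ : H} (h : boundedInverse K₀ ψ = 0) : ψ = 0 := by
  have := boundedInverse_mem_graph hK₀ ψ
  rw [h] at this
  exact K₀.graph_fst_eq_zero_snd this rfl

theorem boundedInverse_isSelfAdjoint : IsSelfAdjoint (boundedInverse K₀) :=
  (boundedInverse_isPositive hK₀).isSelfAdjoint

theorem rpow_eq_cfc (r : ℝ) :
    boundedInverse K₀ ^ r = cfc (fun x : ℝ => x ^ r) (boundedInverse K₀) :=
  CFC.rpow_eq_cfc_real (boundedInverse_nonneg hK₀)

theorem spectrum_boundedInverse_nonneg {x : ℝ} (hx : x ∈ spectrum ℝ (boundedInverse K₀)) : 0 ≤ x :=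
  spectrum_nonneg_of_nonneg (boundedInverse_nonneg hK₀) hx

/-- The spectrum of K₀⁻¹ may contain 0, so additivity is limited to nonnegative exponents, for which
t ↦ t^r is continuous there. -/
theorem rpow_add' {r s : ℝ} (hr : 0 ≤ r) (hs : 0 ≤ s) :
    boundedInverse K₀ ^ (r + s) = boundedInverse K₀ ^ r * boundedInverse K₀ ^ s := by
  rw [rpow_eq_cfc hK₀, rpow_eq_cfc hK₀, rpow_eq_cfc hK₀,
    ← cfc_mul _ _ _ (Real.continuous_rpow_const hr).continuousOn
      (Real.continuous_rpow_const hs).continuousOn]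
  refine cfc_congr fun x hx => ?_
  exact Real.rpow_add_of_nonneg (spectrum_boundedInverse_nonneg hK₀ hx) hr hs

theorem rpow_add_apply {r s : ℝ} (hr : 0 ≤ r) (hs : 0 ≤ s) (ψ : H) :
    (boundedInverse K₀ ^ (r + s)) ψ = (boundedInverse K₀ ^ r) ((boundedInverse K₀ ^ s) ψ) := by
  rw [rpow_add' hK₀ hr hs]; rfl

theorem rpow_zero_apply (ψ : H) : (boundedInverse K₀ ^ (0 : ℝ)) ψ = ψ := by
  rw [CFC.rpow_zero _ (boundedInverse_nonneg hK₀)]; rfl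

theorem rpow_one_apply (ψ : H) : (boundedInverse K₀ ^ (1 : ℝ)) ψ = boundedInverse K₀ ψ := by
  rw [CFC.rpow_one _ (boundedInverse_nonneg hK₀)]

theorem rpow_isSelfAdjoint (r : ℝ) : IsSelfAdjoint (boundedInverse K₀ ^ r : H →L[ℂ] H) := by
  rw [rpow_eq_cfc hK₀]
  exact cfc_predicate _ _

theorem inner_rpow (r : ℝ) (φ ψ : H) :
    inner ℂ ((boundedInverse K₀ ^ r) φ) ψ = inner ℂ φ ((boundedInverse K₀ ^ r) ψ) := by
  have := (ContinuousLinearMap.isSelfAdjoint_iff_isSymmetric.1 (rpow_isSelfAdjoint hK₀ r)) φ ψ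
  exact this

theorem rpow_natCast_injective (n : ℕ) {ψ : H} (h : (boundedInverse K₀ ^ n) ψ = 0) : ψ = 0 := by
  induction n with
  | zero => simpa using h
  | succ n ih => 
    rw [pow_succ'] at h
    exact ih (boundedInverse_injective hK₀ h)

/-- An integer power n ≥ r is injective as an iterate of an injective map, and it factors through
the power r. -/
theorem rpow_injective {r : ℝ} (hr : 0 ≤ r) {ψ : H} (h : (boundedInverse K₀ ^ r) ψ = 0) :
    ψ = 0 := by
  obtain ⟨n, hn⟩ := exists_nat_ge r
  refine rpow_natCast_injective hK₀ n ?_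
  rw [← CFC.rpow_natCast _ _ (boundedInverse_nonneg hK₀)]
  rw [show (n : ℝ) = (n - r) + r by ring, rpow_add_apply hK₀ (by linarith) hr, h, map_zero]

theorem rpow_inj {r : ℝ} (hr : 0 ≤ r) {φ ψ : H}
    (h : (boundedInverse K₀ ^ r) φ = (boundedInverse K₀ ^ r) ψ) : φ = ψ := by
  rw [← sub_eq_zero]
  refine rpow_injective hK₀ hr ?_
  rw [map_sub, h, sub_self]

/-! ### The powers `K₀ ^ r` -/

omit hK₀ in
theorem mem_domain_kpow_of_neg {r : ℝ} (hr : r < 0) (ψ : H) : ψ ∈ (kpow K₀ r).domain := by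
  rw [kpow, if_neg (not_le.2 hr)]
  exact Submodule.mem_top

omit hK₀ in
theorem kpowApply_of_neg {r : ℝ} (hr : r < 0) (ψ : H) :
    kpowApply K₀ r ψ = (boundedInverse K₀ ^ (-r)) ψ := by
  rw [kpowApply, dif_pos (mem_domain_kpow_of_neg hr ψ)]
  have : ∀ L : H →ₗ.[ℂ] H, L = (boundedInverse K₀ ^ (-r) : H →L[ℂ] H).toLinearMap.toPMap ⊤ →
      ∀ h : ψ ∈ L.domain, L ⟨ψ, h⟩ = (boundedInverse K₀ ^ (-r)) ψ := by
    rintro L rfl h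
    rfl
  exact this _ (by rw [kpow, if_neg (not_le.2 hr)]) _

omit hK₀ in
theorem mem_domain_kpow {r : ℝ} (hr : 0 ≤ r) {ψ : H} :
    ψ ∈ (kpow K₀ r).domain ↔ ∃ χ, (boundedInverse K₀ ^ r) χ = ψ := by
  rw [kpow, if_pos hr, LinearPMap.inverse_domain]
  constructor
  · rintro ⟨χ, hχ⟩
    exact ⟨χ, hχ⟩
  · rintro ⟨χ, hχ⟩
    exact ⟨⟨χ, Submodule.mem_top⟩, hχ⟩

theorem kpowApply_rpow {r : ℝ} (hr : 0 ≤ r) (χ : H) :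
    kpowApply K₀ r ((boundedInverse K₀ ^ r) χ) = χ := by
  have hm : (boundedInverse K₀ ^ r) χ ∈ (kpow K₀ r).domain := (mem_domain_kpow hr).2 ⟨χ, rfl⟩
  rw [kpowApply, dif_pos hm]
  have : ∀ L : H →ₗ.[ℂ] H,
      L = ((boundedInverse K₀ ^ r : H →L[ℂ] H).toLinearMap.toPMap ⊤).inverse →
      ∀ h : (boundedInverse K₀ ^ r) χ ∈ L.domain, L ⟨(boundedInverse K₀ ^ r) χ, h⟩ = χ := by
    rintro L rfl h
    refine LinearPMap.inverse_apply_eq (x := ⟨χ, Submodule.mem_top⟩) ?_ rfl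
    rw [LinearMap.ker_eq_bot']
    rintro ⟨x, hx⟩ hx0
    exact Subtype.ext (rpow_injective hK₀ hr hx0)
  exact this _ (by rw [kpow, if_pos hr]) _

omit hK₀ in
theorem kpowApply_eq (r : ℝ) {ψ : H} (h : ψ ∈ (kpow K₀ r).domain) :
    kpowApply K₀ r ψ = kpow K₀ r ⟨ψ, h⟩ := dif_pos h

omit hK₀ in
theorem mem_smoothVectors {ψ : H} : ψ ∈ smoothVectors K₀ ↔ ∀ r, ψ ∈ (kpow K₀ r).domain := by
  simp [smoothVectors]

omit hK₀ in
theorem mem_smoothVectors' {ψ : H} :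
    ψ ∈ smoothVectors K₀ ↔ ∀ r : ℝ, 0 ≤ r → ∃ χ, (boundedInverse K₀ ^ r) χ = ψ := by
  rw [mem_smoothVectors]
  constructor
  · intro h r hr
    exact (mem_domain_kpow hr).1 (h r)
  · intro h r
    rcases lt_or_ge r 0 with hr | hr
    · exact mem_domain_kpow_of_neg hr ψ
    · exact (mem_domain_kpow hr).2 (h r hr)

theorem kpowApply_mem_smoothVectors (r : ℝ) {ψ : H} (h : ψ ∈ smoothVectors K₀) :
    kpowApply K₀ r ψ ∈ smoothVectors K₀ := by
  rw [mem_smoothVectors'] at h ⊢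
  intro s hs
  rcases lt_or_ge r 0 with hr | hr
  · obtain ⟨χ, rfl⟩ := h s hs
    rw [kpowApply_of_neg hr]
    refine ⟨(boundedInverse K₀ ^ (-r)) χ, ?_⟩
    rw [← rpow_add_apply hK₀ hs (by linarith), ← rpow_add_apply hK₀ (by linarith) hs, add_comm]
  · obtain ⟨χ, rfl⟩ := h (r + s) (by linarith)
    rw [rpow_add_apply hK₀ hr hs, kpowApply_rpow hK₀ hr]
    exact ⟨χ, rfl⟩

omit hK₀ in
theorem smoothVectors_le (r : ℝ) : smoothVectors K₀ ≤ (kpow K₀ r).domain :=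
  iInf_le _ r

omit hK₀ in
/-- `K₀ ^ r` as an endomorphism of `ℋ^∞`. -/
def smoothPow (hK₀ : IsPositiveSelfAdjoint K₀) (r : ℝ) : SmoothEnd K₀ :=
  LinearMap.codRestrict (smoothVectors K₀)
    ((kpow K₀ r).toFun ∘ₗ Submodule.inclusion (smoothVectors_le r)) fun u => by
      have := kpowApply_mem_smoothVectors hK₀ r u.2
      rwa [kpowApply_eq r (smoothVectors_le r u.2)] at this

theorem coe_smoothPow (r : ℝ) (u : smoothVectors K₀) :
    (smoothPow hK₀ r u : H) = kpowApply K₀ r u :=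
  (kpowApply_eq r (smoothVectors_le r u.2)).symm

theorem sobolevNorm_eq (r : ℝ) (u : smoothVectors K₀) :
    sobolevNorm K₀ r u = ‖(smoothPow hK₀ r u : H)‖ := by
  rw [coe_smoothPow, sobolevNorm]

theorem smoothPow_isRestriction (r : ℝ) : IsRestriction (smoothPow hK₀ r) (kpow K₀ r) := by
  intro u
  rw [coe_smoothPow, kpowApply_eq r (smoothVectors_le r u.2)]
  exact (kpow K₀ r).mem_graph ⟨u, smoothVectors_le r u.2⟩

theorem eq_smoothPow_of_isRestriction {r : ℝ} {a : SmoothEnd K₀}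
    (h : IsRestriction a (kpow K₀ r)) : a = smoothPow hK₀ r := by
  ext u
  exact (kpow K₀ r).mem_graph_snd_inj (h u) (smoothPow_isRestriction hK₀ r u) rfl

/-- A sufficiently high power of K₀⁻¹ absorbs K₀^r whatever the sign of r and leaves a bounded
operator with nonnegative exponent. As these powers are injective, identities between the
`smoothPow`s are checked after applying one of them. -/
theorem rpow_smoothPow {N r : ℝ} (hN : 0 ≤ N) (hr : r ≤ N) (u : smoothVectors K₀) :
    (boundedInverse K₀ ^ N) (smoothPow hK₀ r u : H) = (boundedInverse K₀ ^ (N - r)) (u : H) := by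
  rw [coe_smoothPow]
  rcases lt_or_ge r 0 with h0 | h0
  · rw [kpowApply_of_neg h0, ← rpow_add_apply hK₀ hN (by linarith), sub_eq_add_neg]
  · obtain ⟨χ, hχ⟩ := mem_smoothVectors'.1 u.2 r h0
    rw [← hχ, kpowApply_rpow hK₀ h0, ← rpow_add_apply hK₀ (by linarith) h0]
    congr 2; ring

theorem smoothPow_neg {r : ℝ} (hr : 0 ≤ r) (u : smoothVectors K₀) :
    (smoothPow hK₀ (-r) u : H) = (boundedInverse K₀ ^ r) (u : H) := by
  have := rpow_smoothPow hK₀ le_rfl (neg_nonpos.2 hr) u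
  rwa [rpow_zero_apply hK₀, zero_sub, neg_neg] at this

theorem smoothPow_add (r s : ℝ) : smoothPow hK₀ (r + s) = smoothPow hK₀ r * smoothPow hK₀ s := by
  ext u
  have hr := le_abs_self r
  have hs := le_abs_self s
  have hr' := abs_nonneg r
  have hs' := abs_nonneg s
  refine rpow_inj hK₀ (r := |s| + |r|) (by linarith) ?_
  rw [rpow_smoothPow hK₀ (by linarith) (by linarith), rpow_add_apply hK₀ hs' hr',
    Module.End.mul_apply, rpow_smoothPow hK₀ hr' hr, ← rpow_add_apply hK₀ hs' (by linarith),
    add_comm |s| (|r| - r), rpow_add_apply hK₀ (by linarith) hs', rpow_smoothPow hK₀ hs' hs,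
    ← rpow_add_apply hK₀ (by linarith) (by linarith)]
  congr 2; ring

theorem smoothPow_zero : smoothPow hK₀ 0 = 1 := by
  ext u
  have := smoothPow_neg hK₀ le_rfl u
  rw [neg_zero, rpow_zero_apply hK₀] at this
  exact this

theorem smoothPow_add_apply (r s : ℝ) (u : smoothVectors K₀) :
    smoothPow hK₀ r (smoothPow hK₀ s u) = smoothPow hK₀ (r + s) u := by
  rw [smoothPow_add]; rfl

/-- Nonpositive powers are bounded and self-adjoint; the positive case follows by substituting K₀^r
u and K₀^r v into the negative one. -/
theorem inner_smoothPow (r : ℝ) (u v : smoothVectors K₀) :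
    inner ℂ (smoothPow hK₀ r u : H) (v : H) = inner ℂ (u : H) (smoothPow hK₀ r v : H) := by
  have key : ∀ {r : ℝ}, 0 ≤ r → ∀ u v : smoothVectors K₀,
      inner ℂ (smoothPow hK₀ (-r) u : H) (v : H) = inner ℂ (u : H) (smoothPow hK₀ (-r) v : H) := by
    intro r hr u v
    rw [smoothPow_neg hK₀ hr, smoothPow_neg hK₀ hr, inner_rpow hK₀]
  rcases le_total r 0 with h | h
  · have := key (neg_nonneg.2 h) u v
    rwa [neg_neg] at this
  · have := key h (smoothPow hK₀ r u) (smoothPow hK₀ r v)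
    rw [smoothPow_add_apply, smoothPow_add_apply, neg_add_cancel, smoothPow_zero] at this
    exact this.symm

theorem norm_smoothPow_le {r s : ℝ} (h : r ≤ s) : ∃ C : ℝ, 0 ≤ C ∧ ∀ u : smoothVectors K₀,
    ‖(smoothPow hK₀ r u : H)‖ ≤ C * ‖(smoothPow hK₀ s u : H)‖ := by
  refine ⟨‖(boundedInverse K₀ ^ (s - r) : H →L[ℂ] H)‖, norm_nonneg _, fun u => ?_⟩
  rw [show r = -(s - r) + s by ring, ← smoothPow_add_apply, smoothPow_neg hK₀ (by linarith)]
  simpa using (boundedInverse K₀ ^ (s - r) : H →L[ℂ] H).le_opNorm _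

end Inverse
end SobolevGrowth
end

noncomputable section
namespace SobolevGrowth
variable {H : Type*} [NormedAddCommGroup H] [InnerProductSpace ℂ H] [CompleteSpace H]

/-! ### Spectral cutoffs -/

section Cutoff

/-- A continuous cutoff vanishing for `t ≤ 1 / n` and equal to `1` for `t ≥ 2 / n`. -/
def cutoff (n : ℕ) (t : ℝ) : ℝ := max 0 (min 1 (n * t - 1))

theorem continuous_cutoff (n : ℕ) : Continuous (cutoff n) := by
  unfold cutoff; fun_prop

theorem cutoff_nonneg (n : ℕ) (t : ℝ) : 0 ≤ cutoff n t := le_max_left _ _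

theorem cutoff_le_one (n : ℕ) (t : ℝ) : cutoff n t ≤ 1 := max_le zero_le_one (min_le_left _ _)

theorem cutoff_eq_zero {n : ℕ} {t : ℝ} (h : n * t ≤ 1) : cutoff n t = 0 :=
  max_eq_left ((min_le_right _ _).trans (by linarith))

theorem cutoff_eq_one {n : ℕ} {t : ℝ} (h : 2 ≤ n * t) : cutoff n t = 1 := by
  rw [cutoff, min_eq_left (by linarith), max_eq_right zero_le_one]

/-- The cutoff vanishes in a neighbourhood of (-∞, 0], where t^r may be singular, so even negative
powers become admissible in the continuous functional calculus. -/
theorem continuous_cutoff_mul_rpow {n : ℕ} (hn : 1 ≤ n) (r : ℝ) :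
    Continuous fun t : ℝ => cutoff n t * t ^ r := by
  rw [continuous_iff_continuousAt]
  intro t
  have hn' : (1 : ℝ) ≤ n := by exact_mod_cast hn
  rcases lt_or_ge 0 t with ht | ht
  · exact (continuous_cutoff n).continuousAt.mul (Real.continuousAt_rpow_const _ _ (Or.inl ht.ne'))
  · have : (fun t : ℝ => cutoff n t * t ^ r) =ᶠ[𝓝 t] fun _ => 0 := by
      have h1 : Set.Iio (1 / (n : ℝ)) ∈ 𝓝 t := Iio_mem_nhds (lt_of_le_of_lt ht (by positivity))
      filter_upwards [h1] with x hx
      rw [cutoff_eq_zero, zero_mul]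
      have := (lt_div_iff₀ (by positivity : (0 : ℝ) < n)).1 hx
      linarith
    exact continuousAt_const.congr this.symm

variable (K₀ : H →ₗ.[ℂ] H) in
/-- The cutoff of `K₀⁻¹`. -/
def cutoffOp (n : ℕ) : H →L[ℂ] H := cfc (cutoff n) (boundedInverse K₀)

variable {K₀ : H →ₗ.[ℂ] H}

theorem norm_cutoffOp_apply_le (n : ℕ) (ψ : H) : ‖cutoffOp K₀ n ψ‖ ≤ ‖ψ‖ := by
  have : ‖cutoffOp K₀ n‖ ≤ 1 := by
    refine norm_cfc_le zero_le_one fun x _ => ?_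
    rw [Real.norm_of_nonneg (cutoff_nonneg _ _)]
    exact cutoff_le_one _ _
  simpa using (cutoffOp K₀ n).le_of_opNorm_le this ψ

theorem inner_cutoffOp (n : ℕ) (φ ψ : H) :
    inner ℂ (cutoffOp K₀ n φ) ψ = inner ℂ φ (cutoffOp K₀ n ψ) :=
  (ContinuousLinearMap.isSelfAdjoint_iff_isSymmetric.1
    (cfc_predicate (cutoff n) (boundedInverse K₀))) φ ψ

/-- Where the cutoff of index n is nonzero, t > 1/n ≥ 2/m, and there the cutoff of index m equals 1.
The larger cutoff thus acts as a unit on the range of the smaller one. -/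
theorem cutoffOp_comp_cutoffOp {m n : ℕ} (h : 2 * n ≤ m) (ψ : H) :
    cutoffOp K₀ m (cutoffOp K₀ n ψ) = cutoffOp K₀ n ψ := by
  have : cutoffOp K₀ m * cutoffOp K₀ n = cutoffOp K₀ n := by
    rw [cutoffOp, cutoffOp, ← cfc_mul _ _ _ (continuous_cutoff m).continuousOn
      (continuous_cutoff n).continuousOn]
    refine cfc_congr fun t _ => ?_
    have h' : (2 : ℝ) * n ≤ m := by exact_mod_cast h
    rcases le_or_gt ((n : ℝ) * t) 1 with h1 | h1
    · simp [cutoff_eq_zero h1]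
    · have ht : 0 < t := by
        by_contra ht
        have : (n : ℝ) * t ≤ 0 := mul_nonpos_of_nonneg_of_nonpos (by positivity) (not_lt.1 ht)
        linarith
      simp only [cutoff_eq_one (n := m) (t := t) (by nlinarith), one_mul]
  exact DFunLike.congr_fun this ψ

theorem cutoffOp_rpow_comm (hK₀ : IsPositiveSelfAdjoint K₀) (n : ℕ) (r : ℝ) (ψ : H) :
    cutoffOp K₀ n ((boundedInverse K₀ ^ r) ψ) = (boundedInverse K₀ ^ r) (cutoffOp K₀ n ψ) := by
  have : Commute (cutoffOp K₀ n) (boundedInverse K₀ ^ r) := by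
    rw [rpow_eq_cfc hK₀]
    exact cfc_commute_cfc _ _ _
  exact DFunLike.congr_fun this.eq ψ

/-- The factor is the function cutoff(t) t^(-r) of K₀⁻¹, which is bounded. Hence cutoffs map H into
the domain of every power of K₀. -/
theorem exists_cutoffOp_eq (hK₀ : IsPositiveSelfAdjoint K₀) {n : ℕ} (hn : 1 ≤ n) {r : ℝ}
    (hr : 0 ≤ r) :
    ∃ G : H →L[ℂ] H, ∀ ψ, cutoffOp K₀ n ψ = (boundedInverse K₀ ^ r) (G ψ) := by
  refine ⟨cfc (fun t : ℝ => cutoff n t * t ^ (-r)) (boundedInverse K₀), fun ψ => ?_⟩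
  have : cutoffOp K₀ n = (boundedInverse K₀ ^ r) *
      cfc (fun t : ℝ => cutoff n t * t ^ (-r)) (boundedInverse K₀) := by
    rw [rpow_eq_cfc hK₀, ← cfc_mul _ _ _ (Real.continuous_rpow_const hr).continuousOn
      (continuous_cutoff_mul_rpow hn _).continuousOn]
    refine cfc_congr fun t ht => ?_
    rcases (spectrum_boundedInverse_nonneg hK₀ ht).eq_or_lt with h0 | h0
    · subst h0
      simp [cutoff_eq_zero (n := n) (t := 0) (by simp)]
    · rw [mul_left_comm, ← Real.rpow_add h0, add_neg_cancel, Real.rpow_zero, mul_one]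
  rw [this]; rfl

theorem cutoffOp_mem (hK₀ : IsPositiveSelfAdjoint K₀) {n : ℕ} (hn : 1 ≤ n) (ψ : H) :
    cutoffOp K₀ n ψ ∈ smoothVectors K₀ := by
  rw [mem_smoothVectors']
  intro r hr
  obtain ⟨G, hG⟩ := exists_cutoffOp_eq hK₀ hn hr
  exact ⟨G ψ, (hG ψ).symm⟩

/-- The cutoff of index `n + 1` as a map from `H` to `ℋ^∞`. -/
def smoothCutoff (hK₀ : IsPositiveSelfAdjoint K₀) (n : ℕ) : H →ₗ[ℂ] smoothVectors K₀ :=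
  LinearMap.codRestrict _ (cutoffOp K₀ (n + 1)).toLinearMap (cutoffOp_mem hK₀ (Nat.le_add_left 1 n))

variable (hK₀ : IsPositiveSelfAdjoint K₀)
include hK₀

theorem coe_smoothCutoff (n : ℕ) (ψ : H) : (smoothCutoff hK₀ n ψ : H) = cutoffOp K₀ (n + 1) ψ := rfl

theorem norm_smoothCutoff_le (n : ℕ) (ψ : H) : ‖(smoothCutoff hK₀ n ψ : H)‖ ≤ ‖ψ‖ :=
  norm_cutoffOp_apply_le _ _

theorem inner_smoothCutoff (n : ℕ) (φ ψ : H) :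
    inner ℂ (smoothCutoff hK₀ n φ : H) ψ = inner ℂ φ (smoothCutoff hK₀ n ψ : H) :=
  inner_cutoffOp _ _ _

theorem smoothPow_smoothCutoff (n : ℕ) (r : ℝ) (u : smoothVectors K₀) :
    smoothPow hK₀ r (smoothCutoff hK₀ n u) = smoothCutoff hK₀ n (smoothPow hK₀ r u : H) := by
  ext
  refine rpow_inj hK₀ (abs_nonneg r) ?_
  rw [rpow_smoothPow hK₀ (abs_nonneg r) (le_abs_self r), coe_smoothCutoff, coe_smoothCutoff,
    ← cutoffOp_rpow_comm hK₀, ← cutoffOp_rpow_comm hK₀,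
    rpow_smoothPow hK₀ (abs_nonneg r) (le_abs_self r)]

/-- `smoothCutoff n` has index n + 1, so doubling the index means passing from n to 2n + 1. -/
theorem smoothCutoff_smoothCutoff (n : ℕ) (ψ : H) :
    smoothCutoff hK₀ (2 * n + 1) (smoothCutoff hK₀ n ψ : H) = smoothCutoff hK₀ n ψ := by
  ext
  exact cutoffOp_comp_cutoffOp (by omega) ψ

theorem exists_smoothPow_smoothCutoff_eq (n : ℕ) (r : ℝ) :
    ∃ G : H →L[ℂ] H, ∀ ψ, (smoothPow hK₀ r (smoothCutoff hK₀ n ψ) : H) = G ψ := by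
  rcases le_total r 0 with h | h
  · refine ⟨(boundedInverse K₀ ^ (-r)) * cutoffOp K₀ (n + 1), fun ψ => ?_⟩
    rw [show r = -(-r) by ring, smoothPow_neg hK₀ (by linarith), coe_smoothCutoff]
    simp
  · obtain ⟨G, hG⟩ := exists_cutoffOp_eq hK₀ (Nat.le_add_left 1 n) h
    refine ⟨G, fun ψ => ?_⟩
    refine rpow_inj hK₀ h ?_
    rw [rpow_smoothPow hK₀ h le_rfl, sub_self, rpow_zero_apply hK₀, coe_smoothCutoff, hG]

/-- On the spectrum |t - cutoff(t) t| ≤ 2/(n + 1): the difference vanishes for t ≥ 2/(n + 1) and is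
at most t otherwise. The rate of convergence costs the one power of K₀ that supplies the factor t.
-/
theorem norm_sub_smoothCutoff_le (n : ℕ) (r : ℝ) (u : smoothVectors K₀) :
    ‖(smoothPow hK₀ r (u - smoothCutoff hK₀ n u) : H)‖ ≤
      2 / (n + 1) * ‖(smoothPow hK₀ (r + 1) u : H)‖ := by
  have key : ∀ ψ : H, ‖boundedInverse K₀ ψ - cutoffOp K₀ (n + 1) (boundedInverse K₀ ψ)‖ ≤
      2 / (n + 1) * ‖ψ‖ := by
    intro ψ
    have h1 : ‖cfc (fun t : ℝ => t - cutoff (n + 1) t * t) (boundedInverse K₀)‖ ≤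
        2 / ((n : ℝ) + 1) := by
      refine norm_cfc_le (by positivity) fun t ht => ?_
      have ht0 := spectrum_boundedInverse_nonneg hK₀ ht
      have h2 := cutoff_nonneg (n + 1) t
      have h3 := cutoff_le_one (n + 1) t
      rw [Real.norm_of_nonneg (by nlinarith)]
      rw [le_div_iff₀ (by positivity)]
      rcases le_or_gt 2 (((n + 1 : ℕ) : ℝ) * t) with h4 | h4
      · rw [cutoff_eq_one h4]; simp
      · push_cast at h4
        nlinarith [mul_nonneg ht0 h2]
    have h2 : cfc (fun t : ℝ => t - cutoff (n + 1) t * t) (boundedInverse K₀) =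
        boundedInverse K₀ - cutoffOp K₀ (n + 1) * boundedInverse K₀ := by
      have h0 : cfc (fun t : ℝ => t) (boundedInverse K₀) = boundedInverse K₀ :=
        cfc_id' ℝ _ (boundedInverse_isSelfAdjoint hK₀)
      have hc := (continuous_cutoff (n + 1))
      rw [cfc_sub (fun t : ℝ => t) (fun t => cutoff (n + 1) t * t) _ (by fun_prop)
        (hc.mul continuous_id).continuousOn, cfc_mul _ _ _ hc.continuousOn (by fun_prop), h0]
      rfl
    have h3 := ContinuousLinearMap.le_of_opNorm_le _ h1 ψ
    rw [h2] at h3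
    simpa using h3
  have h := key (smoothPow hK₀ (r + 1) u)
  have h1 : boundedInverse K₀ (smoothPow hK₀ (r + 1) u : H) = smoothPow hK₀ r u := by
    rw [← rpow_one_apply hK₀, ← smoothPow_neg hK₀ zero_le_one, smoothPow_add_apply]
    congr 3; ring
  rw [h1] at h
  rw [map_sub, smoothPow_smoothCutoff]
  exact h

/-- The domain of K₀ is dense and consists of vectors K₀⁻¹χ, on which the cutoffs converge to the
identity. -/
theorem dense_smoothVectors : Dense (smoothVectors K₀ : Set H) := by
  have h1 : (K₀.domain : Set H) ⊆ closure (smoothVectors K₀ : Set H) := by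
    intro x hx
    have h2 : Tendsto (fun n : ℕ => cutoffOp K₀ (n + 1) x) atTop (𝓝 x) := by
      have hT := boundedInverse_apply hK₀ ⟨x, hx⟩
      dsimp only at hT
      set χ := K₀ ⟨x, hx⟩
      rw [tendsto_iff_norm_sub_tendsto_zero]
      have hz : Tendsto (fun n : ℕ => 2 / ((n : ℝ) + 1) * ‖χ‖) atTop (𝓝 0) := by
        have := (tendsto_one_div_add_atTop_nhds_zero_nat (𝕜 := ℝ)).const_mul (2 * ‖χ‖)
        rw [mul_zero] at this
        refine this.congr fun n => ?_
        ring
      refine squeeze_zero (fun _ => norm_nonneg _) (fun n => ?_) hz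
      have h3 : ‖cfc (fun t : ℝ => cutoff (n + 1) t * t - t) (boundedInverse K₀)‖ ≤
          2 / ((n : ℝ) + 1) := by
        refine norm_cfc_le (by positivity) fun t ht => ?_
        have ht0 := spectrum_boundedInverse_nonneg hK₀ ht
        have h2 := cutoff_nonneg (n + 1) t
        have h3 := cutoff_le_one (n + 1) t
        rw [Real.norm_of_nonpos (by nlinarith)]
        rw [le_div_iff₀ (by positivity)]
        rcases le_or_gt 2 (((n + 1 : ℕ) : ℝ) * t) with h4 | h4
        · rw [cutoff_eq_one h4]; simp
        · push_cast at h4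
          nlinarith [mul_nonneg ht0 h2]
      have h4 : cfc (fun t : ℝ => cutoff (n + 1) t * t - t) (boundedInverse K₀) =
          cutoffOp K₀ (n + 1) * boundedInverse K₀ - boundedInverse K₀ := by
        have h0 : cfc (fun t : ℝ => t) (boundedInverse K₀) = boundedInverse K₀ :=
          cfc_id' ℝ _ (boundedInverse_isSelfAdjoint hK₀)
        have hc := (continuous_cutoff (n + 1))
        rw [cfc_sub (fun t => cutoff (n + 1) t * t) (fun t : ℝ => t) _ 
          (hc.mul continuous_id).continuousOn (by fun_prop),
          cfc_mul _ _ _ hc.continuousOn (by fun_prop), h0]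
        rfl
      have h5 := ContinuousLinearMap.le_of_opNorm_le _ h3 χ
      rw [h4] at h5
      simpa [hT] using h5
    exact mem_closure_of_tendsto h2 (Eventually.of_forall fun n =>
      cutoffOp_mem hK₀ (Nat.le_add_left 1 n) x)
  have h2 : closure (K₀.domain : Set H) ⊆ closure (smoothVectors K₀ : Set H) :=
    closure_minimal h1 isClosed_closure
  intro x
  exact h2 (hK₀.isSelfAdjoint.dense_domain x)

/-- Completeness of ℋ^∞: applying the bounded operator K₀^(-r) to the limit η_r gives η_0, so η_0
lies in the range of K₀^(-r) for every r ≥ 0. -/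
theorem exists_limit_of_smoothPow_tendsto {ι : Type*} {l : Filter ι} [l.NeBot]
    {u : ι → smoothVectors K₀}
    {η : ℝ → H} (h : ∀ r, Tendsto (fun n => (smoothPow hK₀ r (u n) : H)) l (𝓝 (η r))) :
    ∃ w : smoothVectors K₀, ∀ r, (smoothPow hK₀ r w : H) = η r := by
  have h0 : ∀ r : ℝ, 0 ≤ r → (boundedInverse K₀ ^ r) (η r) = η 0 := by
    intro r hr
    have h1 := ((boundedInverse K₀ ^ r : H →L[ℂ] H).continuous.tendsto _).comp (h r)
    refine tendsto_nhds_unique h1 ?_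
    have := h 0
    rw [smoothPow_zero] at this
    refine this.congr fun n => ?_
    simp [rpow_smoothPow hK₀ hr le_rfl, rpow_zero_apply hK₀]
  have hm : η 0 ∈ smoothVectors K₀ := mem_smoothVectors'.2 fun r hr => ⟨_, h0 r hr⟩
  refine ⟨⟨η 0, hm⟩, fun r => ?_⟩
  rcases le_total 0 r with hr | hr
  · rw [coe_smoothPow]
    simp only
    rw [← h0 r hr, kpowApply_rpow hK₀ hr]
  · have h1 := ((boundedInverse K₀ ^ (-r) : H →L[ℂ] H).continuous.tendsto _).comp (h 0)
    have h2 := tendsto_nhds_unique (h r) (h1.congr fun n => by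
      rw [smoothPow_zero, Function.comp_apply, Module.End.one_apply,
        ← smoothPow_neg hK₀ (by linarith), neg_neg])
    rw [h2, show r = -(-r) by ring, smoothPow_neg hK₀ (by linarith), neg_neg]

/-- Intermediate norms are controlled by a small multiple of a stronger norm. -/
theorem exists_norm_sq_smoothPow_le {a b : ℝ} (hab : a < b) (hb : 0 < b) {ε : ℝ} (hε : 0 < ε) :
    ∃ C : ℝ, 0 ≤ C ∧ ∀ u : smoothVectors K₀, ‖(smoothPow hK₀ a u : H)‖ ^ 2 ≤
      ε * ‖(smoothPow hK₀ b u : H)‖ ^ 2 + C * ‖(u : H)‖ ^ 2 := by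
  set T := boundedInverse K₀ with hT
  set δ := b - a with hδ
  have hδ0 : 0 < δ := by linarith
  obtain ⟨C, hC, hCt⟩ : ∃ C : ℝ, 0 ≤ C ∧ ∀ t ∈ spectrum ℝ T,
      t ^ (δ + δ) ≤ ε + C * t ^ (b + b) := by
    -- The threshold at which t^(2δ) = ε. Below it the term ε suffices; above it t^(2b) is bounded
    -- below, and t^(2δ) ≤ ‖T‖^(2δ) is absorbed by C.
    set t₀ := ε ^ (1 / (δ + δ)) with ht₀
    have ht₀' : 0 < t₀ := Real.rpow_pos_of_pos hε _
    refine ⟨‖T‖ ^ (δ + δ) / t₀ ^ (b + b), by positivity, fun t ht => ?_⟩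
    have ht0 := spectrum_boundedInverse_nonneg hK₀ ht
    rcases le_total t t₀ with h | h
    · have h1 : t ^ (δ + δ) ≤ ε := by
        calc t ^ (δ + δ) ≤ t₀ ^ (δ + δ) := Real.rpow_le_rpow ht0 h (by linarith)
          _ = ε := by rw [ht₀, ← Real.rpow_mul hε.le, one_div_mul_cancel (by linarith),
            Real.rpow_one]
      have : 0 ≤ ‖T‖ ^ (δ + δ) / t₀ ^ (b + b) * t ^ (b + b) := by positivity
      linarith
    -- The bound of the spectrum by ‖T‖ needs ‖1‖ = 1; if H is trivial the spectrum is empty.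
    · have hnt : Nontrivial H := by
        by_contra hn
        rw [not_nontrivial_iff_subsingleton] at hn
        have : Subsingleton (H →L[ℂ] H) := inferInstance
        simp at ht
      have h1 : t ^ (δ + δ) ≤ ‖T‖ ^ (δ + δ) := by
        refine Real.rpow_le_rpow ht0 ?_ (by linarith)
        have := spectrum.norm_le_norm_of_mem ht
        rwa [Real.norm_of_nonneg ht0] at this
      have h2 : t₀ ^ (b + b) ≤ t ^ (b + b) := Real.rpow_le_rpow ht₀'.le h (by linarith)
      have h3 : ‖T‖ ^ (δ + δ) ≤ ‖T‖ ^ (δ + δ) / t₀ ^ (b + b) * t ^ (b + b) := by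
        rw [div_mul_eq_mul_div, le_div_iff₀ (by positivity)]
        exact mul_le_mul_of_nonneg_left h2 (by positivity)
      linarith
  refine ⟨C, hC, fun u => ?_⟩
  -- The scalar inequality becomes an operator inequality, whose quadratic form at χ = K₀^b u is the
  -- claim, since K₀^a u = T^δ χ and u = T^b χ.
  have hop : (T ^ (δ + δ) : H →L[ℂ] H) ≤ (ε : ℝ) • 1 + C • (T ^ (b + b) : H →L[ℂ] H) := by
    have hcb := (Real.continuous_rpow_const (q := b + b) (by linarith))
    rw [rpow_eq_cfc hK₀, rpow_eq_cfc hK₀, ← cfc_smul _ _ _ hcb.continuousOn,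
      ← Algebra.algebraMap_eq_smul_one, ← cfc_const_add _ _ _ (by fun_prop)
        (boundedInverse_isSelfAdjoint hK₀)]
    refine cfc_mono (fun t ht => ?_) (Real.continuous_rpow_const (by linarith)).continuousOn
      (by fun_prop)
    simpa using hCt t ht
  obtain ⟨χ, hχ⟩ : ∃ χ : H, χ = (smoothPow hK₀ b u : H) := ⟨_, rfl⟩
  rw [← hχ]
  have hsq : ∀ r : ℝ, 0 ≤ r → ‖(T ^ r) χ‖ ^ 2 = (inner ℂ χ ((T ^ (r + r)) χ)).re := by
    intro r hr
    rw [rpow_add_apply hK₀ hr hr, ← inner_rpow hK₀, ← inner_self_eq_norm_sq (𝕜 := ℂ)]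
    rfl
  have h1 : (smoothPow hK₀ a u : H) = (T ^ δ) χ := by
    rw [hχ, ← smoothPow_neg hK₀ hδ0.le, smoothPow_add_apply]
    congr 3; rw [hδ]; ring
  have h2 : (u : H) = (T ^ b) χ := by
    rw [hχ, rpow_smoothPow hK₀ hb.le le_rfl, sub_self, rpow_zero_apply hK₀]
  rw [h1, h2, hsq _ hδ0.le, hsq _ hb.le]
  have h3 := ((ContinuousLinearMap.le_def _ _).1 hop).re_inner_nonneg_right χ
  have h4 : ‖χ‖ ^ 2 = (inner ℂ χ χ).re := (inner_self_eq_norm_sq (𝕜 := ℂ) χ).symm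
  rw [h4]
  simp only [ContinuousLinearMap.sub_apply, ContinuousLinearMap.add_apply,
    ContinuousLinearMap.smul_apply, ContinuousLinearMap.one_apply, inner_sub_right,
    inner_add_right, inner_smul_right_eq_smul, map_sub, map_add] at h3
  simp only [RCLike.re_to_complex, Complex.real_smul, Complex.mul_re, Complex.ofReal_re,
    Complex.ofReal_im, zero_mul, sub_zero, Complex.add_re, Complex.sub_re] at h3
  linarith

end Cutoff
end SobolevGrowth
end

noncomputable section
namespace SobolevGrowth
variable {H : Type*} [NormedAddCommGroup H] [InnerProductSpace ℂ H] [CompleteSpace H]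

/-! ### Linear differential equations with bounded coefficients -/

section LinearODE

/-- The terms of the Dyson series. -/
def dysonTerm {E : Type*} [NormedAddCommGroup E] [NormedSpace ℝ E] (B : ℝ → E → E) (s : ℝ) (x : E) :
    ℕ → ℝ → E
  | 0 => fun _ => x
  | k + 1 => fun t => ∫ σ in s..t, B σ (dysonTerm B s x k σ)

/-- The k-th iterated integral is bounded by (M|t - s|)^k / k! times ‖x‖, so the Dyson series and
the series of its derivatives converge locally uniformly. -/
theorem exists_linear_ode_solution {E : Type*} [NormedAddCommGroup E] [NormedSpace ℂ E]
    [CompleteSpace E] {B : ℝ → E →L[ℂ] E} (hB : Continuous B) {M : ℝ} (hM : ∀ t, ‖B t‖ ≤ M)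
    (s : ℝ) (x : E) :
    ∃ y : ℝ → E, y s = x ∧ ∀ t, HasDerivAt y (B t (y t)) t := by
  have hM0 : 0 ≤ M := (norm_nonneg _).trans (hM 0)
  set Y := dysonTerm (fun t => B t) s x with hY
  have hcont : ∀ k, Continuous (Y k) := by
    intro k
    induction k with
    | zero => exact continuous_const
    | succ k ih =>
      exact intervalIntegral.continuous_primitive
        (fun a b => (hB.clm_apply ih).intervalIntegrable a b) s
  have hder : ∀ k t, HasDerivAt (Y (k + 1)) (B t (Y k t)) t := by
    intro k t
    exact intervalIntegral.integral_hasDerivAt_right ((hB.clm_apply (hcont k)).intervalIntegrable _ _)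
      ((hB.clm_apply (hcont k)).stronglyMeasurableAtFilter _ _)
      (hB.clm_apply (hcont k)).continuousAt
  have hbound : ∀ k t, ‖Y k t‖ ≤ (M * |t - s|) ^ k / k.factorial * ‖x‖ := by
    intro k
    induction k with
    | zero => intro t; simp [hY, dysonTerm]
    | succ k ih =>
      intro t
      have h1 : ‖Y (k + 1) t‖ ≤ ∫ σ in Set.uIoc s t, ‖B σ (Y k σ)‖ :=
        intervalIntegral.norm_integral_le_integral_norm_uIoc
      have h2 : ∫ σ in Set.uIoc s t, ‖B σ (Y k σ)‖ ≤
          ∫ σ in Set.uIoc s t, M ^ (k + 1) / k.factorial * ‖x‖ * |σ - s| ^ k := by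
        have hi : ∀ f : ℝ → ℝ, Continuous f →
            MeasureTheory.IntegrableOn f (Set.uIoc s t) MeasureTheory.volume := fun f hf =>
          (hf.integrableOn_uIcc (a := s) (b := t)).mono_set Set.uIoc_subset_uIcc
        refine MeasureTheory.setIntegral_mono (hi _ (hB.clm_apply (hcont k)).norm)
          (hi _ (by fun_prop)) fun σ => ?_
        calc ‖B σ (Y k σ)‖ ≤ M * ((M * |σ - s|) ^ k / k.factorial * ‖x‖) :=
              ((B σ).le_of_opNorm_le (hM σ) _).trans (mul_le_mul_of_nonneg_left (ih σ) hM0)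
          _ = M ^ (k + 1) / k.factorial * ‖x‖ * |σ - s| ^ k := by rw [mul_pow]; ring
      refine h1.trans (h2.trans (le_of_eq ?_))
      rw [MeasureTheory.integral_const_mul, integral_pow_abs_sub_uIoc, Nat.factorial_succ, mul_pow]
      have : (k.factorial : ℝ) ≠ 0 := by positivity
      push_cast
      field_simp
  have hsum : ∀ t, Summable fun k => Y k t := fun t => by
    refine Summable.of_norm_bounded (g := fun k => (M * |t - s|) ^ k / k.factorial * ‖x‖) ?_
      (fun k => hbound k t)
    exact (Real.summable_pow_div_factorial _).mul_right _
  refine ⟨fun t => ∑' k, Y k t, ?_, fun t => ?_⟩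
  · show ∑' k, Y k s = x
    rw [tsum_eq_single 0]
    · rfl
    · intro k hk
      obtain ⟨k, rfl⟩ := Nat.exists_eq_succ_of_ne_zero hk
      simp [hY, dysonTerm]
  · set R := |t - s| + 1 with hR
    have hts : t ∈ Metric.ball s R := by rw [Metric.mem_ball, Real.dist_eq]; linarith
    have hss : s ∈ Metric.ball s R := Metric.mem_ball_self (by positivity)
    -- The term of index 0 is constant, so differentiation shifts the series by one index.
    set g' : ℕ → ℝ → E := fun k τ => Nat.casesOn k 0 fun k => B τ (Y k τ) with hg'
    have hd : HasDerivAt (fun z => ∑' k, Y k z) (∑' k, g' k t) t := by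
      refine hasDerivAt_tsum_of_isPreconnected
        (u := fun k => Nat.casesOn k 0 fun k => M * ((M * R) ^ k / k.factorial * ‖x‖))
        ?_ Metric.isOpen_ball (convex_ball s R).isPreconnected ?_ ?_ hss (hsum s) hts
      · refine (summable_nat_add_iff 1).1 ?_
        exact ((Real.summable_pow_div_factorial _).mul_right _).mul_left _
      · rintro (_ | k) τ _
        · exact hasDerivAt_const _ _
        · exact hder k τ
      · rintro (_ | k) τ hτ
        · simp [hg']
        · rw [Metric.mem_ball, Real.dist_eq] at hτ
          refine ((B τ).le_of_opNorm_le (hM τ) _).trans (mul_le_mul_of_nonneg_left ?_ hM0)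
          refine (hbound k τ).trans ?_
          gcongr
    have he : ∑' k, g' k t = B t (∑' k, Y k t) := by
      rw [(B t).map_tsum (hsum t)]
      have hs' : Summable fun k => g' k t := by
        refine (summable_nat_add_iff 1).1 ?_
        exact (hsum t).map (B t) (B t).continuous
      rw [hs'.tsum_eq_zero_add]
      simp [hg']
    rwa [he] at hd

/-- Grönwall's inequality on a segment, in both time directions. -/
theorem le_of_abs_deriv_le {φ φ' : ℝ → ℝ} (hφ : ∀ t, HasDerivAt φ (φ' t) t) {K b s t : ℝ}
    (hb : 0 ≤ b) (hK : 0 ≤ K) (h : ∀ τ ∈ Set.uIcc s t, |φ' τ| ≤ K * φ τ + b) :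
    φ t ≤ (φ s + b * |t - s|) * Real.exp (K * |t - s|) := by
  have key : ∀ {φ φ' : ℝ → ℝ} {s t : ℝ}, (∀ t, HasDerivAt φ (φ' t) t) → s ≤ t →
      (∀ τ ∈ Set.Icc s t, |φ' τ| ≤ K * φ τ + b) →
      φ t ≤ (φ s + b * (t - s)) * Real.exp (K * (t - s)) := by
    intro φ φ' s t hφ hst h
    -- The quantity exp(-K(τ - s)) φ(τ) - b(τ - s) is nonincreasing; the weight of the source b may
    -- be dropped because exp(-K(τ - s)) ≤ 1.
    have hd : ∀ τ, HasDerivAt (fun τ => Real.exp (-(K * (τ - s))) * φ τ - b * (τ - s))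
        (Real.exp (-(K * (τ - s))) * (-(K * 1)) * φ τ + Real.exp (-(K * (τ - s))) * φ' τ - b * 1)
        τ := fun τ =>
      ((((((hasDerivAt_id τ).sub_const s).const_mul K).neg).exp.mul (hφ τ)).sub
        (((hasDerivAt_id τ).sub_const s).const_mul b))
    have hanti : AntitoneOn (fun τ => Real.exp (-(K * (τ - s))) * φ τ - b * (τ - s))
        (Set.Icc s t) := by
      refine antitoneOn_of_deriv_nonpos (convex_Icc s t)
        (fun τ _ => (hd τ).continuousAt.continuousWithinAt)
        (fun τ _ => (hd τ).differentiableAt.differentiableWithinAt) fun τ hτ => ?_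
      rw [interior_Icc] at hτ
      rw [(hd τ).deriv]
      have h1 := (le_abs_self _).trans (h τ ⟨hτ.1.le, hτ.2.le⟩)
      have h2 : Real.exp (-(K * (τ - s))) ≤ 1 :=
        Real.exp_le_one_iff.2 (by nlinarith [hτ.1])
      have h3 := Real.exp_pos (-(K * (τ - s)))
      nlinarith
    have h1 := hanti (Set.left_mem_Icc.2 hst) (Set.right_mem_Icc.2 hst) hst
    simp only [sub_self, mul_zero, neg_zero, Real.exp_zero, one_mul, sub_zero] at h1
    have h2 := Real.exp_pos (K * (t - s))
    have h3 : Real.exp (-(K * (t - s))) * Real.exp (K * (t - s)) = 1 := by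
      rw [← Real.exp_add, neg_add_cancel, Real.exp_zero]
    calc φ t = (Real.exp (-(K * (t - s))) * φ t) * Real.exp (K * (t - s)) := by
          rw [mul_right_comm, h3, one_mul]
      _ ≤ _ := by gcongr; linarith
  rcases le_total s t with hst | hst
  · rw [abs_of_nonneg (sub_nonneg.2 hst)]
    exact key hφ hst (by rwa [Set.uIcc_of_le hst] at h)
  -- Backward times follow from time reversal.
  · have h1 := key (φ := fun τ => φ (-τ)) (φ' := fun τ => -φ' (-τ)) (s := -s) (t := -t)
      (fun τ => by
        have := (hφ (-τ)).comp τ (hasDerivAt_neg τ)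
        rw [mul_neg_one] at this
        exact this) (neg_le_neg hst) (by
        intro τ hτ
        rw [abs_neg]
        refine h (-τ) ?_
        rw [Set.uIcc_of_ge hst]
        exact ⟨by linarith [hτ.2], by linarith [hτ.1]⟩)
    simp only [neg_neg] at h1
    rw [abs_of_nonpos (sub_nonpos.2 hst)]
    convert h1 using 3 <;> ring

theorem hasDerivAt_norm_sq {y : ℝ → H} {y' : H} {t : ℝ} (h : HasDerivAt y y' t) :
    HasDerivAt (fun t => ‖y t‖ ^ 2) (2 * (inner ℂ (y t) y').re) t := by
  have h1 := (Complex.reCLM.hasFDerivAt.comp_hasDerivAt t (h.inner ℂ h))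
  have h2 : (fun t => ‖y t‖ ^ 2) = Complex.reCLM ∘ fun t => inner ℂ (y t) (y t) := by
    funext t
    exact (inner_self_eq_norm_sq (𝕜 := ℂ) (y t)).symm
  rw [h2]
  refine h1.congr_deriv ?_
  rw [map_add, Complex.reCLM_apply, Complex.reCLM_apply, ← inner_conj_symm y', Complex.conj_re]
  ring

end LinearODE

/-! ### Smooth curves in `ℋ^∞` and energy estimates -/

section Energy

variable {K₀ : H →ₗ.[ℂ] H} (hK₀ : IsPositiveSelfAdjoint K₀)

/-- Differentiability with respect to all the norms of the scale. -/
def HasSmoothDerivAt (y : ℝ → smoothVectors K₀) (y' : smoothVectors K₀) (t : ℝ) : Prop :=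
  ∀ r, HasDerivAt (fun t => (smoothPow hK₀ r (y t) : H)) (smoothPow hK₀ r y' : H) t

theorem HasSmoothDerivAt.coe {y : ℝ → smoothVectors K₀} {y' : smoothVectors K₀} {t : ℝ}
    (h : HasSmoothDerivAt hK₀ y y' t) : HasDerivAt (fun t => (y t : H)) (y' : H) t := by
  have := h 0
  simpa only [smoothPow_zero, Module.End.one_apply] using this

theorem HasSmoothDerivAt.sub {y z : ℝ → smoothVectors K₀} {y' z' : smoothVectors K₀} {t : ℝ}
    (hy : HasSmoothDerivAt hK₀ y y' t) (hz : HasSmoothDerivAt hK₀ z z' t) :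
    HasSmoothDerivAt hK₀ (fun t => y t - z t) (y' - z') t := by
  intro r
  simp only [map_sub, AddSubgroupClass.coe_sub]
  exact (hy r).sub (hz r)

theorem HasSmoothDerivAt.add {y z : ℝ → smoothVectors K₀} {y' z' : smoothVectors K₀} {t : ℝ}
    (hy : HasSmoothDerivAt hK₀ y y' t) (hz : HasSmoothDerivAt hK₀ z z' t) :
    HasSmoothDerivAt hK₀ (fun t => y t + z t) (y' + z') t := by
  intro r
  simp only [map_add, Submodule.coe_add]
  exact (hy r).add (hz r)

theorem HasSmoothDerivAt.smul {y : ℝ → smoothVectors K₀} {y' : smoothVectors K₀} {t : ℝ} (c : ℂ)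
    (hy : HasSmoothDerivAt hK₀ y y' t) :
    HasSmoothDerivAt hK₀ (fun t => c • y t) (c • y') t := by
  intro r
  simp only [map_smul, Submodule.coe_smul]
  exact (hy r).const_smul c

/-- A smooth endomorphism of finite order maps smooth curves to smooth curves. -/
theorem HasSmoothDerivAt.map {y : ℝ → smoothVectors K₀} {y' : smoothVectors K₀} {t : ℝ}
    (hy : HasSmoothDerivAt hK₀ y y' t) {a : SmoothEnd K₀} {m : ℝ}
    (ha : ∀ r, ∃ C : ℝ, ∀ u, ‖(smoothPow hK₀ r (a u) : H)‖ ≤ C * ‖(smoothPow hK₀ (r + m) u : H)‖) :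
    HasSmoothDerivAt hK₀ (fun t => a (y t)) (a y') t := by
  intro r
  obtain ⟨C, hC⟩ := ha r
  have h := hy (r + m)
  rw [hasDerivAt_iff_isLittleO] at h ⊢
  refine (Asymptotics.IsBigO.of_bound C (Eventually.of_forall fun τ => ?_)).trans_isLittleO h
  have h1 := hC (y τ - y t - ((τ - t : ℝ) : ℂ) • y')
  simp only [map_sub, map_smul, AddSubgroupClass.coe_sub, Submodule.coe_smul] at h1
  simp only [Complex.coe_smul] at h1
  exact h1

theorem inner_smul_I_re_eq_zero {a : SmoothEnd K₀} (ha : IsSymmetricOp a) (u : smoothVectors K₀) :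
    (inner ℂ (u : H) (-Complex.I • (a u : H))).re = 0 := by
  have h1 : (inner ℂ (u : H) (a u : H)).im = 0 := by
    have := ha u u
    rw [← inner_conj_symm] at this
    exact Complex.conj_eq_iff_im.1 this
  rw [inner_smul_right]
  simp [h1]

/-- Commute K₀^r past a: the term with a applied to K₀^r u is purely imaginary in the inner product
by symmetry, so only the commutator contributes, and this is bounded in ℋ^r. It is the basic energy
estimate. -/
theorem abs_re_inner_smoothPow_le {a : SmoothEnd K₀} (ha : IsSymmetricOp a) {r C : ℝ}
    (hC : ∀ u, ‖(smoothPow hK₀ r (a u) - a (smoothPow hK₀ r u) : H)‖ ≤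
      C * ‖(smoothPow hK₀ r u : H)‖) (u : smoothVectors K₀) :
    |(inner ℂ (smoothPow hK₀ r u : H) (smoothPow hK₀ r (-Complex.I • a u) : H)).re| ≤
      C * ‖(smoothPow hK₀ r u : H)‖ ^ 2 := by
  have h1 : (smoothPow hK₀ r (-Complex.I • a u) : H) = -Complex.I • (a (smoothPow hK₀ r u) : H) +
      -Complex.I • (smoothPow hK₀ r (a u) - a (smoothPow hK₀ r u) : H) := by
    rw [map_smul, ← smul_add, Submodule.coe_smul]
    congr 1; abel
  rw [h1, inner_add_right, Complex.add_re, inner_smul_I_re_eq_zero ha, zero_add]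
  refine (Complex.abs_re_le_norm _).trans ((norm_inner_le_norm _ _).trans ?_)
  rw [norm_smul, norm_neg, Complex.norm_I, one_mul]
  nlinarith [hC u, norm_nonneg (smoothPow hK₀ r u : H)]

/-- Symmetric first order operators depending on time in a Lipschitz way. -/
structure IsTameFamily (h : ℝ → SmoothEnd K₀) : Prop where
  symm : ∀ t, IsSymmetricOp (h t)
  bound : ∀ r, ∃ C : ℝ, 0 ≤ C ∧ ∀ t u,
    ‖(smoothPow hK₀ r (h t u) : H)‖ ≤ C * ‖(smoothPow hK₀ (r + 1) u : H)‖
  comm : ∀ r, ∃ C : ℝ, 0 ≤ C ∧ ∀ t u,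
    ‖(smoothPow hK₀ r (h t u) - h t (smoothPow hK₀ r u) : H)‖ ≤ C * ‖(smoothPow hK₀ r u : H)‖
  lip : ∀ r, ∃ C : ℝ, 0 ≤ C ∧ ∀ t t' u,
    ‖(smoothPow hK₀ r (h t u - h t' u) : H)‖ ≤ C * |t - t'| * ‖(smoothPow hK₀ (r + 1) u : H)‖

variable {hK₀} {h : ℝ → SmoothEnd K₀} (hh : IsTameFamily hK₀ h)
include hh

/-- The Sobolev norms of a solution grow at most exponentially. -/
theorem IsTameFamily.norm_solution_le (r : ℝ) : ∃ C : ℝ, 0 ≤ C ∧ ∀ y : ℝ → smoothVectors K₀,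
    (∀ t, HasSmoothDerivAt hK₀ y (-Complex.I • h t (y t)) t) → ∀ t s,
    ‖(smoothPow hK₀ r (y t) : H)‖ ≤ Real.exp (C * |t - s|) * ‖(smoothPow hK₀ r (y s) : H)‖ := by
  obtain ⟨C, hC0, hC⟩ := hh.comm r
  refine ⟨C, hC0, fun y hy t s => ?_⟩
  have h1 := le_of_abs_deriv_le (fun t => hasDerivAt_norm_sq (hy t r)) (K := 2 * C) (b := 0)
    (s := s) (t := t) le_rfl (by positivity) (fun τ _ => by
      rw [abs_mul, abs_two, add_zero, mul_assoc]
      have := abs_re_inner_smoothPow_le hK₀ (hh.symm τ) (hC τ) (y τ)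
      linarith)
  refine abs_le_of_sq_le_sq' ?_ (by positivity) |>.2
  have h2 : Real.exp (2 * C * |t - s|) = Real.exp (C * |t - s|) ^ 2 := by
    rw [← Real.exp_nat_mul]
    push_cast
    ring_nf
  rw [zero_mul, add_zero, h2] at h1
  rw [mul_pow, mul_comm]
  exact h1

/-- The difference of two solutions is a solution that vanishes at time s, and the energy estimate
with r = 0 keeps it zero. -/
theorem IsTameFamily.solution_unique {y z : ℝ → smoothVectors K₀}
    (hy : ∀ t, HasSmoothDerivAt hK₀ y (-Complex.I • h t (y t)) t)
    (hz : ∀ t, HasSmoothDerivAt hK₀ z (-Complex.I • h t (z t)) t) {s : ℝ} (hs : y s = z s) :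
    y = z := by
  obtain ⟨C, -, hC⟩ := hh.norm_solution_le 0
  funext t
  have h1 := hC (fun t => y t - z t) (fun t => by
    rw [map_sub, smul_sub]
    exact (hy t).sub hK₀ (hz t)) t s
  rw [hs, sub_self, map_zero, Submodule.coe_zero, norm_zero, mul_zero, smoothPow_zero] at h1
  have h2 := norm_le_zero_iff.1 h1
  rw [Module.End.one_apply, Submodule.coe_eq_zero] at h2
  exact sub_eq_zero.1 h2

theorem IsTameFamily.norm_solution_eq {y : ℝ → smoothVectors K₀}
    (hy : ∀ t, HasSmoothDerivAt hK₀ y (-Complex.I • h t (y t)) t) (t s : ℝ) :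
    ‖(y t : H)‖ = ‖(y s : H)‖ := by
  have hd : ∀ t, HasDerivAt (fun t => ‖(y t : H)‖ ^ 2) 0 t := fun t => by
    have := hasDerivAt_norm_sq (hy t).coe
    rwa [Submodule.coe_smul, inner_smul_I_re_eq_zero (hh.symm t), mul_zero] at this
  have := is_const_of_deriv_eq_zero (fun t => (hd t).differentiableAt) (fun t => (hd t).deriv) t s
  exact (pow_left_inj₀ (norm_nonneg _) (norm_nonneg _) two_ne_zero).1 this

end Energy
end SobolevGrowth
end

noncomputable section
namespace SobolevGrowth
variable {H : Type*} [NormedAddCommGroup H] [InnerProductSpace ℂ H] [CompleteSpace H]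

/-! ### Existence of solutions by regularization -/

section Regularization

variable {K₀ : H →ₗ.[ℂ] H} (hK₀ : IsPositiveSelfAdjoint K₀)

/-- The regularization `J a J` of an operator by cutoffs. -/
def regularize (n : ℕ) (a : SmoothEnd K₀) : SmoothEnd K₀ :=
  smoothCutoff hK₀ n ∘ₗ (smoothVectors K₀).subtype ∘ₗ a ∘ₗ smoothCutoff hK₀ n ∘ₗ
    (smoothVectors K₀).subtype

theorem regularize_apply (n : ℕ) (a : SmoothEnd K₀) (u : smoothVectors K₀) :
    regularize hK₀ n a u = smoothCutoff hK₀ n (a (smoothCutoff hK₀ n (u : H)) : H) := rfl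

theorem regularize_isSymmetricOp (n : ℕ) {a : SmoothEnd K₀} (ha : IsSymmetricOp a) :
    IsSymmetricOp (regularize hK₀ n a) := by
  intro u v
  rw [regularize_apply, regularize_apply, inner_smoothCutoff, ha, inner_smoothCutoff]

theorem norm_smoothPow_smoothCutoff_le (n : ℕ) (r : ℝ) (u : smoothVectors K₀) :
    ‖(smoothPow hK₀ r (smoothCutoff hK₀ n u) : H)‖ ≤ ‖(smoothPow hK₀ r u : H)‖ := by
  rw [smoothPow_smoothCutoff]
  exact norm_smoothCutoff_le _ _ _

/-- The cutoff J commutes with K₀^r, so the commutator of K₀^r with J a J is J [K₀^r, a] J. The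
constant is that of a, uniformly in the cutoff. -/
theorem regularize_comm_le (n : ℕ) {a : SmoothEnd K₀} {r C : ℝ} (hC0 : 0 ≤ C)
    (hC : ∀ u, ‖(smoothPow hK₀ r (a u) - a (smoothPow hK₀ r u) : H)‖ ≤
      C * ‖(smoothPow hK₀ r u : H)‖) (u : smoothVectors K₀) :
    ‖(smoothPow hK₀ r (regularize hK₀ n a u) - regularize hK₀ n a (smoothPow hK₀ r u) : H)‖ ≤
      C * ‖(smoothPow hK₀ r u : H)‖ := by
  rw [regularize_apply, regularize_apply, smoothPow_smoothCutoff, ← smoothPow_smoothCutoff hK₀ n r u,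
    ← AddSubgroupClass.coe_sub, ← map_sub]
  refine (norm_smoothCutoff_le hK₀ n _).trans ((hC _).trans ?_)
  exact mul_le_mul_of_nonneg_left (norm_smoothPow_smoothCutoff_le hK₀ n r u) hC0

theorem norm_regularize_le (n : ℕ) {a : SmoothEnd K₀} {r C : ℝ} (hC0 : 0 ≤ C)
    (hC : ∀ u, ‖(smoothPow hK₀ r (a u) : H)‖ ≤ C * ‖(smoothPow hK₀ (r + 1) u : H)‖)
    (u : smoothVectors K₀) :
    ‖(smoothPow hK₀ r (regularize hK₀ n a u) : H)‖ ≤ C * ‖(smoothPow hK₀ (r + 1) u : H)‖ := by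
  rw [regularize_apply]
  refine (norm_smoothPow_smoothCutoff_le hK₀ n r _).trans ((hC _).trans ?_)
  exact mul_le_mul_of_nonneg_left (norm_smoothPow_smoothCutoff_le hK₀ n _ u) hC0

/-- J a J - a = -(1 - J) a J - a (1 - J). One power of K₀ is spent on a and one on 1 - J, which
yields the factor 2/(n + 1). -/
theorem norm_regularize_sub_le (n : ℕ) {a : SmoothEnd K₀} {r C C' : ℝ} (hC0 : 0 ≤ C) (hC0' : 0 ≤ C')
    (hC : ∀ u, ‖(smoothPow hK₀ r (a u) : H)‖ ≤ C * ‖(smoothPow hK₀ (r + 1) u : H)‖)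
    (hC' : ∀ u, ‖(smoothPow hK₀ (r + 1) (a u) : H)‖ ≤ C' * ‖(smoothPow hK₀ (r + 1 + 1) u : H)‖)
    (u : smoothVectors K₀) :
    ‖(smoothPow hK₀ r (regularize hK₀ n a u - a u) : H)‖ ≤
      2 * (C + C') / (n + 1) * ‖(smoothPow hK₀ (r + 1 + 1) u : H)‖ := by
  have h1 : regularize hK₀ n a u - a u =
      -(a (smoothCutoff hK₀ n u) - smoothCutoff hK₀ n (a (smoothCutoff hK₀ n u) : H)) -
        a (u - smoothCutoff hK₀ n u) := by
    rw [regularize_apply, map_sub]; abel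
  rw [h1, map_sub, map_neg, AddSubgroupClass.coe_sub]
  refine (norm_sub_le _ _).trans ?_
  rw [NegMemClass.coe_neg, norm_neg]
  have h2 := norm_sub_smoothCutoff_le hK₀ n r (a (smoothCutoff hK₀ n u))
  have h3 := (hC' (smoothCutoff hK₀ n u)).trans
    (mul_le_mul_of_nonneg_left (norm_smoothPow_smoothCutoff_le hK₀ n _ u) hC0')
  have h4 := (hC (u - smoothCutoff hK₀ n u)).trans
    (mul_le_mul_of_nonneg_left (norm_sub_smoothCutoff_le hK₀ n (r + 1) u) hC0)
  have h5 := mul_le_mul_of_nonneg_left h3 (by positivity : (0 : ℝ) ≤ 2 / (n + 1))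
  calc _ ≤ _ := add_le_add (h2.trans h5) h4
    _ = _ := by ring

variable {hK₀} {h : ℝ → SmoothEnd K₀} (hh : IsTameFamily hK₀ h)
include hh

/-- J h(t) J extends to a uniformly bounded operator on H which is Lipschitz in t, so the equation
is solvable in H. Its right side takes values in the range of a cutoff, which keeps the solution in
ℋ^∞. -/
theorem IsTameFamily.exists_regularized_solution (n : ℕ) (s : ℝ) (u : smoothVectors K₀) :
    ∃ y : ℝ → smoothVectors K₀, y s = u ∧
      ∀ t, HasSmoothDerivAt hK₀ y (-Complex.I • regularize hK₀ n (h t) (y t)) t := by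
  obtain ⟨C, hC0, hC⟩ := hh.bound 0
  obtain ⟨L, hL0, hL⟩ := hh.lip 0
  obtain ⟨G, hG⟩ := exists_smoothPow_smoothCutoff_eq hK₀ n (0 + 1)
  simp only [smoothPow_zero, Module.End.one_apply] at hC hL
  set A₀ : ℝ → H →ₗ[ℂ] H := fun t => (-Complex.I) • ((smoothVectors K₀).subtype ∘ₗ
    smoothCutoff hK₀ n ∘ₗ (smoothVectors K₀).subtype ∘ₗ h t ∘ₗ smoothCutoff hK₀ n) with hA₀
  have hA₀' : ∀ t ψ, A₀ t ψ =
      ((-Complex.I • smoothCutoff hK₀ n (h t (smoothCutoff hK₀ n ψ) : H) : smoothVectors K₀) : H) :=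
    fun t ψ => rfl
  have hb : ∀ t ψ, ‖A₀ t ψ‖ ≤ C * ‖G‖ * ‖ψ‖ := by
    intro t ψ
    rw [hA₀', Submodule.coe_smul, norm_smul, norm_neg, Complex.norm_I, one_mul]
    refine (norm_smoothCutoff_le hK₀ n _).trans ((hC t _).trans ?_)
    rw [hG, mul_assoc]
    exact mul_le_mul_of_nonneg_left (G.le_opNorm ψ) hC0
  set A : ℝ → H →L[ℂ] H := fun t => (A₀ t).mkContinuous _ (hb t) with hA
  have hAn : ∀ t, ‖A t‖ ≤ C * ‖G‖ := fun t =>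
    LinearMap.mkContinuous_norm_le _ (mul_nonneg hC0 (norm_nonneg _)) _
  have hAc : Continuous A := by
    refine (LipschitzWith.of_dist_le_mul (K := ⟨L * ‖G‖, mul_nonneg hL0 (norm_nonneg _)⟩)
      fun t t' => ?_).continuous
    rw [dist_eq_norm, Real.dist_eq]
    refine ContinuousLinearMap.opNorm_le_bound _
      (mul_nonneg (mul_nonneg hL0 (norm_nonneg _)) (abs_nonneg _)) fun ψ => ?_
    have h1 : (A t - A t') ψ = ((-Complex.I • smoothCutoff hK₀ n
        ((h t (smoothCutoff hK₀ n ψ) - h t' (smoothCutoff hK₀ n ψ) : smoothVectors K₀) : H) :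
          smoothVectors K₀) : H) := by
      rw [AddSubgroupClass.coe_sub, map_sub, smul_sub]
      rfl
    rw [h1, Submodule.coe_smul, norm_smul, norm_neg, Complex.norm_I, one_mul]
    refine (norm_smoothCutoff_le hK₀ n _).trans ((hL t t' _).trans ?_)
    rw [hG]
    calc L * |t - t'| * ‖G ψ‖ ≤ L * |t - t'| * (‖G‖ * ‖ψ‖) := by
          gcongr; exact G.le_opNorm ψ
      _ = L * ‖G‖ * |t - t'| * ‖ψ‖ := by ring
  obtain ⟨z, hz0, hz⟩ := exists_linear_ode_solution hAc hAn s (u : H)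
  have hcut : ∀ t ψ, (smoothCutoff hK₀ (2 * n + 1) (A t ψ) : H) = A t ψ := by
    intro t ψ
    have h1 : A t ψ = -Complex.I • (smoothCutoff hK₀ n (h t (smoothCutoff hK₀ n ψ) : H) : H) := rfl
    rw [h1, map_smul, smoothCutoff_smoothCutoff]
    rfl
  -- A wider cutoff fixes the velocity, so z minus its cutoff is constant, and z - u is fixed by
  -- that cutoff at all times.
  have hzu : ∀ t, (smoothCutoff hK₀ (2 * n + 1) (z t - u) : H) = z t - u := by
    have hd : ∀ t, HasDerivAt (fun t => z t - cutoffOp K₀ (2 * n + 1 + 1) (z t)) 0 t := by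
      intro t
      have h1 := (hz t).sub (((cutoffOp K₀ (2 * n + 1 + 1)).restrictScalars ℝ).hasFDerivAt.comp_hasDerivAt
        t (hz t))
      have h2 : A t (z t) - (cutoffOp K₀ (2 * n + 1 + 1)) (A t (z t)) = 0 :=
        sub_eq_zero.2 (hcut t (z t)).symm
      exact h1.congr_deriv h2
    intro t
    have h1 := is_const_of_deriv_eq_zero (fun t => (hd t).differentiableAt) (fun t => (hd t).deriv)
      t s
    simp only [hz0] at h1
    rw [map_sub, AddSubgroupClass.coe_sub, coe_smoothCutoff, coe_smoothCutoff]
    have h2 : z t - u = cutoffOp K₀ (2 * n + 1 + 1) (z t) - cutoffOp K₀ (2 * n + 1 + 1) (u : H) := by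
      rw [sub_eq_sub_iff_add_eq_add] at h1 ⊢
      rw [h1]; abel
    exact h2.symm
  -- The solution z, rewritten as a curve in ℋ^∞; its derivative exists in every ℋ^r because K₀^r
  -- times a cutoff is bounded on H.
  refine ⟨fun t => u + smoothCutoff hK₀ (2 * n + 1) (z t - u), by simp [hz0], fun t r => ?_⟩
  have hy : ((u + smoothCutoff hK₀ (2 * n + 1) (z t - u) : smoothVectors K₀) : H) = z t := by
    rw [Submodule.coe_add, hzu]; abel
  obtain ⟨Gr, hGr⟩ := exists_smoothPow_smoothCutoff_eq hK₀ (2 * n + 1) r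
  have h1 : (-Complex.I • regularize hK₀ n (h t) (u + smoothCutoff hK₀ (2 * n + 1) (z t - u))) =
      smoothCutoff hK₀ (2 * n + 1) (A t (z t)) := by
    ext
    rw [hcut, regularize_apply, hy]
    rfl
  show HasDerivAt (fun t => (smoothPow hK₀ r (u + smoothCutoff hK₀ (2 * n + 1) (z t - u)) : H))
    (smoothPow hK₀ r (-Complex.I • regularize hK₀ n (h t)
      (u + smoothCutoff hK₀ (2 * n + 1) (z t - u))) : H) t
  rw [h1, hGr]
  simp only [map_add, Submodule.coe_add, hGr]
  have h2 := ((Gr.restrictScalars ℝ).hasFDerivAt.comp_hasDerivAt t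
    ((hz t).sub_const (u : H))).const_add (smoothPow hK₀ r u : H)
  exact h2

/-- The regularized solutions satisfy energy estimates that are uniform in the regularization. -/
theorem IsTameFamily.norm_regularized_solution_le (r : ℝ) : ∃ C : ℝ, 0 ≤ C ∧
    ∀ (n : ℕ) (y : ℝ → smoothVectors K₀),
    (∀ t, HasSmoothDerivAt hK₀ y (-Complex.I • regularize hK₀ n (h t) (y t)) t) → ∀ t s,
    ‖(smoothPow hK₀ r (y t) : H)‖ ≤ Real.exp (C * |t - s|) * ‖(smoothPow hK₀ r (y s) : H)‖ := by
  obtain ⟨C, hC0, hC⟩ := hh.comm r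
  refine ⟨C, hC0, fun n y hy t s => ?_⟩
  have h1 := le_of_abs_deriv_le (fun t => hasDerivAt_norm_sq (hy t r)) (K := 2 * C) (b := 0)
    (s := s) (t := t) le_rfl (by positivity) (fun τ _ => by
      rw [abs_mul, abs_two, add_zero, mul_assoc]
      have := abs_re_inner_smoothPow_le hK₀ (regularize_isSymmetricOp hK₀ n (hh.symm τ))
        (regularize_comm_le hK₀ n hC0 (hC τ)) (y τ)
      linarith)
  refine abs_le_of_sq_le_sq' ?_ (by positivity) |>.2
  have h2 : Real.exp (2 * C * |t - s|) = Real.exp (C * |t - s|) ^ 2 := by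
    rw [← Real.exp_nat_mul]
    push_cast
    ring_nf
  rw [zero_mul, add_zero, h2] at h1
  rw [mul_pow, mul_comm]
  exact h1

/-- The difference y - z solves the equation regularized at level n, with the source (J_n h J_n -
J_m h J_m) z. This source is small in ℋ^r since z is bounded in ℋ^(r+2) uniformly in m, and
Grönwall's inequality propagates the smallness. -/
theorem IsTameFamily.norm_regularized_sub_le (r R : ℝ) : ∃ C : ℝ, 0 ≤ C ∧
    ∀ (n m : ℕ) (y z : ℝ → smoothVectors K₀),
    (∀ t, HasSmoothDerivAt hK₀ y (-Complex.I • regularize hK₀ n (h t) (y t)) t) →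
    (∀ t, HasSmoothDerivAt hK₀ z (-Complex.I • regularize hK₀ m (h t) (z t)) t) →
    ∀ t s, |t - s| ≤ R → y s = z s →
    ‖(smoothPow hK₀ r (y t - z t) : H)‖ ≤
      C * (1 / (n + 1) + 1 / (m + 1)) * ‖(smoothPow hK₀ (r + 1 + 1) (z s) : H)‖ := by
  obtain ⟨C, hC0, hC⟩ := hh.comm r
  obtain ⟨C₁, hC₁0, hC₁⟩ := hh.bound r
  obtain ⟨C₂, hC₂0, hC₂⟩ := hh.bound (r + 1)
  obtain ⟨C₃, hC₃0, hC₃⟩ := hh.norm_regularized_solution_le (r + 1 + 1)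
  set D := 2 * (C₁ + C₂) * Real.exp (C₃ * R) with hD
  have hD0 : 0 ≤ D := by positivity
  refine ⟨D * Real.sqrt (R * Real.exp ((2 * C + 1) * R)), by positivity,
    fun n m y z hy hz t s hts hys => ?_⟩
  have hR0 : 0 ≤ R := (abs_nonneg _).trans hts
  set N := ‖(smoothPow hK₀ (r + 1 + 1) (z s) : H)‖ with hN
  set δ : ℝ := 1 / (n + 1) + 1 / (m + 1) with hδ
  have hδ0 : 0 ≤ δ := by positivity
  have hw : ∀ t, HasSmoothDerivAt hK₀ (fun t => y t - z t)
      (-Complex.I • regularize hK₀ n (h t) (y t - z t) +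
        -Complex.I • ((regularize hK₀ n (h t) (z t) - h t (z t)) -
          (regularize hK₀ m (h t) (z t) - h t (z t)))) t := by
    intro t
    have h1 := (hy t).sub hK₀ (hz t)
    convert h1 using 1
    rw [map_sub, ← smul_add, ← smul_sub]
    congr 1; abel
  have hβ : ∀ τ ∈ Set.uIcc s t, ‖(smoothPow hK₀ r (-Complex.I •
      ((regularize hK₀ n (h τ) (z τ) - h τ (z τ)) -
        (regularize hK₀ m (h τ) (z τ) - h τ (z τ)))) : H)‖ ≤ D * δ * N := by
    intro τ hτ
    have hτs : |τ - s| ≤ R := (Set.abs_sub_left_of_mem_uIcc hτ).trans hts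
    rw [map_smul, map_sub, Submodule.coe_smul, norm_smul, norm_neg, Complex.norm_I, one_mul,
      AddSubgroupClass.coe_sub]
    refine (norm_sub_le _ _).trans ?_
    have h1 := norm_regularize_sub_le hK₀ n hC₁0 hC₂0 (hC₁ τ) (hC₂ τ) (z τ)
    have h2 := norm_regularize_sub_le hK₀ m hC₁0 hC₂0 (hC₁ τ) (hC₂ τ) (z τ)
    have h3 : ‖(smoothPow hK₀ (r + 1 + 1) (z τ) : H)‖ ≤ Real.exp (C₃ * R) * N := by
      refine (hC₃ m z hz τ s).trans ?_
      gcongr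
    calc _ ≤ _ := add_le_add h1 h2
      _ = 2 * (C₁ + C₂) * δ * ‖(smoothPow hK₀ (r + 1 + 1) (z τ) : H)‖ := by rw [hδ]; ring
      _ ≤ 2 * (C₁ + C₂) * δ * (Real.exp (C₃ * R) * N) := by gcongr
      _ = D * δ * N := by rw [hD]; ring
  -- The commutator accounts for 2C; the extra 1 and the squared source come from 2‖w‖‖b‖ ≤ ‖w‖² +
  -- ‖b‖².
  have h1 := le_of_abs_deriv_le (fun t => hasDerivAt_norm_sq (hw t r)) (K := 2 * C + 1)
    (b := (D * δ * N) ^ 2) (s := s) (t := t) (by positivity) (by positivity) (fun τ hτ => by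
      have h1 := abs_re_inner_smoothPow_le hK₀ (regularize_isSymmetricOp hK₀ n (hh.symm τ))
        (regularize_comm_le hK₀ n hC0 (hC τ)) (y τ - z τ)
      have h2 := hβ τ hτ
      rw [map_add, Submodule.coe_add, inner_add_right, Complex.add_re]
      set b := (smoothPow hK₀ r (-Complex.I • ((regularize hK₀ n (h τ) (z τ) - h τ (z τ)) -
        (regularize hK₀ m (h τ) (z τ) - h τ (z τ)))) : H)
      have h3 : |(inner ℂ (smoothPow hK₀ r (y τ - z τ) : H) b).re| ≤
          ‖(smoothPow hK₀ r (y τ - z τ) : H)‖ * ‖b‖ :=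
        (Complex.abs_re_le_norm _).trans (norm_inner_le_norm _ _)
      rw [abs_mul, abs_two]
      have h4 := abs_add_le (inner ℂ (smoothPow hK₀ r (y τ - z τ) : H)
        (smoothPow hK₀ r (-Complex.I • regularize hK₀ n (h τ) (y τ - z τ)) : H)).re
        (inner ℂ (smoothPow hK₀ r (y τ - z τ) : H) b).re
      have h5 : ‖b‖ ^ 2 ≤ (D * δ * N) ^ 2 := pow_le_pow_left₀ (norm_nonneg _) h2 2
      nlinarith [sq_nonneg (‖(smoothPow hK₀ r (y τ - z τ) : H)‖ - ‖b‖)])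
  beta_reduce at h1
  rw [hys, sub_self, map_zero, Submodule.coe_zero, norm_zero, zero_pow two_ne_zero, zero_add] at h1
  have h2 : ‖(smoothPow hK₀ r (y t - z t) : H)‖ ^ 2 ≤
      (D * δ * N) ^ 2 * (R * Real.exp ((2 * C + 1) * R)) := by
    refine h1.trans ?_
    rw [mul_assoc]
    gcongr
  have h3 := Real.sqrt_le_sqrt h2
  rw [Real.sqrt_sq (norm_nonneg _), Real.sqrt_mul (by positivity), Real.sqrt_sq (by positivity)] at h3
  refine h3.trans (le_of_eq ?_)
  ring

/-- The regularized solutions are Cauchy in every ℋ^r, uniformly for bounded times, so they have a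
limit in ℋ^∞. -/
theorem IsTameFamily.exists_solution (s : ℝ) (u : smoothVectors K₀) :
    ∃ y : ℝ → smoothVectors K₀, y s = u ∧
      ∀ t, HasSmoothDerivAt hK₀ y (-Complex.I • h t (y t)) t := by
  choose y hys hy using fun n => hh.exists_regularized_solution n s u
  have hcau : ∀ r t, ∃ η : H, Tendsto (fun n => (smoothPow hK₀ r (y n t) : H)) atTop (𝓝 η) := by
    intro r t
    obtain ⟨C, hC0, hC⟩ := hh.norm_regularized_sub_le r |t - s|
    set N := ‖(smoothPow hK₀ (r + 1 + 1) u : H)‖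
    refine cauchySeq_tendsto_of_complete
      (cauchySeq_of_le_tendsto_0 (fun n : ℕ => C * (1 / (n + 1) + 1 / (n + 1)) * N) ?_ ?_)
    · intro n m k hn hm
      rw [dist_eq_norm, ← AddSubgroupClass.coe_sub, ← map_sub]
      refine (hC n m (y n) (y m) (hy n) (hy m) t s le_rfl (by rw [hys, hys])).trans ?_
      rw [hys]
      have h1 : (k : ℝ) ≤ n := by exact_mod_cast hn
      have h2 : (k : ℝ) ≤ m := by exact_mod_cast hm
      gcongr
    · have := (((tendsto_one_div_add_atTop_nhds_zero_nat (𝕜 := ℝ)).add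
        (tendsto_one_div_add_atTop_nhds_zero_nat (𝕜 := ℝ))).const_mul C).mul_const N
      simpa using this
  choose η hη using hcau
  choose w hw using fun t => exists_limit_of_smoothPow_tendsto hK₀ (fun r => hη r t)
  have hlim : ∀ r t, Tendsto (fun n => (smoothPow hK₀ r (y n t) : H)) atTop
      (𝓝 (smoothPow hK₀ r (w t))) := fun r t => by rw [hw]; exact hη r t
  have hnorm : ∀ r R, ∃ C : ℝ, 0 ≤ C ∧ ∀ t, |t - s| ≤ R → ‖(smoothPow hK₀ r (w t) : H)‖ ≤ C := by
    intro r R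
    obtain ⟨C, hC0, hC⟩ := hh.norm_regularized_solution_le r
    refine ⟨Real.exp (C * R) * ‖(smoothPow hK₀ r u : H)‖, by positivity, fun t ht => ?_⟩
    refine le_of_tendsto (hlim r t).norm (Eventually.of_forall fun n => ?_)
    refine (hC n (y n) (hy n) t s).trans ?_
    rw [hys]
    gcongr
  have hrate : ∀ r R, ∃ C : ℝ, 0 ≤ C ∧ ∀ n t, |t - s| ≤ R →
      ‖(smoothPow hK₀ r (y n t - w t) : H)‖ ≤ C / (n + 1) := by
    intro r R
    obtain ⟨C, hC0, hC⟩ := hh.norm_regularized_sub_le r R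
    refine ⟨C * ‖(smoothPow hK₀ (r + 1 + 1) u : H)‖, by positivity, fun n t ht => ?_⟩
    have h1 : Tendsto (fun m => ‖(smoothPow hK₀ r (y n t - y m t) : H)‖) atTop
        (𝓝 ‖(smoothPow hK₀ r (y n t - w t) : H)‖) := by
      simp only [map_sub, AddSubgroupClass.coe_sub]
      exact (tendsto_const_nhds.sub (hlim r t)).norm
    have h2 : Tendsto (fun m : ℕ => C * (1 / ((n : ℝ) + 1) + 1 / (m + 1)) *
        ‖(smoothPow hK₀ (r + 1 + 1) u : H)‖) atTop (𝓝 (C * (1 / ((n : ℝ) + 1) + 0) *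
        ‖(smoothPow hK₀ (r + 1 + 1) u : H)‖)) :=
      (((tendsto_one_div_add_atTop_nhds_zero_nat (𝕜 := ℝ)).const_add _).const_mul C).mul_const _
    have h3 := le_of_tendsto_of_tendsto' h1 h2 fun m => by
      have := hC n m (y n) (y m) (hy n) (hy m) t s ht (by rw [hys, hys])
      rwa [hys] at this
    refine h3.trans (le_of_eq ?_)
    ring
  refine ⟨w, ?_, fun t r => ?_⟩
  · have h1 := hlim 0 s
    simp only [hys, smoothPow_zero, Module.End.one_apply] at h1
    exact Subtype.ext (tendsto_nhds_unique h1 tendsto_const_nhds)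
  · set R := |t - s| + 1 with hR
    obtain ⟨C₀, hC₀0, hC₀⟩ := hrate (r + 1) R
    obtain ⟨C₁, hC₁0, hC₁⟩ := hh.bound r
    obtain ⟨C₂, hC₂0, hC₂⟩ := hh.bound (r + 1)
    obtain ⟨C₃, hC₃0, hC₃⟩ := hnorm (r + 1 + 1) R
    have hts : t ∈ Metric.ball s R := by rw [Metric.mem_ball, Real.dist_eq]; linarith
    -- The limit solves the equation because the derivatives converge locally uniformly: the
    -- solutions converge in ℋ^(r+1) at rate 1/(n + 1), and so do the regularized operators on the
    -- limit, which is bounded in ℋ^(r+2).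
    refine hasDerivAt_of_tendstoUniformlyOn (l := atTop)
      (f := fun n t => (smoothPow hK₀ r (y n t) : H))
      (f' := fun n t => (smoothPow hK₀ r (-Complex.I • regularize hK₀ n (h t) (y n t)) : H))
      (g' := fun t => (smoothPow hK₀ r (-Complex.I • h t (w t)) : H))
      Metric.isOpen_ball ?_ (Eventually.of_forall fun n τ _ => hy n τ r) (fun τ _ => hlim r τ) hts
    have hz : Tendsto (fun n : ℕ => (C₁ * C₀ + 2 * (C₁ + C₂) * C₃) * (1 / ((n : ℝ) + 1))) atTop
        (𝓝 0) := by
      simpa using (tendsto_one_div_add_atTop_nhds_zero_nat (𝕜 := ℝ)).const_mul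
        (C₁ * C₀ + 2 * (C₁ + C₂) * C₃)
    rw [Metric.tendstoUniformlyOn_iff]
    intro ε hε
    filter_upwards [hz.eventually (gt_mem_nhds hε)] with n hn τ hτ
    rw [Metric.mem_ball, Real.dist_eq] at hτ
    rw [dist_comm, dist_eq_norm, ← AddSubgroupClass.coe_sub, ← map_sub, ← smul_sub, map_smul,
      Submodule.coe_smul, norm_smul, norm_neg, Complex.norm_I, one_mul]
    refine lt_of_le_of_lt ?_ hn
    have h1 : regularize hK₀ n (h τ) (y n τ) - h τ (w τ) =
        regularize hK₀ n (h τ) (y n τ - w τ) + (regularize hK₀ n (h τ) (w τ) - h τ (w τ)) := by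
      rw [map_sub]; abel
    rw [h1, map_add, Submodule.coe_add]
    have h2 := (norm_regularize_le hK₀ n hC₁0 (hC₁ τ) (y n τ - w τ)).trans
      (mul_le_mul_of_nonneg_left (hC₀ n τ hτ.le) hC₁0)
    have h3 := (norm_regularize_sub_le hK₀ n hC₁0 hC₂0 (hC₁ τ) (hC₂ τ) (w τ)).trans
      (mul_le_mul_of_nonneg_left (hC₃ τ hτ.le) (by positivity))
    calc _ ≤ _ := (norm_add_le _ _).trans (add_le_add h2 h3)
      _ = _ := by ring

end Regularization
end SobolevGrowth
end

noncomputable section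
namespace SobolevGrowth
variable {H : Type*} [NormedAddCommGroup H] [InnerProductSpace ℂ H] [CompleteSpace H]

/-! ### Propagators -/

section Propagator

variable {K₀ : H →ₗ.[ℂ] H} {hK₀ : IsPositiveSelfAdjoint K₀}

/-- The bounded extension of a linear map defined on `ℋ^∞`. -/
def extendDense (L : smoothVectors K₀ →ₗ[ℂ] H) : H →L[ℂ] H :=
  L.extendOfNorm (smoothVectors K₀).subtype

theorem denseRange_subtype (hK₀ : IsPositiveSelfAdjoint K₀) :
    DenseRange (smoothVectors K₀).subtype := by
  have := dense_smoothVectors hK₀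
  rwa [DenseRange, Submodule.coe_subtype, Subtype.range_coe]

theorem extendDense_coe (hK₀ : IsPositiveSelfAdjoint K₀) {L : smoothVectors K₀ →ₗ[ℂ] H} {C : ℝ}
    (hL : ∀ u, ‖L u‖ ≤ C * ‖(u : H)‖) (u : smoothVectors K₀) : extendDense L (u : H) = L u :=
  LinearMap.extendOfNorm_eq (denseRange_subtype hK₀) ⟨C, hL⟩ u

theorem norm_extendDense_le (hK₀ : IsPositiveSelfAdjoint K₀) {L : smoothVectors K₀ →ₗ[ℂ] H} {C : ℝ}
    (hL : ∀ u, ‖L u‖ ≤ C * ‖(u : H)‖) (ψ : H) : ‖extendDense L ψ‖ ≤ C * ‖ψ‖ :=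
  LinearMap.norm_extendOfNorm_apply_le (denseRange_subtype hK₀) C hL ψ

theorem eq_of_eqOn_smoothVectors (hK₀ : IsPositiveSelfAdjoint K₀) {A B : H →L[ℂ] H}
    (h : ∀ u : smoothVectors K₀, A u = B u) : A = B := by
  refine DFunLike.ext' (Continuous.ext_on (dense_smoothVectors hK₀) A.continuous B.continuous ?_)
  intro ψ hψ
  exact h ⟨ψ, hψ⟩

/-- Strong continuity follows from strong continuity on `ℋ^∞` and local boundedness. -/
theorem continuous_apply_of_dense {X : Type*} [TopologicalSpace X] (hK₀ : IsPositiveSelfAdjoint K₀)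
    {F : X → H →L[ℂ] H} (hF : ∀ u : smoothVectors K₀, Continuous fun x => F x u)
    (hb : ∀ x₀, ∃ C : ℝ, ∀ᶠ x in 𝓝 x₀, ∀ ψ, ‖F x ψ‖ ≤ C * ‖ψ‖) (ψ : H) :
    Continuous fun x => F x ψ := by
  rw [continuous_iff_continuousAt]
  intro x₀
  obtain ⟨C, hC⟩ := hb x₀
  rw [ContinuousAt, Metric.tendsto_nhds]
  intro ε hε
  have hC0 : 0 ≤ |C| := abs_nonneg C
  obtain ⟨φ, hφ, hd⟩ := Metric.dense_iff.1 (dense_smoothVectors hK₀) ψ (ε / (3 * (|C| + 1)))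
    (by positivity)
  rw [Metric.mem_ball, dist_eq_norm, lt_div_iff₀ (by positivity)] at hφ
  have h1 := Metric.tendsto_nhds.1 ((hF ⟨φ, hd⟩).tendsto x₀) (ε / 3) (by positivity)
  filter_upwards [h1, hC] with x hx hCx
  have hC₀ := hC.self_of_nhds
  rw [dist_eq_norm] at hx ⊢
  have h2 : F x ψ - F x₀ ψ = -F x (φ - ψ) + (F x φ - F x₀ φ) + F x₀ (φ - ψ) := by
    simp only [map_sub]; abel
  rw [h2]
  have h3 : ∀ x, (∀ ψ, ‖F x ψ‖ ≤ C * ‖ψ‖) → ‖F x (φ - ψ)‖ < ε / 3 := by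
    intro x hx
    have h4 := hx (φ - ψ)
    have h5 : C * ‖φ - ψ‖ ≤ |C| * ‖φ - ψ‖ :=
      mul_le_mul_of_nonneg_right (le_abs_self C) (norm_nonneg _)
    have h6 := norm_nonneg (φ - ψ)
    nlinarith
  have h4 := h3 x hCx
  have h5 := h3 x₀ hC₀
  calc _ ≤ ‖F x (φ - ψ)‖ + ‖F x φ - F x₀ φ‖ + ‖F x₀ (φ - ψ)‖ := by
        refine (norm_add_le _ _).trans (add_le_add_left ((norm_add_le _ _).trans ?_) _)
        rw [norm_neg]
    _ < ε := by linarith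

variable {h : ℝ → SmoothEnd K₀} (hh : IsTameFamily hK₀ h)

namespace IsTameFamily

/-- The evolution on `ℋ^∞`. -/
def evolution (t s : ℝ) : SmoothEnd K₀ where
  toFun u := (hh.exists_solution s u).choose t
  map_add' u v := by
    refine congrFun (hh.solution_unique (hh.exists_solution s (u + v)).choose_spec.2
      (z := fun t => (hh.exists_solution s u).choose t + (hh.exists_solution s v).choose t)
      (fun t => ?_) (s := s) ?_) t
    · rw [map_add, smul_add]
      exact ((hh.exists_solution s u).choose_spec.2 t).add hK₀
        ((hh.exists_solution s v).choose_spec.2 t)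
    · rw [(hh.exists_solution s (u + v)).choose_spec.1, (hh.exists_solution s u).choose_spec.1,
        (hh.exists_solution s v).choose_spec.1]
  map_smul' c u := by
    refine congrFun (hh.solution_unique (hh.exists_solution s (c • u)).choose_spec.2
      (z := fun t => c • (hh.exists_solution s u).choose t) (fun t => ?_) (s := s) ?_) t
    · rw [map_smul, smul_comm]
      exact ((hh.exists_solution s u).choose_spec.2 t).smul hK₀ c
    · rw [(hh.exists_solution s (c • u)).choose_spec.1, (hh.exists_solution s u).choose_spec.1]

theorem evolution_self (s : ℝ) (u : smoothVectors K₀) : hh.evolution s s u = u :=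
  (hh.exists_solution s u).choose_spec.1

theorem hasSmoothDerivAt_evolution (s : ℝ) (u : smoothVectors K₀) (t : ℝ) :
    HasSmoothDerivAt hK₀ (fun t => hh.evolution t s u) (-Complex.I • h t (hh.evolution t s u)) t :=
  (hh.exists_solution s u).choose_spec.2 t

theorem evolution_comp (t s r : ℝ) (u : smoothVectors K₀) :
    hh.evolution t s (hh.evolution s r u) = hh.evolution t r u :=
  congrFun (hh.solution_unique (hh.hasSmoothDerivAt_evolution s _)
    (hh.hasSmoothDerivAt_evolution r u) (s := s) (hh.evolution_self s _)) t

theorem norm_evolution (t s : ℝ) (u : smoothVectors K₀) : ‖(hh.evolution t s u : H)‖ = ‖(u : H)‖ := by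
  have := hh.norm_solution_eq (hh.hasSmoothDerivAt_evolution s u) t s
  rwa [hh.evolution_self] at this

theorem norm_smoothPow_evolution_le (r : ℝ) : ∃ C : ℝ, 0 ≤ C ∧ ∀ t s u,
    ‖(smoothPow hK₀ r (hh.evolution t s u) : H)‖ ≤
      Real.exp (C * |t - s|) * ‖(smoothPow hK₀ r u : H)‖ := by
  obtain ⟨C, hC0, hC⟩ := hh.norm_solution_le r
  refine ⟨C, hC0, fun t s u => ?_⟩
  have := hC _ (hh.hasSmoothDerivAt_evolution s u) t s
  rwa [hh.evolution_self] at this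

theorem norm_evolution_sub_le (r R : ℝ) : ∃ C : ℝ, 0 ≤ C ∧ ∀ t s u, |t - s| ≤ R →
    ‖(smoothPow hK₀ r (hh.evolution t s u - u) : H)‖ ≤
      C * |t - s| * ‖(smoothPow hK₀ (r + 1) u : H)‖ := by
  obtain ⟨C₁, hC₁0, hC₁⟩ := hh.bound r
  obtain ⟨C₂, hC₂0, hC₂⟩ := hh.norm_smoothPow_evolution_le (r + 1)
  refine ⟨C₁ * Real.exp (C₂ * R), by positivity, fun t s u hts => ?_⟩
  have h1 := Convex.norm_image_sub_le_of_norm_hasDerivWithin_le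
    (f := fun t => (smoothPow hK₀ r (hh.evolution t s u) : H)) (s := Set.uIcc s t)
    (C := C₁ * Real.exp (C₂ * R) * ‖(smoothPow hK₀ (r + 1) u : H)‖)
    (fun τ _ => (hh.hasSmoothDerivAt_evolution s u τ r).hasDerivWithinAt) (fun τ hτ => by
      rw [map_smul, Submodule.coe_smul, norm_smul, norm_neg, Complex.norm_I, one_mul]
      refine (hC₁ τ _).trans ?_
      rw [mul_assoc]
      refine mul_le_mul_of_nonneg_left ((hC₂ τ s u).trans ?_) hC₁0
      have : |τ - s| ≤ R := (Set.abs_sub_left_of_mem_uIcc hτ).trans hts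
      gcongr) (convex_uIcc s t) Set.left_mem_uIcc Set.right_mem_uIcc
  simp only [hh.evolution_self] at h1
  rw [map_sub, AddSubgroupClass.coe_sub]
  refine h1.trans (le_of_eq ?_)
  rw [Real.norm_eq_abs]; ring

/-- Both times are moved separately: U(t, s) - U(t₀, s₀) = (U(t, t₀) - 1) U(t₀, s) + U(t₀, s₀)(U(s₀,
s) - 1), and each short-time increment is Lipschitz at the cost of one power of K₀. -/
theorem continuous_smoothPow_evolution (r : ℝ) (u : smoothVectors K₀) :
    Continuous fun x : ℝ × ℝ => (smoothPow hK₀ r (hh.evolution x.1 x.2 u) : H) := by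
  rw [continuous_iff_continuousAt]
  rintro ⟨t₀, s₀⟩
  obtain ⟨C₁, hC₁0, hC₁⟩ := hh.norm_evolution_sub_le r 1
  obtain ⟨C₂, hC₂0, hC₂⟩ := hh.norm_smoothPow_evolution_le (r + 1)
  obtain ⟨C₃, hC₃0, hC₃⟩ := hh.norm_smoothPow_evolution_le r
  set N := ‖(smoothPow hK₀ (r + 1) u : H)‖ with hN
  rw [ContinuousAt, tendsto_iff_norm_sub_tendsto_zero]
  have hz : Tendsto (fun x : ℝ × ℝ => C₁ * |x.1 - t₀| * (Real.exp (C₂ * |t₀ - x.2|) * N) +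
      Real.exp (C₃ * |t₀ - s₀|) * (C₁ * |x.2 - s₀| * N)) (𝓝 (t₀, s₀)) (𝓝 0) := by
    have hc : Continuous (fun x : ℝ × ℝ => C₁ * |x.1 - t₀| * (Real.exp (C₂ * |t₀ - x.2|) * N) +
      Real.exp (C₃ * |t₀ - s₀|) * (C₁ * |x.2 - s₀| * N)) := by fun_prop
    have := hc.tendsto (t₀, s₀)
    simpa using this
  refine squeeze_zero' (Eventually.of_forall fun _ => norm_nonneg _) ?_ hz
  have hev : ∀ᶠ x : ℝ × ℝ in 𝓝 (t₀, s₀), |x.1 - t₀| ≤ 1 ∧ |x.2 - s₀| ≤ 1 := by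
    have h1 : ∀ᶠ x : ℝ × ℝ in 𝓝 (t₀, s₀), |x.1 - t₀| < 1 :=
      (continuous_fst.sub continuous_const).abs.continuousAt.eventually_lt_const (by simp)
    have h2 : ∀ᶠ x : ℝ × ℝ in 𝓝 (t₀, s₀), |x.2 - s₀| < 1 :=
      (continuous_snd.sub continuous_const).abs.continuousAt.eventually_lt_const (by simp)
    filter_upwards [h1, h2] with x hx hx'
    exact ⟨hx.le, hx'.le⟩
  filter_upwards [hev] with ⟨t, s⟩ ⟨ht, hs⟩
  dsimp only at ht hs ⊢
  have h1 : hh.evolution t s u - hh.evolution t₀ s₀ u =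
      (hh.evolution t t₀ (hh.evolution t₀ s u) - hh.evolution t₀ s u) +
        hh.evolution t₀ s₀ (hh.evolution s₀ s u - u) := by
    rw [map_sub, hh.evolution_comp, hh.evolution_comp]; abel
  rw [← AddSubgroupClass.coe_sub, ← map_sub, h1, map_add, Submodule.coe_add]
  refine (norm_add_le _ _).trans (add_le_add ?_ ?_)
  · refine (hC₁ t t₀ _ ht).trans ?_
    gcongr
    exact hC₂ _ _ _
  · refine (hC₃ _ _ _).trans ?_
    gcongr
    rw [abs_sub_comm s s₀]
    exact hC₁ s₀ s u (by rwa [abs_sub_comm])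

/-- The propagator on `H`, together with its conjugates `K₀ ^ r U K₀ ^ (-r)`. -/
def propagatorConj (r t s : ℝ) : H →L[ℂ] H :=
  extendDense ((smoothVectors K₀).subtype ∘ₗ
    (smoothPow hK₀ r * hh.evolution t s * smoothPow hK₀ (-r)))

theorem propagatorConj_bound (r : ℝ) : ∃ C : ℝ, 0 ≤ C ∧ ∀ t s (u : smoothVectors K₀),
    ‖((smoothVectors K₀).subtype ∘ₗ
      (smoothPow hK₀ r * hh.evolution t s * smoothPow hK₀ (-r))) u‖ ≤
      Real.exp (C * |t - s|) * ‖(u : H)‖ := by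
  obtain ⟨C, hC0, hC⟩ := hh.norm_smoothPow_evolution_le r
  refine ⟨C, hC0, fun t s u => ?_⟩
  have := hC t s (smoothPow hK₀ (-r) u)
  rwa [smoothPow_add_apply, add_neg_cancel, smoothPow_zero] at this

theorem propagatorConj_coe (r t s : ℝ) (u : smoothVectors K₀) :
    hh.propagatorConj r t s u = smoothPow hK₀ r (hh.evolution t s (smoothPow hK₀ (-r) u)) := by
  obtain ⟨C, -, hC⟩ := hh.propagatorConj_bound r
  exact extendDense_coe hK₀ (hC t s) u

theorem norm_propagatorConj_le (r : ℝ) : ∃ C : ℝ, 0 ≤ C ∧ ∀ t s ψ,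
    ‖hh.propagatorConj r t s ψ‖ ≤ Real.exp (C * |t - s|) * ‖ψ‖ := by
  obtain ⟨C, hC0, hC⟩ := hh.propagatorConj_bound r
  exact ⟨C, hC0, fun t s => norm_extendDense_le hK₀ (hC t s)⟩

theorem continuous_propagatorConj (r : ℝ) (ψ : H) :
    Continuous fun x : ℝ × ℝ => hh.propagatorConj r x.1 x.2 ψ := by
  refine continuous_apply_of_dense hK₀ (F := fun x : ℝ × ℝ => hh.propagatorConj r x.1 x.2)
    (fun u => ?_) (fun x₀ => ?_) ψ
  · simp only [propagatorConj_coe]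
    exact hh.continuous_smoothPow_evolution r _
  · obtain ⟨C, hC0, hC⟩ := hh.norm_propagatorConj_le r
    have hc : Continuous fun x : ℝ × ℝ => Real.exp (C * |x.1 - x.2|) := by fun_prop
    refine ⟨Real.exp (C * |x₀.1 - x₀.2|) + 1, ?_⟩
    filter_upwards [hc.continuousAt.eventually_lt_const (lt_add_one _)] with x hx ψ
    exact (hC _ _ _).trans (mul_le_mul_of_nonneg_right hx.le (norm_nonneg _))

/-- The propagator on `H`. -/
def propagator (t s : ℝ) : H →L[ℂ] H := hh.propagatorConj 0 t s

theorem propagator_coe (t s : ℝ) (u : smoothVectors K₀) :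
    hh.propagator t s u = hh.evolution t s u := by
  rw [propagator, propagatorConj_coe, neg_zero, smoothPow_zero]
  rfl

/-- An intertwining relation, clear on ℋ^∞ and extended by density. It shows that the propagator
preserves ℋ^r, the range of K₀^(-r), and acts there as the conjugated propagator. -/
theorem propagator_rpow {r : ℝ} (hr : 0 ≤ r) (t s : ℝ) (ψ : H) :
    hh.propagator t s ((boundedInverse K₀ ^ r) ψ) =
      (boundedInverse K₀ ^ r) (hh.propagatorConj r t s ψ) := by
  have : hh.propagator t s ∘L (boundedInverse K₀ ^ r) =
      (boundedInverse K₀ ^ r) ∘L hh.propagatorConj r t s := by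
    refine eq_of_eqOn_smoothVectors hK₀ fun u => ?_
    simp only [ContinuousLinearMap.comp_apply]
    rw [← smoothPow_neg hK₀ hr, propagator_coe, propagatorConj_coe,
      rpow_smoothPow hK₀ hr le_rfl, sub_self, rpow_zero_apply hK₀]
  exact DFunLike.congr_fun this ψ

theorem propagator_self (s : ℝ) : hh.propagator s s = 1 := by
  refine eq_of_eqOn_smoothVectors hK₀ fun u => ?_
  rw [propagator_coe, evolution_self]
  rfl

theorem propagator_comp (t s r : ℝ) : hh.propagator t s * hh.propagator s r = hh.propagator t r := by
  refine eq_of_eqOn_smoothVectors hK₀ fun u => ?_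
  rw [ContinuousLinearMap.mul_def, ContinuousLinearMap.comp_apply, propagator_coe, propagator_coe,
    propagator_coe, evolution_comp]

theorem norm_propagator (t s : ℝ) (ψ : H) : ‖hh.propagator t s ψ‖ = ‖ψ‖ := by
  have h1 : (fun ψ => ‖hh.propagator t s ψ‖) = fun ψ => ‖ψ‖ := by
    refine Continuous.ext_on (dense_smoothVectors hK₀) (by fun_prop) (by fun_prop) fun ψ hψ => ?_
    have := hh.norm_evolution t s ⟨ψ, hψ⟩
    rw [← hh.propagator_coe] at this
    exact this
  exact congrFun h1 ψ

theorem inner_propagator (t s : ℝ) (φ ψ : H) :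
    inner ℂ (hh.propagator t s φ) ψ = inner ℂ φ (hh.propagator s t ψ) := by
  have h1 : ψ = hh.propagator t s (hh.propagator s t ψ) := by
    rw [← ContinuousLinearMap.comp_apply, ← ContinuousLinearMap.mul_def, propagator_comp,
      propagator_self]
    rfl
  conv_lhs => rw [h1]
  let L : H →ₗᵢ[ℂ] H := ⟨(hh.propagator t s).toLinearMap, hh.norm_propagator t s⟩
  exact L.inner_map_map φ _

theorem isPropagator : IsPropagator h hh.propagator where
  refl := hh.propagator_self
  comp := hh.propagator_comp
  isometry := hh.norm_propagator
  mem r t s ψ hψ := by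
    rcases lt_or_ge r 0 with hr | hr
    · exact mem_domain_kpow_of_neg hr _
    · obtain ⟨χ, rfl⟩ := (mem_domain_kpow hr).1 hψ
      exact (mem_domain_kpow hr).2 ⟨_, (hh.propagator_rpow hr t s χ).symm⟩
  bounded r t s := by
    rcases lt_or_ge r 0 with hr | hr
    -- Negative orders follow by duality: pair η = K₀^r U ψ with itself and move U to the other side
    -- as the reversed propagator on ℋ^(-r).
    · obtain ⟨C, hC0, hC⟩ := hh.norm_propagatorConj_le (-r)
      refine ⟨Real.exp (C * |s - t|), fun ψ _ => ?_⟩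
      rw [sobolevNorm, sobolevNorm, kpowApply_of_neg hr, kpowApply_of_neg hr]
      have hr' : 0 ≤ -r := by linarith
      set η := (boundedInverse K₀ ^ (-r)) (hh.propagator t s ψ) with hη
      have h1 : ‖η‖ ^ 2 = (inner ℂ ((boundedInverse K₀ ^ (-r)) ψ)
          (hh.propagatorConj (-r) s t η)).re := by
        rw [inner_rpow hK₀, ← propagator_rpow hh hr', ← inner_propagator, ← inner_rpow hK₀, ← hη]
        exact (inner_self_eq_norm_sq (𝕜 := ℂ) η).symm
      have h2 := (Complex.re_le_norm _).trans (norm_inner_le_norm (𝕜 := ℂ)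
        ((boundedInverse K₀ ^ (-r)) ψ) (hh.propagatorConj (-r) s t η))
      have h3 := hC s t η
      rw [← h1] at h2
      rcases (norm_nonneg η).eq_or_lt with h0 | h0
      · rw [← h0]; positivity
      · have h4 : ‖η‖ * ‖η‖ ≤
            (Real.exp (C * |s - t|) * ‖(boundedInverse K₀ ^ (-r)) ψ‖) * ‖η‖ := by
          calc ‖η‖ * ‖η‖ = ‖η‖ ^ 2 := (sq _).symm
            _ ≤ _ := h2
            _ ≤ ‖(boundedInverse K₀ ^ (-r)) ψ‖ * (Real.exp (C * |s - t|) * ‖η‖) := by gcongr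
            _ = _ := by ring
        exact le_of_mul_le_mul_right h4 h0
    · obtain ⟨C, hC0, hC⟩ := hh.norm_propagatorConj_le r
      refine ⟨Real.exp (C * |t - s|), fun ψ hψ => ?_⟩
      obtain ⟨χ, rfl⟩ := (mem_domain_kpow hr).1 hψ
      rw [sobolevNorm, sobolevNorm, hh.propagator_rpow hr, kpowApply_rpow hK₀ hr,
        kpowApply_rpow hK₀ hr]
      exact hC t s χ
  continuous r ψ hψ := by
    rcases lt_or_ge r 0 with hr | hr
    · simp only [kpowApply_of_neg hr]
      exact (boundedInverse K₀ ^ (-r) : H →L[ℂ] H).continuous.comp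
        (hh.continuous_propagatorConj 0 ψ)
    · obtain ⟨χ, rfl⟩ := (mem_domain_kpow hr).1 hψ
      simp only [hh.propagator_rpow hr, kpowApply_rpow hK₀ hr]
      exact hh.continuous_propagatorConj r χ
  hasDerivAt r t s ψ φ hφ := by
    have h1 : φ = hh.evolution t s ψ := by
      ext
      rw [hφ, propagator_coe]
    have h2 := hh.hasSmoothDerivAt_evolution s ψ t r
    rw [map_smul, Submodule.coe_smul, ← h1] at h2
    simp only [coe_smoothPow, ← hh.propagator_coe] at h2
    exact h2

end IsTameFamily

theorem IsPropagator.mem_smoothVectors {U : ℝ → ℝ → H →L[ℂ] H} (hU : IsPropagator h U) (t s : ℝ)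
    (u : smoothVectors K₀) : U t s u ∈ smoothVectors K₀ :=
  SobolevGrowth.mem_smoothVectors.2 fun r => hU.mem r t s u (smoothVectors_le r u.2)

/-- A propagator, as an operator on `ℋ^∞`, solves the equation in the scale. -/
theorem IsPropagator.hasSmoothDerivAt (hK₀ : IsPositiveSelfAdjoint K₀) {U : ℝ → ℝ → H →L[ℂ] H}
    (hU : IsPropagator h U) (s t : ℝ) (u : smoothVectors K₀) :
    HasSmoothDerivAt hK₀ (fun t => ⟨U t s u, hU.mem_smoothVectors t s u⟩)
      (-Complex.I • h t ⟨U t s u, hU.mem_smoothVectors t s u⟩) t := by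
  intro r
  have := hU.hasDerivAt r t s u ⟨U t s u, hU.mem_smoothVectors t s u⟩ rfl
  rw [map_smul, Submodule.coe_smul]
  simp only [coe_smoothPow]
  exact this

-- On ℋ^∞ every propagator yields smooth solutions, which are unique; density of ℋ^∞ settles the
-- rest of H.
include hh in
theorem IsPropagator.unique {U U' : ℝ → ℝ → H →L[ℂ] H} (hU : IsPropagator h U)
    (hU' : IsPropagator h U') : U' = U := by
  funext t s
  refine eq_of_eqOn_smoothVectors hK₀ fun u => ?_
  have := hh.solution_unique (fun t => hU'.hasSmoothDerivAt hK₀ s t u)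
    (fun t => hU.hasSmoothDerivAt hK₀ s t u) (s := s)
    (by simp only [hU.refl, hU'.refl])
  exact congrArg Subtype.val (congrFun this t)

end Propagator
end SobolevGrowth
end

noncomputable section
namespace SobolevGrowth

/-! ### Bounded smooth maps into spaces with countably many seminorms -/

section Calculus

variable {F G K : Type*} [AddCommGroup F] [Module ℂ F] [AddCommGroup G] [Module ℂ G]
  [AddCommGroup K] [Module ℂ K] {E : Type*} [AddCommGroup E] [Module ℝ E]

/-- The sum of the first `N` seminorms of a family. -/
def seminormSum (p : ℕ → Seminorm ℂ F) (N : ℕ) : Seminorm ℂ F := ∑ i ∈ Finset.range N, p i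

theorem seminormSum_apply (p : ℕ → Seminorm ℂ F) (N : ℕ) (a : F) :
    seminormSum p N a = ∑ i ∈ Finset.range N, p i a := by
  induction N with
  | zero => simp [seminormSum]
  | succ N ih =>
    rw [Finset.sum_range_succ, ← ih, seminormSum, Finset.sum_range_succ, add_apply]
    rfl

theorem seminormSum_mono (p : ℕ → Seminorm ℂ F) {M N : ℕ} (h : M ≤ N) (a : F) :
    seminormSum p M a ≤ seminormSum p N a := by
  rw [seminormSum_apply, seminormSum_apply]
  exact Finset.sum_le_sum_of_subset_of_nonneg (Finset.range_mono h) fun i _ _ => apply_nonneg _ _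

theorem le_seminormSum (p : ℕ → Seminorm ℂ F) (j : ℕ) (a : F) : p j a ≤ seminormSum p (j + 1) a := by
  rw [seminormSum_apply]
  exact Finset.single_le_sum (f := fun i => p i a) (fun i _ => apply_nonneg _ _)
    (Finset.self_mem_range_succ j)

theorem seminorm_sum_le {ι : Type*} (P : Seminorm ℂ F) (s : Finset ι) (f : ι → F) :
    P (∑ i ∈ s, f i) ≤ ∑ i ∈ s, P (f i) :=
  Finset.le_sum_of_subadditive P (map_zero P).le (map_add_le_add P) s f

/-- Continuity of a linear map in terms of seminorms. -/
def IsBoundedMap (p : ℕ → Seminorm ℂ F) (q : ℕ → Seminorm ℂ G) (L : F →ₗ[ℂ] G) : Prop :=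
  ∀ j, ∃ (N : ℕ) (C : ℝ), 0 ≤ C ∧ ∀ a, q j (L a) ≤ C * seminormSum p N a

/-- Continuity of a bilinear map in terms of seminorms. -/
def IsBoundedBilin (p : ℕ → Seminorm ℂ F) (q : ℕ → Seminorm ℂ G) (r : ℕ → Seminorm ℂ K)
    (b : F →ₗ[ℂ] G →ₗ[ℂ] K) : Prop :=
  ∀ j, ∃ (N : ℕ) (C : ℝ), 0 ≤ C ∧ ∀ a c, r j (b a c) ≤ C * seminormSum p N a * seminormSum q N c

/-- Uniform boundedness with respect to every seminorm. -/
def IsBoundedFamily (p : ℕ → Seminorm ℂ F) {X : Type*} (f : X → F) : Prop :=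
  ∀ j, ∃ C : ℝ, ∀ x, p j (f x) ≤ C

/-- `g` is the derivative of `f` in the direction `w`, with a uniform quadratic remainder. -/
def HasUniformDeriv (p : ℕ → Seminorm ℂ F) (w : E) (f g : E → F) : Prop :=
  ∀ j, ∃ C : ℝ, ∀ (x : E) (t : ℝ), p j (f (x + t • w) - f x - (t : ℂ) • g x) ≤ C * t ^ 2

/-- Boundedness of the directional derivatives up to order `N`. -/
def IsBoundedSmoothOrder (p : ℕ → Seminorm ℂ F) : ℕ → (E → F) → Prop
  | 0, f => IsBoundedFamily p f
  | N + 1, f => IsBoundedFamily p f ∧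
      ∀ w : E, ∃ g, HasUniformDeriv p w f g ∧ IsBoundedSmoothOrder p N g

/-- Boundedness of the directional derivatives of all orders. -/
def IsBoundedSmooth (p : ℕ → Seminorm ℂ F) (f : E → F) : Prop := ∀ N, IsBoundedSmoothOrder p N f

variable {p : ℕ → Seminorm ℂ F} {q : ℕ → Seminorm ℂ G} {r : ℕ → Seminorm ℂ K}

section BoundedFamily
variable {X : Type*}

theorem IsBoundedFamily.seminormSum {f : X → F} (hf : IsBoundedFamily p f) (N : ℕ) :
    ∃ C : ℝ, 0 ≤ C ∧ ∀ x, SobolevGrowth.seminormSum p N (f x) ≤ C := by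
  choose C hC using hf
  refine ⟨∑ i ∈ Finset.range N, |C i|, Finset.sum_nonneg fun _ _ => abs_nonneg _, fun x => ?_⟩
  rw [seminormSum_apply]
  exact Finset.sum_le_sum fun i _ => (hC i x).trans (le_abs_self _)

theorem IsBoundedFamily.nonneg {f : X → F} (hf : IsBoundedFamily p f) (j : ℕ) :
    ∃ C : ℝ, 0 ≤ C ∧ ∀ x, p j (f x) ≤ C := by
  obtain ⟨C, hC⟩ := hf j
  exact ⟨|C|, abs_nonneg _, fun x => (hC x).trans (le_abs_self _)⟩

theorem IsBoundedFamily.add {f g : X → F} (hf : IsBoundedFamily p f) (hg : IsBoundedFamily p g) :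
    IsBoundedFamily p fun x => f x + g x := fun j => by
  obtain ⟨C, hC⟩ := hf j
  obtain ⟨D, hD⟩ := hg j
  exact ⟨C + D, fun x => (map_add_le_add _ _ _).trans (add_le_add (hC x) (hD x))⟩

theorem IsBoundedFamily.map {L : F →ₗ[ℂ] G} (hL : IsBoundedMap p q L) {f : X → F}
    (hf : IsBoundedFamily p f) : IsBoundedFamily q fun x => L (f x) := fun j => by
  obtain ⟨N, C, hC0, hC⟩ := hL j
  obtain ⟨D, hD0, hD⟩ := hf.seminormSum N
  exact ⟨C * D, fun x => (hC _).trans (mul_le_mul_of_nonneg_left (hD x) hC0)⟩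

theorem IsBoundedFamily.bilin {b : F →ₗ[ℂ] G →ₗ[ℂ] K} (hb : IsBoundedBilin p q r b) {f : X → F}
    {g : X → G} (hf : IsBoundedFamily p f) (hg : IsBoundedFamily q g) :
    IsBoundedFamily r fun x => b (f x) (g x) := fun j => by
  obtain ⟨N, C, hC0, hC⟩ := hb j
  obtain ⟨D, hD0, hD⟩ := hf.seminormSum N
  obtain ⟨D', hD'0, hD'⟩ := hg.seminormSum N
  refine ⟨C * D * D', fun x => (hC _ _).trans ?_⟩
  have := hD x
  have := hD' x
  have : 0 ≤ SobolevGrowth.seminormSum q N (g x) := apply_nonneg _ _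
  gcongr

end BoundedFamily

theorem HasUniformDeriv.nonneg {w : E} {f g : E → F} (h : HasUniformDeriv p w f g) (j : ℕ) :
    ∃ C : ℝ, 0 ≤ C ∧ ∀ (x : E) (t : ℝ), p j (f (x + t • w) - f x - (t : ℂ) • g x) ≤ C * t ^ 2 := by
  obtain ⟨C, hC⟩ := h j
  exact ⟨|C|, abs_nonneg _, fun x t => (hC x t).trans
    (mul_le_mul_of_nonneg_right (le_abs_self _) (sq_nonneg t))⟩

theorem HasUniformDeriv.seminormSum {w : E} {f g : E → F} (h : HasUniformDeriv p w f g) (N : ℕ) :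
    ∃ C : ℝ, 0 ≤ C ∧ ∀ (x : E) (t : ℝ),
      SobolevGrowth.seminormSum p N (f (x + t • w) - f x - (t : ℂ) • g x) ≤ C * t ^ 2 := by
  choose C hC0 hC using h.nonneg
  refine ⟨∑ i ∈ Finset.range N, C i, Finset.sum_nonneg fun _ _ => hC0 _, fun x t => ?_⟩
  rw [seminormSum_apply, Finset.sum_mul]
  exact Finset.sum_le_sum fun i _ => hC i x t

/-- For |t| ≤ 1 the quadratic remainder is dominated by |t|; for |t| ≥ 1 the boundedness of f alone
suffices. -/
theorem HasUniformDeriv.lipschitz {w : E} {f g : E → F} (h : HasUniformDeriv p w f g)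
    (hf : IsBoundedFamily p f) (hg : IsBoundedFamily p g) (j : ℕ) :
    ∃ C : ℝ, 0 ≤ C ∧ ∀ (x : E) (t : ℝ), p j (f (x + t • w) - f x) ≤ C * |t| := by
  obtain ⟨C, hC0, hC⟩ := h.nonneg j
  obtain ⟨B, hB0, hB⟩ := hf.nonneg j
  obtain ⟨D, hD0, hD⟩ := hg.nonneg j
  refine ⟨C + D + 2 * B, by positivity, fun x t => ?_⟩
  rcases le_total |t| 1 with ht | ht
  · have h1 : p j (f (x + t • w) - f x) ≤ C * t ^ 2 + |t| * D := by
      have h2 : f (x + t • w) - f x = (f (x + t • w) - f x - (t : ℂ) • g x) + (t : ℂ) • g x := by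
        abel
      rw [h2]
      refine (map_add_le_add _ _ _).trans (add_le_add (hC x t) ?_)
      rw [map_smul_eq_mul, Complex.norm_real, Real.norm_eq_abs]
      exact mul_le_mul_of_nonneg_left (hD x) (abs_nonneg t)
    have h3 : t ^ 2 ≤ |t| := by rw [← sq_abs]; nlinarith [abs_nonneg t]
    nlinarith [abs_nonneg t]
  · have h1 : p j (f (x + t • w) - f x) ≤ B + B :=
      (map_sub_le_add _ _ _).trans (add_le_add (hB _) (hB _))
    nlinarith

theorem HasUniformDeriv.lipschitz_seminormSum {w : E} {f g : E → F} (h : HasUniformDeriv p w f g)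
    (hf : IsBoundedFamily p f) (hg : IsBoundedFamily p g) (N : ℕ) :
    ∃ C : ℝ, 0 ≤ C ∧ ∀ (x : E) (t : ℝ),
      SobolevGrowth.seminormSum p N (f (x + t • w) - f x) ≤ C * |t| := by
  choose C hC0 hC using h.lipschitz hf hg
  refine ⟨∑ i ∈ Finset.range N, C i, Finset.sum_nonneg fun _ _ => hC0 _, fun x t => ?_⟩
  rw [seminormSum_apply, Finset.sum_mul]
  exact Finset.sum_le_sum fun i _ => hC i x t

theorem HasUniformDeriv.const (w : E) (a : F) : HasUniformDeriv p w (fun _ => a) fun _ => 0 :=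
  fun j => ⟨0, fun x t => by simp⟩

theorem HasUniformDeriv.add {w : E} {f g f' g' : E → F} (hf : HasUniformDeriv p w f f')
    (hg : HasUniformDeriv p w g g') :
    HasUniformDeriv p w (fun x => f x + g x) fun x => f' x + g' x := fun j => by
  obtain ⟨C, hC⟩ := hf j
  obtain ⟨D, hD⟩ := hg j
  refine ⟨C + D, fun x t => ?_⟩
  have h1 : f (x + t • w) + g (x + t • w) - (f x + g x) - (t : ℂ) • (f' x + g' x) =
      (f (x + t • w) - f x - (t : ℂ) • f' x) + (g (x + t • w) - g x - (t : ℂ) • g' x) := by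
    rw [smul_add]; abel
  rw [h1, add_mul]
  exact (map_add_le_add _ _ _).trans (add_le_add (hC x t) (hD x t))

theorem HasUniformDeriv.map {L : F →ₗ[ℂ] G} (hL : IsBoundedMap p q L) {w : E} {f f' : E → F}
    (hf : HasUniformDeriv p w f f') :
    HasUniformDeriv q w (fun x => L (f x)) fun x => L (f' x) := fun j => by
  obtain ⟨N, C, hC0, hC⟩ := hL j
  obtain ⟨D, hD0, hD⟩ := hf.seminormSum N
  refine ⟨C * D, fun x t => ?_⟩
  rw [← map_sub, ← map_smul, ← map_sub, mul_assoc]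
  exact (hC _).trans (mul_le_mul_of_nonneg_left (hD x t) hC0)

theorem isBoundedMap_smul (c : ℂ) : IsBoundedMap p p (c • LinearMap.id) := fun j => by
  refine ⟨j + 1, ‖c‖, norm_nonneg c, fun a => ?_⟩
  rw [LinearMap.smul_apply, LinearMap.id_apply, map_smul_eq_mul]
  exact mul_le_mul_of_nonneg_left (le_seminormSum p j a) (norm_nonneg c)

/-- Leibniz' rule with three remainder terms: the remainders of f and g, and the product of f' with
an increment of g, which is quadratic in t because g is Lipschitz. -/
theorem HasUniformDeriv.bilin {b : F →ₗ[ℂ] G →ₗ[ℂ] K} (hb : IsBoundedBilin p q r b) {w : E}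
    {f f' : E → F} {g g' : E → G} (hf : HasUniformDeriv p w f f') (hg : HasUniformDeriv q w g g')
    (hf0 : IsBoundedFamily p f) (hf1 : IsBoundedFamily p f') (hg0 : IsBoundedFamily q g)
    (hg1 : IsBoundedFamily q g') :
    HasUniformDeriv r w (fun x => b (f x) (g x)) fun x => b (f' x) (g x) + b (f x) (g' x) :=
  fun j => by
  obtain ⟨N, C, hC0, hC⟩ := hb j
  obtain ⟨A, hA0, hA⟩ := hf.seminormSum N
  obtain ⟨A', hA'0, hA'⟩ := hg.seminormSum N
  obtain ⟨L, hL0, hL⟩ := hg.lipschitz_seminormSum hg0 hg1 N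
  obtain ⟨B, hB0, hB⟩ := hf0.seminormSum N
  obtain ⟨B', hB'0, hB'⟩ := hf1.seminormSum N
  obtain ⟨D, hD0, hD⟩ := hg0.seminormSum N
  refine ⟨C * A * D + C * B' * L + C * B * A', fun x t => ?_⟩
  have h1 : b (f (x + t • w)) (g (x + t • w)) - b (f x) (g x) -
      (t : ℂ) • (b (f' x) (g x) + b (f x) (g' x)) =
      b (f (x + t • w) - f x - (t : ℂ) • f' x) (g (x + t • w)) +
      (t : ℂ) • b (f' x) (g (x + t • w) - g x) +
      b (f x) (g (x + t • w) - g x - (t : ℂ) • g' x) := by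
    simp only [map_sub, map_smul, LinearMap.sub_apply, LinearMap.smul_apply, smul_add, smul_sub]
    abel
  rw [h1]
  refine (map_add_le_add _ _ _).trans ((add_le_add (map_add_le_add _ _ _) le_rfl).trans ?_)
  rw [map_smul_eq_mul, Complex.norm_real, Real.norm_eq_abs]
  have n1 : ∀ y : G, 0 ≤ SobolevGrowth.seminormSum q N y := fun y => apply_nonneg _ _
  have n2 : ∀ y : F, 0 ≤ SobolevGrowth.seminormSum p N y := fun y => apply_nonneg _ _
  have e1 : r j (b (f (x + t • w) - f x - (t : ℂ) • f' x) (g (x + t • w))) ≤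
      C * (A * t ^ 2) * D := (hC _ _).trans (by
    have := hA x t
    have := hD (x + t • w)
    have := n1 (g (x + t • w))
    gcongr)
  have e2 : r j (b (f' x) (g (x + t • w) - g x)) ≤ C * B' * (L * |t|) := (hC _ _).trans (by
    have := hB' x
    have := hL x t
    have := n1 (g (x + t • w) - g x)
    gcongr)
  have e3 : r j (b (f x) (g (x + t • w) - g x - (t : ℂ) • g' x)) ≤ C * B * (A' * t ^ 2) :=
    (hC _ _).trans (by
      have := hB x
      have := hA' x t
      have := n1 (g (x + t • w) - g x - (t : ℂ) • g' x)
      gcongr)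
  have e4 : |t| * r j (b (f' x) (g (x + t • w) - g x)) ≤ C * B' * L * t ^ 2 := by
    calc _ ≤ |t| * (C * B' * (L * |t|)) := mul_le_mul_of_nonneg_left e2 (abs_nonneg t)
      _ = C * B' * L * |t| ^ 2 := by ring
      _ = _ := by rw [sq_abs]
  linarith

theorem IsBoundedSmoothOrder.bounded {N : ℕ} {f : E → F} (h : IsBoundedSmoothOrder p N f) :
    IsBoundedFamily p f := by
  cases N with
  | zero => exact h
  | succ N => exact h.1

theorem IsBoundedSmoothOrder.add {N : ℕ} {f g : E → F} (hf : IsBoundedSmoothOrder p N f)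
    (hg : IsBoundedSmoothOrder p N g) : IsBoundedSmoothOrder p N fun x => f x + g x := by
  induction N generalizing f g with
  | zero => exact IsBoundedFamily.add hf hg
  | succ N ih =>
    refine ⟨hf.1.add hg.1, fun w => ?_⟩
    obtain ⟨f', hf', hf''⟩ := hf.2 w
    obtain ⟨g', hg', hg''⟩ := hg.2 w
    exact ⟨_, hf'.add hg', ih hf'' hg''⟩

theorem IsBoundedSmoothOrder.map {L : F →ₗ[ℂ] G} (hL : IsBoundedMap p q L) {N : ℕ} {f : E → F}
    (hf : IsBoundedSmoothOrder p N f) : IsBoundedSmoothOrder q N fun x => L (f x) := by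
  induction N generalizing f with
  | zero => exact IsBoundedFamily.map hL hf
  | succ N ih =>
    refine ⟨hf.1.map hL, fun w => ?_⟩
    obtain ⟨f', hf', hf''⟩ := hf.2 w
    exact ⟨_, hf'.map hL, ih hf''⟩

theorem IsBoundedSmoothOrder.const (N : ℕ) (a : F) :
    IsBoundedSmoothOrder p N fun _ : E => a := by
  induction N generalizing a with
  | zero => exact fun j => ⟨p j a, fun _ => le_rfl⟩
  | succ N ih => exact ⟨fun j => ⟨p j a, fun _ => le_rfl⟩, fun w => ⟨_, .const w a, ih 0⟩⟩

theorem IsBoundedSmoothOrder.of_succ {N : ℕ} {f : E → F} (h : IsBoundedSmoothOrder p (N + 1) f) :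
    IsBoundedSmoothOrder p N f := by
  induction N generalizing f with
  | zero => exact h.1
  | succ N ih =>
    refine ⟨h.1, fun w => ?_⟩
    obtain ⟨g, hg, hg'⟩ := h.2 w
    exact ⟨g, hg, ih hg'⟩

theorem IsBoundedSmoothOrder.bilin {b : F →ₗ[ℂ] G →ₗ[ℂ] K} (hb : IsBoundedBilin p q r b) {N : ℕ}
    {f : E → F} {g : E → G} (hf : IsBoundedSmoothOrder p N f) (hg : IsBoundedSmoothOrder q N g) :
    IsBoundedSmoothOrder r N fun x => b (f x) (g x) := by
  induction N generalizing f g with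
  | zero => exact IsBoundedFamily.bilin hb hf hg
  | succ N ih =>
    refine ⟨hf.1.bilin hb hg.1, fun w => ?_⟩
    obtain ⟨f', hf', hf''⟩ := hf.2 w
    obtain ⟨g', hg', hg''⟩ := hg.2 w
    exact ⟨_, hf'.bilin hb hg' hf.1 hf''.bounded hg.1 hg''.bounded,
      (ih hf'' hg.of_succ).add (ih hf.of_succ hg'')⟩

namespace IsBoundedSmooth

theorem bounded {f : E → F} (h : IsBoundedSmooth p f) : IsBoundedFamily p f := h 0

theorem add {f g : E → F} (hf : IsBoundedSmooth p f) (hg : IsBoundedSmooth p g) :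
    IsBoundedSmooth p fun x => f x + g x := fun N => (hf N).add (hg N)

theorem map {L : F →ₗ[ℂ] G} (hL : IsBoundedMap p q L) {f : E → F} (hf : IsBoundedSmooth p f) :
    IsBoundedSmooth q fun x => L (f x) := fun N => (hf N).map hL

theorem smul (c : ℂ) {f : E → F} (hf : IsBoundedSmooth p f) : IsBoundedSmooth p fun x => c • f x :=
  hf.map (isBoundedMap_smul c)

theorem const (a : F) : IsBoundedSmooth p fun _ : E => a := fun N => .const N a

theorem bilin {b : F →ₗ[ℂ] G →ₗ[ℂ] K} (hb : IsBoundedBilin p q r b) {f : E → F} {g : E → G}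
    (hf : IsBoundedSmooth p f) (hg : IsBoundedSmooth q g) :
    IsBoundedSmooth r fun x => b (f x) (g x) := fun N => (hf N).bilin hb (hg N)

end IsBoundedSmooth

/-- If the seminorms separate points, uniform derivatives are unique. -/
theorem HasUniformDeriv.unique (hp : ∀ a : F, (∀ j, p j a = 0) → a = 0) {w : E} {f g g' : E → F}
    (h : HasUniformDeriv p w f g) (h' : HasUniformDeriv p w f g') : g = g' := by
  funext x
  refine sub_eq_zero.1 (hp _ fun j => ?_)
  obtain ⟨C, hC0, hC⟩ := h.nonneg j
  obtain ⟨D, hD0, hD⟩ := h'.nonneg j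
  refine le_antisymm (le_of_forall_pos_le_add fun ε hε => ?_) (apply_nonneg _ _)
  set t : ℝ := ε / (C + D + 1) with ht
  have ht0 : 0 < t := by positivity
  have h1 : p j ((t : ℂ) • (g x - g' x)) ≤ C * t ^ 2 + D * t ^ 2 := by
    have h2 : (t : ℂ) • (g x - g' x) = (f (x + t • w) - f x - (t : ℂ) • g' x) -
        (f (x + t • w) - f x - (t : ℂ) • g x) := by
      rw [smul_sub]; abel
    rw [h2, add_comm (C * t ^ 2)]
    exact (map_sub_le_add _ _ _).trans (add_le_add (hD x t) (hC x t))
  rw [map_smul_eq_mul, Complex.norm_real, Real.norm_of_nonneg ht0.le] at h1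
  have h2 : p j (g x - g' x) ≤ (C + D) * t := by
    refine le_of_mul_le_mul_left ?_ ht0
    calc _ ≤ _ := h1
      _ = _ := by ring
  have h3 : (C + D) * t ≤ ε := by
    rw [ht, mul_div_assoc', div_le_iff₀ (by positivity)]
    nlinarith
  linarith

/-- The definition of smoothness may supply a different derivative for every order; uniqueness of
derivatives makes them coincide. -/
theorem IsBoundedSmooth.exists_deriv (hp : ∀ a : F, (∀ j, p j a = 0) → a = 0) {f : E → F}
    (hf : IsBoundedSmooth p f) (w : E) : ∃ g, HasUniformDeriv p w f g ∧ IsBoundedSmooth p g := by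
  obtain ⟨g, hg, -⟩ := (hf 1).2 w
  refine ⟨g, hg, fun N => ?_⟩
  obtain ⟨g', hg', hN⟩ := (hf (N + 1)).2 w
  rwa [hg.unique hp hg']

/-! ### Comparison with partial derivatives -/

/-- The mean value inequality for a seminorm. -/
theorem seminorm_sub_le_of_deriv (P : Seminorm ℂ F) {f f' : ℝ → F}
    (hf : ∀ t, Tendsto (fun h : ℝ => P (((h⁻¹ : ℝ) : ℂ) • (f (t + h) - f t) - f' t)) (𝓝[≠] 0) (𝓝 0))
    {M t : ℝ} (hM : ∀ τ ∈ Set.uIcc 0 t, P (f' τ) ≤ M) : P (f t - f 0) ≤ M * |t| := by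
  have key : ∀ {f f' : ℝ → F} {t : ℝ}, 0 ≤ t →
      (∀ t, Tendsto (fun h : ℝ => P (((h⁻¹ : ℝ) : ℂ) • (f (t + h) - f t) - f' t)) (𝓝[≠] 0) (𝓝 0)) →
      (∀ τ ∈ Set.Icc 0 t, P (f' τ) ≤ M) → P (f t - f 0) ≤ M * t := by
    intro f f' t ht hf hM
    have hbase : ∀ x h : ℝ, h ≠ 0 → P (f (x + h) - f x) ≤
        |h| * (P (((h⁻¹ : ℝ) : ℂ) • (f (x + h) - f x) - f' x) + P (f' x)) := by
      intro x h hh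
      have h1 : f (x + h) - f x = ((h : ℝ) : ℂ) •
          ((((h⁻¹ : ℝ) : ℂ) • (f (x + h) - f x) - f' x) + f' x) := by
        rw [sub_add_cancel, smul_smul, ← Complex.ofReal_mul, mul_inv_cancel₀ hh, Complex.ofReal_one,
          one_smul]
      conv_lhs => rw [h1]
      rw [map_smul_eq_mul, Complex.norm_real, Real.norm_eq_abs]
      exact mul_le_mul_of_nonneg_left (map_add_le_add _ _ _) (abs_nonneg h)
    have hcont : Continuous fun τ => P (f τ - f 0) := by
      rw [continuous_iff_continuousAt]
      intro x
      have h1 : Tendsto (fun h : ℝ => P (f (x + h) - f x)) (𝓝 0) (𝓝 0) := by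
        have h2 : Tendsto (fun h : ℝ => |h| *
            (P (((h⁻¹ : ℝ) : ℂ) • (f (x + h) - f x) - f' x) + P (f' x))) (𝓝[≠] 0) (𝓝 0) := by
          have h3 : Tendsto (fun h : ℝ => |h|) (𝓝[≠] 0) (𝓝 0) := by
            have := (continuous_abs (G := ℝ)).tendsto 0
            rw [abs_zero] at this
            exact this.mono_left nhdsWithin_le_nhds
          simpa using h3.mul ((hf x).add_const _)
        have h4 : Tendsto (fun h : ℝ => P (f (x + h) - f x)) (𝓝[≠] 0) (𝓝 0) := by
          refine squeeze_zero' (Eventually.of_forall fun _ => apply_nonneg _ _) ?_ h2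
          filter_upwards [self_mem_nhdsWithin] with h hh
          exact hbase x h hh
        have h5 := continuousAt_iff_punctured_nhds (f := fun h : ℝ => P (f (x + h) - f x)) (a := 0)
        simp only [ContinuousAt, add_zero, sub_self, map_zero] at h5
        exact h5.2 h4
      have h2 : Tendsto (fun z : ℝ => P (f z - f x)) (𝓝 x) (𝓝 0) := by
        have h3 : Tendsto (fun z : ℝ => z - x) (𝓝 x) (𝓝 0) := by
          have := (continuous_sub_right x).tendsto x
          rwa [sub_self] at this
        refine (h1.comp h3).congr fun z => ?_
        simp
      rw [ContinuousAt, tendsto_iff_norm_sub_tendsto_zero]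
      refine squeeze_zero (fun _ => norm_nonneg _) (fun z => ?_) h2
      rw [Real.norm_eq_abs]
      refine (abs_sub_map_le_sub P _ _).trans (le_of_eq ?_)
      rw [sub_sub_sub_cancel_right]
    -- The comparison theorem for right slopes is applied to the real function τ ↦ P(f τ - f 0), as
    -- only seminorms of f are under control.
    have h1 := image_le_of_liminf_slope_right_le_deriv_boundary (f := fun τ => P (f τ - f 0))
      (B := fun τ => M * τ) (B' := fun _ => M) (a := 0) (b := t) hcont.continuousOn
      (by simp) (by fun_prop)
      (fun x _ => by simpa using ((hasDerivAt_id x).const_mul M).hasDerivWithinAt)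
      (fun x hx r hr => by
        have hlt : P (f' x) < r := lt_of_le_of_lt (hM x ⟨hx.1, hx.2.le⟩) hr
        have h2 := (hf x).eventually (gt_mem_nhds (sub_pos.2 hlt))
        have h3 : Tendsto (fun z : ℝ => z - x) (𝓝[>] x) (𝓝[≠] 0) := by
          refine tendsto_nhdsWithin_iff.2 ⟨?_, ?_⟩
          · have := (continuous_sub_right x).tendsto x
            rw [sub_self] at this
            exact this.mono_left nhdsWithin_le_nhds
          · filter_upwards [self_mem_nhdsWithin] with z hz
            exact (sub_pos.2 hz).ne'
        refine Eventually.frequently ?_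
        filter_upwards [h3.eventually h2, self_mem_nhdsWithin] with z hz hxz
        have hpos : 0 < z - x := sub_pos.2 hxz
        rw [add_sub_cancel] at hz
        have h4 := hbase x (z - x) hpos.ne'
        rw [add_sub_cancel, abs_of_pos hpos] at h4
        have h5 : P (f z - f 0) - P (f x - f 0) ≤ P (f z - f x) := by
          have h6 := (le_abs_self _).trans (abs_sub_map_le_sub P (f z - f 0) (f x - f 0))
          rwa [sub_sub_sub_cancel_right] at h6
        rw [slope_def_field, div_lt_iff₀ hpos]
        nlinarith) ⟨ht, le_rfl⟩
    exact h1
  rcases le_total 0 t with ht | ht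
  · rw [abs_of_nonneg ht]
    exact key ht hf (by rwa [Set.uIcc_of_le ht] at hM)
  · rw [abs_of_nonpos ht]
    have h1 := key (f := fun τ => f (-τ)) (f' := fun τ => -f' (-τ)) (t := -t) (by linarith)
      (fun τ => by
        have h2 : Tendsto (fun h : ℝ => -h) (𝓝[≠] 0) (𝓝[≠] 0) := by
          refine tendsto_nhdsWithin_iff.2 ⟨?_, ?_⟩
          · have := (continuous_neg (G := ℝ)).tendsto 0
            rw [neg_zero] at this
            exact this.mono_left nhdsWithin_le_nhds
          · filter_upwards [self_mem_nhdsWithin] with z hz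
            exact neg_ne_zero.2 hz
        refine ((hf (-τ)).comp h2).congr fun h => ?_
        have h3 : (((h⁻¹ : ℝ) : ℂ) • (f (-(τ + h)) - f (-τ)) - -f' (-τ)) =
            -((((-h)⁻¹ : ℝ) : ℂ) • (f (-τ + -h) - f (-τ)) - f' (-τ)) := by
          rw [neg_sub, neg_add, inv_neg, Complex.ofReal_neg, neg_smul]
          abel
        rw [h3, map_neg_eq_map]
        rfl) (fun τ hτ => by
        rw [map_neg_eq_map]
        refine hM _ ?_
        rw [Set.uIcc_of_ge ht]
        exact ⟨by linarith [hτ.2], by linarith [hτ.1]⟩)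
    simpa using h1

theorem HasUniformDeriv.smul_dir {w : E} {f g : E → F} (h : HasUniformDeriv p w f g) (c : ℝ) :
    HasUniformDeriv p (c • w) f fun x => (c : ℂ) • g x := fun j => by
  obtain ⟨C, hC⟩ := h j
  refine ⟨C * c ^ 2, fun x t => ?_⟩
  have := hC x (t * c)
  rw [smul_smul, smul_smul, ← Complex.ofReal_mul]
  refine this.trans (le_of_eq ?_)
  ring

/-- Move along w₁ and afterwards along w₂. The second derivative is evaluated at the shifted point,
and the Lipschitz bound brings it back to x with an error quadratic in t. -/
theorem HasUniformDeriv.add_dir {w₁ w₂ : E} {f g₁ g₂ : E → F} (h₁ : HasUniformDeriv p w₁ f g₁)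
    (h₂ : HasUniformDeriv p w₂ f g₂)
    (hl : ∀ j, ∃ C : ℝ, 0 ≤ C ∧ ∀ (x : E) (t : ℝ), p j (g₂ (x + t • w₁) - g₂ x) ≤ C * |t|) :
    HasUniformDeriv p (w₁ + w₂) f fun x => g₁ x + g₂ x := fun j => by
  obtain ⟨C, hC⟩ := h₁ j
  obtain ⟨D, hD⟩ := h₂ j
  obtain ⟨L, hL0, hL⟩ := hl j
  refine ⟨C + D + L, fun x t => ?_⟩
  have h1 : f (x + t • (w₁ + w₂)) - f x - (t : ℂ) • (g₁ x + g₂ x) =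
      (f (x + t • w₁) - f x - (t : ℂ) • g₁ x) +
      (f (x + t • w₁ + t • w₂) - f (x + t • w₁) - (t : ℂ) • g₂ (x + t • w₁)) +
      (t : ℂ) • (g₂ (x + t • w₁) - g₂ x) := by
    rw [smul_add t, ← add_assoc, smul_add, smul_sub]; abel
  rw [h1]
  refine (map_add_le_add _ _ _).trans ((add_le_add (map_add_le_add _ _ _) le_rfl).trans ?_)
  rw [map_smul_eq_mul, Complex.norm_real, Real.norm_eq_abs]
  have e := mul_le_mul_of_nonneg_left (hL x t) (abs_nonneg t)
  have e2 : |t| * (L * |t|) = L * t ^ 2 := by rw [← sq_abs t]; ring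
  linarith [hC x t, hD (x + t • w₁) t]

theorem HasUniformDeriv.finset_sum {n : ℕ} {f : (Fin n → ℝ) → F} {g : Fin n → (Fin n → ℝ) → F}
    (hg : ∀ i, HasUniformDeriv p (Pi.single i (1 : ℝ)) f (g i))
    (hl : ∀ i l j, ∃ C : ℝ, 0 ≤ C ∧ ∀ (x : Fin n → ℝ) (t : ℝ),
      p j (g l (x + t • Pi.single i (1 : ℝ)) - g l x) ≤ C * |t|) (w : Fin n → ℝ)
    (s : Finset (Fin n)) :
    HasUniformDeriv p (∑ i ∈ s, w i • Pi.single i (1 : ℝ)) f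
      fun x => ∑ i ∈ s, (w i : ℂ) • g i x := by
  classical
  induction s using Finset.induction_on with
  | empty => exact fun j => ⟨0, fun x t => by simp⟩
  | insert a s ha ih =>
    simp only [Finset.sum_insert ha]
    refine ((hg a).smul_dir (w a)).add_dir ih fun j => ?_
    choose C hC0 hC using fun l => hl a l j
    refine ⟨∑ l ∈ s, |w l| * (C l * |w a|),
      Finset.sum_nonneg fun l _ => mul_nonneg (abs_nonneg _) (mul_nonneg (hC0 l) (abs_nonneg _)),
      fun x t => ?_⟩
    rw [← Finset.sum_sub_distrib, Finset.sum_mul]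
    refine (seminorm_sum_le (p j) _ _).trans (Finset.sum_le_sum fun l _ => ?_)
    rw [← smul_sub, map_smul_eq_mul, Complex.norm_real, Real.norm_eq_abs, smul_smul, mul_assoc]
    refine mul_le_mul_of_nonneg_left ((hC l x (t * w a)).trans (le_of_eq ?_)) (abs_nonneg _)
    rw [abs_mul]; ring

theorem single_eq_smul_single {n : ℕ} (i : Fin n) (h : ℝ) :
    (Pi.single i h : Fin n → ℝ) = h • Pi.single i (1 : ℝ) := by
  rw [← Pi.single_smul i h, smul_eq_mul, mul_one]

theorem tendsto_slope_line {w : E} {f g : E → F} {j : ℕ}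
    (h : ∀ x, Tendsto (fun h : ℝ => p j (((h⁻¹ : ℝ) : ℂ) • (f (x + h • w) - f x) - g x))
      (𝓝[≠] 0) (𝓝 0)) (x : E) (t : ℝ) :
    Tendsto (fun h : ℝ => p j (((h⁻¹ : ℝ) : ℂ) • (f (x + (t + h) • w) -
      f (x + t • w)) - g (x + t • w))) (𝓝[≠] 0) (𝓝 0) := by
  have h1 := h (x + t • w)
  have h2 : ∀ h : ℝ, x + t • w + h • w = x + (t + h) • w := fun h => by
    rw [add_smul t h, ← add_assoc x]
  simp only [h2] at h1
  exact h1

theorem lipschitz_of_tendsto_slope {w : E} {f g : E → F} {j : ℕ}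
    (h : ∀ x, Tendsto (fun h : ℝ => p j (((h⁻¹ : ℝ) : ℂ) • (f (x + h • w) - f x) - g x))
      (𝓝[≠] 0) (𝓝 0)) {C : ℝ} (hC : ∀ x, p j (g x) ≤ C) (x : E) (t : ℝ) :
    p j (f (x + t • w) - f x) ≤ C * |t| := by
  have h0 := tendsto_slope_line (p := p) (j := j) h x
  have h1 := seminorm_sub_le_of_deriv (p j) (f := fun t => f (x + t • w))
    (f' := fun t => g (x + t • w))
    h0 (M := C) (t := t) (fun τ _ => hC (x + τ • w))
  simp only [zero_smul, add_zero] at h1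
  exact h1

/-- The mean value inequality for f(x + tw) - t g(x), whose derivative g(x + tw) - g(x) is at most
C|t| on the segment. -/
theorem quadratic_of_tendsto_slope {w : E} {f g : E → F} {j : ℕ}
    (h : ∀ x, Tendsto (fun h : ℝ => p j (((h⁻¹ : ℝ) : ℂ) • (f (x + h • w) - f x) - g x))
      (𝓝[≠] 0) (𝓝 0)) {C : ℝ} (hC0 : 0 ≤ C)
    (hC : ∀ (x : E) (t : ℝ), p j (g (x + t • w) - g x) ≤ C * |t|)
    (x : E) (t : ℝ) :
    p j (f (x + t • w) - f x - (t : ℂ) • g x) ≤ C * t ^ 2 := by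
  have h3 : ∀ (A B Y Z : F) (t h : ℝ), h ≠ 0 → ((h⁻¹ : ℝ) : ℂ) • (A - B) - Y =
      ((h⁻¹ : ℝ) : ℂ) • ((A - ((t + h : ℝ) : ℂ) • Z) - (B - (t : ℂ) • Z)) - (Y - Z) := by
    intro A B Y Z t h hh
    have hh' : ((h⁻¹ : ℝ) : ℂ) * (h : ℂ) = 1 := by
      rw [← Complex.ofReal_mul, inv_mul_cancel₀ hh, Complex.ofReal_one]
    have h4 : (A - ((t + h : ℝ) : ℂ) • Z) - (B - (t : ℂ) • Z) = (A - B) - (h : ℂ) • Z := by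
      rw [Complex.ofReal_add, add_smul]; abel
    rw [h4, smul_sub _ (A - B), smul_smul, hh', one_smul]
    abel
  have h5 : ∀ t : ℝ, Tendsto (fun h : ℝ => p j (((h⁻¹ : ℝ) : ℂ) •
      ((f (x + (t + h) • w) - ((t + h : ℝ) : ℂ) • g x) -
      (f (x + t • w) - (t : ℂ) • g x)) -
      (g (x + t • w) - g x))) (𝓝[≠] 0) (𝓝 0) := by
    intro t
    refine (tendsto_slope_line h x t).congr' ?_
    filter_upwards [self_mem_nhdsWithin] with h hh
    rw [← h3 _ _ _ _ t h hh]
  have h1 := seminorm_sub_le_of_deriv (p j)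
    (f := fun t => f (x + t • w) - (t : ℂ) • g x)
    (f' := fun t => g (x + t • w) - g x) h5 (M := C * |t|) (t := t)
    (fun τ hτ => by
      have h2 : |τ| ≤ |t| := by simpa using Set.abs_sub_left_of_mem_uIcc hτ
      exact (hC x τ).trans (mul_le_mul_of_nonneg_left h2 hC0))
  simp only [zero_smul, add_zero, Complex.ofReal_zero, sub_zero] at h1
  rw [mul_assoc, ← sq, sq_abs] at h1
  rwa [sub_right_comm]

/-- Bounds on the partial derivatives of the next order make the present ones Lipschitz, and a
Lipschitz derivative gives a uniform quadratic remainder. Directional derivatives are linear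
combinations of partial ones, so the class is reproduced at every order. -/
theorem IsSmoothBounded.isBoundedSmooth {n : ℕ} {f : (Fin n → ℝ) → F} (hf : IsSmoothBounded p f) :
    IsBoundedSmooth p f := by
  obtain ⟨D, hD0, hD, -, hb⟩ := hf
  replace hD : ∀ (α : Fin n → ℕ) (i : Fin n) (j : ℕ) (x : Fin n → ℝ),
      Tendsto (fun h : ℝ => p j (((h⁻¹ : ℝ) : ℂ) • (D α (x + h • Pi.single i (1 : ℝ)) - D α x) -
        D (α + Pi.single i 1) x)) (𝓝[≠] 0) (𝓝 0) := by
    intro α i j x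
    refine (hD α i x j).congr fun h => ?_
    rw [single_eq_smul_single i h]
  have hlip : ∀ α (i : Fin n) (j : ℕ), ∃ C : ℝ, 0 ≤ C ∧ ∀ (x : Fin n → ℝ) (t : ℝ),
      p j (D α (x + t • Pi.single i (1 : ℝ)) - D α x) ≤ C * |t| := by
    intro α i j
    obtain ⟨C, hC0, hC⟩ := IsBoundedFamily.nonneg (p := p) (hb (α + Pi.single i 1)) j
    exact ⟨C, hC0, fun x t => lipschitz_of_tendsto_slope (hD α i j) hC x t⟩
  have hquad : ∀ α (i : Fin n), HasUniformDeriv p (Pi.single i (1 : ℝ)) (D α)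
      (D (α + Pi.single i 1)) := by
    intro α i j
    obtain ⟨C, hC0, hC⟩ := hlip (α + Pi.single i 1) i j
    exact ⟨C, fun x t => quadratic_of_tendsto_slope (hD α i j) hC0 hC x t⟩
  have hsum : ∀ N (s : Finset (Fin n)) (c : Fin n → ℂ) (g : Fin n → (Fin n → ℝ) → F),
      (∀ i, IsBoundedSmoothOrder p N (g i)) →
      IsBoundedSmoothOrder p N fun x => ∑ i ∈ s, c i • g i x := by
    intro N s c g hg
    classical
    induction s using Finset.induction_on with
    | empty => simpa using IsBoundedSmoothOrder.const N (0 : F)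
    | insert a s ha ih =>
      simp only [Finset.sum_insert ha]
      exact ((hg a).map (isBoundedMap_smul (c a))).add ih
  have hall : ∀ N α, IsBoundedSmoothOrder p N (D α) := by
    intro N
    induction N with
    | zero => exact fun α => hb α
    | succ N ih =>
      refine fun α => ⟨hb α, fun w => ?_⟩
      refine ⟨fun x => ∑ i, (w i : ℂ) • D (α + Pi.single i 1) x, ?_, hsum N _ _ _ fun i => ih _⟩
      have := HasUniformDeriv.finset_sum (fun i => hquad α i) (fun i l j => hlip _ i j) w
        Finset.univ
      rwa [show ∑ i, w i • Pi.single i (1 : ℝ) = w by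
        simpa using (pi_eq_sum_univ' w).symm] at this
  intro N
  rw [← hD0]
  exact hall N 0

end Calculus
end SobolevGrowth
end

noncomputable section
namespace SobolevGrowth

/-! ### Baire category in spaces with countably many seminorms -/

section Baire

variable {F : Type*} [AddCommGroup F] [Module ℂ F] {p : ℕ → Seminorm ℂ F}

/-- Cauchy sequences with respect to a family of seminorms. -/
def IsCauchySequence (p : ℕ → Seminorm ℂ F) (u : ℕ → F) : Prop :=
  ∀ (j : ℕ) (ε : ℝ), 0 < ε → ∃ N : ℕ, ∀ k ≥ N, ∀ l ≥ N, p j (u k - u l) < ε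

/-- Convergence of sequences with respect to a family of seminorms. -/
def SeqTendsto (p : ℕ → Seminorm ℂ F) (u : ℕ → F) (a : F) : Prop :=
  ∀ j, Tendsto (fun k => p j (u k - a)) atTop (𝓝 0)

/-- Sequential completeness with respect to a family of seminorms. -/
def IsSeqComplete (p : ℕ → Seminorm ℂ F) : Prop :=
  ∀ u : ℕ → F, IsCauchySequence p u → ∃ a, SeqTendsto p u a

theorem seminorm_le_of_tendsto (P : Seminorm ℂ F) {u : ℕ → F} {a b : F} {C : ℝ}
    (hu : Tendsto (fun k => P (u k - a)) atTop (𝓝 0)) (h : ∀ᶠ k in atTop, P (u k - b) ≤ C) :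
    P (a - b) ≤ C := by
  have h1 : Tendsto (fun k => P (u k - a) + C) atTop (𝓝 (0 + C)) := hu.add_const C
  rw [zero_add] at h1
  refine ge_of_tendsto h1 ?_
  filter_upwards [h] with k hk
  have h2 : a - b = (u k - b) - (u k - a) := by abel
  rw [h2]
  linarith [map_sub_le_add P (u k - b) (u k - a)]

theorem SeqTendsto.seminormSum {u : ℕ → F} {a : F} (h : SeqTendsto p u a) (N : ℕ) :
    Tendsto (fun k => SobolevGrowth.seminormSum p N (u k - a)) atTop (𝓝 0) := by
  simp only [seminormSum_apply]
  simpa using tendsto_finsetSum (Finset.range N) fun i _ => h i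

theorem isCauchySequence_of_le {u : ℕ → F} {N : ℕ → ℕ} {δ : ℕ → ℝ} (hN : ∀ n, n < N n)
    (hδ : Tendsto δ atTop (𝓝 0))
    (h : ∀ n m, n ≤ m → seminormSum p (N n) (u m - u n) ≤ δ n) : IsCauchySequence p u := by
  intro j ε hε
  obtain ⟨M, hM⟩ := eventually_atTop.1 (hδ.eventually (gt_mem_nhds (half_pos hε)))
  have key : ∀ k ≥ max j M, p j (u k - u (max j M)) < ε / 2 := fun k hk =>
    (le_seminormSum p j _).trans_lt (((seminormSum_mono p
      ((le_max_left j M).trans_lt (hN _)) _).trans (h _ k hk)).trans_lt (hM _ (le_max_right _ _)))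
  refine ⟨max j M, fun k hk l hl => ?_⟩
  have h1 : u k - u l = (u k - u (max j M)) - (u l - u (max j M)) := by abel
  rw [h1]
  linarith [map_sub_le_add (p j) (u k - u (max j M)) (u l - u (max j M)), key k hk, key l hl]

/-- The Baire category theorem: one of countably many sets covering the space is dense in a ball. -/
theorem exists_dense_in_ball (hp : IsSeqComplete p) (B : ℕ → Set F) (hB : ∀ a, ∃ n, a ∈ B n) :
    ∃ (n : ℕ) (a₀ : F) (N : ℕ) (δ : ℝ), 0 < δ ∧ ∀ a, seminormSum p N (a - a₀) < δ →
      ∀ (M : ℕ) (η : ℝ), 0 < η → ∃ b ∈ B n, seminormSum p M (a - b) < η := by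
  by_contra! hcon
  -- A state is a ball: centre, number of seminorms, radius. Each step at least halves the radius
  -- and places the new centre at distance at least two new radii from B n, so that the limit of the
  -- centres lies in no B n.
  have step : ∀ (n : ℕ) (s : F × ℕ × ℝ), 0 < s.2.2 → ∃ s' : F × ℕ × ℝ, 0 < s'.2.2 ∧
      s'.2.2 ≤ s.2.2 / 2 ∧ s.2.1 < s'.2.1 ∧ seminormSum p s.2.1 (s'.1 - s.1) ≤ s.2.2 / 2 ∧
      ∀ b ∈ B n, 2 * s'.2.2 ≤ seminormSum p s'.2.1 (s'.1 - b) := by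
    rintro n ⟨a₀, N, δ⟩ hδ
    obtain ⟨a, ha, M, η, hη, h⟩ := hcon n a₀ N (δ / 2) (half_pos hδ)
    refine ⟨(a, max M (N + 1), min (δ / 2) (η / 2)), lt_min (half_pos hδ) (half_pos hη),
      min_le_left _ _, lt_of_lt_of_le (Nat.lt_succ_self N) (le_max_right _ _), ha.le,
      fun b hb => ?_⟩
    have h1 := (h b hb).trans (seminormSum_mono p (le_max_left M (N + 1)) (a - b))
    have h2 := min_le_right (δ / 2) (η / 2)
    dsimp only
    linarith
  choose! f hf using step
  let s : ℕ → F × ℕ × ℝ := fun n => Nat.rec (0, 1, 1) (fun n s => f n s) n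
  have hs : ∀ n, s (n + 1) = f n (s n) := fun n => rfl
  have hpos : ∀ n, 0 < (s n).2.2 := by
    intro n
    induction n with
    | zero => exact one_pos
    | succ n ih => rw [hs]; exact (hf n _ ih).1
  have hhalf : ∀ n, (s (n + 1)).2.2 ≤ (s n).2.2 / 2 := fun n => (hf n _ (hpos n)).2.1
  have hNlt : ∀ n, (s n).2.1 < (s (n + 1)).2.1 := fun n => (hf n _ (hpos n)).2.2.1
  have hNmono : StrictMono fun n => (s n).2.1 := strictMono_nat_of_lt_succ hNlt
  have hNn : ∀ n, n < (s n).2.1 := by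
    intro n
    induction n with
    | zero => exact one_pos
    | succ n ih => exact lt_of_le_of_lt ih (hNlt n)
  have hdist : ∀ n m, n ≤ m →
      seminormSum p (s n).2.1 ((s m).1 - (s n).1) ≤ (s n).2.2 - (s m).2.2 := by
    intro n m hnm
    induction m, hnm using Nat.le_induction with
    | base => simp
    | succ m hnm ih =>
      have h1 : (s (m + 1)).1 - (s n).1 = ((s (m + 1)).1 - (s m).1) + ((s m).1 - (s n).1) := by abel
      rw [h1]
      have h2 := (seminormSum_mono p (hNmono.monotone hnm) _).trans (hf m _ (hpos m)).2.2.2.1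
      rw [← hs] at h2
      linarith [map_add_le_add (seminormSum p (s n).2.1) ((s (m + 1)).1 - (s m).1)
        ((s m).1 - (s n).1), hhalf m]
  have hδ : Tendsto (fun n => (s n).2.2) atTop (𝓝 0) := by
    have h1 : ∀ n, (s n).2.2 ≤ (1 / 2 : ℝ) ^ n := by
      intro n
      induction n with
      | zero => simp [s]
      | succ n ih => rw [pow_succ]; linarith [hhalf n]
    exact squeeze_zero (fun n => (hpos n).le) h1
      (tendsto_pow_atTop_nhds_zero_of_lt_one (by norm_num) (by norm_num))
  have hdist' : ∀ n m, n ≤ m → seminormSum p (s n).2.1 ((s m).1 - (s n).1) ≤ (s n).2.2 :=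
    fun n m hnm => (hdist n m hnm).trans (by linarith [hpos m])
  obtain ⟨a, ha⟩ := hp _ (isCauchySequence_of_le (u := fun n => (s n).1) hNn hδ hdist')
  obtain ⟨n, hn⟩ := hB a
  have h1 := (hf n _ (hpos n)).2.2.2.2 a hn
  rw [← hs] at h1
  have h2 := seminorm_le_of_tendsto (seminormSum p (s (n + 1)).2.1) (ha.seminormSum _)
    (eventually_atTop.2 ⟨n + 1, fun m hm => hdist' (n + 1) m hm⟩)
  rw [map_sub_rev] at h2
  linarith [hpos (n + 1)]

/-- A seminorm on a Fréchet space is approximately dominated by the given seminorms. -/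
theorem exists_approx_ball (hp : IsSeqComplete p) (Q : Seminorm ℂ F) :
    ∃ (N : ℕ) (δ : ℝ), 0 < δ ∧ ∀ (ε : ℝ), 0 < ε → ∀ a, seminormSum p N a < δ * ε →
      ∀ (M : ℕ) (η : ℝ), 0 < η → ∃ b, Q b ≤ ε ∧ seminormSum p M (a - b) < η := by
  obtain ⟨n, a₀, N, δ, hδ, h⟩ := exists_dense_in_ball hp (fun n : ℕ => {a | Q a ≤ n})
    (fun a => exists_nat_ge (Q a))
  have hn : (0 : ℝ) < 2 * (n + 1) := by positivity
  refine ⟨N, δ / (2 * (n + 1)), div_pos hδ hn, fun ε hε a ha M η hη => ?_⟩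
  -- The scaling that brings a into the ball around a₀. The approximants of a₀ + c a and of a₀ both
  -- satisfy Q ≤ n, so their difference divided by c approximates a with Q ≤ 2n/c ≤ ε.
  set c : ℝ := 2 * (n + 1) / ε with hc
  have hc0 : 0 < c := div_pos hn hε
  have h0 : seminormSum p N (a₀ - a₀) < δ := by rw [sub_self, map_zero]; exact hδ
  have h1 : seminormSum p N (a₀ + (c : ℂ) • a - a₀) < δ := by
    rw [add_sub_cancel_left, map_smul_eq_mul, Complex.norm_real, Real.norm_of_nonneg hc0.le]
    have : c * (δ / (2 * (n + 1)) * ε) = δ := by rw [hc]; field_simp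
    calc _ < c * (δ / (2 * (n + 1)) * ε) := mul_lt_mul_of_pos_left ha hc0
      _ = δ := this
  have hη' : 0 < c * η / 2 := by positivity
  obtain ⟨b, hb, hb'⟩ := h _ h1 M _ hη'
  obtain ⟨b₀, hb₀, hb₀'⟩ := h _ h0 M _ hη'
  have hcc : ((c⁻¹ : ℝ) : ℂ) * (c : ℂ) = 1 := by
    rw [← Complex.ofReal_mul, inv_mul_cancel₀ hc0.ne', Complex.ofReal_one]
  refine ⟨((c⁻¹ : ℝ) : ℂ) • (b - b₀), ?_, ?_⟩
  · rw [map_smul_eq_mul, Complex.norm_real, Real.norm_of_nonneg (inv_pos.2 hc0).le]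
    have h2 : Q (b - b₀) ≤ n + n := (map_sub_le_add _ _ _).trans (add_le_add hb hb₀)
    rw [inv_mul_le_iff₀ hc0]
    have h3 : c * ε = 2 * (n + 1) := by rw [hc]; field_simp
    linarith
  · have h2 : a - ((c⁻¹ : ℝ) : ℂ) • (b - b₀) =
        ((c⁻¹ : ℝ) : ℂ) • ((a₀ + (c : ℂ) • a - b) - (a₀ - b₀)) := by
      have h3 : (a₀ + (c : ℂ) • a - b) - (a₀ - b₀) = (c : ℂ) • a - (b - b₀) := by abel
      rw [h3, smul_sub _ ((c : ℂ) • a), smul_smul, hcc, one_smul]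
    rw [h2, map_smul_eq_mul, Complex.norm_real, Real.norm_of_nonneg (inv_pos.2 hc0).le,
      inv_mul_lt_iff₀ hc0]
    linarith [map_sub_le_add (seminormSum p M) (a₀ + (c : ℂ) • a - b) (a₀ - b₀)]

variable {G : Type*} [AddCommGroup G] [Module ℂ G] {q : ℕ → Seminorm ℂ G} {ι : Type*}

/-- A pointwise bounded family of linear maps with closed graphs between Fréchet spaces is
equicontinuous. -/
theorem exists_uniform_bound (hp : IsSeqComplete p) (hq : IsSeqComplete q) (L : ι → F →ₗ[ℂ] G)
    (hL : ∀ i u a b, SeqTendsto p u a → SeqTendsto q (fun k => L i (u k)) b → L i a = b)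
    (hb : ∀ a j, ∃ C : ℝ, ∀ i, q j (L i a) ≤ C) (j : ℕ) :
    ∃ (N : ℕ) (C : ℝ), 0 ≤ C ∧ ∀ i a, q j (L i a) ≤ C * seminormSum p N a := by
  -- The supremum over the family is a finite seminorm by pointwise boundedness, but its continuity
  -- is not known; the Baire argument supplies an approximate bound instead.
  have hQ : ∀ k, ∃ Q : Seminorm ℂ F, ∀ i a, seminormSum q k (L i a) ≤ Q a := by
    intro k
    have hbd : ∀ a, BddAbove (Set.range fun i => ((seminormSum q k).comp (L i)) a) := by
      intro a
      obtain ⟨C, -, hC⟩ := IsBoundedFamily.seminormSum (p := q) (f := fun i => L i a) (hb a) k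
      exact ⟨C, by rintro _ ⟨i, rfl⟩; exact hC i⟩
    refine ⟨⨆ i, (seminormSum q k).comp (L i), fun i a => ?_⟩
    rw [Seminorm.iSup_apply (Seminorm.bddAbove_range_iff.2 hbd)]
    exact le_ciSup (hbd a) i
  choose Q hQ using hQ
  choose N δ hδ hball using fun k => exists_approx_ball hp (Q (k + j + 1))
  have hpow : ∀ k : ℕ, (0 : ℝ) < (1 / 2) ^ k := fun k => by positivity
  -- As in the open mapping theorem, the remainder is corrected successively. At stage k the
  -- correction has geometric size in Q(k + j + 1), which controls more and more seminorms of G, and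
  -- the new remainder is small in more and more seminorms of F.
  have step : ∀ (k : ℕ) (r : F), seminormSum p (N k) r < δ k * (1 / 2) ^ k →
      ∃ r' : F, Q (k + j + 1) (r - r') ≤ (1 / 2) ^ k ∧
        seminormSum p (N (k + 1)) r' < δ (k + 1) * (1 / 2) ^ (k + 1) ∧
        seminormSum p (k + 1) r' ≤ (1 / 2) ^ (k + 1) := by
    intro k r hr
    obtain ⟨b, hb1, hb2⟩ := hball k _ (hpow k) r hr (max (N (k + 1)) (k + 1))
      (min (δ (k + 1) * (1 / 2) ^ (k + 1)) ((1 / 2) ^ (k + 1)))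
      (lt_min (mul_pos (hδ _) (hpow _)) (hpow _))
    refine ⟨r - b, by rwa [sub_sub_cancel], ?_, ?_⟩
    · exact lt_of_le_of_lt (seminormSum_mono p (le_max_left _ _) _)
        (hb2.trans_le (min_le_left _ _))
    · exact (seminormSum_mono p (le_max_right _ _) _).trans
        (hb2.le.trans (min_le_right _ _))
  choose! f hf using step
  -- The corrections sum to a, and their images under L i form a Cauchy sequence with total size at
  -- most Σ 2^(-k) = 2. The closed graph identifies the limit of the images with L i a.
  have main : ∀ a, seminormSum p (N 0) a < δ 0 → ∀ i, q j (L i a) ≤ 2 := by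
    intro a ha i
    let r : ℕ → F := fun n => Nat.rec a (fun n s => f n s) n
    have hr : ∀ n, r (n + 1) = f n (r n) := fun n => rfl
    have hrN : ∀ n, seminormSum p (N n) (r n) < δ n * (1 / 2) ^ n := by
      intro n
      induction n with
      | zero => rw [pow_zero, mul_one]; exact ha
      | succ n ih => rw [hr]; exact (hf n _ ih).2.1
    have hr0 : ∀ k n, k ≤ n → seminormSum p (k + 1) (r (n + 1)) ≤ (1 / 2) ^ (n + 1) := fun k n hk =>
      (seminormSum_mono p (Nat.succ_le_succ hk) _).trans (hf n _ (hrN n)).2.2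
    have hlim : SeqTendsto p (fun n => a - r n) a := by
      intro k
      have h1 : Tendsto (fun n : ℕ => (1 / 2 : ℝ) ^ n) atTop (𝓝 0) :=
        tendsto_pow_atTop_nhds_zero_of_lt_one (by norm_num) (by norm_num)
      refine squeeze_zero' (Eventually.of_forall fun _ => apply_nonneg _ _) ?_ h1
      filter_upwards [eventually_ge_atTop (k + 1)] with n hn
      rw [sub_sub_cancel_left, map_neg_eq_map]
      obtain ⟨m, rfl⟩ : ∃ m, n = m + 1 := ⟨n - 1, by omega⟩
      exact (le_seminormSum p k _).trans (hr0 k m (by omega))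
    have hdist : ∀ n m, n ≤ m → seminormSum q (n + j + 1) (L i (a - r m) - L i (a - r n)) ≤
        2 * (1 / 2) ^ n - 2 * (1 / 2) ^ m := by
      intro n m hnm
      induction m, hnm using Nat.le_induction with
      | base => simp
      | succ m hnm ih =>
        have h1 : L i (a - r (m + 1)) - L i (a - r n) =
            L i (r m - r (m + 1)) + (L i (a - r m) - L i (a - r n)) := by
          simp only [map_sub]; abel
        rw [h1]
        have h2 := (seminormSum_mono q (show n + j + 1 ≤ m + j + 1 by omega)
          (L i (r m - r (m + 1)))).trans ((hQ _ i _).trans (hf m _ (hrN m)).1)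
        have h3 := map_add_le_add (seminormSum q (n + j + 1)) (L i (r m - r (m + 1)))
          (L i (a - r m) - L i (a - r n))
        have h4 : (1 / 2 : ℝ) ^ (m + 1) = (1 / 2) ^ m / 2 := by rw [pow_succ]; ring
        linarith
    have hcau : IsCauchySequence q fun n => L i (a - r n) := by
      refine isCauchySequence_of_le (N := fun n => n + j + 1) (δ := fun n => 2 * (1 / 2) ^ n)
        (fun n => by omega) ?_ fun n m hnm => (hdist n m hnm).trans ?_
      · simpa using (tendsto_pow_atTop_nhds_zero_of_lt_one (r := (1 / 2 : ℝ)) (by norm_num)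
          (by norm_num)).const_mul 2
      · linarith [hpow m]
    obtain ⟨b, hb⟩ := hq _ hcau
    rw [hL i _ a b hlim hb]
    have h1 := seminorm_le_of_tendsto (q j) (b := 0) (C := 2) (hb j) (Eventually.of_forall fun m => by
      rw [sub_zero]
      have h2 := hdist 0 m (Nat.zero_le m)
      rw [zero_add] at h2
      have h3 : r 0 = a := rfl
      rw [h3, sub_self, map_zero, sub_zero] at h2
      have := hpow m
      exact (le_seminormSum q j _).trans (h2.trans (by linarith)))
    rwa [sub_zero] at h1
  refine ⟨N 0, 2 / δ 0, (div_pos two_pos (hδ 0)).le, fun i a => ?_⟩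
  have hδ0 := hδ 0
  refine le_of_forall_gt_imp_ge_of_dense fun s hs => ?_
  have hs' : seminormSum p (N 0) a < δ 0 * s / 2 := by
    rw [div_mul_eq_mul_div, div_lt_iff₀ hδ0] at hs
    linarith
  have hs0 : 0 < s := by
    have := (apply_nonneg (seminormSum p (N 0)) a).trans_lt hs'
    by_contra hcon
    nlinarith
  have h1 := main (((2 / s : ℝ) : ℂ) • a) (by
    rw [map_smul_eq_mul, Complex.norm_real, Real.norm_of_nonneg (div_pos two_pos hs0).le]
    rw [div_mul_eq_mul_div, div_lt_iff₀ hs0]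
    linarith) i
  rw [map_smul, map_smul_eq_mul, Complex.norm_real, Real.norm_of_nonneg (div_pos two_pos hs0).le,
    div_mul_eq_mul_div, div_le_iff₀ hs0] at h1
  linarith

end Baire
end SobolevGrowth
end

noncomputable section
namespace SobolevGrowth
variable {H : Type*} [NormedAddCommGroup H] [InnerProductSpace ℂ H] [CompleteSpace H]

/-! ### The graded algebra -/

section Classes

variable {K₀ : H →ₗ.[ℂ] H} {hK₀ : IsPositiveSelfAdjoint K₀} {𝒜 : OperatorClasses K₀}

theorem IsBoundedBilin.left {F G K : Type*} [AddCommGroup F] [Module ℂ F] [AddCommGroup G]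
    [Module ℂ G] [AddCommGroup K] [Module ℂ K] {p : ℕ → Seminorm ℂ F} {q : ℕ → Seminorm ℂ G}
    {r : ℕ → Seminorm ℂ K} {b : F →ₗ[ℂ] G →ₗ[ℂ] K} (hb : IsBoundedBilin p q r b) (a : F) :
    IsBoundedMap q r (b a) := fun j => by
  obtain ⟨N, C, hC0, hC⟩ := hb j
  exact ⟨N, C * seminormSum p N a, mul_nonneg hC0 (apply_nonneg _ _), fun c => hC a c⟩

theorem OperatorClasses.partialSum_eq (m : ℝ) (N : ℕ) (a : 𝒜.cls m) :
    𝒜.partialSum m N a = seminormSum (𝒜.seminorm m) N a :=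
  (seminormSum_apply _ _ _).symm

namespace OperatorClasses.IsGradedLieAlgebra

variable (h𝒜 : 𝒜.IsGradedLieAlgebra)
include h𝒜

theorem isSeqComplete (m : ℝ) : IsSeqComplete (𝒜.seminorm m) := h𝒜.complete m

theorem norm_le (hK₀ : IsPositiveSelfAdjoint K₀) (m r : ℝ) : ∃ (N : ℕ) (C : ℝ), 0 ≤ C ∧
    ∀ (a : 𝒜.cls m) (u : smoothVectors K₀), ‖(smoothPow hK₀ r ((a : SmoothEnd K₀) u) : H)‖ ≤
      C * seminormSum (𝒜.seminorm m) N a * ‖(smoothPow hK₀ (r + m) u : H)‖ := by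
  obtain ⟨N, C, hC⟩ := h𝒜.embedding m (r + m)
  refine ⟨N, |C|, abs_nonneg C, fun a u => ?_⟩
  have h1 := hC a u
  rw [add_sub_cancel_right, sobolevNorm_eq hK₀, sobolevNorm_eq hK₀, partialSum_eq] at h1
  refine h1.trans ?_
  have : 0 ≤ seminormSum (𝒜.seminorm m) N a := apply_nonneg _ _
  gcongr
  exact le_abs_self C

theorem eq_zero (hK₀ : IsPositiveSelfAdjoint K₀) {m : ℝ} (a : 𝒜.cls m)
    (ha : ∀ j, 𝒜.seminorm m j a = 0) : a = 0 := by
  obtain ⟨N, C, -, hC⟩ := h𝒜.norm_le hK₀ m 0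
  refine Subtype.ext (LinearMap.ext fun u => Subtype.ext ?_)
  have h1 := hC a u
  rw [seminormSum_apply, Finset.sum_eq_zero fun i _ => ha i, mul_zero, zero_mul, smoothPow_zero hK₀]
    at h1
  simpa using h1

theorem smoothPow_mem (hK₀ : IsPositiveSelfAdjoint K₀) (r : ℝ) : smoothPow hK₀ r ∈ 𝒜.cls r := by
  obtain ⟨a, ha, h⟩ := h𝒜.pow_mem r
  rwa [← eq_smoothPow_of_isRestriction hK₀ h]

theorem cls_mono {m' m : ℝ} (h : m' ≤ m) : 𝒜.cls m' ≤ 𝒜.cls m := (h𝒜.mono m' m h).1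

theorem isBoundedMap_inclusion {m' m : ℝ} (h : m' ≤ m) :
    IsBoundedMap (𝒜.seminorm m') (𝒜.seminorm m) (Submodule.inclusion (h𝒜.cls_mono h)) := by
  intro j
  obtain ⟨N, C, hC⟩ := (h𝒜.mono m' m h).2 j
  refine ⟨N, |C|, abs_nonneg C, fun a => ?_⟩
  have h1 := hC a
  rw [partialSum_eq] at h1
  exact h1.trans (mul_le_mul_of_nonneg_right (le_abs_self C) (apply_nonneg _ _))

theorem commutator_mem {m n q : ℝ} (hq : m + n - 1 ≤ q) {a b : SmoothEnd K₀} (ha : a ∈ 𝒜.cls m)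
    (hb : b ∈ 𝒜.cls n) : a * b - b * a ∈ 𝒜.cls q :=
  h𝒜.cls_mono hq ((h𝒜.commutator m n).1 ⟨a, ha⟩ ⟨b, hb⟩)

/-- The commutator as a bilinear map. -/
def bracket {m n q : ℝ} (hq : m + n - 1 ≤ q) : 𝒜.cls m →ₗ[ℂ] 𝒜.cls n →ₗ[ℂ] 𝒜.cls q :=
  LinearMap.mk₂ ℂ (fun a b => ⟨(a : SmoothEnd K₀) * b - (b : SmoothEnd K₀) * a,
      h𝒜.commutator_mem hq a.2 b.2⟩)
    (fun a a' b => Subtype.ext (by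
      simp only [Submodule.coe_add, add_mul, mul_add]; abel))
    (fun c a b => Subtype.ext (by
      simp only [Submodule.coe_smul, smul_mul_assoc, mul_smul_comm, smul_sub]))
    (fun a b b' => Subtype.ext (by
      simp only [Submodule.coe_add, add_mul, mul_add]; abel))
    (fun c a b => Subtype.ext (by
      simp only [Submodule.coe_smul, smul_mul_assoc, mul_smul_comm, smul_sub]))

theorem coe_bracket {m n q : ℝ} (hq : m + n - 1 ≤ q) (a : 𝒜.cls m) (b : 𝒜.cls n) :
    (h𝒜.bracket hq a b : SmoothEnd K₀) = (a : SmoothEnd K₀) * b - (b : SmoothEnd K₀) * a := rfl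

theorem isBoundedBilin_bracket {m n q : ℝ} (hq : m + n - 1 ≤ q) :
    IsBoundedBilin (𝒜.seminorm m) (𝒜.seminorm n) (𝒜.seminorm q) (h𝒜.bracket hq) := by
  intro j
  obtain ⟨N, C, hC0, hC⟩ := h𝒜.isBoundedMap_inclusion hq j
  choose M B hB using (h𝒜.commutator m n).2
  have hle : ∀ {L L' : ℕ}, L ≤ L' → ∀ (k : ℝ) (a : 𝒜.cls k), 𝒜.partialSum k L a ≤
      seminormSum (𝒜.seminorm k) L' a := fun h k a => by
    rw [partialSum_eq]; exact seminormSum_mono _ h a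
  refine ⟨(Finset.range N).sup M, C * ∑ i ∈ Finset.range N, |B i|,
    mul_nonneg hC0 (Finset.sum_nonneg fun _ _ => abs_nonneg _), fun a b => ?_⟩
  refine (hC ⟨_, (h𝒜.commutator m n).1 a b⟩).trans ?_
  rw [mul_assoc, mul_assoc]
  refine mul_le_mul_of_nonneg_left ?_ hC0
  rw [seminormSum_apply, Finset.sum_mul]
  refine Finset.sum_le_sum fun i hi => (hB i a b).trans ?_
  have h1 := hle (Finset.le_sup (f := M) hi) m a
  have h2 := hle (Finset.le_sup (f := M) hi) n b
  have h3 : 0 ≤ 𝒜.partialSum n (M i) b := by rw [partialSum_eq]; exact apply_nonneg _ _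
  have h4 : 0 ≤ 𝒜.partialSum m (M i) a := by rw [partialSum_eq]; exact apply_nonneg _ _
  rw [mul_assoc]
  gcongr
  exact le_abs_self _

/-- The commutator of an element of 𝒜_1 with K₀^r has order r + 1 - 1 = r, which is the gain that
the energy estimates need. -/
theorem isTameFamily (hK₀ : IsPositiveSelfAdjoint K₀) {f : ℝ → 𝒜.cls 1}
    (hf : IsBoundedFamily (𝒜.seminorm 1) f)
    (hl : ∀ j, ∃ C : ℝ, 0 ≤ C ∧ ∀ t t', 𝒜.seminorm 1 j (f t - f t') ≤ C * |t - t'|)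
    (hs : ∀ t, IsSymmetricOp (f t : SmoothEnd K₀)) :
    IsTameFamily hK₀ fun t => (f t : SmoothEnd K₀) where
  symm := hs
  bound r := by
    obtain ⟨N, C, hC0, hC⟩ := h𝒜.norm_le hK₀ 1 r
    obtain ⟨B, hB0, hB⟩ := hf.seminormSum N
    refine ⟨C * B, mul_nonneg hC0 hB0, fun t u => (hC _ u).trans ?_⟩
    have := hB t
    gcongr
  comm r := by
    have hq : r + 1 - 1 ≤ r := by linarith
    obtain ⟨N, C, hC0, hC⟩ := h𝒜.norm_le hK₀ r 0
    obtain ⟨B, hB0, hB⟩ := (hf.map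
      ((h𝒜.isBoundedBilin_bracket hq).left ⟨_, h𝒜.smoothPow_mem hK₀ r⟩)).seminormSum N
    refine ⟨C * B, mul_nonneg hC0 hB0, fun t u => ?_⟩
    have h1 := hC (h𝒜.bracket hq ⟨_, h𝒜.smoothPow_mem hK₀ r⟩ (f t)) u
    rw [smoothPow_zero, zero_add] at h1
    refine h1.trans ?_
    have := hB t
    gcongr
  lip r := by
    obtain ⟨N, C, hC0, hC⟩ := h𝒜.norm_le hK₀ 1 r
    choose B hB0 hB using hl
    refine ⟨C * ∑ i ∈ Finset.range N, B i, mul_nonneg hC0 (Finset.sum_nonneg fun _ _ => hB0 _),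
      fun t t' u => (hC (f t - f t') u).trans ?_⟩
    have h1 : seminormSum (𝒜.seminorm 1) N (f t - f t') ≤
        (∑ i ∈ Finset.range N, B i) * |t - t'| := by
      rw [seminormSum_apply, Finset.sum_mul]
      exact Finset.sum_le_sum fun i _ => hB i t t'
    rw [mul_assoc C (∑ i ∈ Finset.range N, B i)]
    exact mul_le_mul_of_nonneg_right (mul_le_mul_of_nonneg_left h1 hC0) (norm_nonneg _)

theorem isTameFamily_const (hK₀ : IsPositiveSelfAdjoint K₀) {a : SmoothEnd K₀} (ha : a ∈ 𝒜.cls 1)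
    (hs : IsSymmetricOp a) : IsTameFamily hK₀ fun _ => a :=
  h𝒜.isTameFamily hK₀ (f := fun _ => ⟨a, ha⟩) (fun j => ⟨_, fun _ => le_rfl⟩)
    (fun j => ⟨0, le_rfl, fun t t' => by
      rw [zero_mul]; exact ((congrArg (𝒜.seminorm 1 j) (sub_self (⟨a, ha⟩ : 𝒜.cls 1))).trans (map_zero _)).le⟩) fun _ => hs

end OperatorClasses.IsGradedLieAlgebra

theorem IsSymmetricOp.add {a b : SmoothEnd K₀} (ha : IsSymmetricOp a) (hb : IsSymmetricOp b) :
    IsSymmetricOp (a + b) := fun u v => by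
  simp only [LinearMap.add_apply, Submodule.coe_add, inner_add_left, inner_add_right, ha u v, hb u v]

theorem IsSymmetricOp.smul {a : SmoothEnd K₀} (c : ℝ) (ha : IsSymmetricOp a) :
    IsSymmetricOp ((c : ℂ) • a) := fun u v => by
  simp only [LinearMap.smul_apply, Submodule.coe_smul, inner_smul_left, inner_smul_right, ha u v,
    Complex.conj_ofReal]

theorem IsSymmetricOp.sum {ι : Type*} (s : Finset ι) {a : ι → SmoothEnd K₀}
    (ha : ∀ i, IsSymmetricOp (a i)) : IsSymmetricOp (∑ i ∈ s, a i) := by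
  classical
  induction s using Finset.induction_on with
  | empty => intro u v; simp
  | insert i s hi ih => rw [Finset.sum_insert hi]; exact (ha i).add ih

theorem IsRestriction.isSymmetricOp {a : SmoothEnd K₀} {L : H →ₗ.[ℂ] H} (hL : IsSelfAdjoint L)
    (ha : IsRestriction a L) : IsSymmetricOp a := fun u v => by
  obtain ⟨x, hx, hx'⟩ := (LinearPMap.mem_graph_iff L).1 (ha u)
  obtain ⟨y, hy, hy'⟩ := (LinearPMap.mem_graph_iff L).1 (ha v)
  have h1 := inner_apply_eq_of_isSelfAdjoint hL x y
  rw [hx, hx', hy, hy'] at h1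
  exact h1

theorem isSymmetricOp_dotOp {d : ℕ} {k : Fin d → SmoothEnd K₀} (hk : ∀ j, IsSymmetricOp (k j))
    (τ : Fin d → ℝ) : IsSymmetricOp (dotOp τ k) := .sum _ fun j => (hk j).smul (τ j)

theorem dotOp_mem {d : ℕ} {k : Fin d → SmoothEnd K₀} {m : ℝ} (hk : ∀ j, k j ∈ 𝒜.cls m)
    (τ : Fin d → ℝ) : dotOp τ k ∈ 𝒜.cls m :=
  Submodule.sum_mem _ fun j _ => Submodule.smul_mem _ _ (hk j)

theorem dotOp_neg {d : ℕ} (k : Fin d → SmoothEnd K₀) (τ : Fin d → ℝ) :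
    dotOp (-τ) k = -dotOp τ k := by
  refine LinearMap.ext fun u => ?_
  simp only [dotOp, LinearMap.neg_apply, LinearMap.sum_apply, LinearMap.smul_apply, Pi.neg_apply,
    Complex.ofReal_neg, neg_smul, Finset.sum_neg_distrib]

theorem dotOp_add {d : ℕ} (k : Fin d → SmoothEnd K₀) (τ τ' : Fin d → ℝ) :
    dotOp (τ + τ') k = dotOp τ k + dotOp τ' k := by
  simp only [dotOp, Pi.add_apply, Complex.ofReal_add, add_smul, Finset.sum_add_distrib]

theorem dotOp_smul {d : ℕ} (k : Fin d → SmoothEnd K₀) (c : ℝ) (τ : Fin d → ℝ) :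
    dotOp (c • τ) k = (c : ℂ) • dotOp τ k := by
  simp only [dotOp, Pi.smul_apply, smul_eq_mul, Complex.ofReal_mul, mul_smul, Finset.smul_sum]

theorem commute_dotOp {d : ℕ} {k : Fin d → SmoothEnd K₀} {a : SmoothEnd K₀}
    (h : ∀ j, Commute a (k j)) (τ : Fin d → ℝ) : Commute a (dotOp τ k) :=
  Commute.sum_right _ _ _ fun j _ => (h j).smul_right _

/-- Applying K₀⁻¹ to ν·K u recovers u, so ν·K is the first power of K₀ on ℋ^∞ and commutation with
ν·K amounts to commutation with K₀. -/
theorem dotOp_eq_smoothPow_one (hK₀ : IsPositiveSelfAdjoint K₀) {d : ℕ} {k : Fin d → SmoothEnd K₀}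
    {ν : Fin d → ℝ} (h : IsRestriction (dotOp ν k) K₀) : dotOp ν k = smoothPow hK₀ 1 := by
  refine LinearMap.ext fun u => Subtype.ext ?_
  obtain ⟨x, hx, hx'⟩ := (LinearPMap.mem_graph_iff K₀).1 (h u)
  dsimp only at hx hx'
  have h1 : (u : H) = (boundedInverse K₀ ^ (1 : ℝ)) (dotOp ν k u : H) := by
    rw [rpow_one_apply hK₀, ← hx', boundedInverse_apply hK₀, hx]
  rw [coe_smoothPow, h1, kpowApply_rpow hK₀ zero_le_one]

end Classes
end SobolevGrowth
end

noncomputable section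
namespace SobolevGrowth
variable {H : Type*} [NormedAddCommGroup H] [InnerProductSpace ℂ H] [CompleteSpace H]

/-! ### One-parameter unitary groups -/

section Groups

omit [CompleteSpace H] in
/-- The product rule for a strongly differentiable family of operators. -/
theorem hasDerivAt_strong_apply {A : ℝ → H →L[ℂ] H} {y : ℝ → H} {d y' : H} {t C : ℝ}
    (hb : ∀ᶠ s in 𝓝 t, ∀ ψ, ‖A s ψ‖ ≤ C * ‖ψ‖) (hc : ∀ ψ, ContinuousAt (fun s => A s ψ) t)
    (hA : HasDerivAt (fun s => A s (y t)) d t) (hy : HasDerivAt y y' t) :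
    HasDerivAt (fun s => A s (y s)) (d + A t y') t := by
  have h1 : HasDerivAt (fun s => A s (y s - y t)) (A t y') t := by
    rw [hasDerivAt_iff_isLittleO]
    have e1 : (fun s => A s (y s - y t - (s - t) • y')) =o[𝓝 t] fun s => s - t := by
      refine Asymptotics.IsBigO.trans_isLittleO ?_ (hasDerivAt_iff_isLittleO.1 hy)
      exact Asymptotics.IsBigO.of_bound C (hb.mono fun s hs => hs _)
    have e2 : (fun s => (s - t) • (A s y' - A t y')) =o[𝓝 t] fun s => s - t := by
      have h3 : (fun s => A s y' - A t y') =o[𝓝 t] fun _ => (1 : ℝ) := by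
        rw [Asymptotics.isLittleO_one_iff]
        simpa using (hc y').sub_const (A t y')
      have h4 := (Asymptotics.isBigO_refl (fun s : ℝ => s - t) (𝓝 t)).smul_isLittleO h3
      simpa using h4
    refine (e1.add e2).congr_left fun s => ?_
    simp only [sub_self, map_zero, sub_zero, map_sub, smul_sub]
    rw [(A s).map_smul_of_tower]
    abel
  have h2 := hA.add h1
  refine h2.congr_of_eventuallyEq (Eventually.of_forall fun s => ?_)
  simp

variable {K₀ : H →ₗ.[ℂ] H} {hK₀ : IsPositiveSelfAdjoint K₀}

/-- Boundedness of order `m` on the scale of `K₀`. -/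
def HasOrder (hK₀ : IsPositiveSelfAdjoint K₀) (m : ℝ) (a : SmoothEnd K₀) : Prop :=
  ∀ r, ∃ C : ℝ, ∀ u, ‖(smoothPow hK₀ r (a u) : H)‖ ≤ C * ‖(smoothPow hK₀ (r + m) u : H)‖

theorem hasOrder_of_mem {𝒜 : OperatorClasses K₀} (h𝒜 : 𝒜.IsGradedLieAlgebra)
    (hK₀ : IsPositiveSelfAdjoint K₀) {m : ℝ} {a : SmoothEnd K₀} (ha : a ∈ 𝒜.cls m) :
    HasOrder hK₀ m a := fun r => by
  obtain ⟨N, C, -, hC⟩ := h𝒜.norm_le hK₀ m r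
  exact ⟨_, fun u => hC ⟨a, ha⟩ u⟩

namespace IsTameFamily

variable {X X' : SmoothEnd K₀} (hX : IsTameFamily hK₀ fun _ => -X)
  (hX' : IsTameFamily hK₀ fun _ => -X')

/-- The flow of `y' = i X y` on `ℋ^∞`. -/
def flow (t : ℝ) : SmoothEnd K₀ := hX.evolution t 0

theorem flow_zero : hX.flow 0 = 1 := LinearMap.ext fun u => hX.evolution_self 0 u

theorem hasSmoothDerivAt_flow (u : smoothVectors K₀) (t : ℝ) :
    HasSmoothDerivAt hK₀ (fun t => hX.flow t u) (Complex.I • X (hX.flow t u)) t := by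
  have h := hX.hasSmoothDerivAt_evolution 0 u t
  rwa [LinearMap.neg_apply, smul_neg, neg_smul, neg_neg] at h

/-- The form of uniqueness from which the group law, commutation, products and scaling of flows are
read off: exhibit the other side as a solution of the same equation. -/
theorem eq_flow {y : ℝ → smoothVectors K₀}
    (hy : ∀ t, HasSmoothDerivAt hK₀ y (Complex.I • X (y t)) t) (t : ℝ) : y t = hX.flow t (y 0) := by
  refine congrFun (hX.solution_unique (y := y) (z := fun t => hX.flow t (y 0)) (fun t => ?_)
    (hX.hasSmoothDerivAt_evolution 0 (y 0)) (s := 0) ?_) t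
  · rw [LinearMap.neg_apply, smul_neg, neg_smul, neg_neg]
    exact hy t
  · rw [flow_zero]; rfl

theorem flow_add (s t : ℝ) : hX.flow (s + t) = hX.flow s * hX.flow t := by
  refine LinearMap.ext fun u => ?_
  have h := hX.eq_flow (y := fun s => hX.flow (s + t) u)
    (fun s r => (hX.hasSmoothDerivAt_flow u (s + t) r).comp_add_const s t) s
  rw [zero_add] at h
  exact h

theorem norm_flow (t : ℝ) (u : smoothVectors K₀) : ‖(hX.flow t u : H)‖ = ‖(u : H)‖ :=
  hX.norm_evolution t 0 u

theorem commute_flow {a : SmoothEnd K₀} {m : ℝ} (ha : HasOrder hK₀ m a) (h : Commute a X) (t : ℝ) :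
    Commute a (hX.flow t) := by
  refine LinearMap.ext fun u => ?_
  have h1 := hX.eq_flow (y := fun t => a (hX.flow t u)) (fun t => by
    have h2 := (hX.hasSmoothDerivAt_flow u t).map hK₀ ha
    rw [map_smul] at h2
    have h3 : a (X (hX.flow t u)) = X (a (hX.flow t u)) := LinearMap.congr_fun h (hX.flow t u)
    rwa [h3] at h2) t
  rw [flow_zero] at h1
  exact h1

/-- In each ℋ^r this is the strong product rule for the conjugated propagator, which is locally
bounded and strongly continuous. -/
theorem hasSmoothDerivAt_flow_apply {y : ℝ → smoothVectors K₀} {y' : smoothVectors K₀} {t : ℝ}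
    (hy : HasSmoothDerivAt hK₀ y y' t) :
    HasSmoothDerivAt hK₀ (fun t => hX.flow t (y t))
      (Complex.I • X (hX.flow t (y t)) + hX.flow t y') t := by
  intro r
  have hcoe : ∀ (s : ℝ) (u : smoothVectors K₀), (smoothPow hK₀ r (hX.flow s u) : H) =
      hX.propagatorConj r s 0 (smoothPow hK₀ r u : H) := by
    intro s u
    rw [propagatorConj_coe, smoothPow_add_apply, neg_add_cancel, smoothPow_zero]
    rfl
  obtain ⟨C, hC0, hC⟩ := hX.norm_propagatorConj_le r
  have h1 := hasDerivAt_strong_apply (A := fun s => hX.propagatorConj r s 0)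
    (y := fun s => (smoothPow hK₀ r (y s) : H)) (C := Real.exp (C * (|t| + 1)))
    (d := (smoothPow hK₀ r (Complex.I • X (hX.flow t (y t))) : H)) (t := t) (by
      filter_upwards [Metric.ball_mem_nhds t one_pos] with s hs ψ
      refine (hC s 0 ψ).trans (mul_le_mul_of_nonneg_right (Real.exp_le_exp.2
        (mul_le_mul_of_nonneg_left ?_ hC0)) (norm_nonneg _))
      rw [sub_zero]
      rw [Metric.mem_ball, Real.dist_eq] at hs
      have := abs_sub_abs_le_abs_sub s t
      linarith)
    (fun ψ => ((hX.continuous_propagatorConj r ψ).comp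
      (continuous_id.prodMk continuous_const)).continuousAt)
    ((hX.hasSmoothDerivAt_flow (y t) t r).congr_of_eventuallyEq
      (Eventually.of_forall fun s => (hcoe s (y t)).symm)) (hy r)
  have h2 : HasDerivAt (fun s => (smoothPow hK₀ r (hX.flow s (y s)) : H)) _ t :=
    h1.congr_of_eventuallyEq (Eventually.of_forall fun s => hcoe s (y s))
  refine h2.congr_deriv ?_
  rw [← hcoe, map_add, Submodule.coe_add]

/-- Since X' commutes with the flow of X, the product solves the equation of X + X'. -/
theorem flow_mul_flow (hXX' : IsTameFamily hK₀ fun _ => -(X + X')) {m : ℝ}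
    (ho : HasOrder hK₀ m X') (h : Commute X' X) (t : ℝ) :
    hX.flow t * hX'.flow t = hXX'.flow t := by
  refine LinearMap.ext fun u => ?_
  have h1 := hXX'.eq_flow (y := fun t => hX.flow t (hX'.flow t u)) (fun t => by
    have h2 := hX.hasSmoothDerivAt_flow_apply (hX'.hasSmoothDerivAt_flow u t)
    have h3 : X' (hX.flow t (hX'.flow t u)) = hX.flow t (X' (hX'.flow t u)) :=
      LinearMap.congr_fun (hX.commute_flow ho h t) _
    rwa [map_smul, ← smul_add, ← h3] at h2) t
  rw [flow_zero, flow_zero] at h1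
  exact h1

theorem flow_smul (c : ℝ) (hcX : IsTameFamily hK₀ fun _ => -((c : ℂ) • X)) (t : ℝ) :
    hcX.flow t = hX.flow (c * t) := by
  refine LinearMap.ext fun u => ?_
  have h1 := hcX.eq_flow (y := fun t => hX.flow (c * t) u) (fun t r => by
    have h2 := (hX.hasSmoothDerivAt_flow u (c * t) r).scomp t ((hasDerivAt_id t).const_mul c)
    refine h2.congr_deriv ?_
    simp only [LinearMap.smul_apply, map_smul, Submodule.coe_smul, mul_one]
    rw [smul_comm, Complex.coe_smul]) t
  rw [mul_zero, flow_zero] at h1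
  exact h1.symm

theorem isUnitaryGroup : IsUnitaryGroup X fun t => hX.propagator t 0 where
  map_zero := hX.propagator_self 0
  map_add s t := by
    refine eq_of_eqOn_smoothVectors hK₀ fun u => ?_
    rw [mul_apply_eq_comp, propagator_coe, propagator_coe, propagator_coe]
    exact congrArg _ (LinearMap.congr_fun (hX.flow_add s t) u)
  isometry t ψ := hX.norm_propagator t 0 ψ
  continuous ψ := by
    have h := hX.isPropagator.continuous 0 ψ ((mem_domain_kpow le_rfl).2 ⟨ψ, rpow_zero_apply hK₀ ψ⟩)
    have h1 : ∀ χ : H, kpowApply K₀ 0 χ = χ := fun χ => by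
      conv_lhs => rw [← rpow_zero_apply hK₀ χ]
      exact kpowApply_rpow hK₀ le_rfl χ
    simp only [h1] at h
    have h2 : Continuous fun t : ℝ => (t, (0 : ℝ)) := by fun_prop
    have h3 := h.comp h2
    exact h3
  hasDerivAt u := by
    have h := (hX.hasSmoothDerivAt_flow u 0).coe hK₀
    rw [flow_zero] at h
    exact h.congr_of_eventuallyEq (Eventually.of_forall fun s => hX.propagator_coe s 0 u)

/-- Along the flow of X the curve G(-s) e^{isX} u has zero derivative, so G is determined by its
generator on ℋ^∞. This is what gives `expI`, defined by choice, a definite value. -/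
theorem eq_propagator_of_isUnitaryGroup {G : ℝ → H →L[ℂ] H} (hG : IsUnitaryGroup X G) (t : ℝ) :
    G t = hX.propagator t 0 := by
  refine eq_of_eqOn_smoothVectors hK₀ fun u => ?_
  -- Differentiability is given only at time 0; the group law G(-s) = G(-t) G(t - s) moves it to
  -- other times.
  have hder : ∀ (v : smoothVectors K₀) (t : ℝ), HasDerivAt (fun s => G (-s) (v : H))
      (-(G (-t) (Complex.I • (X v : H)))) t := by
    intro v t
    have h0 : HasDerivAt (fun s => G s (v : H)) (Complex.I • (X v : H)) (t - t) := by
      rw [sub_self]; exact hG.hasDerivAt v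
    have h1 := (h0.scomp t ((hasDerivAt_id t).const_sub t))
    have h2 := (((G (-t)).restrictScalars ℝ).hasFDerivAt
      (x := G (t - t) (v : H))).comp_hasDerivAt t h1
    refine (h2.congr_of_eventuallyEq (Eventually.of_forall fun s => ?_)).congr_deriv ?_
    · change G (-s) (v : H) = G (-t) (G (t - s) (v : H))
      rw [← mul_apply_eq_comp, ← hG.map_add]
      congr 2
      ring
    · simp
  have hconst : ∀ t, HasDerivAt (fun s => G (-s) (hX.flow s u : H)) 0 t := by
    intro t
    have h1 := hasDerivAt_strong_apply (A := fun s => G (-s)) (y := fun s => (hX.flow s u : H))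
      (C := 1) (t := t) (Eventually.of_forall fun s ψ => by rw [hG.isometry, one_mul])
      (fun ψ => ((hG.continuous ψ).comp continuous_neg).continuousAt) (hder (hX.flow t u) t)
      ((hX.hasSmoothDerivAt_flow u t).coe hK₀)
    refine h1.congr_deriv ?_
    rw [Submodule.coe_smul, neg_add_cancel]
  have h1 := is_const_of_deriv_eq_zero (fun t => (hconst t).differentiableAt)
    (fun t => (hconst t).deriv) t 0
  simp only [neg_zero, hG.map_zero, flow_zero] at h1
  rw [propagator_coe]
  have h2 := congrArg (G t) h1
  rw [← mul_apply_eq_comp, ← hG.map_add, add_neg_cancel, hG.map_zero] at h2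
  exact h2.symm

theorem expI_eq : expI X = hX.propagator 1 0 :=
  hX.eq_propagator_of_isUnitaryGroup (Classical.epsilon_spec
    (p := IsUnitaryGroup X) ⟨_, hX.isUnitaryGroup⟩) 1

theorem expI_coe (u : smoothVectors K₀) : expI X (u : H) = hX.flow 1 u := by
  rw [hX.expI_eq, propagator_coe]; rfl

end IsTameFamily

end Groups
end SobolevGrowth
end

noncomputable section
namespace SobolevGrowth
variable {H : Type*} [NormedAddCommGroup H] [InnerProductSpace ℂ H] [CompleteSpace H]

/-! ### Joint spectrum and periodicity -/

section JointSpectrum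

open scoped IsMulCommutative in
/-- Evaluation of an exponential on the joint spectrum of commuting self-adjoint elements. -/
theorem mul_exp_eq_of_joint {A : Type*} [CStarAlgebra A] {d : ℕ} (c C : A) (a : Fin d → A)
    (hc : IsSelfAdjoint c) (hC : IsSelfAdjoint C) (ha : ∀ i, IsSelfAdjoint (a i))
    (hcC : Commute c C) (hca : ∀ i, Commute c (a i)) (hCa : ∀ i, Commute C (a i))
    (haa : ∀ i j, Commute (a i) (a j)) (hCc : C * c = c) (j : Fin d) (z w : ℂ)
    (h : ∀ b : Fin d → ℝ, ¬ IsUnit ((C - 1) * (C - 1) +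
      ∑ i, (a i - algebraMap ℂ A (b i)) * (a i - algebraMap ℂ A (b i))) →
      Complex.exp (z * b j) = w) :
    c * NormedSpace.exp (z • a j) = w • c := by
  -- The operators generate a commutative C*-algebra, on which the identity can be checked on
  -- characters by Gelfand duality.
  let s : Set A := {c, C} ∪ Set.range a
  have hsa : ∀ x ∈ s, IsSelfAdjoint x := by
    rintro x ((rfl | rfl) | ⟨i, rfl⟩)
    exacts [hc, hC, ha i]
  have hcomm : ∀ x ∈ s, ∀ y ∈ s, x * y = y * x := by
    rintro x ((rfl | rfl) | ⟨i, rfl⟩) y ((rfl | rfl) | ⟨k, rfl⟩)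
    exacts [rfl, hcC, hca k, hcC.symm, rfl, hCa k, (hca i).symm, (hCa i).symm, haa i k]
  have : IsMulCommutative (StarAlgebra.adjoin ℂ s) :=
    StarAlgebra.isMulCommutative_adjoin ℂ hcomm fun x hx y hy => by
      rw [(hsa y hy).star_eq]; exact hcomm x hx y hy
  let S : StarSubalgebra ℂ A := (StarAlgebra.adjoin ℂ s).topologicalClosure
  have hS : IsClosed (S : Set A) := (StarAlgebra.adjoin ℂ s).isClosed_topologicalClosure
  let _ : CommRing S := (StarAlgebra.adjoin ℂ s).commRingTopologicalClosure mul_comm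
  let _ : CommCStarAlgebra S := { }
  have hsub : ∀ x ∈ s, x ∈ S := fun x hx =>
    StarSubalgebra.le_topologicalClosure _ (StarAlgebra.subset_adjoin ℂ s hx)
  let c' : S := ⟨c, hsub c (Or.inl (Or.inl rfl))⟩
  let C' : S := ⟨C, hsub C (Or.inl (Or.inr rfl))⟩
  let a' : Fin d → S := fun i => ⟨a i, hsub _ (Or.inr ⟨i, rfl⟩)⟩
  have key : c' * NormedSpace.exp (z • a' j) = w • c' := by
    apply (gelfandStarTransform S).injective
    refine ContinuousMap.ext fun φ => ?_
    change φ (c' * NormedSpace.exp (z • a' j)) = φ (w • c')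
    rw [map_mul, map_smul, smul_eq_mul]
    -- Characters that kill c see 0 on both sides; for the others C c = c forces φ(C) = 1, and the
    -- φ(a i) are real.
    rcases eq_or_ne (φ c') 0 with h0 | h0
    · rw [h0, zero_mul, mul_zero]
    have hφC : φ C' = 1 := by
      have h1 : φ (C' * c') = φ c' := congrArg φ (Subtype.ext hCc)
      rw [map_mul] at h1
      exact mul_right_cancel₀ h0 (h1.trans (one_mul _).symm)
    have hφa : ∀ i, φ (a' i) = ((φ (a' i)).re : ℂ) := fun i => by
      have h1 : IsSelfAdjoint (a' i) := Subtype.ext (ha i)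
      exact (Complex.conj_eq_iff_re.1 (h1.map φ)).symm
    have hexp : φ (NormedSpace.exp (z • a' j)) = Complex.exp (z * (φ (a' j)).re) := by
      let _ : NormedAlgebra ℚ S := NormedAlgebra.restrictScalars ℚ ℂ S
      rw [NormedSpace.map_exp φ (map_continuous φ), map_smul, smul_eq_mul, hφa j,
        ← Complex.exp_eq_exp_ℂ]
      simp
    rw [hexp, h (fun i => (φ (a' i)).re), mul_comm]
    intro hu
    -- The character annihilates this sum of squares, so it is not invertible and the point (φ(a i))
    -- is one at which the exponential is prescribed.
    let Q : S := (C' - 1) * (C' - 1) +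
      ∑ i, (a' i - algebraMap ℂ S (φ (a' i)).re) * (a' i - algebraMap ℂ S (φ (a' i)).re)
    have hQ : φ Q = 0 := by
      simp only [Q, map_add, map_mul, map_sub, map_sum, hφC, map_one, AlgHomClass.commutes]
      simp only [← hφa]
      simp
    have hQu : IsUnit Q := by
      -- Spectral permanence: invertibility in the large algebra implies invertibility in the closed
      -- star subalgebra.
      refine (StarSubalgebra.coe_isUnit S).1 ?_
      convert hu using 1
      simp [Q, C', a']
    have h2 := hQu.map φ
    rw [hQ] at h2
    exact not_isUnit_zero h2
  have h2 := congrArg (S.subtype) key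
  let _ : NormedAlgebra ℚ S := NormedAlgebra.restrictScalars ℚ ℂ S
  let _ : Algebra ℚ A := (NormedAlgebra.restrictScalars ℚ ℂ A).toAlgebra
  rw [map_mul, map_smul, NormedSpace.map_exp S.subtype continuous_subtype_val, map_smul] at h2
  exact h2

/-- If the self-adjoint operators `C` and `B i` have no joint approximate eigenvector for the
eigenvalues `1` and `b i`, then the associated sum of squares is invertible. -/
theorem exists_approx_eigenvector {d : ℕ} (C : H →L[ℂ] H) (B : Fin d → H →L[ℂ] H)
    (hC : IsSelfAdjoint C) (hB : ∀ i, IsSelfAdjoint (B i)) (b : Fin d → ℝ)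
    (h : ¬ IsUnit ((C - 1) * (C - 1) + ∑ i, (B i - algebraMap ℂ (H →L[ℂ] H) (b i)) *
      (B i - algebraMap ℂ (H →L[ℂ] H) (b i)))) {ε : ℝ} (hε : 0 < ε) :
    ∃ ψ : H, ‖ψ‖ = 1 ∧ ‖C ψ - ψ‖ < ε ∧ ∀ i, ‖B i ψ - (b i : ℂ) • ψ‖ < ε := by
  have hsq : ∀ D : H →L[ℂ] H, IsSelfAdjoint D → ∀ ψ, (inner ℂ ((D * D) ψ) ψ).re = ‖D ψ‖ ^ 2 := by
    intro D hD ψ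
    have h1 : inner ℂ ((D * D) ψ) ψ = inner ℂ (D ψ) (D ψ) :=
      (ContinuousLinearMap.isSelfAdjoint_iff_isSymmetric.1 hD) (D ψ) ψ
    rw [h1, inner_self_eq_norm_sq_to_K]
    norm_cast
  have hC1 : IsSelfAdjoint (C - 1) := hC.sub (.one _)
  have hB1 : ∀ i, IsSelfAdjoint (B i - algebraMap ℂ (H →L[ℂ] H) (b i)) := fun i =>
    (hB i).sub (by
      rw [isSelfAdjoint_iff, ← algebraMap_star_comm]
      congr 1
      exact Complex.conj_ofReal _)
  by_contra! hcon
  apply h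
  set Q := (C - 1) * (C - 1) + ∑ i, (B i - algebraMap ℂ (H →L[ℂ] H) (b i)) *
      (B i - algebraMap ℂ (H →L[ℂ] H) (b i)) with hQ
  have hQsa : IsSelfAdjoint Q := by
    refine IsSelfAdjoint.add ?_ (isSelfAdjoint_sum _ fun i _ => ?_)
    · exact hC1.mul_self_nonneg.isSelfAdjoint
    · exact (hB1 i).mul_self_nonneg.isSelfAdjoint
  have hform : ∀ ψ, (inner ℂ (Q ψ) ψ).re =
      ‖C ψ - ψ‖ ^ 2 + ∑ i, ‖B i ψ - (b i : ℂ) • ψ‖ ^ 2 := by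
    intro ψ
    have h1 : Q ψ = ((C - 1) * (C - 1)) ψ + ∑ i, ((B i - algebraMap ℂ (H →L[ℂ] H) (b i)) *
      (B i - algebraMap ℂ (H →L[ℂ] H) (b i))) ψ := by
      rw [hQ, add_apply, sum_apply]
    rw [h1, inner_add_left, sum_inner, Complex.add_re, Complex.re_sum, hsq _ hC1]
    congr 1
    refine Finset.sum_congr rfl fun i _ => ?_
    rw [hsq _ (hB1 i)]
    rfl
  -- If every unit vector violates one of the approximate equations by ε, the quadratic form of Q is
  -- at least ε², so Q dominates a strictly positive operator and is invertible.
  have hlow : ∀ ψ : H, ε ^ 2 * ‖ψ‖ ^ 2 ≤ (inner ℂ (Q ψ) ψ).re := by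
    have h1 : ∀ ψ : H, ‖ψ‖ = 1 → ε ^ 2 ≤ (inner ℂ (Q ψ) ψ).re := by
      intro ψ hψ
      rw [hform]
      rcases lt_or_ge ‖C ψ - ψ‖ ε with h2 | h2
      · obtain ⟨i, hi⟩ := hcon ψ hψ h2
        have h3 := Finset.single_le_sum (f := fun i => ‖B i ψ - (b i : ℂ) • ψ‖ ^ 2)
          (fun i _ => sq_nonneg _) (Finset.mem_univ i)
        have h4 : ε ^ 2 ≤ ‖B i ψ - (b i : ℂ) • ψ‖ ^ 2 := pow_le_pow_left₀ hε.le hi 2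
        nlinarith [sq_nonneg ‖C ψ - ψ‖]
      · have h3 : 0 ≤ ∑ i, ‖B i ψ - (b i : ℂ) • ψ‖ ^ 2 := Finset.sum_nonneg fun i _ => sq_nonneg _
        have h4 : ε ^ 2 ≤ ‖C ψ - ψ‖ ^ 2 := pow_le_pow_left₀ hε.le h2 2
        linarith
    intro ψ
    rcases eq_or_ne ψ 0 with rfl | hψ
    · simp
    have hpos : 0 < ‖ψ‖ := norm_pos_iff.2 hψ
    have h2 := h1 (((‖ψ‖⁻¹ : ℝ) : ℂ) • ψ) (by
      rw [norm_smul, Complex.norm_real, norm_inv, norm_norm, inv_mul_cancel₀ hpos.ne'])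
    rw [map_smul, inner_smul_left, inner_smul_right, Complex.conj_ofReal, Complex.re_ofReal_mul,
      Complex.re_ofReal_mul, ← mul_assoc, ← sq, inv_pow] at h2
    have hpos2 : 0 < ‖ψ‖ ^ 2 := by positivity
    calc ε ^ 2 * ‖ψ‖ ^ 2 ≤ ((‖ψ‖ ^ 2)⁻¹ * (inner ℂ (Q ψ) ψ).re) * ‖ψ‖ ^ 2 :=
          mul_le_mul_of_nonneg_right h2 hpos2.le
      _ = _ := by field_simp
  have hle : algebraMap ℝ (H →L[ℂ] H) (ε ^ 2) ≤ Q := by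
    rw [ContinuousLinearMap.le_def]
    refine ⟨ContinuousLinearMap.isSelfAdjoint_iff_isSymmetric.1
      (hQsa.sub (IsSelfAdjoint.algebraMap _ (.all _))), fun ψ => ?_⟩
    rw [ContinuousLinearMap.reApplyInnerSelf_apply]
    have h1 : (Q - algebraMap ℝ (H →L[ℂ] H) (ε ^ 2)) ψ = Q ψ - ((ε ^ 2 : ℝ) : ℂ) • ψ := rfl
    rw [h1, inner_sub_left, inner_smul_left, Complex.conj_ofReal, inner_self_eq_norm_sq_to_K]
    have h2 := hlow ψ
    have h3 : RCLike.re (inner ℂ (Q ψ) ψ - ((ε ^ 2 : ℝ) : ℂ) * ((‖ψ‖ : ℂ)) ^ 2) =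
        (inner ℂ (Q ψ) ψ).re - ε ^ 2 * ‖ψ‖ ^ 2 := by
      simp only [RCLike.re_to_complex, Complex.sub_re, ← Complex.ofReal_pow, ← Complex.ofReal_mul,
        Complex.ofReal_re]
    exact h3 ▸ sub_nonneg.2 h2
  exact CStarAlgebra.isUnit_of_le _ hle (IsStrictlyPositive.iff_of_unital.2
    ⟨algebraMap_nonneg _ (sq_nonneg ε), (IsUnit.mk0 _ (pow_pos hε 2).ne').map (algebraMap ℝ _)⟩)

end JointSpectrum
end SobolevGrowth
end

noncomputable section
namespace SobolevGrowth
variable {H : Type*} [NormedAddCommGroup H] [InnerProductSpace ℂ H] [CompleteSpace H]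

/-! ### Periodicity of the unitary groups up to a phase -/

section Periodicity

variable {K₀ : H →ₗ.[ℂ] H} (hK₀ : IsPositiveSelfAdjoint K₀)

theorem commute_smoothPow_neg {a : SmoothEnd K₀} {r : ℝ} (h : Commute a (smoothPow hK₀ r)) :
    Commute a (smoothPow hK₀ (-r)) := by
  have h1 : smoothPow hK₀ (-r) * smoothPow hK₀ r = 1 := by
    rw [← smoothPow_add, neg_add_cancel, smoothPow_zero]
  have h2 : smoothPow hK₀ r * smoothPow hK₀ (-r) = 1 := by
    rw [← smoothPow_add, add_neg_cancel, smoothPow_zero]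
  calc a * smoothPow hK₀ (-r) = smoothPow hK₀ (-r) * smoothPow hK₀ r * (a * smoothPow hK₀ (-r)) := by
        rw [h1, one_mul]
    _ = smoothPow hK₀ (-r) * (a * smoothPow hK₀ r) * smoothPow hK₀ (-r) := by
        rw [h.eq]; simp only [mul_assoc]
    _ = smoothPow hK₀ (-r) * a := by rw [mul_assoc, mul_assoc, h2, mul_one]

/-- The operator a K₀⁻¹ is bounded and commutes with K₀⁻¹, hence with the cutoff function of K₀⁻¹;
then write a = (a K₀⁻¹) K₀. -/
theorem smoothCutoff_comm {a : SmoothEnd K₀} (ha : HasOrder hK₀ 1 a)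
    (h : Commute a (smoothPow hK₀ 1)) (n : ℕ) (u : smoothVectors K₀) :
    a (smoothCutoff hK₀ n u) = smoothCutoff hK₀ n (a u : H) := by
  have h1 := commute_smoothPow_neg hK₀ h
  obtain ⟨C, hC⟩ := ha 0
  have hb : ∀ v, ‖((smoothVectors K₀).subtype ∘ₗ (a * smoothPow hK₀ (-1))) v‖ ≤ C * ‖(v : H)‖ := by
    intro v
    have h2 := hC (smoothPow hK₀ (-1) v)
    rw [smoothPow_zero, zero_add, smoothPow_add_apply, add_neg_cancel, smoothPow_zero] at h2
    exact h2
  have hBc := extendDense_coe hK₀ hb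
  set B : H →L[ℂ] H := extendDense ((smoothVectors K₀).subtype ∘ₗ (a * smoothPow hK₀ (-1))) with hB
  have hT : ∀ v : smoothVectors K₀, boundedInverse K₀ (v : H) = smoothPow hK₀ (-1) v := fun v => by
    rw [smoothPow_neg hK₀ zero_le_one, rpow_one_apply hK₀]
  have hcomm : Commute (boundedInverse K₀) B := by
    refine eq_of_eqOn_smoothVectors hK₀ fun v => ?_
    rw [mul_apply_eq_comp, mul_apply_eq_comp, hBc, hT, hBc]
    refine (hT _).trans ?_
    exact congrArg _ (LinearMap.congr_fun (h1.mul_left (Commute.refl _)) v).symm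
  have hcut := (boundedInverse_isSelfAdjoint hK₀).commute_cfc hcomm (cutoff (n + 1))
  have h3 : ∀ v : smoothVectors K₀, cutoffOp K₀ (n + 1) (B v) = B (cutoffOp K₀ (n + 1) v) :=
    fun v => DFunLike.congr_fun hcut (v : H)
  refine Subtype.ext ?_
  have h4 : ∀ v : smoothVectors K₀, B (smoothPow hK₀ 1 v) = a v := fun v => by
    rw [hBc]
    change (a (smoothPow hK₀ (-1) (smoothPow hK₀ 1 v)) : H) = a v
    rw [smoothPow_add_apply, neg_add_cancel, smoothPow_zero]
    rfl
  rw [coe_smoothCutoff, ← h4 u, h3, ← h4, smoothPow_smoothCutoff, coe_smoothCutoff]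

theorem smoothCutoff_smoothCutoff_comm (m n : ℕ) (ψ : H) :
    smoothCutoff hK₀ m (smoothCutoff hK₀ n ψ : H) = smoothCutoff hK₀ n (smoothCutoff hK₀ m ψ : H) := by
  refine Subtype.ext ?_
  simp only [coe_smoothCutoff]
  exact DFunLike.congr_fun (cfc_commute_cfc (cutoff (m + 1)) (cutoff (n + 1)) (boundedInverse K₀)) ψ

theorem exists_cutoff_extension {a : SmoothEnd K₀} (ha : HasOrder hK₀ 1 a) (n : ℕ) :
    ∃ B : H →L[ℂ] H, ∀ ψ, B ψ = a (smoothCutoff hK₀ n ψ) := by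
  obtain ⟨C, hC⟩ := ha 0
  obtain ⟨G, hG⟩ := exists_smoothPow_smoothCutoff_eq hK₀ n 1
  refine ⟨((smoothVectors K₀).subtype ∘ₗ a ∘ₗ smoothCutoff hK₀ n).mkContinuous (|C| * ‖G‖)
    fun ψ => ?_, fun ψ => rfl⟩
  have h1 := hC (smoothCutoff hK₀ n ψ)
  rw [smoothPow_zero, zero_add, hG] at h1
  refine h1.trans ?_
  rw [mul_assoc]
  exact mul_le_mul (le_abs_self C) (G.le_opNorm ψ) (norm_nonneg _) (abs_nonneg C)

theorem isSelfAdjoint_cutoff_extension {a : SmoothEnd K₀} (ha : HasOrder hK₀ 1 a)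
    (h : Commute a (smoothPow hK₀ 1)) (hs : IsSymmetricOp a) (n : ℕ) {B : H →L[ℂ] H}
    (hB : ∀ ψ, B ψ = a (smoothCutoff hK₀ n ψ)) : IsSelfAdjoint B := by
  rw [ContinuousLinearMap.isSelfAdjoint_iff']
  refine eq_of_eqOn_smoothVectors hK₀ fun u => ?_
  refine (dense_smoothVectors hK₀).eq_of_inner_left (𝕜 := ℂ) fun v hv => ?_
  lift v to smoothVectors K₀ using hv
  rw [ContinuousLinearMap.adjoint_inner_left, hB, hB, smoothCutoff_comm hK₀ ha h,
    ← inner_smoothCutoff]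
  rw [← hs, smoothCutoff_comm hK₀ ha h]

/-- The cutoff C = J carries the extra eigenvalue 1: an approximate eigenvector ψ is close to χ =
Jψ, which lies in ℋ^∞ and hence in the domains of the unbounded K j, where B j ψ = k j χ. The
normalization of χ is the required vector. -/
theorem mem_jointSpectrum_of_not_isUnit {d : ℕ} {K : Fin d → H →ₗ.[ℂ] H}
    {k : Fin d → SmoothEnd K₀} (hk : ∀ j, IsRestriction (k j) (K j)) {n : ℕ} {C : H →L[ℂ] H}
    {B : Fin d → H →L[ℂ] H} (hC : IsSelfAdjoint C) (hB : ∀ i, IsSelfAdjoint (B i))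
    (hCn : ∀ ψ, C ψ = smoothCutoff hK₀ n ψ) (hBn : ∀ i ψ, B i ψ = k i (smoothCutoff hK₀ n ψ))
    (b : Fin d → ℝ)
    (h : ¬ IsUnit ((C - 1) * (C - 1) + ∑ i, (B i - algebraMap ℂ (H →L[ℂ] H) (b i)) *
      (B i - algebraMap ℂ (H →L[ℂ] H) (b i)))) : b ∈ jointSpectrum K := by
  intro ε hε
  have hS : 0 ≤ ∑ i, |b i| := Finset.sum_nonneg fun _ _ => abs_nonneg _
  -- The bound 1/2 keeps ‖χ‖ ≥ 1/2; the other one makes the error δ(1 + Σ|b i|), divided by ‖χ‖,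
  -- less than ε.
  set δ : ℝ := min (1 / 2) (ε / (4 * (1 + ∑ i, |b i|))) with hδ
  have hδ0 : 0 < δ := lt_min (by norm_num) (by positivity)
  have hδ1 : δ ≤ 1 / 2 := min_le_left _ _
  have hδ2 : δ * (4 * (1 + ∑ i, |b i|)) ≤ ε := by
    have := min_le_right (1 / 2) (ε / (4 * (1 + ∑ i, |b i|)))
    rwa [le_div_iff₀ (by positivity)] at this
  obtain ⟨ψ, hψ, h1, h2⟩ := exists_approx_eigenvector C B hC hB b h hδ0
  set χ := smoothCutoff hK₀ n ψ with hχ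
  rw [hCn] at h1
  have hnorm : 1 / 2 ≤ ‖(χ : H)‖ := by
    have := norm_sub_norm_le ψ (χ : H)
    rw [norm_sub_rev] at this
    linarith
  have hpos : 0 < ‖(χ : H)‖ := by linarith
  refine ⟨((‖(χ : H)‖⁻¹ : ℝ) : ℂ) • (χ : H), ?_, fun j => ?_⟩
  · rw [norm_smul, Complex.norm_real, norm_inv, norm_norm, inv_mul_cancel₀ hpos.ne']
  obtain ⟨x, hx, hx'⟩ := (LinearPMap.mem_graph_iff (K j)).1
    (hk j (((‖(χ : H)‖⁻¹ : ℝ) : ℂ) • χ))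
  dsimp only at hx hx'
  rw [Submodule.coe_smul] at hx
  have hmem : ((‖(χ : H)‖⁻¹ : ℝ) : ℂ) • (χ : H) ∈ (K j).domain := hx ▸ x.2
  refine ⟨hmem, ?_⟩
  have hKx : K j ⟨_, hmem⟩ = ((‖(χ : H)‖⁻¹ : ℝ) : ℂ) • (k j χ : H) := by
    have : (⟨_, hmem⟩ : (K j).domain) = x := Subtype.ext hx.symm
    rw [this, hx', map_smul, Submodule.coe_smul]
  have h3 : (k j χ : H) - (b j : ℂ) • (χ : H) =
      (B j ψ - (b j : ℂ) • ψ) - (b j : ℂ) • ((χ : H) - ψ) := by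
    rw [hBn, smul_sub]; abel
  have h4 : ‖(k j χ : H) - (b j : ℂ) • (χ : H)‖ < δ * (1 + ∑ i, |b i|) := by
    rw [h3]
    have h5 : |b j| ≤ ∑ i, |b i| :=
      Finset.single_le_sum (f := fun i => |b i|) (fun _ _ => abs_nonneg _) (Finset.mem_univ j)
    have h6 : ‖(b j : ℂ) • ((χ : H) - ψ)‖ ≤ (∑ i, |b i|) * δ := by
      rw [norm_smul, Complex.norm_real, Real.norm_eq_abs]
      exact mul_le_mul h5 h1.le (norm_nonneg _) hS
    linarith [norm_sub_le (B j ψ - (b j : ℂ) • ψ) ((b j : ℂ) • ((χ : H) - ψ)), h2 j]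
  rw [hKx, smul_comm, ← smul_sub, norm_smul, Complex.norm_real, norm_inv, norm_norm]
  rw [inv_mul_lt_iff₀ hpos]
  nlinarith

theorem smooth_hasSmoothDerivAt_cutoff {y : ℝ → H} {y' : H} {t : ℝ} (n : ℕ)
    (hy : HasDerivAt y y' t) :
    HasSmoothDerivAt hK₀ (fun s => smoothCutoff hK₀ n (y s)) (smoothCutoff hK₀ n y') t := by
  intro r
  obtain ⟨G, hG⟩ := exists_smoothPow_smoothCutoff_eq hK₀ n r
  simp only [hG]
  exact ((G.restrictScalars ℝ).hasFDerivAt (x := y t)).comp_hasDerivAt t hy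

/-- If the joint spectrum is contained in `ℕ^d + λ`, the group generated by `k j` is periodic up to
a phase. -/
theorem flow_two_pi {d : ℕ} {K : Fin d → H →ₗ.[ℂ] H} {k : Fin d → SmoothEnd K₀}
    (hk : ∀ j, IsRestriction (k j) (K j)) (hsymm : ∀ j, IsSymmetricOp (k j))
    (hord : ∀ j, HasOrder hK₀ 1 (k j)) (hcomm : ∀ i j, k i * k j = k j * k i)
    (hcommΛ : ∀ j, Commute (k j) (smoothPow hK₀ 1)) {lam : Fin d → ℝ}
    (hspec : jointSpectrum K ⊆ {μ | ∃ a : Fin d → ℕ, ∀ j, μ j = a j + lam j}) (j : Fin d)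
    (hX : IsTameFamily hK₀ fun _ => -k j) :
    hX.flow (2 * Real.pi) = Complex.exp (2 * Real.pi * Complex.I * lam j) • 1 := by
  set w := Complex.exp (2 * Real.pi * Complex.I * lam j) with hw
  have key : ∀ (n : ℕ) (u : smoothVectors K₀),
      hX.flow (2 * Real.pi) (smoothCutoff hK₀ n (u : H)) = w • smoothCutoff hK₀ n (u : H) := by
    intro n u
    -- The bounded operators k i J with the wider cutoff agree with k i on the range of the cutoff
    -- of index n, so there e^{itk_j} is the exponential of a bounded operator and the joint
    -- spectral calculus applies.
    choose B hB using fun i => exists_cutoff_extension hK₀ (hord i) (2 * n + 1)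
    have hBsa : ∀ i, IsSelfAdjoint (B i) := fun i =>
      isSelfAdjoint_cutoff_extension hK₀ (hord i) (hcommΛ i) (hsymm i) _ (hB i)
    have hcsa : ∀ n, IsSelfAdjoint (cutoffOp K₀ n) := fun n => cfc_predicate _ _
    have hcB : ∀ m i, Commute (cutoffOp K₀ (m + 1)) (B i) := by
      intro m i
      refine eq_of_eqOn_smoothVectors hK₀ fun v => ?_
      rw [mul_apply_eq_comp, mul_apply_eq_comp, hB, hB, ← coe_smoothCutoff hK₀,
        ← coe_smoothCutoff hK₀, ← smoothCutoff_comm hK₀ (hord i) (hcommΛ i),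
        smoothCutoff_smoothCutoff_comm]
    have hBB : ∀ i l, Commute (B i) (B l) := by
      intro i l
      refine eq_of_eqOn_smoothVectors hK₀ fun v => ?_
      rw [mul_apply_eq_comp, mul_apply_eq_comp, hB, hB, hB, hB,
        ← smoothCutoff_comm hK₀ (hord i) (hcommΛ i), ← smoothCutoff_comm hK₀ (hord l) (hcommΛ l)]
      exact congrArg _ (LinearMap.congr_fun (hcomm i l) _)
    have hexp := mul_exp_eq_of_joint (cutoffOp K₀ (n + 1)) (cutoffOp K₀ (2 * n + 1 + 1)) B (hcsa _)
      (hcsa _) hBsa (cfc_commute_cfc _ _ _) (hcB n) (hcB (2 * n + 1)) hBB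
      (ContinuousLinearMap.ext fun ψ => cutoffOp_comp_cutoffOp (by omega) ψ) j
      (2 * Real.pi * Complex.I) w (fun b hb => by
        obtain ⟨a, ha⟩ := hspec (mem_jointSpectrum_of_not_isUnit hK₀ hk (hcsa _) hBsa
          (fun ψ => (coe_smoothCutoff hK₀ _ ψ).symm) hB b hb)
        rw [ha j, Complex.ofReal_add, mul_add, Complex.exp_add, hw]
        have h1 : Complex.exp (2 * Real.pi * Complex.I * ((a j : ℝ) : ℂ)) = 1 := by
          rw [Complex.ofReal_natCast, mul_comm]
          exact Complex.exp_nat_mul_two_pi_mul_I (a j)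
        rw [h1, one_mul])
    -- The curve solves the flow equation because k j commutes with cutoffs and the wider cutoff is
    -- absorbed by the narrower one.
    have hsol : ∀ t, HasSmoothDerivAt hK₀
        (fun s : ℝ => smoothCutoff hK₀ n (NormedSpace.exp (s • (Complex.I • B j)) (u : H)))
        (Complex.I • k j (smoothCutoff hK₀ n
          (NormedSpace.exp (t • (Complex.I • B j)) (u : H)))) t := by
      intro t
      have h1 := hasDerivAt_exp_smul_const' (𝕂 := ℝ) (Complex.I • B j) t
      let L : (H →L[ℂ] H) →L[ℝ] H := (ContinuousLinearMap.apply ℂ H (u : H)).restrictScalars ℝ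
      have h2 : HasDerivAt (fun s : ℝ => NormedSpace.exp (s • (Complex.I • B j)) (u : H))
          (((Complex.I • B j) * NormedSpace.exp (t • (Complex.I • B j))) (u : H)) t := by
        have h0 : HasFDerivAt L L (NormedSpace.exp (t • (Complex.I • B j))) := L.hasFDerivAt
        exact h0.comp_hasDerivAt t h1
      have h3 := smooth_hasSmoothDerivAt_cutoff hK₀ n h2
      rw [mul_apply_eq_comp, smul_apply, map_smul, hB,
        ← smoothCutoff_comm hK₀ (hord j) (hcommΛ j), smoothCutoff_smoothCutoff_comm,
        smoothCutoff_smoothCutoff] at h3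
      exact h3
    have h1 := hX.eq_flow hsol (2 * Real.pi)
    rw [zero_smul, NormedSpace.exp_zero, one_apply_eq_self] at h1
    rw [← h1]
    refine Subtype.ext ?_
    have h2 := DFunLike.congr_fun hexp (u : H)
    rw [coe_smoothCutoff, Submodule.coe_smul, coe_smoothCutoff]
    refine Eq.trans ?_ h2
    rw [mul_apply_eq_comp]
    congr 3
    rw [← Complex.coe_smul, smul_smul]
    push_cast
    rfl
  refine LinearMap.ext fun u => Subtype.ext ?_
  rw [LinearMap.smul_apply, Module.End.one_apply, Submodule.coe_smul, ← sub_eq_zero,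
    ← norm_eq_zero]
  -- The identity passes from cutoff vectors to all u because the flow is isometric and the cutoffs
  -- converge on ℋ^1.
  have hlim : Tendsto (fun n : ℕ => (1 + ‖w‖) * (2 / ((n : ℝ) + 1) * ‖(smoothPow hK₀ 1 u : H)‖))
      atTop (𝓝 0) := by
    have h1 : Tendsto (fun n : ℕ => 2 / ((n : ℝ) + 1)) atTop (𝓝 0) := by
      simpa [div_eq_mul_inv] using
        (tendsto_one_div_add_atTop_nhds_zero_nat (𝕜 := ℝ)).const_mul 2
    simpa using (h1.mul_const ‖(smoothPow hK₀ 1 u : H)‖).const_mul (1 + ‖w‖)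
  refine le_antisymm (ge_of_tendsto' hlim fun n => ?_) (norm_nonneg _)
  have h1 := norm_sub_smoothCutoff_le hK₀ n 0 u
  rw [smoothPow_zero, zero_add] at h1
  change ‖((u - smoothCutoff hK₀ n (u : H) : smoothVectors K₀) : H)‖ ≤ _ at h1
  have h2 : (hX.flow (2 * Real.pi) u : H) - w • (u : H) =
      (hX.flow (2 * Real.pi) (u - smoothCutoff hK₀ n (u : H)) : H) -
        w • ((u - smoothCutoff hK₀ n (u : H) : smoothVectors K₀) : H) := by
    rw [map_sub, key, Submodule.coe_sub, Submodule.coe_sub, Submodule.coe_smul, smul_sub]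
    abel
  rw [h2]
  refine (norm_sub_le _ _).trans ?_
  rw [hX.norm_flow, norm_smul, add_mul, one_mul]
  gcongr

end Periodicity
end SobolevGrowth
end

noncomputable section
namespace SobolevGrowth
variable {H : Type*} [NormedAddCommGroup H] [InnerProductSpace ℂ H] [CompleteSpace H]

/-! ### Conjugation by the unitary groups -/

section Conjugation

variable {K₀ : H →ₗ.[ℂ] H}

theorem IsBoundedMap.exists_seminormSum_le {F G : Type*} [AddCommGroup F] [Module ℂ F]
    [AddCommGroup G] [Module ℂ G] {p : ℕ → Seminorm ℂ F} {q : ℕ → Seminorm ℂ G} {L : F →ₗ[ℂ] G}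
    (hL : IsBoundedMap p q L) (N : ℕ) : ∃ (M : ℕ) (C : ℝ), 0 ≤ C ∧ ∀ a,
      seminormSum q N (L a) ≤ C * seminormSum p M a := by
  choose M C hC0 hC using hL
  refine ⟨(Finset.range N).sup M, ∑ i ∈ Finset.range N, C i, Finset.sum_nonneg fun _ _ => hC0 _,
    fun a => ?_⟩
  rw [seminormSum_apply, Finset.sum_mul]
  exact Finset.sum_le_sum fun i hi => (hC i a).trans
    (mul_le_mul_of_nonneg_left (seminormSum_mono p (Finset.le_sup (f := M) hi) a) (hC0 i))

theorem map_sub_sub_smul {F G : Type*} [AddCommGroup F] [Module ℂ F] [AddCommGroup G] [Module ℂ G]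
    (L : F →ₗ[ℂ] G) (a b c : F) (t : ℂ) : L a - L b - t • L c = L (a - b - t • c) := by
  rw [map_sub, map_sub, map_smul]

/-- Commuting symmetric operators of order one with the Egorov property. -/
structure IsCommutingSystem (𝒜 : OperatorClasses K₀) {d : ℕ} (k : Fin d → SmoothEnd K₀) : Prop where
  pos : IsPositiveSelfAdjoint K₀
  graded : 𝒜.IsGradedLieAlgebra
  mem : ∀ j, k j ∈ 𝒜.cls 1
  symm : ∀ j, IsSymmetricOp (k j)
  comm : ∀ i j, k i * k j = k j * k i
  egorov : HasEgorovProperty 𝒜 k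

theorem HasUniformDeriv.tendsto_slope {F E : Type*} [AddCommGroup F] [Module ℂ F] [AddCommGroup E]
    [Module ℝ E] {p : ℕ → Seminorm ℂ F} {w : E} {f g : E → F} (h : HasUniformDeriv p w f g) (j : ℕ)
    (x : E) : Tendsto (fun t : ℝ => p j (((t⁻¹ : ℝ) : ℂ) • (f (x + t • w) - f x) - g x))
      (𝓝[≠] 0) (𝓝 0) := by
  obtain ⟨C, hC0, hC⟩ := h.nonneg j
  have h1 : Tendsto (fun t : ℝ => C * |t|) (𝓝[≠] 0) (𝓝 0) := by
    have h2 : Continuous fun t : ℝ => C * |t| := by fun_prop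
    have h3 := h2.tendsto 0
    rw [abs_zero, mul_zero] at h3
    exact h3.mono_left nhdsWithin_le_nhds
  refine squeeze_zero' (Eventually.of_forall fun _ => apply_nonneg _ _) ?_ h1
  filter_upwards [self_mem_nhdsWithin] with t ht
  have ht' : ((t⁻¹ : ℝ) : ℂ) * (t : ℂ) = 1 := by
    rw [← Complex.ofReal_mul, inv_mul_cancel₀ ht, Complex.ofReal_one]
  have h4 : ((t⁻¹ : ℝ) : ℂ) • (f (x + t • w) - f x) - g x =
      ((t⁻¹ : ℝ) : ℂ) • (f (x + t • w) - f x - (t : ℂ) • g x) := by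
    rw [smul_sub _ (f (x + t • w) - f x), smul_smul, ht', one_smul]
  rw [h4, map_smul_eq_mul, Complex.norm_real, Real.norm_eq_abs, abs_inv]
  have hpos : 0 < |t| := abs_pos.2 ht
  rw [inv_mul_le_iff₀ hpos]
  refine (hC x t).trans (le_of_eq ?_)
  rw [← sq_abs t]; ring

theorem OperatorClasses.IsGradedLieAlgebra.tendsto_apply {𝒜 : OperatorClasses K₀}
    (h𝒜 : 𝒜.IsGradedLieAlgebra) (hK₀ : IsPositiveSelfAdjoint K₀) {m : ℝ} {X : Type*} {l : Filter X}
    {f : X → 𝒜.cls m} {a : 𝒜.cls m} (h : ∀ j, Tendsto (fun x => 𝒜.seminorm m j (f x - a)) l (𝓝 0))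
    (u : smoothVectors K₀) :
    Tendsto (fun x => ((f x : SmoothEnd K₀) u : H)) l (𝓝 ((a : SmoothEnd K₀) u : H)) := by
  obtain ⟨N, C, hC0, hC⟩ := h𝒜.norm_le hK₀ m 0
  rw [tendsto_iff_norm_sub_tendsto_zero]
  have h1 : Tendsto (fun x => C * seminormSum (𝒜.seminorm m) N (f x - a) *
      ‖(smoothPow hK₀ (0 + m) u : H)‖) l (𝓝 0) := by
    have h2 : Tendsto (fun x => seminormSum (𝒜.seminorm m) N (f x - a)) l (𝓝 0) := by
      simp only [seminormSum_apply]
      simpa using tendsto_finsetSum (Finset.range N) fun i _ => h i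
    simpa using (h2.const_mul C).mul_const _
  refine squeeze_zero (fun _ => norm_nonneg _) (fun x => ?_) h1
  have h3 := hC (f x - a) u
  rw [smoothPow_zero] at h3
  exact h3

namespace IsCommutingSystem

variable {𝒜 : OperatorClasses K₀} {d : ℕ} {k : Fin d → SmoothEnd K₀}
  (hk : IsCommutingSystem 𝒜 k)
include hk

theorem tame (τ : Fin d → ℝ) : IsTameFamily hk.pos fun _ => -dotOp τ k :=
  hk.graded.isTameFamily_const hk.pos (Submodule.neg_mem _ (dotOp_mem hk.mem τ)) (by
    rw [← dotOp_neg]; exact isSymmetricOp_dotOp hk.symm _)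

theorem hasOrder_dotOp (τ : Fin d → ℝ) : HasOrder hk.pos 1 (dotOp τ k) :=
  hasOrder_of_mem hk.graded hk.pos (dotOp_mem hk.mem τ)

theorem commute_dotOp (τ τ' : Fin d → ℝ) : Commute (dotOp τ k) (dotOp τ' k) :=
  SobolevGrowth.commute_dotOp (fun j =>
    (SobolevGrowth.commute_dotOp (fun i => hk.comm j i) τ).symm) τ'

/-- The unitary operator `e^{iτ·K}` on `ℋ^∞`. -/
def expOp (τ : Fin d → ℝ) : SmoothEnd K₀ := (hk.tame τ).flow 1

theorem expOp_smul (t : ℝ) (τ : Fin d → ℝ) : hk.expOp (t • τ) = (hk.tame τ).flow t := by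
  have h := hk.tame (t • τ)
  rw [dotOp_smul] at h
  rw [← mul_one t, ← (hk.tame τ).flow_smul t h 1, mul_one, expOp]
  congr 1
  exact dotOp_smul k t τ

theorem expOp_zero : hk.expOp 0 = 1 := by
  rw [← zero_smul ℝ (0 : Fin d → ℝ), expOp_smul, IsTameFamily.flow_zero]

theorem expOp_add (τ τ' : Fin d → ℝ) : hk.expOp (τ + τ') = hk.expOp τ * hk.expOp τ' := by
  have h := hk.tame (τ + τ')
  rw [dotOp_add] at h
  rw [expOp, expOp, expOp, (hk.tame τ).flow_mul_flow (hk.tame τ') h (hk.hasOrder_dotOp τ')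
    (hk.commute_dotOp τ' τ)]
  congr 1
  exact dotOp_add k τ τ'

theorem expOp_mul_neg (τ : Fin d → ℝ) : hk.expOp τ * hk.expOp (-τ) = 1 := by
  rw [← expOp_add, add_neg_cancel, expOp_zero]

/-- The Egorov hypothesis, stated through the unitary groups on H, rewritten as a conjugation of
operators on ℋ^∞. -/
theorem exists_conj_eq {m : ℝ} (a : 𝒜.cls m) : ∃ F : (Fin d → ℝ) → 𝒜.cls m,
    IsSmoothBounded (𝒜.seminorm m) F ∧
    ∀ τ, (F τ : SmoothEnd K₀) = hk.expOp τ * a * hk.expOp (-τ) := by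
  obtain ⟨F, hF, h⟩ := hk.egorov m a a.2
  refine ⟨F, hF, fun τ => LinearMap.ext fun u => Subtype.ext ?_⟩
  have h1 := h τ (hk.expOp (-τ) u) u (by
    rw [(hk.tame τ).expI_coe]
    exact congrArg _ (LinearMap.congr_fun (hk.expOp_mul_neg τ) u).symm)
  rw [(hk.tame τ).expI_coe] at h1
  exact h1

/-- Conjugation by `e^{iτ·K}`. -/
def conj (m : ℝ) (τ : Fin d → ℝ) : 𝒜.cls m →ₗ[ℂ] 𝒜.cls m where
  toFun a := ⟨hk.expOp τ * a * hk.expOp (-τ), by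
    obtain ⟨F, -, h⟩ := hk.exists_conj_eq a
    rw [← h]; exact (F τ).2⟩
  map_add' a b := Subtype.ext (by simp only [Submodule.coe_add, mul_add, add_mul])
  map_smul' c a := Subtype.ext (by
    simp only [Submodule.coe_smul, mul_smul_comm, smul_mul_assoc, RingHom.id_apply])

theorem coe_conj {m : ℝ} (τ : Fin d → ℝ) (a : 𝒜.cls m) :
    (hk.conj m τ a : SmoothEnd K₀) = hk.expOp τ * a * hk.expOp (-τ) := rfl

theorem conj_zero {m : ℝ} (a : 𝒜.cls m) : hk.conj m 0 a = a := Subtype.ext (by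
  rw [coe_conj, neg_zero, expOp_zero, one_mul, mul_one])

theorem conj_add {m : ℝ} (τ τ' : Fin d → ℝ) (a : 𝒜.cls m) :
    hk.conj m (τ + τ') a = hk.conj m τ (hk.conj m τ' a) := Subtype.ext (by
  rw [coe_conj, coe_conj, coe_conj, neg_add_rev, expOp_add, expOp_add]
  simp only [mul_assoc])

theorem isBoundedSmooth_conj {m : ℝ} (a : 𝒜.cls m) :
    IsBoundedSmooth (𝒜.seminorm m) fun τ => hk.conj m τ a := by
  obtain ⟨F, hF, h⟩ := hk.exists_conj_eq a
  have : (fun τ => hk.conj m τ a) = F := funext fun τ => Subtype.ext (h τ).symm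
  rw [this]
  exact hF.isBoundedSmooth

/-- Each orbit under conjugation is bounded by the Egorov hypothesis. Each conjugation has a closed
graph, since convergence in 𝒜_m implies strong convergence on ℋ^∞, so the Baire argument gives a
bound uniform in τ and linear in a. -/
theorem conj_bound (m : ℝ) (j : ℕ) : ∃ (N : ℕ) (C : ℝ), 0 ≤ C ∧ ∀ τ (a : 𝒜.cls m),
    𝒜.seminorm m j (hk.conj m τ a) ≤ C * seminormSum (𝒜.seminorm m) N a := by
  refine exists_uniform_bound (hk.graded.isSeqComplete m) (hk.graded.isSeqComplete m)
    (fun τ => hk.conj m τ) (fun τ u a b hu hb => ?_)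
    (fun a => (hk.isBoundedSmooth_conj a).bounded) j
  refine Subtype.ext (LinearMap.ext fun x => Subtype.ext ?_)
  have h1 := hk.graded.tendsto_apply hk.pos hb x
  have h2 := hk.graded.tendsto_apply hk.pos hu (hk.expOp (-τ) x)
  have h3 := (((hk.tame τ).propagator 1 0).continuous.tendsto _).comp h2
  rw [IsTameFamily.propagator_coe] at h3
  refine tendsto_nhds_unique h3 (h1.congr fun n => ?_)
  exact ((hk.tame τ).propagator_coe 1 0 _).symm

/-- The derivation `a ↦ i [w·K, a]`. -/
def deriv (m : ℝ) (w : Fin d → ℝ) : 𝒜.cls m →ₗ[ℂ] 𝒜.cls m :=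
  Complex.I • hk.graded.bracket (show 1 + m - 1 ≤ m by linarith) ⟨dotOp w k, dotOp_mem hk.mem w⟩

theorem coe_deriv {m : ℝ} (w : Fin d → ℝ) (a : 𝒜.cls m) :
    (hk.deriv m w a : SmoothEnd K₀) = Complex.I • (dotOp w k * a - a * dotOp w k) := rfl

theorem isBoundedMap_deriv (m : ℝ) (w : Fin d → ℝ) :
    IsBoundedMap (𝒜.seminorm m) (𝒜.seminorm m) (hk.deriv m w) := by
  intro j
  obtain ⟨N, C, hC0, hC⟩ := (hk.graded.isBoundedBilin_bracket (show 1 + m - 1 ≤ m by linarith)).left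
    ⟨dotOp w k, dotOp_mem hk.mem w⟩ j
  refine ⟨N, C, hC0, fun a => ?_⟩
  rw [deriv, LinearMap.smul_apply, map_smul_eq_mul, Complex.norm_I, one_mul]
  exact hC a

/-- Smoothness of the orbit yields some derivative at 0; evaluation on vectors identifies it as
i[w·K, a]. The group law and the uniform bound for conjugations carry the remainder estimate from 0
to every τ. -/
theorem hasUniformDeriv_conj {m : ℝ} (w : Fin d → ℝ) (a : 𝒜.cls m) :
    HasUniformDeriv (𝒜.seminorm m) w (fun τ => hk.conj m τ a)
      fun τ => hk.conj m τ (hk.deriv m w a) := by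
  have hsep : ∀ a : 𝒜.cls m, (∀ j, 𝒜.seminorm m j a = 0) → a = 0 :=
    fun a => hk.graded.eq_zero hk.pos a
  obtain ⟨D, hD, -⟩ := (hk.isBoundedSmooth_conj a).exists_deriv hsep w
  have h0 : D 0 = hk.deriv m w a := by
    refine Subtype.ext (LinearMap.ext fun u => Subtype.ext ?_)
    have h1 : HasDerivAt (fun t : ℝ => ((hk.conj m (t • w) a : SmoothEnd K₀) u : H))
        ((D 0 : SmoothEnd K₀) u : H) 0 := by
      rw [hasDerivAt_iff_tendsto_slope_zero]
      refine (hk.graded.tendsto_apply hk.pos (fun j => hD.tendsto_slope j 0) u).congr fun t => ?_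
      simp only [zero_add, zero_smul]
      rfl
    have h2 := (hk.tame w).hasSmoothDerivAt_flow_apply
      (y := fun t => (a : SmoothEnd K₀) ((hk.tame w).flow (-t) u))
      (y' := (a : SmoothEnd K₀) (-(Complex.I • dotOp w k u))) (t := 0) (by
        refine HasSmoothDerivAt.map hk.pos ?_ (hasOrder_of_mem hk.graded hk.pos a.2)
        intro r
        have h3 := (hk.tame w).hasSmoothDerivAt_flow u (-0) r
        have h4 := h3.scomp (0 : ℝ) (hasDerivAt_neg (0 : ℝ))
        refine h4.congr_deriv ?_
        rw [neg_zero, IsTameFamily.flow_zero, map_neg, Submodule.coe_neg, neg_one_smul]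
        rfl)
    have h3 := h1.unique ((h2.coe hk.pos).congr_of_eventuallyEq (Eventually.of_forall fun t => by
      dsimp only
      rw [coe_conj, ← neg_smul, expOp_smul, expOp_smul]
      rfl))
    rw [h3]
    simp only [neg_zero, IsTameFamily.flow_zero, Module.End.one_apply, map_neg, map_smul]
    rw [coe_deriv]
    simp only [LinearMap.smul_apply, LinearMap.sub_apply, Module.End.mul_apply, smul_sub]
    rw [sub_eq_add_neg]
  intro j
  obtain ⟨N, C, hC0, hC⟩ := hk.conj_bound m j
  obtain ⟨B, hB0, hB⟩ := hD.seminormSum N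
  refine ⟨C * B, fun τ t => ?_⟩
  have h1 := map_sub_sub_smul (F := 𝒜.cls m) (G := 𝒜.cls m) (hk.conj m τ) (hk.conj m (t • w) a) (hk.conj m 0 a)
    (hk.deriv m w a) (t : ℂ)
  rw [← conj_add, ← conj_add, add_zero] at h1
  have h2 := hB 0 t
  rw [h0, zero_add] at h2
  rw [mul_assoc]
  refine Eq.trans_le (congrArg (𝒜.seminorm m j) h1) ?_
  exact (hC _ _).trans (mul_le_mul_of_nonneg_left h2 hC0)

/-- The constants here and in the quadratic estimate depend on a only through a seminorm, which
allows differentiating the conjugation of a family a(x) that varies with x. -/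
theorem conj_lipschitz (m : ℝ) (w : Fin d → ℝ) (j : ℕ) : ∃ (N : ℕ) (C : ℝ), 0 ≤ C ∧
    ∀ τ (t : ℝ) (a : 𝒜.cls m), 𝒜.seminorm m j (hk.conj m (τ + t • w) a - hk.conj m τ a) ≤
      C * seminormSum (𝒜.seminorm m) N a * |t| := by
  obtain ⟨N, C, hC0, hC⟩ := hk.conj_bound m j
  obtain ⟨N', C', hC'0, hC'⟩ : ∃ (N' : ℕ) (C' : ℝ), 0 ≤ C' ∧ ∀ a : 𝒜.cls m,
      seminormSum (𝒜.seminorm m) N (hk.deriv m w a) ≤ C' * seminormSum (𝒜.seminorm m) N' a :=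
    (hk.isBoundedMap_deriv m w).exists_seminormSum_le N
  refine ⟨N', C * C', mul_nonneg hC0 hC'0, fun τ t a => ?_⟩
  refine lipschitz_of_tendsto_slope (p := 𝒜.seminorm m) (w := w) (f := fun τ => hk.conj m τ a)
    (g := fun τ => hk.conj m τ (hk.deriv m w a)) (fun τ =>
    (hk.hasUniformDeriv_conj w a).tendsto_slope j τ) (fun τ => (hC τ _).trans ?_) τ t
  rw [mul_assoc]
  exact mul_le_mul_of_nonneg_left (hC' a) hC0

theorem conj_quadratic (m : ℝ) (w : Fin d → ℝ) (j : ℕ) : ∃ (N : ℕ) (C : ℝ), 0 ≤ C ∧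
    ∀ τ (t : ℝ) (a : 𝒜.cls m), 𝒜.seminorm m j (hk.conj m (τ + t • w) a - hk.conj m τ a -
      (t : ℂ) • hk.conj m τ (hk.deriv m w a)) ≤ C * seminormSum (𝒜.seminorm m) N a * t ^ 2 := by
  obtain ⟨N, C, hC0, hC⟩ := hk.conj_lipschitz m w j
  obtain ⟨N', C', hC'0, hC'⟩ : ∃ (N' : ℕ) (C' : ℝ), 0 ≤ C' ∧ ∀ a : 𝒜.cls m,
      seminormSum (𝒜.seminorm m) N (hk.deriv m w a) ≤ C' * seminormSum (𝒜.seminorm m) N' a :=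
    (hk.isBoundedMap_deriv m w).exists_seminormSum_le N
  refine ⟨N', C * C', mul_nonneg hC0 hC'0, fun τ t a => ?_⟩
  have hn : 0 ≤ seminormSum (𝒜.seminorm m) N' a := apply_nonneg _ _
  refine quadratic_of_tendsto_slope (p := 𝒜.seminorm m) (w := w) (f := fun τ => hk.conj m τ a)
    (g := fun τ => hk.conj m τ (hk.deriv m w a)) (fun τ =>
    (hk.hasUniformDeriv_conj w a).tendsto_slope j τ) (by positivity)
    (fun τ t => (hC τ t _).trans ?_) τ t
  rw [mul_assoc C C']
  exact mul_le_mul_of_nonneg_right (mul_le_mul_of_nonneg_left (hC' a) hC0) (abs_nonneg t)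

end IsCommutingSystem

end Conjugation
end SobolevGrowth
end

noncomputable section
namespace SobolevGrowth

/-! ### Averages of periodic functions with values in a Fréchet space -/

section Average

variable {F : Type*} [AddCommGroup F] [Module ℂ F] {p : ℕ → Seminorm ℂ F}
  {G : Type*} [AddCommGroup G] [Module ℂ G] {q : ℕ → Seminorm ℂ G} {ι : Type*} [Fintype ι] [DecidableEq ι]

theorem isCauchySequence_of_geometric {u : ℕ → F}
    (h : ∀ j, ∃ C : ℝ, 0 ≤ C ∧ ∀ L, p j (u (L + 1) - u L) ≤ C * (1 / 2) ^ L) :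
    IsCauchySequence p u := by
  intro j ε hε
  obtain ⟨C, hC0, hC⟩ := h j
  have key : ∀ n k, p j (u (n + k) - u n) ≤ 2 * C * ((1 / 2) ^ n - (1 / 2) ^ (n + k)) := by
    intro n k
    induction k with
    | zero => simp
    | succ k ih =>
      have h1 : u (n + (k + 1)) - u n = (u (n + k + 1) - u (n + k)) + (u (n + k) - u n) := by
        rw [← add_assoc]; abel
      rw [h1]
      refine (map_add_le_add _ _ _).trans ((add_le_add (hC (n + k)) ih).trans (le_of_eq ?_))
      rw [← add_assoc, pow_succ _ (n + k)]
      ring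
  have h0 : Tendsto (fun n : ℕ => 2 * C * (1 / 2 : ℝ) ^ n) atTop (𝓝 0) := by
    have := (tendsto_pow_atTop_nhds_zero_of_lt_one (r := (1 / 2 : ℝ)) (by norm_num)
      (by norm_num)).const_mul (2 * C)
    rwa [mul_zero] at this
  obtain ⟨M, hM⟩ := eventually_atTop.1 (h0.eventually (gt_mem_nhds (half_pos hε)))
  have h2 : ∀ k ≥ M, p j (u k - u M) < ε / 2 := by
    intro k hk
    obtain ⟨l, rfl⟩ := Nat.exists_eq_add_of_le hk
    refine ((key M l).trans ?_).trans_lt (hM M le_rfl)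
    have : (0 : ℝ) ≤ (1 / 2) ^ (M + l) := by positivity
    nlinarith
  refine ⟨M, fun k hk l hl => ?_⟩
  have h1 : u k - u l = (u k - u M) - (u l - u M) := by abel
  rw [h1]
  linarith [map_sub_le_add (p j) (u k - u M) (u l - u M), h2 k hk, h2 l hl]

/-- The vertices of the unit cube. -/
def cubeVertex (ε : ι → Bool) : ι → ℝ := fun i => if ε i then 1 else 0

/-- The mean of the values at the vertices of a cube of side `2⁻ˡ`. -/
def dyadicStep (l : ℕ) (f : (ι → ℝ) → F) (x : ι → ℝ) : F :=
  ((2 : ℂ) ^ Fintype.card ι)⁻¹ • ∑ ε : ι → Bool, f (x + ((2 : ℝ) ^ l)⁻¹ • cubeVertex ε)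

/-- The mean over the points of the unit cube with coordinates in `2⁻ᴸ ℤ`. -/
def dyadicAvg : ℕ → ((ι → ℝ) → F) → F
  | 0, f => f 0
  | L + 1, f => dyadicAvg L (dyadicStep (L + 1) f)

theorem card_cube : Fintype.card (ι → Bool) = 2 ^ Fintype.card ι := by
  rw [Fintype.card_fun, Fintype.card_bool]

theorem seminorm_dyadicStep_le (P : Seminorm ℂ F) (l : ℕ) {f : (ι → ℝ) → F} {C : ℝ}
    {x : ι → ℝ} (h : ∀ ε, P (f (x + ((2 : ℝ) ^ l)⁻¹ • cubeVertex ε)) ≤ C) :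
    P (dyadicStep l f x) ≤ C := by
  rw [dyadicStep, map_smul_eq_mul, norm_inv, norm_pow, Complex.norm_ofNat,
    inv_mul_le_iff₀ (by positivity)]
  refine (seminorm_sum_le P _ _).trans ((Finset.sum_le_sum fun ε _ => h ε).trans (le_of_eq ?_))
  rw [Finset.sum_const, Finset.card_univ, card_cube, nsmul_eq_mul]
  push_cast
  rfl

theorem seminorm_dyadicAvg_le (P : Seminorm ℂ F) (L : ℕ) {f : (ι → ℝ) → F} {C : ℝ}
    (h : ∀ x, P (f x) ≤ C) : P (dyadicAvg L f) ≤ C := by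
  induction L generalizing f with
  | zero => exact h 0
  | succ L ih => exact ih fun x => seminorm_dyadicStep_le P _ fun ε => h _

/-- The averages are finite linear combinations of values, so they commute with every linear map.
Vector-valued averages can therefore be compared with scalar integrals by applying functionals. -/
theorem dyadicAvg_map (φ : F →ₗ[ℂ] G) (L : ℕ) (f : (ι → ℝ) → F) :
    dyadicAvg L (fun x => φ (f x)) = φ (dyadicAvg L f) := by
  induction L generalizing f with
  | zero => rfl
  | succ L ih =>
    rw [dyadicAvg, dyadicAvg, ← ih]
    congr 1
    funext x
    rw [dyadicStep, dyadicStep, map_smul, map_sum]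

theorem dyadicAvg_sub (L : ℕ) (f g : (ι → ℝ) → F) :
    dyadicAvg L (fun x => f x - g x) = dyadicAvg L f - dyadicAvg L g := by
  induction L generalizing f g with
  | zero => rfl
  | succ L ih =>
    rw [dyadicAvg, dyadicAvg, dyadicAvg, ← ih]
    congr 1
    funext x
    rw [dyadicStep, dyadicStep, dyadicStep, Finset.sum_sub_distrib, smul_sub]

theorem dyadicAvg_add (L : ℕ) (f g : (ι → ℝ) → F) :
    dyadicAvg L (fun x => f x + g x) = dyadicAvg L f + dyadicAvg L g := by
  induction L generalizing f g with
  | zero => rfl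
  | succ L ih =>
    rw [dyadicAvg, dyadicAvg, dyadicAvg, ← ih]
    congr 1
    funext x
    rw [dyadicStep, dyadicStep, dyadicStep, Finset.sum_add_distrib, smul_add]

theorem dyadicStep_sub_self (l : ℕ) (f : (ι → ℝ) → F) (x : ι → ℝ) :
    dyadicStep l f x - f x = dyadicStep l (fun y => f y - f x) x := by
  rw [dyadicStep, dyadicStep, Finset.sum_sub_distrib, smul_sub, Finset.sum_const, Finset.card_univ,
    card_cube, ← Nat.cast_smul_eq_nsmul ℂ, smul_smul]
  push_cast
  rw [inv_mul_cancel₀ (pow_ne_zero _ two_ne_zero), one_smul]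

/-- The average over the unit cube. -/
def IsAverage (p : ℕ → Seminorm ℂ F) (f : (ι → ℝ) → F) (a : F) : Prop :=
  SeqTendsto p (fun L => dyadicAvg L f) a

/-- Successive averages differ by the mean of increments of f over vectors of length of order
2^(-L), so the Lipschitz bound makes them a geometric Cauchy sequence. -/
theorem exists_isAverage (hp : IsSeqComplete p) {f : (ι → ℝ) → F}
    (hf : ∀ (w : ι → ℝ) (j : ℕ), ∃ C : ℝ, 0 ≤ C ∧ ∀ (x : ι → ℝ) (t : ℝ),
      p j (f (x + t • w) - f x) ≤ C * |t|) : ∃ a, IsAverage p f a := by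
  refine hp _ (isCauchySequence_of_geometric fun j => ?_)
  choose C hC0 hC using fun w => hf w j
  refine ⟨∑ ε : ι → Bool, C (cubeVertex ε), Finset.sum_nonneg fun _ _ => hC0 _, fun L => ?_⟩
  rw [dyadicAvg, ← dyadicAvg_sub]
  refine seminorm_dyadicAvg_le (p j) L fun x => ?_
  rw [dyadicStep_sub_self]
  refine seminorm_dyadicStep_le (p j) _ fun ε => (hC _ _ _).trans ?_
  have h1 : |((2 : ℝ) ^ (L + 1))⁻¹| ≤ (1 / 2) ^ L := by
    rw [abs_of_pos (by positivity), one_div, inv_pow]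
    exact inv_anti₀ (by positivity) (pow_le_pow_right₀ (by norm_num) (Nat.le_succ L))
  exact mul_le_mul (Finset.single_le_sum (f := fun ε => C (cubeVertex ε)) (fun _ _ => hC0 _)
    (Finset.mem_univ ε)) h1 (abs_nonneg _) (Finset.sum_nonneg fun _ _ => hC0 _)

theorem IsAverage.seminorm_le {f : (ι → ℝ) → F} {a : F} (h : IsAverage p f a) {j : ℕ} {C : ℝ}
    (hC : ∀ x, p j (f x) ≤ C) : p j a ≤ C := by
  have h1 := seminorm_le_of_tendsto (p j) (b := 0) (h j) (C := C)
    (Eventually.of_forall fun L => by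
      rw [sub_zero]
      exact seminorm_dyadicAvg_le (p j) L hC)
  rwa [sub_zero] at h1

theorem SeqTendsto.map {L : F →ₗ[ℂ] G} (hL : IsBoundedMap p q L) {u : ℕ → F} {a : F}
    (h : SeqTendsto p u a) : SeqTendsto q (fun n => L (u n)) (L a) := by
  intro j
  obtain ⟨N, C, hC0, hC⟩ := hL j
  have h1 := (h.seminormSum N).const_mul C
  rw [mul_zero] at h1
  refine squeeze_zero (fun _ => apply_nonneg _ _) (fun n => ?_) h1
  rw [← map_sub]
  exact hC _

theorem IsAverage.map {L : F →ₗ[ℂ] G} (hL : IsBoundedMap p q L) {f : (ι → ℝ) → F} {a : F}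
    (h : IsAverage p f a) : IsAverage q (fun x => L (f x)) (L a) := by
  have := SeqTendsto.map hL h
  simp only [← dyadicAvg_map] at this
  exact this

/-- Boundedness of a linear functional with respect to finitely many seminorms. -/
def IsBoundedFunctional (p : ℕ → Seminorm ℂ F) (φ : F →ₗ[ℂ] ℂ) : Prop :=
  IsBoundedMap p (fun _ => normSeminorm ℂ ℂ) φ

theorem SeqTendsto.functional {φ : F →ₗ[ℂ] ℂ} (hφ : IsBoundedFunctional p φ) {u : ℕ → F} {a : F}
    (h : SeqTendsto p u a) : Tendsto (fun n => φ (u n)) atTop (𝓝 (φ a)) := by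
  rw [tendsto_iff_norm_sub_tendsto_zero]
  exact SeqTendsto.map hφ h 0

theorem IsAverage.tendsto {φ : F →ₗ[ℂ] ℂ} (hφ : IsBoundedFunctional p φ) {f : (ι → ℝ) → F} {a : F}
    (h : IsAverage p f a) :
    Tendsto (fun L => dyadicAvg L fun x => φ (f x)) atTop (𝓝 (φ a)) := by
  simp only [dyadicAvg_map]
  exact SeqTendsto.functional hφ h

end Average

/-! ### Characters of the torus -/

section Torus

set_option linter.unusedSectionVars false

open MeasureTheory

local instance : MeasureSpace UnitAddCircle := ⟨AddCircle.haarAddCircle⟩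

local instance : Measure.IsAddHaarMeasure (volume : Measure UnitAddCircle) :=
  inferInstanceAs (Measure.IsAddHaarMeasure AddCircle.haarAddCircle)

local instance : IsProbabilityMeasure (volume : Measure UnitAddCircle) :=
  inferInstanceAs (IsProbabilityMeasure AddCircle.haarAddCircle)

variable {ι : Type*} [Fintype ι] [DecidableEq ι]

/-- The projection of `ℝ^ι` onto the torus `(ℝ/ℤ)^ι`. -/
def toTorus (x : ι → ℝ) : UnitAddTorus ι := fun i => (x i : UnitAddCircle)

/-- The pairing of a frequency with a vector. -/
def freq (k : ι → ℤ) (x : ι → ℝ) : ℝ := ∑ i, (k i : ℝ) * x i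

/-- The character `x ↦ e^{2πi k·x}`. -/
def torusChar (k : ι → ℤ) (x : ι → ℝ) : ℂ :=
  Complex.exp (Complex.I * ((2 * Real.pi * freq k x : ℝ) : ℂ))

theorem freq_add (k : ι → ℤ) (x y : ι → ℝ) : freq k (x + y) = freq k x + freq k y := by
  simp only [freq, Pi.add_apply, mul_add, Finset.sum_add_distrib]

theorem freq_smul (k : ι → ℤ) (t : ℝ) (x : ι → ℝ) : freq k (t • x) = t * freq k x := by
  simp only [freq, Pi.smul_apply, smul_eq_mul, Finset.mul_sum]
  exact Finset.sum_congr rfl fun i _ => by ring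

theorem freq_single (k : ι → ℤ) (i : ι) (t : ℝ) :
    freq k (Pi.single i t) = k i * t := by
  rw [freq, Finset.sum_eq_single i]
  · rw [Pi.single_eq_same]
  · intro l _ hl
    rw [Pi.single_eq_of_ne hl, mul_zero]
  · simp

theorem torusChar_add (k : ι → ℤ) (x y : ι → ℝ) :
    torusChar k (x + y) = torusChar k x * torusChar k y := by
  rw [torusChar, torusChar, torusChar, ← Complex.exp_add, freq_add]
  congr 1
  push_cast
  ring

theorem norm_torusChar (k : ι → ℤ) (x : ι → ℝ) : ‖torusChar k x‖ = 1 := by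
  rw [torusChar, mul_comm, Complex.norm_exp_ofReal_mul_I]

theorem torusChar_zero_left (x : ι → ℝ) : torusChar 0 x = 1 := by
  simp [torusChar, freq]

theorem torusChar_neg (k : ι → ℤ) (x : ι → ℝ) : torusChar (-k) x * torusChar k x = 1 := by
  rw [torusChar, torusChar, ← Complex.exp_add, ← mul_add, ← Complex.ofReal_add]
  simp [freq]

theorem mFourier_toTorus (k : ι → ℤ) (x : ι → ℝ) :
    UnitAddTorus.mFourier k (toTorus x) = torusChar k x := by
  rw [UnitAddTorus.mFourier, ContinuousMap.coe_mk, torusChar, freq]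
  simp only [toTorus, fourier_coe_apply]
  rw [← Complex.exp_sum]
  congr 1
  push_cast
  rw [Finset.mul_sum, Finset.mul_sum]
  exact Finset.sum_congr rfl fun i _ => by ring

theorem torusChar_single (k : ι → ℤ) (i : ι) (n : ℤ) :
    torusChar k (Pi.single i (n : ℝ)) = 1 := by
  rw [torusChar, freq_single, Complex.exp_eq_one_iff]
  refine ⟨k i * n, ?_⟩
  push_cast
  ring

theorem norm_torusChar_smul_sub_one_le (k : ι → ℤ) (w : ι → ℝ) (t : ℝ) :
    ‖torusChar k (t • w) - 1‖ ≤ 2 * Real.pi * |freq k w| * |t| := by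
  rw [torusChar]
  refine (Real.norm_exp_I_mul_ofReal_sub_one_le).trans (le_of_eq ?_)
  rw [freq_smul, Real.norm_eq_abs, abs_mul, abs_mul, abs_mul, abs_of_pos Real.pi_pos, abs_two]
  ring

theorem norm_exp_sub_one_sub_le (x : ℝ) :
    ‖Complex.exp (Complex.I * x) - 1 - Complex.I * x‖ ≤ 2 * x ^ 2 := by
  have hn : ‖Complex.I * (x : ℂ)‖ = |x| := by
    rw [norm_mul, Complex.norm_I, one_mul, Complex.norm_real, Real.norm_eq_abs]
  rcases le_total |x| 1 with h | h
  · have := Complex.norm_exp_sub_one_sub_id_le (x := Complex.I * x) (by rwa [hn])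
    rw [hn, sq_abs] at this
    nlinarith [sq_nonneg x]
  · have h1 := Real.norm_exp_I_mul_ofReal_sub_one_le (x := x)
    rw [Real.norm_eq_abs] at h1
    have h2 := norm_sub_le (Complex.exp (Complex.I * x) - 1) (Complex.I * x)
    rw [hn] at h2
    rw [← sq_abs]
    nlinarith

theorem norm_torusChar_smul_sub_le (k : ι → ℤ) (w : ι → ℝ) (t : ℝ) :
    ‖torusChar k (t • w) - 1 - (t : ℂ) * (2 * Real.pi * Complex.I * freq k w)‖ ≤
      2 * (2 * Real.pi * freq k w) ^ 2 * t ^ 2 := by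
  have := norm_exp_sub_one_sub_le (2 * Real.pi * freq k (t • w))
  rw [freq_smul] at this
  rw [torusChar, freq_smul]
  convert this using 1
  · congr 1
    push_cast
    ring
  · ring

/-- A character is multiplicative, so it is an eigenfunction of each averaging step, and the sum
over the vertices of the cube factors over the coordinates. -/
theorem dyadicStep_torusChar (l : ℕ) (k : ι → ℤ) (x : ι → ℝ) :
    dyadicStep l (torusChar k) x = (∏ i, ((1 + Complex.exp (Complex.I *
      ((2 * Real.pi * (k i * ((2 : ℝ) ^ l)⁻¹) : ℝ) : ℂ))) / 2)) * torusChar k x := by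
  rw [dyadicStep, Finset.prod_div_distrib, Finset.prod_const, Finset.card_univ]
  simp only [torusChar_add]
  rw [← Finset.mul_sum, smul_eq_mul]
  have h : ∑ ε : ι → Bool, torusChar k (((2 : ℝ) ^ l)⁻¹ • cubeVertex ε) =
      ∏ i, (1 + Complex.exp (Complex.I * ((2 * Real.pi * (k i * ((2 : ℝ) ^ l)⁻¹) : ℝ) : ℂ))) := by
    have h1 : ∀ i, 1 + Complex.exp (Complex.I * ((2 * Real.pi * (k i * ((2 : ℝ) ^ l)⁻¹) : ℝ) : ℂ)) =
        ∑ b : Bool, if b then Complex.exp (Complex.I *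
          ((2 * Real.pi * (k i * ((2 : ℝ) ^ l)⁻¹) : ℝ) : ℂ)) else 1 := fun i => by
      rw [Fintype.sum_bool, add_comm]; simp
    simp only [h1]
    rw [Finset.prod_univ_sum, Fintype.piFinset_univ]
    refine Finset.sum_congr rfl fun ε _ => ?_
    rw [torusChar, freq, Finset.mul_sum, Complex.ofReal_sum, Finset.mul_sum, Complex.exp_sum]
    refine Finset.prod_congr rfl fun i _ => ?_
    rw [Pi.smul_apply, cubeVertex]
    split_ifs <;> simp
  rw [h]
  field_simp

theorem dyadicAvg_const_mul (L : ℕ) (c : ℂ) (f : (ι → ℝ) → ℂ) :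
    dyadicAvg L (fun x => c * f x) = c * dyadicAvg L f :=
  dyadicAvg_map (LinearMap.mul ℂ ℂ c) L f

/-- If m is 2^a times an odd number, then l = a + 1 works. The corresponding factor in the
eigenvalue of the averaging step is zero. -/
theorem exists_exp_eq_neg_one {m : ℤ} (hm : m ≠ 0) : ∃ l : ℕ, 1 ≤ l ∧
    Complex.exp (Complex.I * ((2 * Real.pi * (m * ((2 : ℝ) ^ l)⁻¹) : ℝ) : ℂ)) = -1 := by
  obtain ⟨a, b, hb, rfl⟩ : ∃ (a : ℕ) (b : ℤ), ¬ 2 ∣ b ∧ m = 2 ^ a * b := by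
    obtain ⟨b, h1, h2⟩ := (FiniteMultiplicity.exists_eq_pow_mul_and_not_dvd
      (Int.finiteMultiplicity_iff.2 ⟨by norm_num, hm⟩ : FiniteMultiplicity 2 m))
    exact ⟨_, b, h2, h1⟩
  refine ⟨a + 1, Nat.le_add_left _ _, ?_⟩
  obtain ⟨c, rfl⟩ : Odd b := by rwa [← Int.not_even_iff_odd, even_iff_two_dvd]
  have h1 : Complex.I * ((2 * Real.pi * (((2 ^ a * (2 * c + 1) : ℤ) : ℝ) * ((2 : ℝ) ^ (a + 1))⁻¹) :
      ℝ) : ℂ) = Real.pi * Complex.I + c * (2 * Real.pi * Complex.I) := by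
    push_cast
    rw [pow_succ]
    field_simp
    ring
  rw [h1, Complex.exp_add, Complex.exp_int_mul_two_pi_mul_I, mul_one, Complex.exp_pi_mul_I]

/-- One step annihilates the character, and every further step only multiplies it by a scalar. -/
theorem eventually_dyadicAvg_torusChar {k : ι → ℤ} (hk : k ≠ 0) :
    ∀ᶠ L in atTop, dyadicAvg L (torusChar k) = 0 := by
  obtain ⟨i, hi⟩ := Function.ne_iff.1 hk
  obtain ⟨l, hl, h⟩ := exists_exp_eq_neg_one hi
  have hstep : dyadicStep l (torusChar k) = fun _ => 0 := by
    funext x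
    rw [dyadicStep_torusChar, Finset.prod_eq_zero (Finset.mem_univ i), zero_mul]
    rw [h]; norm_num
  have h0 : ∀ L, dyadicAvg L (fun _ : ι → ℝ => (0 : ℂ)) = 0 := fun L => by
    have := dyadicAvg_const_mul L 0 (fun _ : ι → ℝ => (0 : ℂ))
    simpa using this
  filter_upwards [eventually_ge_atTop l] with L hL
  induction L, hL using Nat.le_induction with
  | base =>
    obtain ⟨n, rfl⟩ := Nat.exists_eq_add_of_le' hl
    rw [dyadicAvg, hstep, h0]
  | succ n hn ih =>
    rw [dyadicAvg]
    have : dyadicStep (n + 1) (torusChar k) = fun x => _ * torusChar k x :=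
      funext fun x => dyadicStep_torusChar (n + 1) k x
    rw [this, dyadicAvg_const_mul, ih, mul_zero]

/-- Translation by 1/(2 k i) in a coordinate with k i ≠ 0 preserves the integral and changes the
sign of the character. -/
theorem integral_mFourier {k : ι → ℤ} (hk : k ≠ 0) :
    ∫ y : UnitAddTorus ι, UnitAddTorus.mFourier k y = 0 := by
  obtain ⟨i, hi⟩ := Function.ne_iff.1 hk
  have hi' : (k i : ℝ) ≠ 0 := by exact_mod_cast hi
  set s : UnitAddTorus ι := toTorus (Pi.single i (2 * (k i : ℝ))⁻¹) with hs
  have h1 : ∀ y, UnitAddTorus.mFourier k (y + s) = -UnitAddTorus.mFourier k y := by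
    intro y
    have h2 : UnitAddTorus.mFourier k (y + s) =
        UnitAddTorus.mFourier k y * UnitAddTorus.mFourier k s := by
      simp only [UnitAddTorus.mFourier, ContinuousMap.coe_mk, Pi.add_apply, fourier_apply,
        smul_add, AddCircle.toCircle_add, Circle.coe_mul, Finset.prod_mul_distrib]
    rw [h2, hs, mFourier_toTorus, torusChar, freq_single]
    have h3 : Complex.I * ((2 * Real.pi * ((k i : ℝ) * (2 * (k i : ℝ))⁻¹) : ℝ) : ℂ) =
        Real.pi * Complex.I := by
      have : (k i : ℝ) * (2 * (k i : ℝ))⁻¹ = 1 / 2 := by field_simp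
      rw [this]
      push_cast
      ring
    rw [h3, Complex.exp_pi_mul_I, mul_neg_one]
  have h4 := integral_add_right_eq_self (μ := (volume : Measure (UnitAddTorus ι)))
    (fun y => UnitAddTorus.mFourier k y) s
  simp only [h1, integral_neg] at h4
  exact self_eq_neg.1 h4.symm

/-- The convergence holds for characters, hence for trigonometric polynomials. These are dense, and
both the averages and the integral are contractive in the supremum norm. -/
theorem tendsto_dyadicAvg (f : C(UnitAddTorus ι, ℂ)) :
    Tendsto (fun L => dyadicAvg L fun x => f (toTorus x)) atTop (𝓝 (∫ y, f y)) := by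
  have hdense : f ∈ closure (Submodule.span ℂ (Set.range (UnitAddTorus.mFourier (d := ι))) :
      Set C(UnitAddTorus ι, ℂ)) := by
    have h := UnitAddTorus.span_mFourier_closure_eq_top (d := ι)
    have h' : f ∈ (Submodule.span ℂ (Set.range (UnitAddTorus.mFourier (d := ι)))).topologicalClosure := by
      rw [h]; trivial
    exact h'
  have hint : ∀ g : C(UnitAddTorus ι, ℂ), Integrable (fun y => g y) (volume : Measure (UnitAddTorus ι)) :=
    fun g => g.continuous.integrable_of_hasCompactSupport (HasCompactSupport.of_compactSpace _)
  have hspan : ∀ g ∈ Submodule.span ℂ (Set.range (UnitAddTorus.mFourier (d := ι))),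
      Tendsto (fun L => dyadicAvg L fun x => g (toTorus x)) atTop (𝓝 (∫ y, g y)) := by
    intro g hg
    induction hg using Submodule.span_induction with
    | mem g hg =>
      obtain ⟨k, rfl⟩ := hg
      simp only [mFourier_toTorus]
      by_cases hk : k = 0
      · subst hk
        have h1 : ∀ L, dyadicAvg L (torusChar (0 : ι → ℤ)) = 1 := by
          intro L
          induction L with
          | zero => exact torusChar_zero_left 0
          | succ L ih =>
            have : dyadicStep (L + 1) (torusChar (0 : ι → ℤ)) = torusChar 0 := by
              funext x
              rw [dyadicStep_torusChar]
              simp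
            rw [dyadicAvg, this, ih]
        simp only [h1, UnitAddTorus.mFourier_zero, ContinuousMap.one_apply]
        simp
      · rw [integral_mFourier hk]
        exact tendsto_const_nhds.congr' ((eventually_dyadicAvg_torusChar hk).mono fun L hL => hL.symm)
    | zero =>
      have := fun L => dyadicAvg_const_mul L 0 (fun _ : ι → ℝ => (0 : ℂ))
      simp only [zero_mul] at this
      simp [this]
    | add g g' _ _ hg hg' =>
      simp only [ContinuousMap.add_apply]
      rw [integral_add (hint g) (hint g')]
      simp only [dyadicAvg_add]
      exact hg.add hg'
    | smul c g _ hg =>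
      simp only [ContinuousMap.smul_apply, smul_eq_mul, dyadicAvg_const_mul]
      rw [integral_const_mul]
      exact hg.const_mul c
  rw [Metric.tendsto_atTop]
  intro ε hε
  obtain ⟨g, hg, hfg⟩ := Metric.mem_closure_iff.1 hdense (ε / 3) (by positivity)
  obtain ⟨N, hN⟩ := Metric.tendsto_atTop.1 (hspan g hg) (ε / 3) (by positivity)
  refine ⟨N, fun L hL => ?_⟩
  have hb : ∀ y, ‖f y - g y‖ ≤ dist f g := fun y => by
    rw [← dist_eq_norm]; exact ContinuousMap.dist_apply_le_dist y
  have h1 : ‖dyadicAvg L (fun x => f (toTorus x)) - dyadicAvg L fun x => g (toTorus x)‖ ≤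
      dist f g := by
    rw [← dyadicAvg_sub]
    exact seminorm_dyadicAvg_le (normSeminorm ℂ ℂ) L fun x => hb _
  have h2 : ‖(∫ y, f y) - ∫ y, g y‖ ≤ dist f g := by
    rw [← integral_sub (hint f) (hint g)]
    refine (norm_integral_le_of_norm_le_const (Eventually.of_forall hb)).trans ?_
    simp
  have h3 := hN L hL
  rw [← dist_eq_norm] at h1 h2
  calc _ ≤ dist (dyadicAvg L fun x => f (toTorus x)) (dyadicAvg L fun x => g (toTorus x)) +
        dist (dyadicAvg L fun x => g (toTorus x)) (∫ y, g y) + dist (∫ y, g y) (∫ y, f y) :=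
      dist_triangle4 _ _ _ _
    _ < ε := by rw [dist_comm (∫ y, g y)]; linarith

theorem exists_continuousMap_torus {f : (ι → ℝ) → ℂ} (hf : Continuous f)
    (hper : ∀ (x : ι → ℝ) (m : ι → ℤ), f (x + fun i => (m i : ℝ)) = f x) :
    ∃ g : C(UnitAddTorus ι, ℂ), ∀ x, g (toTorus x) = f x := by
  have hq : IsOpenQuotientMap (toTorus (ι := ι)) :=
    IsOpenQuotientMap.piMap fun _ => QuotientAddGroup.isOpenQuotientMap_mk
  have hfac : ∀ x y, toTorus x = toTorus y → f x = f y := by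
    intro x y h
    choose m hm using fun i => (QuotientAddGroup.eq_iff_sub_mem.1 (congrFun h i))
    have h1 : x = y + fun i => (m i : ℝ) := by
      funext i
      have := hm i
      simp only [zsmul_eq_mul, mul_one] at this
      rw [Pi.add_apply, this]; ring
    rw [h1, hper]
  refine ⟨⟨Function.extend toTorus f 0, hq.isQuotientMap.continuous_iff.2 ?_⟩, fun x => ?_⟩
  · convert hf using 1
    funext x
    exact Function.FactorsThrough.extend_apply (fun x y h => hfac x y h) _ x
  · exact Function.FactorsThrough.extend_apply (fun x y h => hfac x y h) _ x

end Torus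
end SobolevGrowth
end

noncomputable section
namespace SobolevGrowth

/-! ### Fourier series with values in a Fréchet space -/

section FourierSeries

open MeasureTheory

set_option linter.unusedSectionVars false

local instance : MeasureSpace UnitAddCircle := ⟨AddCircle.haarAddCircle⟩

local instance : Measure.IsAddHaarMeasure (volume : Measure UnitAddCircle) :=
  inferInstanceAs (Measure.IsAddHaarMeasure AddCircle.haarAddCircle)

local instance : IsProbabilityMeasure (volume : Measure UnitAddCircle) :=
  inferInstanceAs (IsProbabilityMeasure AddCircle.haarAddCircle)

variable {F : Type*} [AddCommGroup F] [Module ℂ F] {p : ℕ → Seminorm ℂ F}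
  {ι : Type*} [Fintype ι] [DecidableEq ι]

/-- The bounded functionals separate points. -/
def IsSeparated (p : ℕ → Seminorm ℂ F) : Prop :=
  ∀ a : F, (∀ φ : F →ₗ[ℂ] ℂ, IsBoundedFunctional p φ → φ a = 0) → a = 0

theorem IsSeparated.eq (hs : IsSeparated p) {a b : F}
    (h : ∀ φ : F →ₗ[ℂ] ℂ, IsBoundedFunctional p φ → φ a = φ b) : a = b :=
  sub_eq_zero.1 (hs _ fun φ hφ => by rw [map_sub, h φ hφ, sub_self])

theorem IsSeparated.eq_zero (hs : IsSeparated p) {a : F} (h : ∀ j, p j a = 0) : a = 0 := by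
  refine hs a fun φ hφ => ?_
  obtain ⟨N, C, hC0, hC⟩ := hφ 0
  have h1 := hC a
  rw [seminormSum_apply, Finset.sum_eq_zero fun i _ => h i, mul_zero] at h1
  exact norm_le_zero_iff.1 h1

/-! #### Series -/

/-- The cube of frequencies of size at most `n`. -/
def freqBox (ι : Type*) [Fintype ι] [DecidableEq ι] (n : ℕ) : Finset (ι → ℤ) :=
  Fintype.piFinset fun _ => Finset.Icc (-(n : ℤ)) n

theorem freqBox_mono : Monotone (freqBox ι) := by
  intro m n h
  refine Fintype.piFinset_subset _ _ fun _ => Finset.Icc_subset_Icc ?_ ?_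
  · exact neg_le_neg (by exact_mod_cast h)
  · exact_mod_cast h

theorem tendsto_freqBox : Tendsto (freqBox ι) atTop atTop := by
  refine tendsto_atTop_finset_of_monotone freqBox_mono fun k => ?_
  refine ⟨∑ i, (k i).natAbs, Fintype.mem_piFinset.2 fun i => Finset.mem_Icc.2 ?_⟩
  have h1 : (k i).natAbs ≤ ∑ i, (k i).natAbs :=
    Finset.single_le_sum (f := fun i => (k i).natAbs) (fun _ _ => Nat.zero_le _) (Finset.mem_univ i)
  omega

/-- Convergence of a series indexed by the frequencies. -/
def HasSeriesSum (p : ℕ → Seminorm ℂ F) (a : (ι → ℤ) → F) (s : F) : Prop :=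
  SeqTendsto p (fun n => ∑ k ∈ freqBox ι n, a k) s

theorem exists_hasSeriesSum (hp : IsSeqComplete p) {a : (ι → ℤ) → F}
    (ha : ∀ j, Summable fun k => p j (a k)) : ∃ s, HasSeriesSum p a s := by
  refine hp _ fun j ε hε => ?_
  have h1 := (ha j).hasSum.comp tendsto_freqBox
  obtain ⟨N, hN⟩ := Metric.cauchySeq_iff.1 h1.cauchySeq ε hε
  have key : ∀ k l, k ≤ l → p j ((∑ x ∈ freqBox ι l, a x) - ∑ x ∈ freqBox ι k, a x) ≤
      (∑ x ∈ freqBox ι l, p j (a x)) - ∑ x ∈ freqBox ι k, p j (a x) := by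
    intro k l hkl
    rw [← Finset.sum_sdiff (freqBox_mono hkl), ← Finset.sum_sdiff (freqBox_mono hkl),
      add_sub_cancel_right, add_sub_cancel_right]
    exact seminorm_sum_le _ _ _
  refine ⟨N, fun k hk l hl => ?_⟩
  have h2 := hN k hk l hl
  rw [Real.dist_eq] at h2
  rcases le_total k l with h | h
  · rw [← map_neg_eq_map, neg_sub]
    refine (key k l h).trans_lt ?_
    rw [abs_sub_comm] at h2
    exact (le_abs_self _).trans_lt h2
  · exact (key l k h).trans_lt ((le_abs_self _).trans_lt h2)

theorem HasSeriesSum.seminorm_le {a : (ι → ℤ) → F} {s : F} (h : HasSeriesSum p a s) {j : ℕ}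
    {β : (ι → ℤ) → ℝ} (hβ : Summable β) (hle : ∀ k, p j (a k) ≤ β k) : p j s ≤ ∑' k, β k := by
  have h1 := seminorm_le_of_tendsto (p j) (b := 0) (h j) (C := ∑' k, β k)
    (Eventually.of_forall fun n => by
      rw [sub_zero]
      refine (seminorm_sum_le _ _ _).trans ((Finset.sum_le_sum fun k _ => hle k).trans ?_)
      exact hβ.sum_le_tsum _ fun k _ => (apply_nonneg (p j) (a k)).trans (hle k))
  rwa [sub_zero] at h1

theorem SeqTendsto.add {u v : ℕ → F} {a b : F} (hu : SeqTendsto p u a) (hv : SeqTendsto p v b) :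
    SeqTendsto p (fun n => u n + v n) (a + b) := fun j => by
  have h := (hu j).add (hv j)
  rw [add_zero] at h
  refine squeeze_zero (fun _ => apply_nonneg _ _) (fun n => ?_) h
  rw [add_sub_add_comm]
  exact map_add_le_add _ _ _

theorem HasSeriesSum.add {a b : (ι → ℤ) → F} {s t : F} (ha : HasSeriesSum p a s)
    (hb : HasSeriesSum p b t) : HasSeriesSum p (fun k => a k + b k) (s + t) := by
  have := SeqTendsto.add ha hb
  simp only [← Finset.sum_add_distrib] at this
  exact this

theorem HasSeriesSum.map {G : Type*} [AddCommGroup G] [Module ℂ G] {q : ℕ → Seminorm ℂ G}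
    {L : F →ₗ[ℂ] G} (hL : IsBoundedMap p q L) {a : (ι → ℤ) → F} {s : F} (ha : HasSeriesSum p a s) :
    HasSeriesSum q (fun k => L (a k)) (L s) := by
  have := SeqTendsto.map hL ha
  simp only [map_sum] at this
  exact this

theorem HasSeriesSum.smul (c : ℂ) {a : (ι → ℤ) → F} {s : F} (ha : HasSeriesSum p a s) :
    HasSeriesSum p (fun k => c • a k) (c • s) := ha.map (isBoundedMap_smul c)

theorem HasSeriesSum.sub {a b : (ι → ℤ) → F} {s t : F} (ha : HasSeriesSum p a s)
    (hb : HasSeriesSum p b t) : HasSeriesSum p (fun k => a k - b k) (s - t) := by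
  have := ha.add (hb.smul (-1))
  simp only [neg_smul, one_smul, ← sub_eq_add_neg] at this
  exact this

theorem HasSeriesSum.unique (hs : IsSeparated p) {a : (ι → ℤ) → F} {s t : F}
    (h : HasSeriesSum p a s) (h' : HasSeriesSum p a t) : s = t :=
  hs.eq fun _ hφ => tendsto_nhds_unique (SeqTendsto.functional hφ h) (SeqTendsto.functional hφ h')

/-! #### Rapidly decreasing coefficients -/

/-- The integer vectors inject into a lattice, where large negative powers of the norm are summable;
the sup norms agree. -/
theorem exists_summable_weight (ι : Type*) [Fintype ι] :
    ∃ n : ℕ, Summable fun k : ι → ℤ => ((1 + ‖k‖) ^ n)⁻¹ := by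
  classical
  set L := Submodule.span ℤ (Set.range (Pi.basisFun ℝ ι)) with hL
  set n := Module.finrank ℤ L + 1 with hn
  refine ⟨n, ?_⟩
  have h1 := ZLattice.summable_norm_pow_inv L n (Nat.lt_succ_self _)
  have hmem : ∀ k : ι → ℤ, (fun i => (k i : ℝ)) ∈ L := by
    intro k
    refine ((Pi.basisFun ℝ ι).mem_span_iff_repr_mem ℤ _).2 fun i => ⟨k i, by simp⟩
  have h2 : Function.Injective fun k : ι → ℤ => (⟨fun i => (k i : ℝ), hmem k⟩ : L) := by
    intro k l h
    funext i
    have := congrFun (congrArg Subtype.val h) i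
    exact Int.cast_injective (α := ℝ) this
  have h3 := h1.comp_injective h2
  have hnorm : ∀ k : ι → ℤ, ‖(⟨fun i => (k i : ℝ), hmem k⟩ : L)‖ = ‖k‖ := by
    intro k
    have h4 : ∀ i, ‖(k i : ℝ)‖ = ‖k i‖ := fun i => (Int.norm_eq_abs _).symm
    rw [Submodule.coe_norm]
    refine le_antisymm ((pi_norm_le_iff_of_nonneg (norm_nonneg _)).2 fun i => ?_)
      ((pi_norm_le_iff_of_nonneg (norm_nonneg _)).2 fun i => ?_)
    · rw [h4]; exact norm_le_pi_norm k i
    · rw [← h4]; exact norm_le_pi_norm (fun i => (k i : ℝ)) i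
  -- The lattice sum contributes 0 at k = 0, where the weight is 1, so this single term is added
  -- separately.
  have h5 := h3.add (summable_of_ne_finset_zero (s := {(0 : ι → ℤ)})
    (f := fun k : ι → ℤ => if k = 0 then (1 : ℝ) else 0) fun k hk => by simpa using hk)
  refine Summable.of_nonneg_of_le (fun k => by positivity) (fun k => ?_) h5
  dsimp only [Function.comp_apply]
  rw [hnorm]
  split_ifs with hk
  · subst hk
    simp [hn]
  · rw [add_zero]
    have : 0 < ‖k‖ := norm_pos_iff.2 hk
    rw [inv_pow]
    exact inv_anti₀ (by positivity) (pow_le_pow_left₀ (norm_nonneg _) (by linarith) _)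

/-- Rapid decrease of a family of coefficients. -/
def IsRapid (p : ℕ → Seminorm ℂ F) (a : (ι → ℤ) → F) : Prop :=
  ∀ (s j : ℕ), ∃ C : ℝ, ∀ k, (1 + ‖k‖) ^ s * p j (a k) ≤ C

theorem IsRapid.summable {a : (ι → ℤ) → F} (ha : IsRapid p a) (s j : ℕ) :
    Summable fun k => (1 + ‖k‖) ^ s * p j (a k) := by
  obtain ⟨n, hn⟩ := exists_summable_weight ι
  obtain ⟨C, hC⟩ := ha (n + s) j
  refine Summable.of_nonneg_of_le (fun k => by positivity) (fun k => ?_) (hn.mul_left C)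
  rw [← div_eq_mul_inv, le_div_iff₀ (by positivity)]
  refine le_of_eq_of_le ?_ (hC k)
  rw [pow_add]; ring

theorem IsRapid.smul {a : (ι → ℤ) → F} (ha : IsRapid p a) {c : (ι → ℤ) → ℂ}
    (hc : ∃ (C : ℝ) (M : ℕ), ∀ k, ‖c k‖ ≤ C * (1 + ‖k‖) ^ M) : IsRapid p fun k => c k • a k := by
  obtain ⟨C, M, hC⟩ := hc
  intro s j
  obtain ⟨D, hD⟩ := ha (s + M) j
  refine ⟨|C| * D, fun k => ?_⟩
  rw [map_smul_eq_mul]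
  calc (1 + ‖k‖) ^ s * (‖c k‖ * p j (a k))
      ≤ (1 + ‖k‖) ^ s * ((|C| * (1 + ‖k‖) ^ M) * p j (a k)) := by
        have h1 : ‖c k‖ ≤ |C| * (1 + ‖k‖) ^ M := (hC k).trans
          (mul_le_mul_of_nonneg_right (le_abs_self C) (by positivity))
        gcongr
    _ = |C| * ((1 + ‖k‖) ^ (s + M) * p j (a k)) := by rw [pow_add]; ring
    _ ≤ |C| * D := mul_le_mul_of_nonneg_left (hD k) (abs_nonneg C)

theorem abs_freq_le (k : ι → ℤ) (w : ι → ℝ) : |freq k w| ≤ (∑ i, |w i|) * (1 + ‖k‖) := by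
  rw [freq, Finset.sum_mul]
  refine (Finset.abs_sum_le_sum_abs _ _).trans (Finset.sum_le_sum fun i _ => ?_)
  rw [abs_mul, mul_comm]
  refine mul_le_mul_of_nonneg_left ?_ (abs_nonneg _)
  have h := norm_le_pi_norm k i
  rw [Int.norm_eq_abs] at h
  linarith

theorem IsRapid.freq_smul {a : (ι → ℤ) → F} (ha : IsRapid p a) (w : ι → ℝ) :
    IsRapid p fun k => (2 * Real.pi * Complex.I * freq k w : ℂ) • a k := by
  refine ha.smul ⟨2 * Real.pi * ∑ i, |w i|, 1, fun k => ?_⟩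
  rw [norm_mul, norm_mul, norm_mul, Complex.norm_I, Complex.norm_ofNat, Complex.norm_real,
    Complex.norm_real, Real.norm_eq_abs, Real.norm_eq_abs, abs_of_pos Real.pi_pos, mul_one, pow_one,
    mul_assoc (2 * Real.pi)]
  exact mul_le_mul_of_nonneg_left (abs_freq_le k w) (by positivity)

/-- `f` is the sum of the Fourier series with coefficients `a`. -/
def IsFourierSum (p : ℕ → Seminorm ℂ F) (a : (ι → ℤ) → F) (f : (ι → ℝ) → F) : Prop :=
  ∀ x, HasSeriesSum p (fun k => torusChar k x • a k) (f x)

theorem seminorm_torusChar_smul (P : Seminorm ℂ F) (k : ι → ℤ) (x : ι → ℝ) (b : F) :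
    P (torusChar k x • b) = P b := by
  rw [map_smul_eq_mul, norm_torusChar, one_mul]

theorem IsRapid.exists_isFourierSum (hp : IsSeqComplete p) {a : (ι → ℤ) → F} (ha : IsRapid p a) :
    ∃ f, IsFourierSum p a f := by
  have : ∀ x, ∃ s, HasSeriesSum p (fun k => torusChar k x • a k) s := fun x =>
    exists_hasSeriesSum hp fun j => by
      simp only [seminorm_torusChar_smul]
      simpa using ha.summable 0 j
  choose f hf using this
  exact ⟨f, hf⟩

theorem IsFourierSum.isBoundedFamily {a : (ι → ℤ) → F} (ha : IsRapid p a) {f : (ι → ℝ) → F}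
    (hf : IsFourierSum p a f) : IsBoundedFamily p f := fun j =>
  ⟨_, fun x => (hf x).seminorm_le (by simpa using ha.summable 0 j)
    fun k => (seminorm_torusChar_smul (p j) k x (a k)).le⟩

/-- The second-order Taylor estimate for each character costs a factor (1 + ‖k‖)², which rapid
decrease makes summable. -/
theorem IsFourierSum.hasUniformDeriv {a : (ι → ℤ) → F} (ha : IsRapid p a) {f g : (ι → ℝ) → F}
    {w : ι → ℝ} (hf : IsFourierSum p a f)
    (hg : IsFourierSum p (fun k => (2 * Real.pi * Complex.I * freq k w : ℂ) • a k) g) :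
    HasUniformDeriv p w f g := by
  intro j
  set c := 2 * (2 * Real.pi * ∑ i, |w i|) ^ 2 with hc
  refine ⟨∑' k, c * ((1 + ‖k‖) ^ 2 * p j (a k)), fun x t => ?_⟩
  have h1 := ((hf (x + t • w)).sub (hf x)).sub ((hg x).smul (t : ℂ))
  have hsum : Summable fun k => c * ((1 + ‖k‖) ^ 2 * p j (a k)) * t ^ 2 :=
    ((ha.summable 2 j).mul_left c).mul_right _
  refine (h1.seminorm_le hsum fun k => ?_).trans (le_of_eq (tsum_mul_right))
  have h2 : torusChar k (x + t • w) • a k - torusChar k x • a k -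
      (t : ℂ) • torusChar k x • (2 * Real.pi * Complex.I * freq k w : ℂ) • a k =
      torusChar k x • (torusChar k (t • w) - 1 - (t : ℂ) * (2 * Real.pi * Complex.I * freq k w)) •
        a k := by
    rw [torusChar_add, smul_smul, smul_smul, smul_smul, ← sub_smul, ← sub_smul]
    congr 1
    ring
  rw [h2, seminorm_torusChar_smul, map_smul_eq_mul]
  have h3 : (2 * Real.pi * freq k w) ^ 2 ≤ (2 * Real.pi * ((∑ i, |w i|) * (1 + ‖k‖))) ^ 2 := by
    rw [← sq_abs, abs_mul, abs_mul, abs_two, abs_of_pos Real.pi_pos]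
    have := abs_freq_le k w
    gcongr
  calc _ ≤ (2 * (2 * Real.pi * freq k w) ^ 2 * t ^ 2) * p j (a k) :=
        mul_le_mul_of_nonneg_right (norm_torusChar_smul_sub_le k w t) (apply_nonneg _ _)
    _ ≤ (2 * (2 * Real.pi * ((∑ i, |w i|) * (1 + ‖k‖))) ^ 2 * t ^ 2) * p j (a k) := by gcongr
    _ = _ := by rw [hc]; ring

theorem IsFourierSum.isBoundedSmooth (hp : IsSeqComplete p) {a : (ι → ℤ) → F} (ha : IsRapid p a)
    {f : (ι → ℝ) → F} (hf : IsFourierSum p a f) : IsBoundedSmooth p f := by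
  intro N
  induction N generalizing a f with
  | zero => exact hf.isBoundedFamily ha
  | succ N ih =>
    refine ⟨hf.isBoundedFamily ha, fun w => ?_⟩
    obtain ⟨g, hg⟩ := (ha.freq_smul w).exists_isFourierSum hp
    exact ⟨g, hf.hasUniformDeriv ha hg, ih (ha.freq_smul w) hg⟩

theorem IsFourierSum.periodic (hs : IsSeparated p) {a : (ι → ℤ) → F} {f : (ι → ℝ) → F}
    (hf : IsFourierSum p a f) (x : ι → ℝ) (i : ι) (n : ℤ) :
    f (x + Pi.single i (n : ℝ)) = f x := by
  have h1 := hf (x + Pi.single i (n : ℝ))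
  simp only [torusChar_add, torusChar_single, mul_one] at h1
  exact h1.unique hs (hf x)

/-! #### Fourier coefficients -/

/-- `c` is the Fourier coefficient of `f` of frequency `k`. -/
def IsFourierCoeff (p : ℕ → Seminorm ℂ F) (f : (ι → ℝ) → F) (k : ι → ℤ) (c : F) : Prop :=
  IsAverage p (fun x => torusChar (-k) x • f x) c

/-- The product of f with a character is Lipschitz, so its dyadic averages converge. -/
theorem exists_isFourierCoeff (hp : IsSeqComplete p) (hs : IsSeparated p) {f : (ι → ℝ) → F}
    (hf : IsBoundedSmooth p f) (k : ι → ℤ) : ∃ c, IsFourierCoeff p f k c := by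
  refine exists_isAverage hp fun w j => ?_
  obtain ⟨g, hg, hg'⟩ := hf.exists_deriv (fun _ h => hs.eq_zero h) w
  obtain ⟨C, hC0, hC⟩ := hg.lipschitz hf.bounded hg'.bounded j
  obtain ⟨B, hB0, hB⟩ := hf.bounded.nonneg j
  refine ⟨2 * Real.pi * |freq (-k) w| * B + C, by positivity, fun x t => ?_⟩
  have h1 : torusChar (-k) (x + t • w) • f (x + t • w) - torusChar (-k) x • f x =
      torusChar (-k) x • ((torusChar (-k) (t • w) - 1) • f (x + t • w) + (f (x + t • w) - f x)) := by
    rw [torusChar_add, smul_add, smul_smul, ← sub_add_cancel (torusChar (-k) x * torusChar (-k) (t • w))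
      (torusChar (-k) x), mul_sub, mul_one, add_smul, smul_sub]
    abel
  rw [h1, seminorm_torusChar_smul]
  refine (map_add_le_add _ _ _).trans ?_
  rw [map_smul_eq_mul, add_mul]
  refine add_le_add ?_ (hC x t)
  calc _ ≤ (2 * Real.pi * |freq (-k) w| * |t|) * B :=
        mul_le_mul (norm_torusChar_smul_sub_one_le _ _ _) (hB _) (apply_nonneg _ _) (by positivity)
    _ = _ := by ring

theorem IsFourierCoeff.seminorm_le {f : (ι → ℝ) → F} {k : ι → ℤ} {c : F}
    (h : IsFourierCoeff p f k c) {j : ℕ} {C : ℝ} (hC : ∀ x, p j (f x) ≤ C) : p j c ≤ C :=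
  IsAverage.seminorm_le h fun x => by rw [seminorm_torusChar_smul]; exact hC x

theorem IsFourierCoeff.map {G : Type*} [AddCommGroup G] [Module ℂ G] {q : ℕ → Seminorm ℂ G}
    {L : F →ₗ[ℂ] G} (hL : IsBoundedMap p q L) {f : (ι → ℝ) → F} {k : ι → ℤ} {c : F}
    (h : IsFourierCoeff p f k c) : IsFourierCoeff q (fun x => L (f x)) k (L c) := by
  have := IsAverage.map hL h
  simp only [map_smul] at this
  exact this

/-- Periodicity with respect to the integer lattice. -/
def IsLatticePeriodic (f : (ι → ℝ) → F) : Prop :=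
  ∀ (x : ι → ℝ) (m : ι → ℤ), f (x + fun i => (m i : ℝ)) = f x

theorem isLatticePeriodic_of_single {f : (ι → ℝ) → F}
    (h : ∀ (x : ι → ℝ) (i : ι) (n : ℤ), f (x + Pi.single i (n : ℝ)) = f x) : IsLatticePeriodic f := by
  intro x m
  have h1 : ∀ s : Finset ι, f (x + ∑ i ∈ s, Pi.single i (m i : ℝ)) = f x := by
    intro s
    induction s using Finset.induction_on with
    | empty => simp
    | insert a s ha ih =>
      rw [Finset.sum_insert ha, add_comm (Pi.single a _), ← add_assoc, h, ih]
  have h2 := h1 Finset.univ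
  rwa [Finset.univ_sum_single] at h2

theorem IsBoundedSmooth.continuous_functional (hs : IsSeparated p) {f : (ι → ℝ) → F}
    (hf : IsBoundedSmooth p f) {φ : F →ₗ[ℂ] ℂ} (hφ : IsBoundedFunctional p φ) :
    Continuous fun x => φ (f x) := by
  have hl : ∀ i : ι, ∃ C : ℝ, 0 ≤ C ∧ ∀ (x : ι → ℝ) (t : ℝ),
      ‖φ (f (x + Pi.single i t)) - φ (f x)‖ ≤ C * |t| := by
    intro i
    obtain ⟨g, hg, hg'⟩ := hf.exists_deriv (fun _ h => hs.eq_zero h) (Pi.single i (1 : ℝ))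
    obtain ⟨N, D, hD0, hD⟩ := hφ 0
    obtain ⟨C, hC0, hC⟩ := hg.lipschitz_seminormSum hf.bounded hg'.bounded N
    refine ⟨D * C, mul_nonneg hD0 hC0, fun x t => ?_⟩
    have h1 : (Pi.single i t : ι → ℝ) = t • Pi.single i (1 : ℝ) := by
      rw [← Pi.single_smul i t, smul_eq_mul, mul_one]
    rw [h1, ← map_sub, mul_assoc]
    exact (hD _).trans (mul_le_mul_of_nonneg_left (hC x t) hD0)
  choose C hC0 hC using hl
  have h1 : ∀ (s : Finset ι) (x h : ι → ℝ),
      ‖φ (f (x + ∑ i ∈ s, Pi.single i (h i))) - φ (f x)‖ ≤ ∑ i ∈ s, C i * |h i| := by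
    intro s x h
    induction s using Finset.induction_on with
    | empty => simp
    | insert a s ha ih =>
      rw [Finset.sum_insert ha, Finset.sum_insert ha, add_comm (Pi.single a _), ← add_assoc]
      refine (norm_sub_le_norm_sub_add_norm_sub _ (φ (f (x + ∑ i ∈ s, Pi.single i (h i)))) _).trans ?_
      exact add_le_add (hC _ _ _) ih
  rw [continuous_iff_continuousAt]
  intro x
  rw [ContinuousAt, tendsto_iff_norm_sub_tendsto_zero]
  have h2 : Tendsto (fun y : ι → ℝ => ∑ i, C i * |(y - x) i|) (𝓝 x) (𝓝 0) := by
    have h3 : Continuous fun y : ι → ℝ => ∑ i, C i * |(y - x) i| := by fun_prop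
    have h4 := h3.tendsto x
    simpa using h4
  refine squeeze_zero (fun _ => norm_nonneg _) (fun y => ?_) h2
  have h3 := h1 Finset.univ x (y - x)
  rwa [Finset.univ_sum_single, add_sub_cancel] at h3

/-- The reduction to scalars: a bounded functional turns f into a continuous function on the torus
and the dyadic coefficients into ordinary Fourier coefficients. -/
theorem IsBoundedSmooth.exists_torus (hs : IsSeparated p) {f : (ι → ℝ) → F}
    (hf : IsBoundedSmooth p f) (hper : IsLatticePeriodic f) {φ : F →ₗ[ℂ] ℂ}
    (hφ : IsBoundedFunctional p φ) :
    ∃ g : C(UnitAddTorus ι, ℂ), (∀ x, g (toTorus x) = φ (f x)) ∧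
      ∀ k c, IsFourierCoeff p f k c → φ c = UnitAddTorus.mFourierCoeff g k := by
  obtain ⟨g, hg⟩ := exists_continuousMap_torus (hf.continuous_functional hs hφ)
    fun x m => by rw [hper]
  refine ⟨g, hg, fun k c hc => ?_⟩
  have h1 := IsAverage.tendsto hφ hc
  have h2 := tendsto_dyadicAvg (UnitAddTorus.mFourier (-k) * g)
  refine tendsto_nhds_unique h1 (h2.congr fun L => ?_)
  congr 1
  funext x
  rw [ContinuousMap.mul_apply, mFourier_toTorus, hg, map_smul, smul_eq_mul]

/-- A substitute for integration by parts: after applying a functional, translation invariance of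
the integral expresses (e^{2πi t k·w} - 1) c - t c' as the integral of the uniform remainder, which
is O(t²). Dividing by t and letting t → 0 gives the relation. -/
theorem IsFourierCoeff.deriv (hs : IsSeparated p) {f g : (ι → ℝ) → F} (hf : IsBoundedSmooth p f)
    (hg : IsBoundedSmooth p g) (hfp : IsLatticePeriodic f) (hgp : IsLatticePeriodic g) {w : ι → ℝ}
    (h : HasUniformDeriv p w f g) {k : ι → ℤ} {c c' : F} (hc : IsFourierCoeff p f k c)
    (hc' : IsFourierCoeff p g k c') : c' = (2 * Real.pi * Complex.I * freq k w : ℂ) • c := by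
  refine hs.eq fun φ hφ => ?_
  obtain ⟨u, hu, hu'⟩ := hf.exists_torus hs hfp hφ
  obtain ⟨v, hv, hv'⟩ := hg.exists_torus hs hgp hφ
  rw [map_smul, smul_eq_mul, hu' k c hc, hv' k c' hc']
  set a := UnitAddTorus.mFourierCoeff u k with ha
  set b := UnitAddTorus.mFourierCoeff v k with hb
  obtain ⟨N, D, hD0, hD⟩ := hφ 0
  obtain ⟨C, hC0, hC⟩ := h.seminormSum N
  have hint : ∀ g : C(UnitAddTorus ι, ℂ), Integrable (fun y => g y) (volume : Measure (UnitAddTorus ι)) :=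
    fun g => g.continuous.integrable_of_hasCompactSupport (HasCompactSupport.of_compactSpace _)
  have key : ∀ t : ℝ, ‖(torusChar k (t • w) - 1) * a - t * b‖ ≤ D * C * t ^ 2 := by
    intro t
    set s : UnitAddTorus ι := toTorus (t • w) with hsd
    set us : C(UnitAddTorus ι, ℂ) := u.comp ⟨fun y => y + s, by fun_prop⟩ with hus
    -- Translating the function multiplies its Fourier coefficient by the value of the character.
    have h1 : ∫ y, (UnitAddTorus.mFourier (-k) * us) y = torusChar k (t • w) * a := by
      have h2 := integral_add_right_eq_self (μ := (volume : Measure (UnitAddTorus ι)))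
        (fun y => (UnitAddTorus.mFourier (-k) y * u y)) s
      have h3 : ∀ y, UnitAddTorus.mFourier (-k) (y + s) =
          UnitAddTorus.mFourier (-k) y * torusChar (-k) (t • w) := by
        intro y
        rw [← mFourier_toTorus]
        simp only [UnitAddTorus.mFourier, ContinuousMap.coe_mk, Pi.add_apply, fourier_apply,
          smul_add, AddCircle.toCircle_add, Circle.coe_mul, Finset.prod_mul_distrib, hsd]
      rw [ha, UnitAddTorus.mFourierCoeff]
      simp only [smul_eq_mul]
      rw [← h2, ← integral_const_mul]
      congr 1
      funext y
      have h5 : us y = u (y + s) := rfl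
      rw [h3, ContinuousMap.mul_apply, h5]
      linear_combination -(UnitAddTorus.mFourier (-k) y * u (y + s)) * torusChar_neg k (t • w)
    have h4 : (torusChar k (t • w) - 1) * a - t * b =
        ∫ y, (UnitAddTorus.mFourier (-k) * (us - u - (t : ℂ) • v)) y := by
      have e1 : UnitAddTorus.mFourier (-k) * (us - u - (t : ℂ) • v) =
          UnitAddTorus.mFourier (-k) * us - UnitAddTorus.mFourier (-k) * u -
            (t : ℂ) • (UnitAddTorus.mFourier (-k) * v) := by
        rw [mul_sub, mul_sub, mul_smul_comm]
      rw [e1]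
      simp only [ContinuousMap.sub_apply, ContinuousMap.smul_apply]
      have e2 := integral_sub (μ := (volume : Measure (UnitAddTorus ι)))
        ((hint (UnitAddTorus.mFourier (-k) * us)).sub (hint (UnitAddTorus.mFourier (-k) * u)))
        ((hint (UnitAddTorus.mFourier (-k) * v)).smul (t : ℂ))
      refine Eq.trans ?_ e2.symm
      have e3 := integral_sub (hint (UnitAddTorus.mFourier (-k) * us))
        (hint (UnitAddTorus.mFourier (-k) * u))
      have e4 := integral_smul (μ := (volume : Measure (UnitAddTorus ι))) (t : ℂ)
        fun y => (UnitAddTorus.mFourier (-k) * v) y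
      refine Eq.trans ?_ (congrArg₂ (· - ·) e3.symm e4.symm)
      rw [h1, sub_mul, one_mul]
      rfl
    rw [h4]
    refine (norm_integral_le_of_norm_le_const (C := D * C * t ^ 2)
      (Eventually.of_forall fun y => ?_)).trans (by simp)
    obtain ⟨x, rfl⟩ : ∃ x, toTorus x = y :=
      ⟨fun i => (y i).out, funext fun i => QuotientAddGroup.out_eq' _⟩
    rw [ContinuousMap.mul_apply, mFourier_toTorus, norm_mul, norm_torusChar, one_mul]
    have h5 : us (toTorus x) = φ (f (x + t • w)) := by
      rw [← hu]; rfl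
    rw [ContinuousMap.sub_apply, ContinuousMap.sub_apply, ContinuousMap.smul_apply, h5, hu, hv,
      ← map_sub, ← map_smul, ← map_sub, mul_assoc]
    exact (hD _).trans (mul_le_mul_of_nonneg_left (hC x t) hD0)
  set e : ℂ := 2 * Real.pi * Complex.I * freq k w with he
  have h6 : ∀ t : ℝ, 0 < t → ‖e * a - b‖ ≤
      (D * C + 2 * (2 * Real.pi * freq k w) ^ 2 * ‖a‖) * t := by
    intro t ht
    have h7 : (t : ℂ) * (e * a - b) = ((torusChar k (t • w) - 1) * a - t * b) -
        (torusChar k (t • w) - 1 - t * e) * a := by ring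
    have h8 : ‖(t : ℂ) * (e * a - b)‖ ≤ D * C * t ^ 2 +
        2 * (2 * Real.pi * freq k w) ^ 2 * t ^ 2 * ‖a‖ := by
      rw [h7]
      refine (norm_sub_le _ _).trans (add_le_add (key t) ?_)
      rw [norm_mul]
      exact mul_le_mul_of_nonneg_right (norm_torusChar_smul_sub_le k w t) (norm_nonneg _)
    rw [norm_mul, Complex.norm_real, Real.norm_of_nonneg ht.le] at h8
    refine le_of_mul_le_mul_left (h8.trans (le_of_eq ?_)) ht
    ring
  have h9 : ‖e * a - b‖ ≤ 0 := by
    have h10 : Tendsto (fun t : ℝ => (D * C + 2 * (2 * Real.pi * freq k w) ^ 2 * ‖a‖) * t)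
        (𝓝[>] 0) (𝓝 0) := by
      have h11 : Continuous fun t : ℝ => (D * C + 2 * (2 * Real.pi * freq k w) ^ 2 * ‖a‖) * t := by
        fun_prop
      have h12 := h11.tendsto 0
      rw [mul_zero] at h12
      exact h12.mono_left nhdsWithin_le_nhds
    refine ge_of_tendsto h10 ?_
    filter_upwards [self_mem_nhdsWithin] with t ht
    exact h6 t ht
  exact (sub_eq_zero.1 (norm_le_zero_iff.1 h9)).symm

theorem HasUniformDeriv.isLatticePeriodic (hs : IsSeparated p) {f g : (ι → ℝ) → F} {w : ι → ℝ}
    (h : HasUniformDeriv p w f g) (hf : IsLatticePeriodic f) : IsLatticePeriodic g := by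
  intro x m
  have h1 : HasUniformDeriv p w f fun x => g (x + fun i => (m i : ℝ)) := by
    intro j
    obtain ⟨C, hC⟩ := h j
    refine ⟨C, fun x t => ?_⟩
    have h2 := hC (x + fun i => (m i : ℝ)) t
    rwa [hf, add_right_comm, hf] at h2
  exact congrFun (h1.unique (fun _ h => hs.eq_zero h) h) x

/-- Each differentiation gains a factor ‖k‖: differentiate along the coordinate in which |k i| is
largest and use 2π ≥ 1. -/
theorem exists_seminorm_coeff_le (hp : IsSeqComplete p) (hs : IsSeparated p) (s j : ℕ)
    {f : (ι → ℝ) → F} (hf : IsBoundedSmooth p f) (hfp : IsLatticePeriodic f) :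
    ∃ C : ℝ, 0 ≤ C ∧ ∀ k c, IsFourierCoeff p f k c → ‖k‖ ^ s * p j c ≤ C := by
  induction s generalizing f with
  | zero =>
    obtain ⟨C, hC0, hC⟩ := hf.bounded.nonneg j
    exact ⟨C, hC0, fun k c hc => by rw [pow_zero, one_mul]; exact hc.seminorm_le hC⟩
  | succ s ih =>
    choose g hg hg' using fun i : ι =>
      hf.exists_deriv (fun _ h => hs.eq_zero h) (Pi.single i (1 : ℝ))
    choose C hC0 hC using fun i => ih (hg' i) ((hg i).isLatticePeriodic hs hfp)
    refine ⟨∑ i, C i, Finset.sum_nonneg fun i _ => hC0 i, fun k c hc => ?_⟩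
    by_cases hk : k = 0
    · subst hk
      rw [norm_zero, zero_pow (Nat.succ_ne_zero s), zero_mul]
      exact Finset.sum_nonneg fun i _ => hC0 i
    · obtain ⟨i, hi⟩ : ∃ i, ‖k i‖ = ‖k‖ := by
        have : Nonempty ι := by
          by_contra hne
          rw [not_nonempty_iff] at hne
          exact hk (Subsingleton.elim _ _)
        obtain ⟨i, -, hi⟩ := Finset.exists_max_image Finset.univ (fun i => ‖k i‖) Finset.univ_nonempty
        exact ⟨i, le_antisymm (norm_le_pi_norm k i)
          ((pi_norm_le_iff_of_nonneg (norm_nonneg _)).2 fun l => hi l (Finset.mem_univ l))⟩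
      obtain ⟨c', hc'⟩ := exists_isFourierCoeff hp hs (hg' i) k
      have h1 := hc.deriv hs hf (hg' i) hfp ((hg i).isLatticePeriodic hs hfp) (hg i) hc'
      have h2 : ‖k‖ * p j c ≤ p j c' := by
        rw [h1, map_smul_eq_mul, freq_single, mul_one, norm_mul, norm_mul, norm_mul, Complex.norm_I,
          Complex.norm_ofNat, Complex.norm_real, Complex.norm_real, Real.norm_of_nonneg Real.pi_pos.le,
          mul_one, ← hi, Int.norm_eq_abs, Real.norm_eq_abs]
        refine mul_le_mul_of_nonneg_right ?_ (apply_nonneg _ _)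
        have := Real.pi_gt_three
        nlinarith [abs_nonneg (k i : ℝ)]
      calc ‖k‖ ^ (s + 1) * p j c = ‖k‖ ^ s * (‖k‖ * p j c) := by ring
        _ ≤ ‖k‖ ^ s * p j c' := by gcongr
        _ ≤ C i := hC i k c' hc'
        _ ≤ _ := Finset.single_le_sum (f := C) (fun i _ => hC0 i) (Finset.mem_univ i)

theorem isRapid_of_isFourierCoeff (hp : IsSeqComplete p) (hs : IsSeparated p) {f : (ι → ℝ) → F}
    (hf : IsBoundedSmooth p f) (hfp : IsLatticePeriodic f) {c : (ι → ℤ) → F}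
    (hc : ∀ k, IsFourierCoeff p f k (c k)) : IsRapid p c := by
  intro s j
  obtain ⟨C, hC0, hC⟩ := exists_seminorm_coeff_le hp hs s j hf hfp
  obtain ⟨D, hD0, hD⟩ := exists_seminorm_coeff_le hp hs 0 j hf hfp
  refine ⟨2 ^ s * C + 2 ^ s * D, fun k => ?_⟩
  have h1 := hC k _ (hc k)
  have h2 := hD k _ (hc k)
  rw [pow_zero, one_mul] at h2
  have h3 : 0 ≤ p j (c k) := apply_nonneg _ _
  rcases le_total ‖k‖ 1 with h | h
  · have : (1 + ‖k‖) ^ s ≤ 2 ^ s := pow_le_pow_left₀ (by positivity) (by linarith) s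
    calc _ ≤ 2 ^ s * D := mul_le_mul this h2 h3 (by positivity)
      _ ≤ _ := by have : 0 ≤ 2 ^ s * C := by positivity
                  linarith
  · have h4 : (1 + ‖k‖) ^ s ≤ 2 ^ s * ‖k‖ ^ s := by
      rw [← mul_pow]
      exact pow_le_pow_left₀ (by positivity) (by linarith) s
    calc _ ≤ (2 ^ s * ‖k‖ ^ s) * p j (c k) := mul_le_mul_of_nonneg_right h4 h3
      _ = 2 ^ s * (‖k‖ ^ s * p j (c k)) := by ring
      _ ≤ 2 ^ s * C := by gcongr
      _ ≤ _ := by have : 0 ≤ 2 ^ s * D := by positivity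
                  linarith

/-- Fourier inversion for smooth periodic maps. -/
theorem isFourierSum_of_isFourierCoeff (hp : IsSeqComplete p) (hs : IsSeparated p)
    {f : (ι → ℝ) → F} (hf : IsBoundedSmooth p f) (hfp : IsLatticePeriodic f) {c : (ι → ℤ) → F}
    (hc : ∀ k, IsFourierCoeff p f k (c k)) : IsFourierSum p c f := by
  have hr := isRapid_of_isFourierCoeff hp hs hf hfp hc
  obtain ⟨g, hg⟩ := hr.exists_isFourierSum hp
  -- The sum of the series agrees with f because scalar Fourier inversion holds after every bounded
  -- functional and these separate points.
  have : g = f := by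
    funext x
    refine hs.eq fun φ hφ => ?_
    obtain ⟨u, hu, hu'⟩ := hf.exists_torus hs hfp hφ
    have h1 := SeqTendsto.functional hφ (hg x)
    simp only [map_sum, map_smul, smul_eq_mul] at h1
    have hsum : Summable (UnitAddTorus.mFourierCoeff u) := by
      obtain ⟨N, D, hD0, hD⟩ := hφ 0
      have h2 : Summable fun k => D * seminormSum p N (c k) := by
        simp only [seminormSum_apply]
        exact (summable_sum fun i _ => by simpa using hr.summable 0 i).mul_left D
      refine Summable.of_norm_bounded h2 fun k => ?_
      rw [← hu' k _ (hc k)]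
      exact hD _
    have h3 := (UnitAddTorus.hasSum_mFourier_series_apply_of_summable hsum (toTorus x)).comp
      tendsto_freqBox
    rw [hu] at h3
    refine tendsto_nhds_unique h1 (h3.congr fun n => ?_)
    refine Finset.sum_congr rfl fun k _ => ?_
    dsimp only
    rw [mFourier_toTorus, hu' k _ (hc k), smul_eq_mul, mul_comm]
  rwa [this] at hg

/-- The homological equation on the torus with a Diophantine frequency. -/
theorem exists_homological (hp : IsSeqComplete p) (hs : IsSeparated p) {f : (ι → ℝ) → F}
    (hf : IsBoundedSmooth p f) (hfp : IsLatticePeriodic f) {w : ι → ℝ}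
    (hw : ∃ (C : ℝ) (M : ℕ), ∀ k : ι → ℤ, k ≠ 0 → 1 ≤ C * ‖k‖ ^ M * |freq k w|) :
    ∃ (X : (ι → ℝ) → F) (Z : F), IsBoundedSmooth p X ∧ IsLatticePeriodic X ∧
      HasUniformDeriv p w X (fun x => f x - Z) ∧
      ∀ (w' : ι → ℝ) (L : F →ₗ[ℂ] F), IsBoundedMap p p L → HasUniformDeriv p w' f (fun x => L (f x)) →
        HasUniformDeriv p w' X (fun x => L (X x)) ∧ L Z = 0 := by
  choose c hc using exists_isFourierCoeff hp hs hf
  have hr := isRapid_of_isFourierCoeff hp hs hf hfp hc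
  have hfc := isFourierSum_of_isFourierCoeff hp hs hf hfp hc
  -- The inverse divisors. They grow at most polynomially by the Diophantine bound, so
  -- multiplication by them preserves rapid decrease; the zero mode cannot be divided and becomes Z.
  set d : (ι → ℤ) → ℂ := fun k => if k = 0 then 0 else (2 * Real.pi * Complex.I * freq k w : ℂ)⁻¹
    with hd
  have hfreq : ∀ k : ι → ℤ, k ≠ 0 → freq k w ≠ 0 := by
    obtain ⟨C, M, hC⟩ := hw
    intro k hk h0
    have := hC k hk
    rw [h0, abs_zero, mul_zero] at this
    linarith
  have ha : IsRapid p fun k => d k • c k := by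
    refine hr.smul ?_
    obtain ⟨C, M, hC⟩ := hw
    refine ⟨|C|, M, fun k => ?_⟩
    rw [hd]
    dsimp only
    split_ifs with hk
    · rw [norm_zero]; positivity
    · have h1 := abs_pos.2 (hfreq k hk)
      rw [norm_inv, norm_mul, norm_mul, norm_mul, Complex.norm_I, Complex.norm_ofNat,
        Complex.norm_real, Complex.norm_real, Real.norm_of_nonneg Real.pi_pos.le, mul_one,
        Real.norm_eq_abs, inv_le_iff_one_le_mul₀ (by positivity)]
      refine (hC k hk).trans ?_
      have h2 := Real.pi_gt_three
      have h3 : C * ‖k‖ ^ M ≤ |C| * (1 + ‖k‖) ^ M :=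
        mul_le_mul (le_abs_self C) (pow_le_pow_left₀ (norm_nonneg _) (by linarith) M)
          (by positivity) (abs_nonneg C)
      refine mul_le_mul h3 ?_ h1.le (by positivity)
      nlinarith
  obtain ⟨X, hX⟩ := ha.exists_isFourierSum hp
  refine ⟨X, c 0, hX.isBoundedSmooth hp ha, isLatticePeriodic_of_single (hX.periodic hs), ?_,
    fun w' L hL hLf => ?_⟩
  · refine hX.hasUniformDeriv ha fun x => ?_
    have h0 : HasSeriesSum p (fun k : ι → ℤ => if k = 0 then c 0 else 0) (c 0) := by
      intro j
      refine tendsto_const_nhds.congr fun n => ?_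
      have : (0 : ι → ℤ) ∈ freqBox ι n :=
        Fintype.mem_piFinset.2 fun i => Finset.mem_Icc.2 ⟨by simp, by simp⟩
      simp [Finset.sum_ite_eq', this]
    convert (hfc x).sub h0 using 2 with k
    rw [hd]
    dsimp only
    split_ifs with hk
    · subst hk
      simp [torusChar_zero_left]
    · have h1 : (2 * Real.pi * Complex.I * freq k w : ℂ) ≠ 0 := by
        have := hfreq k hk
        have := Real.pi_ne_zero
        simp_all [Complex.I_ne_zero]
      rw [smul_smul _ _ (c k), mul_inv_cancel₀ h1, one_smul, sub_zero]
  -- If L is the derivative of f along w', the coefficients are eigenvectors of L. Multiplying them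
  -- by scalars keeps this relation for X, and the zero mode has eigenvalue 0.
  · have hcL : ∀ k, L (c k) = (2 * Real.pi * Complex.I * freq k w' : ℂ) • c k := fun k =>
      (hc k).deriv hs hf (hf.map hL) hfp (fun x m => congrArg L (hfp x m)) hLf ((hc k).map hL)
    refine ⟨hX.hasUniformDeriv ha fun x => ?_, ?_⟩
    · convert (hX x).map hL using 2 with k
      rw [map_smul, map_smul, hcL]
      dsimp only
      rw [smul_comm _ (d k) (c k), smul_comm _ (d k)]
    · rw [hcL]
      simp [freq]

end FourierSeries
end SobolevGrowth
end

noncomputable section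
namespace SobolevGrowth

/-! ### The homological equation for a quasiperiodic family -/

section Action

variable {F : Type*} [AddCommGroup F] [Module ℂ F] {p : ℕ → Seminorm ℂ F}
  {E E' : Type*} [AddCommGroup E] [Module ℝ E] [AddCommGroup E'] [Module ℝ E']
  {T : Type*} [AddCommGroup T] [Module ℝ T]

theorem HasUniformDeriv.comp_linear {f g : E → F} (l : E' →ₗ[ℝ] E) {w : E'}
    (h : HasUniformDeriv p (l w) f g) : HasUniformDeriv p w (fun x => f (l x)) fun x => g (l x) := by
  intro j
  obtain ⟨C, hC⟩ := h j
  refine ⟨C, fun x t => ?_⟩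
  dsimp only
  rw [map_add, map_smul]
  exact hC (l x) t

theorem IsBoundedSmooth.comp_linear {f : E → F} (hf : IsBoundedSmooth p f) (l : E' →ₗ[ℝ] E) :
    IsBoundedSmooth p fun x => f (l x) := by
  intro N
  replace hf := hf N
  induction N generalizing f with
  | zero => exact fun j => (hf j).imp fun C hC x => hC _
  | succ N ih =>
    refine ⟨fun j => (hf.1 j).imp fun C hC x => hC _, fun w => ?_⟩
    obtain ⟨g, hg, hg'⟩ := hf.2 (l w)
    exact ⟨_, hg.comp_linear l, ih hg'⟩

/-- A family of linear maps with a smooth group law, and its infinitesimal generators. -/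
structure IsSmoothAction (p : ℕ → Seminorm ℂ F) (c D : T → F →ₗ[ℂ] F) : Prop where
  zero : ∀ a, c 0 a = a
  add : ∀ τ τ' a, c (τ + τ') a = c τ (c τ' a)
  comm : ∀ w τ a, D w (c τ a) = c τ (D w a)
  smul : ∀ (s : ℝ) w a, D (s • w) a = (s : ℂ) • D w a
  isBoundedMap : ∀ w, IsBoundedMap p p (D w)
  bound : ∀ j, ∃ (N : ℕ) (C : ℝ), 0 ≤ C ∧ ∀ τ a, p j (c τ a) ≤ C * seminormSum p N a
  lipschitz : ∀ w j, ∃ (N : ℕ) (C : ℝ), 0 ≤ C ∧ ∀ τ (t : ℝ) a,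
    p j (c (τ + t • w) a - c τ a) ≤ C * seminormSum p N a * |t|
  quadratic : ∀ w j, ∃ (N : ℕ) (C : ℝ), 0 ≤ C ∧ ∀ τ (t : ℝ) a,
    p j (c (τ + t • w) a - c τ a - (t : ℂ) • c τ (D w a)) ≤ C * seminormSum p N a * t ^ 2

namespace IsSmoothAction

variable {c D : T → F →ₗ[ℂ] F} (hc : IsSmoothAction p c D)
include hc

/-- The parameter of the action and its argument both vary. The remainder splits into the remainder
of A, an increment of the action on A', and the quadratic remainder of the action, all with
constants uniform in the parameter. -/
theorem hasUniformDeriv {A A' : E → F} (hA0 : IsBoundedFamily p A) (hA1 : IsBoundedFamily p A')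
    {w : E} (hA : HasUniformDeriv p w A A') (l : E →ₗ[ℝ] T) :
    HasUniformDeriv p w (fun x => c (l x) (A x)) fun x => c (l x) (A' x + D (l w) (A x)) := by
  intro j
  obtain ⟨N, C, hC0, hC⟩ := hc.bound j
  obtain ⟨N', C', hC'0, hC'⟩ := hc.lipschitz (l w) j
  obtain ⟨N'', C'', hC''0, hC''⟩ := hc.quadratic (l w) j
  obtain ⟨B, hB0, hB⟩ := hA.seminormSum N
  obtain ⟨B', hB'0, hB'⟩ := hA1.seminormSum N'
  obtain ⟨B'', hB''0, hB''⟩ := hA0.seminormSum N''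
  refine ⟨C * B + C' * B' + C'' * B'', fun x t => ?_⟩
  dsimp only
  rw [map_add, map_smul]
  have h1 : c (l x + t • l w) (A (x + t • w)) - c (l x) (A x) -
      (t : ℂ) • c (l x) (A' x + D (l w) (A x)) =
      c (l x + t • l w) (A (x + t • w) - A x - (t : ℂ) • A' x) +
      (t : ℂ) • (c (l x + t • l w) (A' x) - c (l x) (A' x)) +
      (c (l x + t • l w) (A x) - c (l x) (A x) - (t : ℂ) • c (l x) (D (l w) (A x))) := by
    simp only [map_sub, map_add, map_smul, smul_add, smul_sub]
    abel
  rw [h1]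
  refine (map_add_le_add _ _ _).trans ((add_le_add (map_add_le_add _ _ _) le_rfl).trans ?_)
  rw [map_smul_eq_mul, Complex.norm_real, Real.norm_eq_abs, add_mul, add_mul]
  refine add_le_add (add_le_add ?_ ?_) ?_
  · refine (hC _ _).trans ?_
    rw [mul_assoc]
    exact mul_le_mul_of_nonneg_left (hB x t) hC0
  · calc _ ≤ |t| * (C' * B' * |t|) := by
          refine mul_le_mul_of_nonneg_left ((hC' _ t _).trans ?_) (abs_nonneg t)
          have := hB' x
          gcongr
      _ = C' * B' * |t| ^ 2 := by ring
      _ = _ := by rw [sq_abs]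
  · refine (hC'' _ t _).trans ?_
    have := hB'' x
    gcongr

theorem isBoundedSmooth {A : E → F} (hA : IsBoundedSmooth p A) (l : E →ₗ[ℝ] T) :
    IsBoundedSmooth p fun x => c (l x) (A x) := by
  intro N
  replace hA := hA N
  have hb : ∀ {A : E → F}, IsBoundedFamily p A → IsBoundedFamily p fun x => c (l x) (A x) := by
    intro A hA j
    obtain ⟨N, C, hC0, hC⟩ := hc.bound j
    obtain ⟨B, hB0, hB⟩ := hA.seminormSum N
    exact ⟨C * B, fun x => (hC _ _).trans (mul_le_mul_of_nonneg_left (hB x) hC0)⟩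
  induction N generalizing A with
  | zero => exact hb hA
  | succ N ih =>
    refine ⟨hb hA.1, fun w => ?_⟩
    obtain ⟨A', hA', hA''⟩ := hA.2 w
    exact ⟨_, hc.hasUniformDeriv hA.1 hA''.bounded hA' l,
      ih (hA''.add (hA.of_succ.map (hc.isBoundedMap _)))⟩

/-- The homological equation `ω·∂X + D_ν X = A - Z`, for `ν = ∑ᵢ ν'ᵢ vᵢ` with periodic directions
`vᵢ` and `(ω, ν')` Diophantine. -/
theorem exists_homological (hp : IsSeqComplete p) (hs : IsSeparated p) {n e : ℕ} {ω : Fin n → ℝ}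
    {ν' : Fin e → ℝ} {v : Fin e → T} (hper : ∀ i a, c ((2 * Real.pi) • v i) a = a)
    (hw : ∃ (C : ℝ) (M : ℕ), ∀ k : Fin n ⊕ Fin e → ℤ, k ≠ 0 →
      1 ≤ C * ‖k‖ ^ M * |freq k (Sum.elim ω ν')|)
    {A : (Fin n → ℝ) → F} (hA : IsBoundedSmooth p A)
    (hAper : ∀ (θ : Fin n → ℝ) (i : Fin n), A (θ + Pi.single i (2 * Real.pi)) = A θ) :
    ∃ (X : (Fin n → ℝ) → F) (Z : F), IsBoundedSmooth p X ∧
      (∀ (θ : Fin n → ℝ) (i : Fin n), X (θ + Pi.single i (2 * Real.pi)) = X θ) ∧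
      HasUniformDeriv p ω X (fun θ => A θ - Z - D (∑ i, ν' i • v i) (X θ)) ∧
      D (∑ i, ν' i • v i) Z = 0 := by
  have hpi : 2 * Real.pi ≠ 0 := by positivity
  set lθ : (Fin n ⊕ Fin e → ℝ) →ₗ[ℝ] (Fin n → ℝ) :=
    (2 * Real.pi) • LinearMap.funLeft ℝ ℝ Sum.inl with hlθ
  set lτ : (Fin n ⊕ Fin e → ℝ) →ₗ[ℝ] T :=
    (2 * Real.pi) • (Fintype.linearCombination ℝ v ∘ₗ LinearMap.funLeft ℝ ℝ Sum.inr) with hlτ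
  -- The given family conjugated along the directions v i. Angles are measured in units of 2π, so f
  -- is periodic with respect to the integer lattice: in the second group of variables because each
  -- v i is a period of the action.
  set f : (Fin n ⊕ Fin e → ℝ) → F := fun y => c (lτ y) (A (lθ y)) with hf
  have hfs : IsBoundedSmooth p f := hc.isBoundedSmooth (hA.comp_linear lθ) lτ
  have hperz : ∀ i (m : ℤ) a, c (((2 * Real.pi) * m) • v i) a = a := by
    intro i m
    have hnat : ∀ (m : ℕ) a, c (((2 * Real.pi) * m) • v i) a = a := by
      intro m
      induction m with
      | zero => intro a; rw [Nat.cast_zero, mul_zero, zero_smul, hc.zero]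
      | succ m ih => intro a; rw [Nat.cast_succ, mul_add, add_smul, hc.add, mul_one, hper, ih]
    intro a
    obtain ⟨m, rfl | rfl⟩ := m.eq_nat_or_neg
    · exact hnat m a
    · conv_rhs => rw [← hc.zero a]
      conv_lhs => rw [← hnat m a]
      rw [← hc.add, ← add_smul]
      push_cast
      rw [mul_neg, neg_add_cancel, zero_smul]
  have hAz : ∀ (θ : Fin n → ℝ) (i : Fin n) (m : ℤ), A (θ + Pi.single i (2 * Real.pi * m)) = A θ := by
    intro θ i m
    have hnat : ∀ (m : ℕ) (θ : Fin n → ℝ), A (θ + Pi.single i (2 * Real.pi * m)) = A θ := by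
      intro m
      induction m with
      | zero => intro θ; simp
      | succ m ih =>
        intro θ
        rw [Nat.cast_succ, mul_add, Pi.single_add, mul_one, ← add_assoc, hAper, ih]
    obtain ⟨m, rfl | rfl⟩ := m.eq_nat_or_neg
    · exact hnat m θ
    · have h1 := hnat m (θ + Pi.single i (2 * Real.pi * ((-(m : ℤ) : ℤ) : ℝ)))
      rw [← h1, add_assoc, ← Pi.single_add]
      push_cast
      rw [mul_neg, neg_add_cancel, Pi.single_zero, add_zero]
  have hfp : IsLatticePeriodic f := by
    refine isLatticePeriodic_of_single fun x i m => ?_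
    rw [hf]
    dsimp only
    rw [map_add, map_add]
    rcases i with i | i
    · have h1 : lτ (Pi.single (Sum.inl i) (m : ℝ)) = 0 := by
        simp [hlτ, LinearMap.funLeft, Fintype.linearCombination_apply]
      have h2 : lθ (Pi.single (Sum.inl i) (m : ℝ)) = Pi.single i (2 * Real.pi * m) := by
        funext l
        simp [hlθ, LinearMap.funLeft, Pi.single_apply]
      rw [h1, h2, add_zero, hAz]
    · have h1 : lτ (Pi.single (Sum.inr i) (m : ℝ)) = ((2 * Real.pi) * m) • v i := by
        simp [hlτ, LinearMap.funLeft, Fintype.linearCombination_apply, Pi.single_apply, smul_smul]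
      have h2 : lθ (Pi.single (Sum.inr i) (m : ℝ)) = 0 := by
        funext l
        simp [hlθ, LinearMap.funLeft]
      rw [h1, h2, add_zero, hc.add, hperz]
  obtain ⟨X, Z, hX, hXp, hXd, hXL⟩ := SobolevGrowth.exists_homological hp hs hfs hfp hw
  -- Along (0, ν') only the action moves, so f is differentiated by the generator L in the direction
  -- 2πν, and the solution X inherits this property.
  set w' : Fin n ⊕ Fin e → ℝ := Sum.elim 0 ν' with hw'
  set ν := ∑ i, ν' i • v i with hν
  have hlw : lτ w' = (2 * Real.pi) • ν := by
    simp [hlτ, hw', LinearMap.funLeft, Fintype.linearCombination_apply, hν]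
  have hlw0 : lθ w' = 0 := by
    funext l
    simp [hlθ, hw', LinearMap.funLeft]
  set L : F →ₗ[ℂ] F := D ((2 * Real.pi) • ν) with hL
  have hA0 : HasUniformDeriv p w' (fun y => A (lθ y)) fun _ => 0 := by
    refine HasUniformDeriv.comp_linear (g := fun _ => 0) lθ ?_
    rw [hlw0]
    exact fun j => ⟨0, fun x t => by simp⟩
  have hd : HasUniformDeriv p w' f fun y => L (f y) := by
    have h1 := hc.hasUniformDeriv (hA.comp_linear lθ).bounded (fun j => ⟨0, fun x => by simp⟩) hA0 lτ
    simp only [zero_add, hlw] at h1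
    convert h1 using 2
    rw [hf]
    exact hc.comm _ _ _
  obtain ⟨hX', hZ'⟩ := hXL w' L (hc.isBoundedMap _) hd
  have hLX : IsBoundedSmooth p fun y => L (X y) := hX.map (hc.isBoundedMap _)
  -- Subtracting the derivative along (0, ν') leaves that along (ω, 0), and the subtracted term is
  -- the generator applied to X.
  have hsub : HasUniformDeriv p (Sum.elim ω ν' + (-1 : ℝ) • w') X
      fun y => f y - Z + ((-1 : ℝ) : ℂ) • L (X y) := by
    refine hXd.add_dir (hX'.smul_dir (-1)) fun j => ?_
    obtain ⟨g, hg, hg'⟩ := (hLX.smul ((-1 : ℝ) : ℂ)).exists_deriv (fun _ h => hs.eq_zero h)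
      (Sum.elim ω ν')
    exact hg.lipschitz (hLX.smul ((-1 : ℝ) : ℂ)).bounded hg'.bounded j
  -- Restriction to the slice where the action parameter is 0 and f is the original family. The
  -- factor 1/(2π) undoes the rescaling of angles and is compensated by a factor 2π in the final
  -- solution.
  set ly : (Fin n → ℝ) →ₗ[ℝ] (Fin n ⊕ Fin e → ℝ) :=
    (2 * Real.pi)⁻¹ • LinearMap.pi (Sum.elim (fun i => LinearMap.proj i) fun _ => 0) with hly
  have hlyω : ly ω = (2 * Real.pi)⁻¹ • (Sum.elim ω ν' + (-1 : ℝ) • w') := by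
    funext i
    rcases i with i | i <;> simp [hly, hw']
  have hf0 : ∀ θ, f (ly θ) = A θ := by
    intro θ
    have h1 : lτ (ly θ) = 0 := by
      simp [hlτ, hly, LinearMap.funLeft, Fintype.linearCombination_apply]
    have h2 : lθ (ly θ) = θ := by
      funext l
      simp only [hlθ, hly, LinearMap.funLeft, LinearMap.smul_apply, Pi.smul_apply, smul_eq_mul,
        LinearMap.coe_mk, AddHom.coe_mk, Function.comp_apply, LinearMap.pi_apply, Sum.elim_inl,
        LinearMap.proj_apply]
      rw [← mul_assoc, mul_inv_cancel₀ hpi, one_mul]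
    rw [hf]
    dsimp only
    rw [h1, h2, hc.zero]
  have hDν : D ν Z = 0 := by
    have h1 := hZ'
    rw [hL, hc.smul] at h1
    exact (smul_eq_zero.1 h1).resolve_left (by exact_mod_cast hpi)
  refine ⟨fun θ => ((2 * Real.pi : ℝ) : ℂ) • X (ly θ), Z, (hX.comp_linear ly).smul _,
    fun θ i => ?_, ?_, hDν⟩
  · have h1 : ly (Pi.single i (2 * Real.pi)) =
        fun l => ((Pi.single (Sum.inl i) 1 : Fin n ⊕ Fin e → ℤ) l : ℝ) := by
      funext l
      rcases l with l | l
      · by_cases h : l = i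
        · subst h
          simp only [hly, LinearMap.smul_apply, Pi.smul_apply, LinearMap.pi_apply, Sum.elim_inl,
            LinearMap.proj_apply, Pi.single_eq_same, smul_eq_mul, Int.cast_one]
          exact inv_mul_cancel₀ hpi
        · simp [hly, h]
      · simp [hly]
    dsimp only
    rw [map_add, h1, hXp]
  · have h1 := hsub.smul_dir (2 * Real.pi)⁻¹
    rw [← hlyω] at h1
    have h2 := (h1.comp_linear ly).map (isBoundedMap_smul (p := p) ((2 * Real.pi : ℝ) : ℂ))
    simp only [LinearMap.smul_apply, LinearMap.id_apply] at h2
    convert h2 using 2 with θ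
    have h3 : ((2 * Real.pi : ℝ) : ℂ) * (((2 * Real.pi)⁻¹ : ℝ) : ℂ) = 1 := by
      rw [← Complex.ofReal_mul, mul_inv_cancel₀ hpi, Complex.ofReal_one]
    rw [smul_smul, h3, one_smul, hf0, hL, hc.smul, map_smul, Complex.ofReal_neg, Complex.ofReal_one,
      neg_smul, one_smul, ← sub_eq_add_neg]

end IsSmoothAction

theorem one_le_of_isDiophantine {n e : ℕ} {ω : Fin n → ℝ} {ν' : Fin e → ℝ}
    (h : IsDiophantine ω ν') : ∃ (C : ℝ) (M : ℕ), ∀ k : Fin n ⊕ Fin e → ℤ, k ≠ 0 →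
      1 ≤ C * ‖k‖ ^ M * |freq k (Sum.elim ω ν')| := by
  obtain ⟨γ, κ, hγ, h⟩ := h
  -- The ℓ¹ size S of an integer vector is at least 1, so κ may be raised to the natural exponent
  -- ⌈κ⌉₊; and S ≤ (n + e)‖k‖ in the sup norm.
  refine ⟨((n : ℝ) + e) ^ ⌈κ⌉₊ / γ, ⌈κ⌉₊, fun k hk => ?_⟩
  have hne : (fun i => k (Sum.inl i)) ≠ 0 ∨ (fun i => k (Sum.inr i)) ≠ 0 := by
    by_contra! hcon
    refine hk (funext fun i => ?_)
    rcases i with i | i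
    · exact congrFun hcon.1 i
    · exact congrFun hcon.2 i
  have h1 := h _ _ hne
  have h2 : (∑ i, ω i * ((k (Sum.inl i) : ℤ) : ℝ)) + ∑ i, ν' i * ((k (Sum.inr i) : ℤ) : ℝ) =
      freq k (Sum.elim ω ν') := by
    simp only [freq, Fintype.sum_sum_type, Sum.elim_inl, Sum.elim_inr, mul_comm]
  rw [h2] at h1
  set S : ℝ := (∑ i, |((k (Sum.inr i) : ℤ) : ℝ)|) + ∑ i, |((k (Sum.inl i) : ℤ) : ℝ)| with hS
  have hS1 : 1 ≤ S := by
    obtain ⟨i, hi⟩ := Function.ne_iff.1 hk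
    have h3 : (1 : ℝ) ≤ |(k i : ℝ)| := by exact_mod_cast Int.one_le_abs hi
    rcases i with i | i
    · have := Finset.single_le_sum (f := fun i => |((k (Sum.inl i) : ℤ) : ℝ)|)
        (fun _ _ => abs_nonneg _) (Finset.mem_univ i)
      have h0 : 0 ≤ ∑ i, |((k (Sum.inr i) : ℤ) : ℝ)| := Finset.sum_nonneg fun _ _ => abs_nonneg _
      rw [hS]; linarith
    · have := Finset.single_le_sum (f := fun i => |((k (Sum.inr i) : ℤ) : ℝ)|)
        (fun _ _ => abs_nonneg _) (Finset.mem_univ i)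
      have h0 : 0 ≤ ∑ i, |((k (Sum.inl i) : ℤ) : ℝ)| := Finset.sum_nonneg fun _ _ => abs_nonneg _
      rw [hS]; linarith
  have hSn : S ≤ ((n : ℝ) + e) * ‖k‖ := by
    have hb : ∀ i, |(k i : ℝ)| ≤ ‖k‖ := fun i => by
      rw [← Int.norm_eq_abs]; exact norm_le_pi_norm k i
    have e1 := Finset.sum_le_sum fun (i : Fin e) (_ : i ∈ Finset.univ) => hb (Sum.inr i)
    have e2 := Finset.sum_le_sum fun (i : Fin n) (_ : i ∈ Finset.univ) => hb (Sum.inl i)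
    simp only [Finset.sum_const, Finset.card_univ, Fintype.card_fin, nsmul_eq_mul] at e1 e2
    rw [hS]; linarith
  have hSκ : S ^ κ ≤ (((n : ℝ) + e) * ‖k‖) ^ ⌈κ⌉₊ := by
    calc S ^ κ ≤ S ^ (⌈κ⌉₊ : ℝ) := Real.rpow_le_rpow_of_exponent_le hS1 (Nat.le_ceil κ)
      _ = S ^ ⌈κ⌉₊ := Real.rpow_natCast _ _
      _ ≤ _ := pow_le_pow_left₀ (by linarith) hSn _
  have hpos : 0 < S ^ κ := Real.rpow_pos_of_pos (by linarith) κ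
  rw [div_le_iff₀ hpos] at h1
  have h4 : γ ≤ |freq k (Sum.elim ω ν')| * (((n : ℝ) + e) * ‖k‖) ^ ⌈κ⌉₊ :=
    h1.trans (mul_le_mul_of_nonneg_left hSκ (abs_nonneg _))
  rw [mul_pow] at h4
  rw [div_mul_eq_mul_div, div_mul_eq_mul_div, le_div_iff₀ hγ]
  linarith

end Action

/-! ### Bounded functionals and the conjugation action on the operator classes -/

section Classes

variable {H : Type*} [NormedAddCommGroup H] [InnerProductSpace ℂ H] [CompleteSpace H]
  {K₀ : H →ₗ.[ℂ] H}

/-- The functionals b ↦ ⟨a u, b u⟩ are bounded, and their value at a itself is ‖a u‖². -/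
theorem OperatorClasses.IsGradedLieAlgebra.isSeparated {𝒜 : OperatorClasses K₀}
    (h𝒜 : 𝒜.IsGradedLieAlgebra) (hK₀ : IsPositiveSelfAdjoint K₀) (m : ℝ) :
    IsSeparated (𝒜.seminorm m) := by
  intro a ha
  refine Subtype.ext (LinearMap.ext fun u => Subtype.ext ?_)
  set φ : 𝒜.cls m →ₗ[ℂ] ℂ :=
    { toFun := fun b => inner ℂ ((a : SmoothEnd K₀) u : H) ((b : SmoothEnd K₀) u : H)
      map_add' := fun b b' => by
        rw [Submodule.coe_add, LinearMap.add_apply, Submodule.coe_add, inner_add_right]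
      map_smul' := fun c b => by
        rw [Submodule.coe_smul, LinearMap.smul_apply, Submodule.coe_smul, inner_smul_right]
        rfl } with hφ
  have h1 := ha φ (fun j => by
    obtain ⟨N, C, hC0, hC⟩ := h𝒜.norm_le hK₀ m 0
    refine ⟨N, ‖((a : SmoothEnd K₀) u : H)‖ * (C * ‖(smoothPow hK₀ (0 + m) u : H)‖), by positivity,
      fun b => ?_⟩
    have h2 := hC b u
    rw [smoothPow_zero] at h2
    refine (norm_inner_le_norm (𝕜 := ℂ) ((a : SmoothEnd K₀) u : H) ((b : SmoothEnd K₀) u : H)).trans ?_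
    refine (mul_le_mul_of_nonneg_left h2 (norm_nonneg _)).trans (le_of_eq ?_)
    ring)
  exact (inner_self_eq_zero (𝕜 := ℂ)).1 h1

namespace IsCommutingSystem

variable {𝒜 : OperatorClasses K₀} {d : ℕ} {k : Fin d → SmoothEnd K₀}
  (hk : IsCommutingSystem 𝒜 k)
include hk

theorem commute_expOp {m : ℝ} {a : SmoothEnd K₀} (ha : a ∈ 𝒜.cls m) (τ : Fin d → ℝ)
    (h : Commute a (dotOp τ k)) : Commute a (hk.expOp τ) :=
  (hk.tame τ).commute_flow (hasOrder_of_mem hk.graded hk.pos ha) h 1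

theorem isSmoothAction (m : ℝ) :
    IsSmoothAction (𝒜.seminorm m) (hk.conj m) (hk.deriv m) where
  zero := hk.conj_zero
  add := hk.conj_add
  comm w τ a := by
    refine Subtype.ext ?_
    rw [coe_deriv, coe_conj, coe_conj, coe_deriv]
    have h1 := (hk.commute_expOp (dotOp_mem hk.mem w) τ (hk.commute_dotOp w τ)).eq
    have h2 := (hk.commute_expOp (dotOp_mem hk.mem w) (-τ) (hk.commute_dotOp w (-τ))).eq
    rw [mul_smul_comm, smul_mul_assoc, mul_sub, sub_mul]
    congr 2
    · rw [← mul_assoc, ← mul_assoc, h1, mul_assoc (hk.expOp τ)]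
    · rw [mul_assoc (hk.expOp τ * ↑a), ← h2]
      simp only [mul_assoc]
  smul s w a := by
    refine Subtype.ext ?_
    rw [Submodule.coe_smul, coe_deriv, coe_deriv, dotOp_smul, smul_comm, smul_sub (s : ℂ),
      smul_mul_assoc, mul_smul_comm]
  isBoundedMap := hk.isBoundedMap_deriv m
  bound := hk.conj_bound m
  lipschitz := hk.conj_lipschitz m
  quadratic := hk.conj_quadratic m

theorem conj_eq_self {τ : Fin d → ℝ} {c : ℂ} (hτ : hk.expOp τ = c • 1) {m : ℝ} (a : 𝒜.cls m) :
    hk.conj m τ a = a := by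
  refine Subtype.ext ?_
  have h := hk.expOp_mul_neg τ
  rw [hτ, smul_mul_assoc, one_mul] at h
  rw [coe_conj, hτ, smul_mul_assoc, one_mul, smul_mul_assoc, ← mul_smul_comm, h, mul_one]

/-- The parameters that act trivially form a subgroup. It contains 2π times the basis vectors, since
conjugation by a scalar is trivial, hence 2π times the integer lattice. -/
theorem conj_lattice {c : Fin d → ℂ}
    (hper : ∀ j, hk.expOp ((2 * Real.pi) • Pi.single j (1 : ℝ)) = c j • 1) {m : ℝ} (l : Fin d → ℤ)
    (a : 𝒜.cls m) : hk.conj m ((2 * Real.pi) • fun j => (l j : ℝ)) a = a := by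
  set S : AddSubgroup (Fin d → ℝ) :=
    { carrier := {τ | ∀ a : 𝒜.cls m, hk.conj m τ a = a}
      add_mem' := fun {τ τ'} h h' a => by rw [conj_add, h', h]
      zero_mem' := hk.conj_zero
      neg_mem' := fun {τ} h a => by
        conv_lhs => rw [← h a]
        rw [← conj_add, neg_add_cancel, conj_zero] } with hS
  have h1 : ((2 * Real.pi) • fun j => (l j : ℝ)) =
      ∑ j, l j • ((2 * Real.pi) • (Pi.single j (1 : ℝ) : Fin d → ℝ)) := by
    funext i
    simp [Finset.sum_apply, Pi.single_apply, mul_comm]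
  have h2 : ((2 * Real.pi) • fun j => (l j : ℝ)) ∈ S := by
    rw [h1]
    exact S.sum_mem fun j _ => S.zsmul_mem (fun a => hk.conj_eq_self (hper j) a) _
  exact h2 a

end IsCommutingSystem

end Classes
end SobolevGrowth
end

noncomputable section
namespace SobolevGrowth
variable {H : Type*} [NormedAddCommGroup H] [InnerProductSpace ℂ H] [CompleteSpace H]

/-! ### Symbols: smooth periodic families of operators -/

section Symbols

/-- The Jacobi identity for the bracket i[x, y]. -/
theorem bracket_bracket {A : Type*} [Ring A] [Algebra ℂ A] (x y f : A) :
    Complex.I • (x * (Complex.I • (y * f - f * y)) - (Complex.I • (y * f - f * y)) * x) =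
      Complex.I • (y * (Complex.I • (x * f - f * x)) - (Complex.I • (x * f - f * x)) * y) +
      Complex.I • ((Complex.I • (x * y - y * x)) * f - f * (Complex.I • (x * y - y * x))) := by
  simp only [mul_smul_comm, smul_mul_assoc, mul_sub, sub_mul, smul_sub, mul_assoc]
  abel

variable {K₀ : H →ₗ.[ℂ] H} {𝒜 : OperatorClasses K₀} {n : ℕ}

/-- The smooth `2π`-periodic families of operators of order `m`. -/
def symbolClass (𝒜 : OperatorClasses K₀) (n : ℕ) (m : ℝ) :
    Submodule ℂ ((Fin n → ℝ) → SmoothEnd K₀) where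
  carrier := {f | ∃ g : (Fin n → ℝ) → 𝒜.cls m, IsBoundedSmooth (𝒜.seminorm m) g ∧
    (∀ θ, (g θ : SmoothEnd K₀) = f θ) ∧ ∀ θ i, f (θ + Pi.single i (2 * Real.pi)) = f θ}
  add_mem' := by
    rintro f f' ⟨g, hg, hgf, hf⟩ ⟨g', hg', hgf', hf'⟩
    refine ⟨_, hg.add hg', fun θ => ?_, fun θ i => ?_⟩
    · rw [Submodule.coe_add, hgf, hgf']; rfl
    · rw [Pi.add_apply, Pi.add_apply, hf, hf']
  zero_mem' := ⟨_, .const 0, fun θ => rfl, fun θ i => rfl⟩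
  smul_mem' := by
    rintro c f ⟨g, hg, hgf, hf⟩
    refine ⟨_, hg.smul c, fun θ => ?_, fun θ i => ?_⟩
    · rw [Submodule.coe_smul, hgf]; rfl
    · rw [Pi.smul_apply, Pi.smul_apply, hf]

theorem const_mem_symbolClass {m : ℝ} {a : SmoothEnd K₀} (ha : a ∈ 𝒜.cls m) :
    (fun _ => a) ∈ symbolClass 𝒜 n m :=
  ⟨fun _ => ⟨a, ha⟩, .const _, fun _ => rfl, fun _ _ => rfl⟩

theorem HasUniformDeriv.periodic {F E : Type*} [AddCommGroup F] [Module ℂ F] [AddCommGroup E]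
    [Module ℝ E] {p : ℕ → Seminorm ℂ F} (hs : ∀ a : F, (∀ j, p j a = 0) → a = 0) {f g : E → F}
    {w : E} (h : HasUniformDeriv p w f g) {a : E} (hf : ∀ x, f (x + a) = f x) (x : E) :
    g (x + a) = g x := by
  have h1 : HasUniformDeriv p w f fun x => g (x + a) := by
    intro j
    obtain ⟨C, hC⟩ := h j
    refine ⟨C, fun x t => ?_⟩
    have h2 := hC (x + a) t
    rwa [hf, add_right_comm, hf] at h2
  exact congrFun (h1.unique hs h) x

variable (h𝒜 : 𝒜.IsGradedLieAlgebra)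
include h𝒜

theorem symbolClass_mono {m m' : ℝ} (h : m ≤ m') : symbolClass 𝒜 n m ≤ symbolClass 𝒜 n m' := by
  rintro f ⟨g, hg, hgf, hf⟩
  exact ⟨_, hg.map (h𝒜.isBoundedMap_inclusion h), hgf, hf⟩

theorem bracket_mem_symbolClass {m m' q : ℝ} (hq : m + m' - 1 ≤ q)
    {f f' : (Fin n → ℝ) → SmoothEnd K₀} (hf : f ∈ symbolClass 𝒜 n m)
    (hf' : f' ∈ symbolClass 𝒜 n m') :
    Complex.I • (f * f' - f' * f) ∈ symbolClass 𝒜 n q := by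
  obtain ⟨g, hg, hgf, hf⟩ := hf
  obtain ⟨g', hg', hgf', hf'⟩ := hf'
  refine Submodule.smul_mem _ _ ⟨_, IsBoundedSmooth.bilin (h𝒜.isBoundedBilin_bracket hq) hg hg',
    fun θ => ?_, fun θ i => ?_⟩
  · rw [h𝒜.coe_bracket, hgf, hgf']; rfl
  · simp only [Pi.sub_apply, Pi.mul_apply, hf, hf']

/-- All symbols, of any order. -/
def symbols (n : ℕ) : Submodule ℂ ((Fin n → ℝ) → SmoothEnd K₀) where
  carrier := {f | ∃ m, f ∈ symbolClass 𝒜 n m}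
  add_mem' := by
    rintro f f' ⟨m, hf⟩ ⟨m', hf'⟩
    exact ⟨max m m', Submodule.add_mem _ (symbolClass_mono h𝒜 (le_max_left _ _) hf)
      (symbolClass_mono h𝒜 (le_max_right _ _) hf')⟩
  zero_mem' := ⟨0, Submodule.zero_mem _⟩
  smul_mem' := by
    rintro c f ⟨m, hf⟩
    exact ⟨m, Submodule.smul_mem _ c hf⟩

/-- The inner derivation `f ↦ i [x, f]`. -/
def adSymbol (x : symbols h𝒜 n) : Module.End ℂ (symbols h𝒜 n) where
  toFun f := ⟨Complex.I • ((x : (Fin n → ℝ) → SmoothEnd K₀) * f - f * x), by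
    obtain ⟨m, hx⟩ := x.2
    obtain ⟨m', hf⟩ := f.2
    exact ⟨_, bracket_mem_symbolClass h𝒜 le_rfl hx hf⟩⟩
  map_add' f f' := Subtype.ext (by
    simp only [Submodule.coe_add, mul_add, add_mul, ← smul_add]
    congr 1
    abel)
  map_smul' c f := Subtype.ext (by
    simp only [Submodule.coe_smul, mul_smul_comm, smul_mul_assoc, RingHom.id_apply, ← smul_sub,
      smul_comm c])

theorem coe_adSymbol (x f : symbols h𝒜 n) : (adSymbol h𝒜 x f : (Fin n → ℝ) → SmoothEnd K₀) =
    Complex.I • ((x : (Fin n → ℝ) → SmoothEnd K₀) * f - f * x) := rfl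

theorem adSymbol_mem {m m' q : ℝ} (hq : m + m' - 1 ≤ q) {x f : symbols h𝒜 n}
    (hx : (x : (Fin n → ℝ) → SmoothEnd K₀) ∈ symbolClass 𝒜 n m)
    (hf : (f : (Fin n → ℝ) → SmoothEnd K₀) ∈ symbolClass 𝒜 n m') :
    (adSymbol h𝒜 x f : (Fin n → ℝ) → SmoothEnd K₀) ∈ symbolClass 𝒜 n q :=
  bracket_mem_symbolClass h𝒜 hq hx hf

theorem adSymbol_add (x y : symbols h𝒜 n) :
    adSymbol h𝒜 (x + y) = adSymbol h𝒜 x + adSymbol h𝒜 y := by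
  refine LinearMap.ext fun f => Subtype.ext ?_
  rw [LinearMap.add_apply, Submodule.coe_add, coe_adSymbol, coe_adSymbol, coe_adSymbol,
    Submodule.coe_add, ← smul_add, add_mul, mul_add]
  congr 1
  abel

theorem adSymbol_smul (c : ℂ) (x : symbols h𝒜 n) :
    adSymbol h𝒜 (c • x) = c • adSymbol h𝒜 x := by
  refine LinearMap.ext fun f => Subtype.ext ?_
  rw [LinearMap.smul_apply, Submodule.coe_smul, coe_adSymbol, coe_adSymbol,
    Submodule.coe_smul, smul_mul_assoc, mul_smul_comm, ← smul_sub, smul_comm]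

theorem adSymbol_adSymbol (x y f : symbols h𝒜 n) : adSymbol h𝒜 x (adSymbol h𝒜 y f) =
    adSymbol h𝒜 y (adSymbol h𝒜 x f) + adSymbol h𝒜 (adSymbol h𝒜 x y) f := by
  refine Subtype.ext ?_
  rw [Submodule.coe_add]
  simp only [coe_adSymbol]
  exact bracket_bracket _ _ _

/-- `f'` is the derivative of the symbol `f` in the direction `ω`. -/
def HasSymbolDeriv (ω : Fin n → ℝ) (f f' : symbols h𝒜 n) : Prop :=
  ∃ (m : ℝ) (g g' : (Fin n → ℝ) → 𝒜.cls m), IsBoundedSmooth (𝒜.seminorm m) g ∧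
    IsBoundedSmooth (𝒜.seminorm m) g' ∧ HasUniformDeriv (𝒜.seminorm m) ω g g' ∧
    (∀ θ, (g θ : SmoothEnd K₀) = (f : (Fin n → ℝ) → SmoothEnd K₀) θ) ∧
    ∀ θ, (g' θ : SmoothEnd K₀) = (f' : (Fin n → ℝ) → SmoothEnd K₀) θ

variable {h𝒜} {ω : Fin n → ℝ}

/-- Symbols of different orders have derivatives in different Fréchet spaces; raising both to a
common order makes them comparable. -/
theorem HasSymbolDeriv.exists_mono {f f' : symbols h𝒜 n} (h : HasSymbolDeriv h𝒜 ω f f') :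
    ∃ m, ∀ m' ≥ m, ∃ g g' : (Fin n → ℝ) → 𝒜.cls m', IsBoundedSmooth (𝒜.seminorm m') g ∧
    IsBoundedSmooth (𝒜.seminorm m') g' ∧ HasUniformDeriv (𝒜.seminorm m') ω g g' ∧
    (∀ θ, (g θ : SmoothEnd K₀) = (f : (Fin n → ℝ) → SmoothEnd K₀) θ) ∧
    ∀ θ, (g' θ : SmoothEnd K₀) = (f' : (Fin n → ℝ) → SmoothEnd K₀) θ := by
  obtain ⟨m, g, g', hg, hg', hgg', hf, hf'⟩ := h
  exact ⟨m, fun m' hm => ⟨_, _, hg.map (h𝒜.isBoundedMap_inclusion hm),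
    hg'.map (h𝒜.isBoundedMap_inclusion hm), hgg'.map (h𝒜.isBoundedMap_inclusion hm), hf, hf'⟩⟩

theorem HasSymbolDeriv.add {f f' g g' : symbols h𝒜 n} (hf : HasSymbolDeriv h𝒜 ω f f')
    (hg : HasSymbolDeriv h𝒜 ω g g') : HasSymbolDeriv h𝒜 ω (f + g) (f' + g') := by
  obtain ⟨m, hm⟩ := hf.exists_mono
  obtain ⟨m', hm'⟩ := hg.exists_mono
  obtain ⟨a, a', ha, ha', haa, haf, haf'⟩ := hm _ (le_max_left m m')
  obtain ⟨b, b', hb, hb', hbb, hbf, hbf'⟩ := hm' _ (le_max_right m m')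
  refine ⟨_, _, _, ha.add hb, ha'.add hb', haa.add hbb, fun θ => ?_, fun θ => ?_⟩
  · rw [Submodule.coe_add, haf, hbf]; rfl
  · rw [Submodule.coe_add, haf', hbf']; rfl

theorem HasSymbolDeriv.smul (c : ℂ) {f f' : symbols h𝒜 n} (hf : HasSymbolDeriv h𝒜 ω f f') :
    HasSymbolDeriv h𝒜 ω (c • f) (c • f') := by
  obtain ⟨m, a, a', ha, ha', haa, haf, haf'⟩ := hf
  refine ⟨_, _, _, ha.smul c, ha'.smul c, haa.map (isBoundedMap_smul c), fun θ => ?_, fun θ => ?_⟩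
  · rw [Submodule.coe_smul, haf]; rfl
  · rw [Submodule.coe_smul, haf']; rfl

theorem HasSymbolDeriv.ad {x x' f f' : symbols h𝒜 n} (hx : HasSymbolDeriv h𝒜 ω x x')
    (hf : HasSymbolDeriv h𝒜 ω f f') :
    HasSymbolDeriv h𝒜 ω (adSymbol h𝒜 x f) (adSymbol h𝒜 x' f + adSymbol h𝒜 x f') := by
  obtain ⟨m, a, a', ha, ha', haa, hax, hax'⟩ := hx
  obtain ⟨m', b, b', hb, hb', hbb, hbf, hbf'⟩ := hf
  have hB := h𝒜.isBoundedBilin_bracket (le_refl (m + m' - 1))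
  refine ⟨_, _, _, (IsBoundedSmooth.bilin hB ha hb).smul Complex.I,
    ((IsBoundedSmooth.bilin hB ha' hb).add (IsBoundedSmooth.bilin hB ha hb')).smul Complex.I,
    (HasUniformDeriv.bilin hB haa hbb ha.bounded ha'.bounded hb.bounded hb'.bounded).map
      (isBoundedMap_smul Complex.I), fun θ => ?_, fun θ => ?_⟩
  · rw [Submodule.coe_smul, h𝒜.coe_bracket, hax, hbf]; rfl
  · rw [Submodule.coe_smul, Submodule.coe_add, h𝒜.coe_bracket, h𝒜.coe_bracket, hax, hbf, hax', hbf',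
      smul_add]
    rfl

theorem HasSymbolDeriv.unique (hK₀ : IsPositiveSelfAdjoint K₀) {f f' f'' : symbols h𝒜 n}
    (h : HasSymbolDeriv h𝒜 ω f f') (h' : HasSymbolDeriv h𝒜 ω f f'') : f' = f'' := by
  obtain ⟨m, hm⟩ := h.exists_mono
  obtain ⟨m', hm'⟩ := h'.exists_mono
  obtain ⟨a, a', ha, ha', haa, haf, haf'⟩ := hm _ (le_max_left m m')
  obtain ⟨b, b', hb, hb', hbb, hbf, hbf'⟩ := hm' _ (le_max_right m m')
  have h1 : a = b := funext fun θ => Subtype.ext ((haf θ).trans (hbf θ).symm)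
  subst h1
  have h2 := haa.unique (fun x => h𝒜.eq_zero hK₀ x) hbb
  refine Subtype.ext (funext fun θ => ?_)
  rw [← haf', ← hbf', h2]

theorem exists_hasSymbolDeriv (hK₀ : IsPositiveSelfAdjoint K₀) (ω : Fin n → ℝ) {m : ℝ}
    {f : symbols h𝒜 n} (hf : (f : (Fin n → ℝ) → SmoothEnd K₀) ∈ symbolClass 𝒜 n m) :
    ∃ f' : symbols h𝒜 n, HasSymbolDeriv h𝒜 ω f f' ∧
      (f' : (Fin n → ℝ) → SmoothEnd K₀) ∈ symbolClass 𝒜 n m := by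
  obtain ⟨g, hg, hgf, hper⟩ := hf
  have hs : ∀ a : 𝒜.cls m, (∀ j, 𝒜.seminorm m j a = 0) → a = 0 := fun a => h𝒜.eq_zero hK₀ a
  obtain ⟨g', hgg', hg'⟩ := hg.exists_deriv hs ω
  have hmem : (fun θ => (g' θ : SmoothEnd K₀)) ∈ symbolClass 𝒜 n m := by
    refine ⟨g', hg', fun _ => rfl, fun θ i => ?_⟩
    dsimp only
    rw [hgg'.periodic hs fun x => Subtype.ext (by rw [hgf, hgf, hper])]
  exact ⟨⟨_, m, hmem⟩, ⟨m, g, g', hg, hg', hgg', hgf, fun _ => rfl⟩, hmem⟩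

/-- The derivative of symbols in the direction `ω`. -/
def derivSymbol (h𝒜 : 𝒜.IsGradedLieAlgebra) (hK₀ : IsPositiveSelfAdjoint K₀) (ω : Fin n → ℝ) :
    Module.End ℂ (symbols h𝒜 n) :=
  have h : ∀ f : symbols h𝒜 n, ∃ f', HasSymbolDeriv h𝒜 ω f f' := fun f => by
    obtain ⟨m, hm⟩ := f.2
    obtain ⟨f', hf', -⟩ := exists_hasSymbolDeriv hK₀ ω hm
    exact ⟨f', hf'⟩
  { toFun := fun f => (h f).choose
    map_add' := fun f g => (h (f + g)).choose_spec.unique hK₀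
      ((h f).choose_spec.add (h g).choose_spec)
    map_smul' := fun c f => (h (c • f)).choose_spec.unique hK₀ ((h f).choose_spec.smul c) }

theorem hasSymbolDeriv (hK₀ : IsPositiveSelfAdjoint K₀) (ω : Fin n → ℝ) (f : symbols h𝒜 n) :
    HasSymbolDeriv h𝒜 ω f (derivSymbol h𝒜 hK₀ ω f) :=
  Exists.choose_spec (p := fun f' => HasSymbolDeriv h𝒜 ω f f') _

theorem derivSymbol_mem (hK₀ : IsPositiveSelfAdjoint K₀) (ω : Fin n → ℝ) {m : ℝ}
    {f : symbols h𝒜 n} (hf : (f : (Fin n → ℝ) → SmoothEnd K₀) ∈ symbolClass 𝒜 n m) :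
    (derivSymbol h𝒜 hK₀ ω f : (Fin n → ℝ) → SmoothEnd K₀) ∈ symbolClass 𝒜 n m := by
  obtain ⟨f', hf', hm⟩ := exists_hasSymbolDeriv hK₀ ω hf
  rwa [(hasSymbolDeriv hK₀ ω f).unique hK₀ hf']

theorem derivSymbol_adSymbol (hK₀ : IsPositiveSelfAdjoint K₀) (ω : Fin n → ℝ)
    (x f : symbols h𝒜 n) : derivSymbol h𝒜 hK₀ ω (adSymbol h𝒜 x f) =
      adSymbol h𝒜 (derivSymbol h𝒜 hK₀ ω x) f + adSymbol h𝒜 x (derivSymbol h𝒜 hK₀ ω f) :=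
  (hasSymbolDeriv hK₀ ω _).unique hK₀ ((hasSymbolDeriv hK₀ ω x).ad (hasSymbolDeriv hK₀ ω f))

theorem derivSymbol_const (hK₀ : IsPositiveSelfAdjoint K₀) (ω : Fin n → ℝ) {m : ℝ}
    {a : SmoothEnd K₀} (ha : a ∈ 𝒜.cls m) :
    derivSymbol h𝒜 hK₀ ω ⟨_, m, const_mem_symbolClass ha⟩ = 0 :=
  (hasSymbolDeriv hK₀ ω _).unique hK₀ ⟨m, fun _ => ⟨a, ha⟩, fun _ => 0, .const _, .const _,
    .const ω _, fun _ => rfl, fun _ => rfl⟩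

end Symbols

/-! ### Truncated exponentials -/

section TruncatedExp

variable {V : Type*} [AddCommGroup V] [Module ℂ V] {D : V →ₗ[ℂ] V} {L : ℕ → V →ₗ[ℂ] V}

/-- Leibniz' formula: the L l are the iterated commutators with D, and moving an operator through
D^q distributes the q factors between powers of D and commutators. -/
theorem apply_iterate_eq_sum (h : ∀ l f, L l (D f) = D (L l f) + L (l + 1) f) (q l : ℕ) (f : V) :
    L l (D^[q] f) = ∑ x ∈ Finset.HasAntidiagonal.antidiagonal q, q.choose x.1 • D^[x.1] (L (l + x.2) f) := by
  induction q generalizing f with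
  | zero => simp
  | succ q ih =>
    rw [Finset.sum_antidiagonal_choose_succ_nsmul (fun i j => D^[i] (L (l + j) f)) q,
      Function.iterate_succ_apply, ih, ← Finset.sum_add_distrib]
    refine Finset.sum_congr rfl fun x hx => ?_
    have h1 : q.choose x.2 = q.choose x.1 := by
      rw [← Finset.HasAntidiagonal.mem_antidiagonal.1 hx, Nat.choose_symm_add]
    rw [h1, h, iterate_map_add, nsmul_add, add_comm, Function.iterate_succ_apply, add_assoc]

/-- The truncated exponential of `D`. -/
def truncatedExp (D : V →ₗ[ℂ] V) (Q : ℕ) (f : V) : V :=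
  ∑ q ∈ Finset.range (Q + 1), ((q.factorial : ℂ)⁻¹) • D^[q] f

/-- `L 0` is conjugated by the exponential of `D` to `∑ⱼ L j / j!`, up to a remainder. -/
theorem apply_truncatedExp_mem (h : ∀ l f, L l (D f) = D (L l f) + L (l + 1) f) (Q : ℕ) (f : V)
    (S : Submodule ℂ V)
    (h1 : ∀ i, D^[i] (∑ j ∈ Finset.range (Q + 1), ((j.factorial : ℂ)⁻¹) • L j f) ∈ S)
    (h2 : ∀ i j, Q < i + j → D^[i] (L j f) ∈ S) : L 0 (truncatedExp D Q f) ∈ S := by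
  set T : ℕ × ℕ → V := fun x =>
    ((x.1.factorial : ℂ)⁻¹ * (x.2.factorial : ℂ)⁻¹) • D^[x.1] (L x.2 f) with hT
  set B := Finset.range (Q + 1) ×ˢ Finset.range (Q + 1) with hB
  -- By Leibniz' formula the truncated exponential produces exactly the terms with i + j ≤ Q of the
  -- double series Σ D^i L_j f / (i! j!).
  have e1 : L 0 (truncatedExp D Q f) = ∑ x ∈ B with x.1 + x.2 ≤ Q, T x := by
    rw [truncatedExp, map_sum]
    rw [← Finset.sum_fiberwise_of_maps_to (s := B.filter fun x => x.1 + x.2 ≤ Q)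
      (t := Finset.range (Q + 1)) (g := fun x => x.1 + x.2)
      (fun x hx => Finset.mem_range.2 (Nat.lt_succ_of_le (Finset.mem_filter.1 hx).2))]
    refine Finset.sum_congr rfl fun q hq => ?_
    rw [map_smul, apply_iterate_eq_sum h, Finset.smul_sum]
    have e2 : (B.filter fun x => x.1 + x.2 ≤ Q).filter (fun x => x.1 + x.2 = q) =
        Finset.HasAntidiagonal.antidiagonal q := by
      ext x
      simp only [hB, Finset.mem_filter, Finset.mem_product, Finset.mem_range,
        Finset.HasAntidiagonal.mem_antidiagonal] at hq ⊢
      omega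
    rw [e2]
    refine Finset.sum_congr rfl fun x hx => ?_
    rw [hT, zero_add, ← Nat.cast_smul_eq_nsmul ℂ, smul_smul]
    congr 1
    rw [← Finset.HasAntidiagonal.mem_antidiagonal.1 hx, ← Nat.add_choose_mul_factorial_mul_factorial x.1 x.2]
    have f1 : (x.1.factorial : ℂ) ≠ 0 := by exact_mod_cast x.1.factorial_ne_zero
    have f2 : (x.2.factorial : ℂ) ≠ 0 := by exact_mod_cast x.2.factorial_ne_zero
    have f3 : ((x.1 + x.2).choose x.1 : ℂ) ≠ 0 := by
      exact_mod_cast (Nat.choose_pos (Nat.le_add_right _ _)).ne'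
    push_cast
    rw [Nat.choose_symm_add] at f3 ⊢
    field_simp
  -- Complete the triangle to a square. The square factors into powers of D applied to Σ L_j f / j!,
  -- and the added terms have i + j > Q.
  have e3 := Finset.sum_filter_add_sum_filter_not B (fun x => x.1 + x.2 ≤ Q) T
  rw [e1, eq_sub_of_add_eq e3]
  refine S.sub_mem ?_ (S.sum_mem fun x hx => S.smul_mem _ (h2 _ _ ?_))
  · rw [hB, Finset.sum_product]
    refine S.sum_mem fun i _ => ?_
    have e4 : ∑ j ∈ Finset.range (Q + 1), T (i, j) = ((i.factorial : ℂ)⁻¹) •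
        D^[i] (∑ j ∈ Finset.range (Q + 1), ((j.factorial : ℂ)⁻¹) • L j f) := by
      rw [← Module.End.pow_apply, map_sum, Finset.smul_sum]
      refine Finset.sum_congr rfl fun j _ => ?_
      rw [map_smul, smul_smul, Module.End.pow_apply]
    rw [e4]
    exact S.smul_mem _ (h1 i)
  · exact not_le.1 (Finset.mem_filter.1 hx).2

end TruncatedExp
end SobolevGrowth
end

noncomputable section
namespace SobolevGrowth
variable {H : Type*} [NormedAddCommGroup H] [InnerProductSpace ℂ H] [CompleteSpace H]

/-! ### Normal form -/

section NormalForm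

variable {K₀ : H →ₗ.[ℂ] H} {𝒜 : OperatorClasses K₀} {n : ℕ} (h𝒜 : 𝒜.IsGradedLieAlgebra)

/-- The symbols of order `m`, as a subspace of all symbols. -/
def ofOrder (n : ℕ) (m : ℝ) : Submodule ℂ (symbols h𝒜 n) :=
  (symbolClass 𝒜 n m).comap (symbols h𝒜 n).subtype

variable {h𝒜}

theorem ofOrder_mono {m m' : ℝ} (h : m ≤ m') : ofOrder h𝒜 n m ≤ ofOrder h𝒜 n m' :=
  fun _ hf => symbolClass_mono h𝒜 h hf

theorem adSymbol_mem_ofOrder {m m' q : ℝ} (hq : m + m' - 1 ≤ q) {x f : symbols h𝒜 n}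
    (hx : x ∈ ofOrder h𝒜 n m) (hf : f ∈ ofOrder h𝒜 n m') : adSymbol h𝒜 x f ∈ ofOrder h𝒜 n q :=
  adSymbol_mem h𝒜 hq hx hf

/-- A constant symbol. -/
def constSymbol (h𝒜 : 𝒜.IsGradedLieAlgebra) (n : ℕ) {m : ℝ} {a : SmoothEnd K₀} (ha : a ∈ 𝒜.cls m) :
    symbols h𝒜 n := ⟨_, m, const_mem_symbolClass ha⟩

theorem constSymbol_mem {m : ℝ} {a : SmoothEnd K₀} (ha : a ∈ 𝒜.cls m) :
    constSymbol h𝒜 n ha ∈ ofOrder h𝒜 n m := const_mem_symbolClass ha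

variable (hK₀ : IsPositiveSelfAdjoint K₀) (ω : Fin n → ℝ)

/-- The operator `f ↦ ω·∂f + i [A, f]`. -/
def liouville (A : symbols h𝒜 n) : symbols h𝒜 n →ₗ[ℂ] symbols h𝒜 n :=
  derivSymbol h𝒜 hK₀ ω + adSymbol h𝒜 A

theorem liouville_apply (A f : symbols h𝒜 n) :
    liouville hK₀ ω A f = derivSymbol h𝒜 hK₀ ω f + adSymbol h𝒜 A f := rfl

theorem liouville_mem {A f : symbols h𝒜 n} {m : ℝ} (hA : A ∈ ofOrder h𝒜 n 1)
    (hf : f ∈ ofOrder h𝒜 n m) : liouville hK₀ ω A f ∈ ofOrder h𝒜 n m :=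
  Submodule.add_mem _ (derivSymbol_mem hK₀ ω hf) (adSymbol_mem_ofOrder (by linarith) hA hf)

/-- The iterated commutators of `A` with `X`. -/
def iteratedBracket (A X : symbols h𝒜 n) : ℕ → symbols h𝒜 n
  | 0 => liouville hK₀ ω A X
  | l + 1 => adSymbol h𝒜 (iteratedBracket A X l) X

/-- The iterated commutators of the operator `liouville A` with `adSymbol X`. -/
def iteratedCommutator (A X : symbols h𝒜 n) : ℕ → symbols h𝒜 n →ₗ[ℂ] symbols h𝒜 n
  | 0 => liouville hK₀ ω A
  | l + 1 => adSymbol h𝒜 (iteratedBracket hK₀ ω A X l)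

theorem iteratedCommutator_apply (A X : symbols h𝒜 n) (l : ℕ) (f : symbols h𝒜 n) :
    iteratedCommutator hK₀ ω A X l (adSymbol h𝒜 X f) =
      adSymbol h𝒜 X (iteratedCommutator hK₀ ω A X l f) + iteratedCommutator hK₀ ω A X (l + 1) f := by
  cases l with
  | zero =>
    change liouville hK₀ ω A _ = adSymbol h𝒜 X (liouville hK₀ ω A f) +
      adSymbol h𝒜 (liouville hK₀ ω A X) f
    rw [liouville_apply, liouville_apply, liouville_apply, derivSymbol_adSymbol, adSymbol_adSymbol,
      adSymbol_add, LinearMap.add_apply, map_add]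
    abel
  | succ l => exact adSymbol_adSymbol h𝒜 _ _ _

variable {hK₀ ω}

/-- Since X has order at most 1 - η, each bracket with it lowers the order by η. -/
theorem iteratedBracket_mem {A X : symbols h𝒜 n} {m η : ℝ} (hA : A ∈ ofOrder h𝒜 n 1)
    (hX : X ∈ ofOrder h𝒜 n m) (hm : m ≤ 1 - η) (l : ℕ) :
    iteratedBracket hK₀ ω A X l ∈ ofOrder h𝒜 n (m - l * η) := by
  induction l with
  | zero => simpa using! liouville_mem hK₀ ω hA hX
  | succ l ih =>
    refine adSymbol_mem_ofOrder ?_ ih hX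
    push_cast
    linarith

theorem iteratedCommutator_mem {A X f : symbols h𝒜 n} {m η q : ℝ} (hA : A ∈ ofOrder h𝒜 n 1)
    (hX : X ∈ ofOrder h𝒜 n m) (hm : m ≤ 1 - η) (hf : f ∈ ofOrder h𝒜 n q) (l : ℕ) :
    iteratedCommutator hK₀ ω A X l f ∈ ofOrder h𝒜 n (q - l * η) := by
  cases l with
  | zero => simpa using! liouville_mem hK₀ ω hA hf
  | succ l =>
    refine adSymbol_mem_ofOrder ?_ (iteratedBracket_mem hA hX hm l) hf
    push_cast
    linarith

theorem iterate_adSymbol_mem {X f : symbols h𝒜 n} {m η q : ℝ} (hX : X ∈ ofOrder h𝒜 n m)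
    (hm : m ≤ 1 - η) (hf : f ∈ ofOrder h𝒜 n q) (l : ℕ) :
    (adSymbol h𝒜 X)^[l] f ∈ ofOrder h𝒜 n (q - l * η) := by
  induction l with
  | zero => simpa using! hf
  | succ l ih =>
    rw [Function.iterate_succ_apply']
    refine adSymbol_mem_ofOrder ?_ hX ih
    push_cast
    linarith

/-- Conjugation by the exponential of `ad X` replaces `A` by `A + ω·∂X + i [A, X]`, up to terms of
lower order. -/
theorem exists_conjugation {A X : symbols h𝒜 n} {m η : ℝ} (hη : 0 < η) (hA : A ∈ ofOrder h𝒜 n 1)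
    (hX : X ∈ ofOrder h𝒜 n m) (hm : m ≤ 1 - η) (M : ℝ) :
    ∃ A' : symbols h𝒜 n, A' - A - liouville hK₀ ω A X ∈ ofOrder h𝒜 n (m - η) ∧
      ∀ E' ∈ ofOrder h𝒜 n M, liouville hK₀ ω A' E' ∈ ofOrder h𝒜 n 0 →
        ∃ E, E - E' ∈ ofOrder h𝒜 n (M - η) ∧ liouville hK₀ ω A E ∈ ofOrder h𝒜 n 0 := by
  -- Enough terms that the discarded ones, with more than Q brackets on a symbol of order M, have
  -- order at most 0.
  obtain ⟨Q, hQ⟩ : ∃ Q : ℕ, M ≤ Q * η := by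
    obtain ⟨Q, hQ⟩ := exists_nat_ge (M / η)
    exact ⟨Q, by rwa [div_le_iff₀ hη] at hQ⟩
  set y := iteratedBracket hK₀ ω A X with hy
  set L := iteratedCommutator hK₀ ω A X with hL
  -- The truncated expansion of the conjugated operator. The commutators of ad X with the Liouville
  -- operator of A are the inner derivations by the y j, shifted by one index, whence (j + 1)!.
  refine ⟨A + ∑ j ∈ Finset.range (Q + 1), (((j + 1).factorial : ℂ)⁻¹) • y j, ?_,
    fun E' hE' hLE' => ⟨truncatedExp (adSymbol h𝒜 X) (Q + 1) E', ?_, ?_⟩⟩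
  · have h0 : (((0 + 1).factorial : ℂ)⁻¹) • y 0 = liouville hK₀ ω A X := by
      rw [zero_add, Nat.factorial_one, Nat.cast_one, inv_one, one_smul]; rfl
    have h1 : A + ∑ j ∈ Finset.range (Q + 1), (((j + 1).factorial : ℂ)⁻¹) • y j - A -
        liouville hK₀ ω A X =
        ∑ j ∈ Finset.range Q, (((j + 1 + 1).factorial : ℂ)⁻¹) • y (j + 1) := by
      rw [Finset.sum_range_succ', h0]
      abel
    rw [h1]
    refine Submodule.sum_mem _ fun j _ => Submodule.smul_mem _ _ ?_
    refine ofOrder_mono ?_ (iteratedBracket_mem hA hX hm (j + 1))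
    push_cast
    have : 0 ≤ (j : ℝ) * η := by positivity
    linarith
  · have h0 : (((0 : ℕ).factorial : ℂ)⁻¹) • (adSymbol h𝒜 X)^[0] E' = E' := by
      rw [Nat.factorial_zero, Nat.cast_one, inv_one, one_smul]; rfl
    have h1 : truncatedExp (V := ↥(symbols h𝒜 n)) (adSymbol h𝒜 X) (Q + 1) E' - E' =
        ∑ j ∈ Finset.range (Q + 1),
          (((j + 1).factorial : ℂ)⁻¹) • (adSymbol (n := n) h𝒜 X)^[j + 1] E' := by
      rw [truncatedExp, Finset.sum_range_succ', h0]
      abel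
    rw [h1]
    refine Submodule.sum_mem _ fun j _ => Submodule.smul_mem _ _ ?_
    refine ofOrder_mono ?_ (iterate_adSymbol_mem hX hm hE' (j + 1))
    push_cast
    have : 0 ≤ (j : ℝ) * η := by positivity
    linarith
  -- Both kinds of error have order at most 0: powers of ad X applied to the Liouville image of E',
  -- and the terms beyond the truncation.
  · refine apply_truncatedExp_mem (L := L) (iteratedCommutator_apply hK₀ ω A X) (Q + 1) E'
      (ofOrder h𝒜 n 0) (fun i => ?_) fun i j hij => ?_
    · have h1 : ∑ j ∈ Finset.range (Q + 1 + 1), ((j.factorial : ℂ)⁻¹) • L j E' =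
          liouville hK₀ ω (A + ∑ j ∈ Finset.range (Q + 1), (((j + 1).factorial : ℂ)⁻¹) • y j) E' := by
        have h2 : ∀ s : Finset ℕ, adSymbol h𝒜 (∑ j ∈ s, (((j + 1).factorial : ℂ)⁻¹) • y j) E' =
            ∑ j ∈ s, (((j + 1).factorial : ℂ)⁻¹) • adSymbol h𝒜 (y j) E' := by
          intro s
          induction s using Finset.induction_on with
          | empty =>
            refine Subtype.ext ?_
            rw [Finset.sum_empty, Finset.sum_empty, coe_adSymbol, Submodule.coe_zero, zero_mul,
              mul_zero, sub_zero, smul_zero]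
          | insert a s ha ih =>
            rw [Finset.sum_insert ha, Finset.sum_insert ha, adSymbol_add, LinearMap.add_apply, ih,
              adSymbol_smul, LinearMap.smul_apply]
        rw [Finset.sum_range_succ', liouville_apply, adSymbol_add, LinearMap.add_apply, h2,
          Nat.factorial_zero, Nat.cast_one, inv_one, one_smul]
        change _ + liouville hK₀ ω A E' = _
        rw [liouville_apply, add_comm, add_assoc]
        rfl
      rw [h1]
      refine ofOrder_mono ?_ (iterate_adSymbol_mem hX hm hLE' i)
      have : 0 ≤ (i : ℝ) * η := by positivity
      linarith
    · refine ofOrder_mono ?_ (iterate_adSymbol_mem hX hm (iteratedCommutator_mem hA hX hm hE' j) i)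
      have h1 : ((Q : ℝ) + 1) * η ≤ ((i : ℝ) + j) * η := by
        refine mul_le_mul_of_nonneg_right ?_ hη.le
        exact_mod_cast hij.le
      linarith

/-- The homological equation for symbols, as an assumption on the reference operator. -/
def IsHomological (hK₀ : IsPositiveSelfAdjoint K₀) (ω : Fin n → ℝ) (Λ : symbols h𝒜 n)
    (h : SmoothEnd K₀) : Prop :=
  ∀ m, ∀ V ∈ ofOrder h𝒜 n m, ∃ X ∈ ofOrder h𝒜 n m, ∃ (Z : SmoothEnd K₀) (hZ : Z ∈ 𝒜.cls m),
    Commute Z h ∧ liouville hK₀ ω Λ X = constSymbol h𝒜 n hZ - V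

/-- Induction on the number N of conjugations still available; the condition relating m and N says
that after N gains of 1 - ρ the order of V is at most 1 - M. A round solves the homological
equation, moves the resonant part Z' into Z, and pulls the energy of the new Hamiltonian back
through the truncated exponential. -/
theorem exists_normalForm {h : SmoothEnd K₀} (hh : h ∈ 𝒜.cls 1)
    (hhom : IsHomological hK₀ ω (constSymbol h𝒜 n hh) h) {ρ : ℝ} (hρ : ρ < 1) {M : ℕ}
    (hM : h ^ M ∈ 𝒜.cls M) (N : ℕ) {m : ℝ} (hm : m ≤ ρ) (hmN : m ≤ 1 - M + N * (1 - ρ))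
    {Z : SmoothEnd K₀} (hZ : Z ∈ 𝒜.cls ρ) (hZh : Commute Z h) {V : symbols h𝒜 n}
    (hV : V ∈ ofOrder h𝒜 n m) :
    ∃ E : symbols h𝒜 n, E - constSymbol h𝒜 n hM ∈ ofOrder h𝒜 n (M - (1 - ρ)) ∧
      liouville hK₀ ω (constSymbol h𝒜 n hh + constSymbol h𝒜 n hZ + V) E ∈ ofOrder h𝒜 n 0 := by
  have hη : 0 < 1 - ρ := sub_pos.2 hρ
  induction N generalizing m Z V with
  | zero =>
    -- When V has order at most 1 - M, the power h^M is itself the energy: it is constant and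
    -- commutes with h + Z, and its bracket with V has order at most 0.
    refine ⟨constSymbol h𝒜 n hM, ?_, ?_⟩
    · have h0 : constSymbol h𝒜 n hM - constSymbol h𝒜 n hM = 0 := by abel
      rw [h0]; exact Submodule.zero_mem _
    · have h1 : derivSymbol h𝒜 hK₀ ω (constSymbol h𝒜 n hM) = 0 := derivSymbol_const hK₀ ω hM
      have h2 : adSymbol h𝒜 (constSymbol h𝒜 n hh + constSymbol h𝒜 n hZ) (constSymbol h𝒜 n hM) = 0 := by
        refine Subtype.ext (funext fun θ => ?_)
        have h3 : Commute (h + Z) (h ^ M) := ((Commute.refl h).add_left hZh).pow_right M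
        exact (congrArg (Complex.I • ·) (sub_eq_zero.2 h3.eq)).trans (smul_zero _)
      rw [liouville_apply, h1, adSymbol_add, LinearMap.add_apply, h2, zero_add, zero_add]
      refine adSymbol_mem_ofOrder ?_ hV (constSymbol_mem hM)
      push_cast at hmN
      linarith
  | succ N ih =>
    obtain ⟨X, hX, Z', hZ', hZ'h, hXZ⟩ := hhom m V hV
    have hA : constSymbol h𝒜 n hh + constSymbol h𝒜 n hZ + V ∈ ofOrder h𝒜 n 1 :=
      Submodule.add_mem _ (Submodule.add_mem _ (constSymbol_mem hh)
        (ofOrder_mono hρ.le (constSymbol_mem hZ))) (ofOrder_mono (hm.trans hρ.le) hV)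
    obtain ⟨A', hA', hE⟩ := exists_conjugation (hK₀ := hK₀) (ω := ω) hη hA hX (by linarith) M
    have hZZ : Z + Z' ∈ 𝒜.cls ρ := Submodule.add_mem _ hZ (h𝒜.cls_mono hm hZ')
    set V' := A' - (constSymbol h𝒜 n hh + constSymbol h𝒜 n hZZ) with hV'd
    have hV' : V' ∈ ofOrder h𝒜 n (m - (1 - ρ)) := by
      -- By the homological equation, the first order term of the conjugation is Z' - V plus the
      -- bracket of Z + V with X. The first part cancels V; the bracket and the higher terms have
      -- order m - (1 - ρ).
      have h1 : V' = (A' - (constSymbol h𝒜 n hh + constSymbol h𝒜 n hZ + V) -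
          liouville hK₀ ω (constSymbol h𝒜 n hh + constSymbol h𝒜 n hZ + V) X) +
          adSymbol h𝒜 (constSymbol h𝒜 n hZ + V) X := by
        have h2 : liouville hK₀ ω (constSymbol h𝒜 n hh + constSymbol h𝒜 n hZ + V) X =
            (constSymbol h𝒜 n hZ' - V) + adSymbol h𝒜 (constSymbol h𝒜 n hZ + V) X := by
          rw [← hXZ, liouville_apply, liouville_apply, add_assoc (constSymbol h𝒜 n hh), adSymbol_add,
            LinearMap.add_apply, add_assoc]
        have h3 : constSymbol h𝒜 n hZZ = constSymbol h𝒜 n hZ + constSymbol h𝒜 n hZ' := rfl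
        rw [h2, hV'd, h3]
        abel
      rw [h1]
      exact Submodule.add_mem _ hA' (adSymbol_mem_ofOrder (by linarith)
        (Submodule.add_mem _ (constSymbol_mem hZ) (ofOrder_mono hm hV)) hX)
    obtain ⟨E', hE', hLE'⟩ := ih (by linarith) (by push_cast at hmN; linarith) hZZ (hZh.add_left hZ'h) hV'
    have hA'V : constSymbol h𝒜 n hh + constSymbol h𝒜 n hZZ + V' = A' := by rw [hV'd]; abel
    rw [hA'V] at hLE'
    have hE'M : E' ∈ ofOrder h𝒜 n M := by
      have h1 := Submodule.add_mem _ (ofOrder_mono (by linarith) hE') (constSymbol_mem (h𝒜 := h𝒜) (n := n) hM)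
      have h2 : E' - constSymbol h𝒜 n hM + constSymbol h𝒜 n hM = E' := by abel
      rwa [h2] at h1
    obtain ⟨E, hEE', hLE⟩ := hE E' hE'M hLE'
    refine ⟨E, ?_, hLE⟩
    have h1 := Submodule.add_mem _ hEE' hE'
    have h2 : E - E' + (E' - constSymbol h𝒜 n hM) = E - constSymbol h𝒜 n hM := by abel
    rwa [h2] at h1

end NormalForm

/-! ### The homological equation for symbols of the commuting system -/

section Homological

variable {K₀ : H →ₗ.[ℂ] H} {𝒜 : OperatorClasses K₀} {d : ℕ} {k : Fin d → SmoothEnd K₀}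

/-- The abstract homological equation for the conjugation action, whose generator in the direction ν
is i[ν·K, ·]. Vanishing of this generator on Z is the commutation of Z with ν·K. -/
theorem IsCommutingSystem.isHomological (hk : IsCommutingSystem 𝒜 k) {n e : ℕ} {ω : Fin n → ℝ}
    {ν' : Fin e → ℝ} (hDio : IsDiophantine ω ν') {v : Fin e → Fin d → ℤ} {ν : Fin d → ℝ}
    (hv : ∀ j, ν j = ∑ i, ν' i * (v i j : ℝ)) {c : Fin d → ℂ}
    (hper : ∀ j, hk.expOp ((2 * Real.pi) • Pi.single j (1 : ℝ)) = c j • 1) :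
    IsHomological hk.pos ω (constSymbol hk.graded n (dotOp_mem hk.mem ν)) (dotOp ν k) := by
  rintro m V ⟨g, hg, hgV, hVper⟩
  have hν : ∑ i, ν' i • (fun j => (v i j : ℝ)) = ν := by
    funext j
    rw [hv, Finset.sum_apply]
    rfl
  obtain ⟨X, Z, hX, hXper, hXd, hZ⟩ := (hk.isSmoothAction m).exists_homological
    (hk.graded.isSeqComplete m) (hk.graded.isSeparated hk.pos m) (v := fun i j => (v i j : ℝ))
    (fun i a => hk.conj_lattice hper (v i) a) (one_le_of_isDiophantine hDio) hg
    (fun θ i => Subtype.ext (by rw [hgV, hgV]; exact hVper θ i))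
  rw [hν] at hXd hZ
  have hXm : (fun θ => (X θ : SmoothEnd K₀)) ∈ symbolClass 𝒜 n m :=
    ⟨X, hX, fun _ => rfl, fun θ i => by dsimp only; rw [hXper]⟩
  set Xs : symbols hk.graded n := ⟨_, m, hXm⟩ with hXs
  have hd : derivSymbol hk.graded hk.pos ω Xs = V - constSymbol hk.graded n Z.2 -
      adSymbol hk.graded (constSymbol hk.graded n (dotOp_mem hk.mem ν)) Xs := by
    refine (hasSymbolDeriv hk.pos ω Xs).unique hk.pos ?_
    obtain ⟨X', hX', hX's⟩ := hX.exists_deriv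
      (fun a => hk.graded.eq_zero hk.pos a) ω
    have hX'e := hX'.unique (fun a => hk.graded.eq_zero hk.pos a) hXd
    refine ⟨m, X, X', hX, hX's, hX', fun _ => rfl, fun θ => ?_⟩
    rw [hX'e, AddSubgroupClass.coe_sub, AddSubgroupClass.coe_sub, hgV, hk.coe_deriv]
    rfl
  -- The sign is reversed because the abstract equation has right side V - Z.
  refine ⟨-Xs, Submodule.neg_mem _ hXm, Z, Z.2, ?_, ?_⟩
  · have h1 := congrArg Subtype.val hZ
    rw [hk.coe_deriv] at h1
    have h2 := (smul_eq_zero.1 h1).resolve_left Complex.I_ne_zero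
    exact (sub_eq_zero.1 h2).symm
  · refine (map_neg (liouville hk.pos ω _) Xs).trans ?_
    rw [liouville_apply, hd]
    abel

end Homological
end SobolevGrowth
end

noncomputable section
namespace SobolevGrowth
variable {H : Type*} [NormedAddCommGroup H] [InnerProductSpace ℂ H] [CompleteSpace H]

/-! ### Energy estimates -/

section Energy

variable {K₀ : H →ₗ.[ℂ] H} {𝒜 : OperatorClasses K₀} {n : ℕ} {hK₀ : IsPositiveSelfAdjoint K₀}

theorem OperatorClasses.IsGradedLieAlgebra.norm_family_le (h𝒜 : 𝒜.IsGradedLieAlgebra)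
    (hK₀ : IsPositiveSelfAdjoint K₀) {X : Type*} {m : ℝ} {g : X → 𝒜.cls m}
    (hg : IsBoundedFamily (𝒜.seminorm m) g) (r : ℝ) : ∃ C : ℝ, 0 ≤ C ∧
    ∀ x (u : smoothVectors K₀), ‖(smoothPow hK₀ r ((g x : SmoothEnd K₀) u) : H)‖ ≤
      C * ‖(smoothPow hK₀ (r + m) u : H)‖ := by
  obtain ⟨N, C, hC0, hC⟩ := h𝒜.norm_le hK₀ m r
  obtain ⟨B, hB0, hB⟩ := hg.seminormSum N
  refine ⟨C * B, mul_nonneg hC0 hB0, fun x u => (hC _ u).trans ?_⟩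
  have := hB x
  gcongr

/-- The product rule for a family of operators applied to a curve. -/
theorem HasUniformDeriv.hasDerivAt_apply (h𝒜 : 𝒜.IsGradedLieAlgebra) {E : Type*} [AddCommGroup E]
    [Module ℝ E] {m : ℝ} {w : E} {g g' : E → 𝒜.cls m} (hg : HasUniformDeriv (𝒜.seminorm m) w g g')
    {y : ℝ → smoothVectors K₀} {y' : smoothVectors K₀} {t : ℝ} (hy : HasSmoothDerivAt hK₀ y y' t) :
    HasDerivAt (fun t => ((g (t • w) : SmoothEnd K₀) (y t) : H))
      (((g' (t • w) : SmoothEnd K₀) (y t) : H) + ((g (t • w) : SmoothEnd K₀) y' : H)) t := by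
  obtain ⟨N, C, hC0, hC⟩ := h𝒜.norm_le hK₀ m 0
  obtain ⟨B, hB0, hB⟩ : ∃ B : ℝ, 0 ≤ B ∧ ∀ s : ℝ, SobolevGrowth.seminormSum (𝒜.seminorm m) N
      (g (s • w) - g (t • w) - ((s - t : ℝ) : ℂ) • g' (t • w)) ≤ B * (s - t) ^ 2 := by
    choose B hB0 hB using hg.nonneg
    refine ⟨∑ i ∈ Finset.range N, B i, Finset.sum_nonneg fun _ _ => hB0 _, fun s => ?_⟩
    rw [seminormSum_apply, Finset.sum_mul]
    refine Finset.sum_le_sum fun i _ => ?_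
    have h1 := hB i (t • w) (s - t)
    rwa [← add_smul, add_sub_cancel] at h1
  -- The Taylor remainder of the operator family, applied to the moving vector, is O((s - t)²),
  -- because the vector stays bounded in ℋ^m. The rest is the affine family with fixed operators.
  have h1 : HasDerivAt (fun s => (((g (s • w) - g (t • w) - ((s - t : ℝ) : ℂ) • g' (t • w) :
      𝒜.cls m) : SmoothEnd K₀) (y s) : H)) 0 t := by
    rw [hasDerivAt_iff_hasFDerivAt]
    have h2 : (fun s => (((g (s • w) - g (t • w) - ((s - t : ℝ) : ℂ) • g' (t • w) :
        𝒜.cls m) : SmoothEnd K₀) (y s) : H)) =O[𝓝 t] fun s => ‖s - t‖ ^ 2 := by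
      have h3 := (hy m).continuousAt.norm.eventually_lt_const (lt_add_one _)
      refine Asymptotics.IsBigO.of_bound (C * B * (‖(smoothPow hK₀ m (y t) : H)‖ + 1)) ?_
      filter_upwards [h3] with s hs
      have h4 := hC (g (s • w) - g (t • w) - ((s - t : ℝ) : ℂ) • g' (t • w)) (y s)
      rw [smoothPow_zero, zero_add] at h4
      refine h4.trans ?_
      rw [norm_pow, norm_norm, Real.norm_eq_abs, sq_abs]
      calc _ ≤ C * (B * (s - t) ^ 2) * (‖(smoothPow hK₀ m (y t) : H)‖ + 1) := by
            have := hB s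
            have := hs.le
            gcongr
        _ = _ := by ring
    have h5 := h2.hasFDerivAt (𝕜 := ℝ) one_lt_two
    simpa using! h5
  have ha : ∀ s, ∀ r, ∃ C : ℝ, ∀ u, ‖(smoothPow hK₀ r ((g s : SmoothEnd K₀) u) : H)‖ ≤
      C * ‖(smoothPow hK₀ (r + m) u : H)‖ := fun s => hasOrder_of_mem h𝒜 hK₀ (g s).2
  have ha' : ∀ s, ∀ r, ∃ C : ℝ, ∀ u, ‖(smoothPow hK₀ r ((g' s : SmoothEnd K₀) u) : H)‖ ≤
      C * ‖(smoothPow hK₀ (r + m) u : H)‖ := fun s => hasOrder_of_mem h𝒜 hK₀ (g' s).2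
  have h6 := (hy.map hK₀ (ha (t • w))).coe hK₀
  have h7 := ((hasDerivAt_id t).sub_const t).smul ((hy.map hK₀ (ha' (t • w))).coe hK₀)
  refine ((h1.add (h7.add h6)).congr_deriv ?_).congr_of_eventuallyEq
    (Eventually.of_forall fun s => ?_)
  · simp
  · simp only [Pi.add_apply, Pi.smul_apply', id]
    have h8 : ((g (s • w) - g (t • w) - ((s - t : ℝ) : ℂ) • g' (t • w) : 𝒜.cls m) :
      SmoothEnd K₀) = (g (s • w) : SmoothEnd K₀) - g (t • w) - ((s - t : ℝ) : ℂ) • g' (t • w) := rfl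
    rw [h8]
    rw [LinearMap.sub_apply, LinearMap.sub_apply, LinearMap.smul_apply, AddSubgroupClass.coe_sub,
      AddSubgroupClass.coe_sub, Submodule.coe_smul, Complex.coe_smul]
    abel

/-- The time derivative of the expectation of a symbol is the expectation of its image under the
Liouville operator. -/
theorem IsTameFamily.hasDerivAt_inner (h𝒜 : 𝒜.IsGradedLieAlgebra) {ω : Fin n → ℝ}
    {A : symbols h𝒜 n}
    (hh : IsTameFamily hK₀ fun t => (A : (Fin n → ℝ) → SmoothEnd K₀) (t • ω)) (E : symbols h𝒜 n)
    (t s : ℝ) (u : smoothVectors K₀) :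
    HasDerivAt (fun t => inner ℂ (hh.evolution t s u : H)
        ((E : (Fin n → ℝ) → SmoothEnd K₀) (t • ω) (hh.evolution t s u) : H))
      (inner ℂ (hh.evolution t s u : H) ((liouville hK₀ ω A E : (Fin n → ℝ) → SmoothEnd K₀) (t • ω)
        (hh.evolution t s u) : H)) t := by
  obtain ⟨m, g, g', -, -, hgg', hgE, hgE'⟩ := hasSymbolDeriv hK₀ ω E
  have hy := hh.hasSmoothDerivAt_evolution s u t
  have h1 := (hy.coe hK₀).inner ℂ (hgg'.hasDerivAt_apply h𝒜 hy)
  simp only [hgE, hgE'] at h1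
  refine h1.congr_deriv ?_
  have h2 : (liouville hK₀ ω A E : (Fin n → ℝ) → SmoothEnd K₀) (t • ω) =
      (derivSymbol h𝒜 hK₀ ω E : (Fin n → ℝ) → SmoothEnd K₀) (t • ω) + Complex.I •
      ((A : (Fin n → ℝ) → SmoothEnd K₀) (t • ω) * (E : (Fin n → ℝ) → SmoothEnd K₀) (t • ω) -
        (E : (Fin n → ℝ) → SmoothEnd K₀) (t • ω) * (A : (Fin n → ℝ) → SmoothEnd K₀) (t • ω)) := rfl
  have h3 := hh.symm t (hh.evolution t s u)
    ((E : (Fin n → ℝ) → SmoothEnd K₀) (t • ω) (hh.evolution t s u))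
  rw [h2]
  simp only [LinearMap.add_apply, LinearMap.smul_apply, LinearMap.sub_apply, Module.End.mul_apply,
    Submodule.coe_add, Submodule.coe_smul, AddSubgroupClass.coe_sub, inner_add_right,
    inner_smul_right, inner_sub_right, inner_smul_left, map_smul, map_neg, Complex.conj_I, neg_neg,
    h3]
  ring

theorem symbol_norm_le (h𝒜 : 𝒜.IsGradedLieAlgebra) (hK₀ : IsPositiveSelfAdjoint K₀) {m : ℝ}
    {f : symbols h𝒜 n} (hf : f ∈ ofOrder h𝒜 n m) (r : ℝ) : ∃ C : ℝ, 0 ≤ C ∧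
    ∀ θ (u : smoothVectors K₀),
      ‖(smoothPow hK₀ r ((f : (Fin n → ℝ) → SmoothEnd K₀) θ u) : H)‖ ≤
        C * ‖(smoothPow hK₀ (r + m) u : H)‖ := by
  obtain ⟨g, hg, hgf, -⟩ := hf
  obtain ⟨C, hC0, hC⟩ := h𝒜.norm_family_le hK₀ hg.bounded r
  refine ⟨C, hC0, fun θ u => ?_⟩
  have := hC θ u
  rwa [hgf] at this

/-- A symbol with leading part `K₀ ^ (2R)` is comparable with `K₀ ^ (2R)`. -/
theorem exists_abs_inner_sub_le (h𝒜 : 𝒜.IsGradedLieAlgebra) (hK₀ : IsPositiveSelfAdjoint K₀)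
    {R η : ℝ} (hR : 0 < R) (hη : 0 < η) {E : symbols h𝒜 n}
    (hE : E - constSymbol h𝒜 n (h𝒜.smoothPow_mem hK₀ (2 * R)) ∈ ofOrder h𝒜 n (2 * R - η)) :
    ∃ C : ℝ, 0 ≤ C ∧ ∀ θ (u : smoothVectors K₀),
      |(inner ℂ (u : H) ((E : (Fin n → ℝ) → SmoothEnd K₀) θ u : H)).re -
        ‖(smoothPow hK₀ R u : H)‖ ^ 2| ≤
      1 / 2 * ‖(smoothPow hK₀ R u : H)‖ ^ 2 + C * ‖(u : H)‖ ^ 2 := by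
  -- The error of order 2R - η is divided equally between the two sides of the inner product and so
  -- is bounded by ‖K₀^(R - η/2) u‖², an intermediate norm. The small factor 1/(2(C + 1)) below lets
  -- half of ‖K₀^R u‖² absorb it.
  obtain ⟨C, hC0, hC⟩ := symbol_norm_le h𝒜 hK₀ hE (-(R - η / 2))
  obtain ⟨D, hD0, hD⟩ := exists_norm_sq_smoothPow_le hK₀ (show R - η / 2 < R by linarith) hR
    (show 0 < 1 / (2 * (C + 1)) by positivity)
  refine ⟨C * D, mul_nonneg hC0 hD0, fun θ u => ?_⟩
  set S := (E - constSymbol h𝒜 n (h𝒜.smoothPow_mem hK₀ (2 * R)) : symbols h𝒜 n) with hS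
  have h1 : ((E : (Fin n → ℝ) → SmoothEnd K₀) θ u : H) =
      (smoothPow hK₀ R (smoothPow hK₀ R u) : H) + ((S : (Fin n → ℝ) → SmoothEnd K₀) θ u : H) := by
    have h2 : (S : (Fin n → ℝ) → SmoothEnd K₀) θ =
      (E : (Fin n → ℝ) → SmoothEnd K₀) θ - smoothPow hK₀ (2 * R) := rfl
    rw [h2, LinearMap.sub_apply, AddSubgroupClass.coe_sub, smoothPow_add_apply, ← two_mul]
    abel
  have h3 : (inner ℂ (u : H) (smoothPow hK₀ R (smoothPow hK₀ R u) : H)).re =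
      ‖(smoothPow hK₀ R u : H)‖ ^ 2 := by
    rw [← inner_smoothPow]
    exact inner_self_eq_norm_sq (𝕜 := ℂ) _
  have h4 : inner ℂ (u : H) ((S : (Fin n → ℝ) → SmoothEnd K₀) θ u : H) =
      inner ℂ (smoothPow hK₀ (R - η / 2) u : H)
        (smoothPow hK₀ (-(R - η / 2)) ((S : (Fin n → ℝ) → SmoothEnd K₀) θ u) : H) := by
    rw [inner_smoothPow, smoothPow_add_apply, add_neg_cancel, smoothPow_zero]
    rfl
  rw [h1, inner_add_right, Complex.add_re, h3, add_sub_cancel_left, h4]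
  refine (Complex.abs_re_le_norm _).trans ((norm_inner_le_norm (𝕜 := ℂ) _ _).trans ?_)
  have h5 := hC θ u
  rw [show -(R - η / 2) + (2 * R - η) = R - η / 2 by ring] at h5
  have h6 := hD u
  calc _ ≤ ‖(smoothPow hK₀ (R - η / 2) u : H)‖ * (C * ‖(smoothPow hK₀ (R - η / 2) u : H)‖) := by
        gcongr
    _ = C * ‖(smoothPow hK₀ (R - η / 2) u : H)‖ ^ 2 := by ring
    _ ≤ C * (1 / (2 * (C + 1)) * ‖(smoothPow hK₀ R u : H)‖ ^ 2 + D * ‖(u : H)‖ ^ 2) := by gcongr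
    _ = C / (C + 1) * (1 / 2 * ‖(smoothPow hK₀ R u : H)‖ ^ 2) + C * D * ‖(u : H)‖ ^ 2 := by
        field_simp
    _ ≤ _ := by
        have : C / (C + 1) ≤ 1 := by rw [div_le_one (by positivity)]; linarith
        have h7 := mul_le_mul_of_nonneg_right this
          (show 0 ≤ 1 / 2 * ‖(smoothPow hK₀ R u : H)‖ ^ 2 by positivity)
        linarith

/-- If a symbol with leading part `K₀ ^ (2R)` is conserved up to a bounded operator, then the norm of
`ℋ^R` grows at most like the square root of the time. -/
theorem IsTameFamily.norm_sq_evolution_le (h𝒜 : 𝒜.IsGradedLieAlgebra) {ω : Fin n → ℝ}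
    {A : symbols h𝒜 n}
    (hh : IsTameFamily hK₀ fun t => (A : (Fin n → ℝ) → SmoothEnd K₀) (t • ω))
    {R η : ℝ} (hR : 0 < R) (hη : 0 < η) {E : symbols h𝒜 n}
    (hE : E - constSymbol h𝒜 n (h𝒜.smoothPow_mem hK₀ (2 * R)) ∈ ofOrder h𝒜 n (2 * R - η))
    (hAE : liouville hK₀ ω A E ∈ ofOrder h𝒜 n 0) : ∃ C : ℝ, 0 < C ∧ ∀ t s (u : smoothVectors K₀),
    ‖(smoothPow hK₀ R (hh.evolution t s u) : H)‖ ^ 2 ≤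
      C * (1 + |t - s|) * ‖(smoothPow hK₀ R u : H)‖ ^ 2 := by
  obtain ⟨C₁, hC₁, h1⟩ := exists_abs_inner_sub_le h𝒜 hK₀ hR hη hE
  obtain ⟨C₀, hC₀, h0⟩ := symbol_norm_le h𝒜 hK₀ hAE 0
  obtain ⟨C₂, hC₂, h2⟩ := norm_smoothPow_le hK₀ hR.le
  simp only [smoothPow_zero, add_zero, Module.End.one_apply] at h0 h2
  -- From ‖·‖_R²/2 - C₁‖·‖² ≤ φ ≤ (3/2)‖·‖_R² + C₁‖·‖² at the two times, with φ changing by at most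
  -- C₀|t - s|‖u‖²; C₂ compares the norms of H and ℋ^R.
  refine ⟨3 + (4 * C₁ + 2 * C₀) * C₂ ^ 2, by positivity, fun t s u => ?_⟩
  -- The real part is taken because E is not assumed to be symmetric.
  set φ : ℝ → ℝ := fun t => (inner ℂ (hh.evolution t s u : H)
    ((E : (Fin n → ℝ) → SmoothEnd K₀) (t • ω) (hh.evolution t s u) : H)).re with hφ
  have hd : ∀ t, HasDerivAt φ (inner ℂ (hh.evolution t s u : H)
      ((liouville hK₀ ω A E : (Fin n → ℝ) → SmoothEnd K₀) (t • ω)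
        (hh.evolution t s u) : H)).re t := fun t =>
    Complex.reCLM.hasFDerivAt.comp_hasDerivAt t (hh.hasDerivAt_inner h𝒜 E t s u)
  have hle : |φ t - φ s| ≤ C₀ * ‖(u : H)‖ ^ 2 * |t - s| := by
    have h3 := convex_univ.norm_image_sub_le_of_norm_hasDerivWithin_le (𝕜 := ℝ)
      (f := φ) (C := C₀ * ‖(u : H)‖ ^ 2) (fun x _ => (hd x).hasDerivWithinAt) (fun x _ => ?_)
      (Set.mem_univ s) (Set.mem_univ t)
    · simpa [Real.norm_eq_abs] using h3
    · rw [Real.norm_eq_abs]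
      refine (Complex.abs_re_le_norm _).trans ((norm_inner_le_norm (𝕜 := ℂ) _ _).trans ?_)
      have h4 := h0 (x • ω) (hh.evolution x s u)
      rw [hh.norm_evolution] at h4 ⊢
      calc _ ≤ ‖(u : H)‖ * (C₀ * ‖(u : H)‖) := by gcongr
        _ = _ := by ring
  have h5 := abs_le.1 (h1 (t • ω) (hh.evolution t s u))
  have h6 := abs_le.1 (h1 (s • ω) u)
  have h7 := abs_le.1 hle
  have h8 : φ s = (inner ℂ (u : H) ((E : (Fin n → ℝ) → SmoothEnd K₀) (s • ω) u : H)).re := by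
    rw [hφ]
    dsimp only
    rw [hh.evolution_self]
  rw [← h8] at h6
  rw [hh.norm_evolution] at h5
  change _ ≤ φ t - _ ∧ φ t - _ ≤ _ at h5
  have h9 : ‖(u : H)‖ ^ 2 ≤ C₂ ^ 2 * ‖(smoothPow hK₀ R u : H)‖ ^ 2 := by
    rw [← mul_pow]
    have := h2 u
    gcongr
  set X := ‖(smoothPow hK₀ R u : H)‖ ^ 2 with hX
  have hX0 : 0 ≤ X := by positivity
  set T := |t - s|
  have hT : 0 ≤ T := abs_nonneg _
  have h10 : ‖(smoothPow hK₀ R (hh.evolution t s u) : H)‖ ^ 2 ≤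
      3 * X + (4 * C₁ + 2 * C₀ * T) * ‖(u : H)‖ ^ 2 := by linarith
  have h11 : (4 * C₁ + 2 * C₀ * T) * ‖(u : H)‖ ^ 2 ≤
      (4 * C₁ + 2 * C₀ * T) * (C₂ ^ 2 * X) := by gcongr
  have h12 : 0 ≤ 3 * T * X + (4 * C₁ * T + 2 * C₀) * (C₂ ^ 2 * X) := by positivity
  linarith

end Energy
end SobolevGrowth
end

noncomputable section
namespace SobolevGrowth
variable {H : Type*} [NormedAddCommGroup H] [InnerProductSpace ℂ H] [CompleteSpace H]

/-! ### Interpolation -/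

section Interpolation

theorem conj_rpow {U : H →L[ℂ] H} (hU : U ∈ unitary (H →L[ℂ] H)) {a : H →L[ℂ] H} (ha : 0 ≤ a) {p : ℝ}
    (hp : 0 ≤ p) : (U * a * star U) ^ p = U * a ^ p * star U := by
  have h0 : 0 ≤ U * a * star U := star_right_conjugate_nonneg ha U
  rw [CFC.rpow_eq_cfc_real h0, CFC.rpow_eq_cfc_real ha]
  have h1 : Continuous (Unitary.conjStarAlgAut ℂ (H →L[ℂ] H) ⟨U, hU⟩) := by
    change Continuous fun x : H →L[ℂ] H => U * x * star U
    fun_prop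
  exact (StarAlgHomClass.map_cfc (R := ℝ) (S := ℂ) (Unitary.conjStarAlgAut ℂ (H →L[ℂ] H) ⟨U, hU⟩)
    (fun x : ℝ => x ^ p) a (Real.continuous_rpow_const hp).continuousOn h1 (IsSelfAdjoint.of_nonneg ha)
    (IsSelfAdjoint.of_nonneg h0)).symm

theorem smul_rpow {a : H →L[ℂ] H} (ha : 0 ≤ a) {c p : ℝ} (hc : 0 ≤ c) (hp : 0 ≤ p) :
    (c • a) ^ p = c ^ p • a ^ p := by
  rw [CFC.rpow_eq_cfc_real (smul_nonneg hc ha), CFC.rpow_eq_cfc_real ha,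
    ← cfc_smul (c ^ p) (fun x : ℝ => x ^ p) a (Real.continuous_rpow_const hp).continuousOn,
    ← cfc_comp_smul c (fun x : ℝ => x ^ p) a (Real.continuous_rpow_const hp).continuousOn]
  refine cfc_congr fun x hx => ?_
  exact Real.mul_rpow hc (spectrum_nonneg_of_nonneg ha hx)

variable {K₀ : H →ₗ.[ℂ] H} {hK₀ : IsPositiveSelfAdjoint K₀} {h : ℝ → SmoothEnd K₀}

theorem re_inner_rpow (hK₀ : IsPositiveSelfAdjoint K₀) {r : ℝ} (hr : 0 ≤ r) (x : H) :
    (inner ℂ ((boundedInverse K₀ ^ (2 * r)) x) x).re = ‖(boundedInverse K₀ ^ r) x‖ ^ 2 := by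
  rw [two_mul, rpow_add_apply hK₀ hr hr, inner_rpow hK₀]
  exact inner_self_eq_norm_sq (𝕜 := ℂ) _

theorem nonneg_rpow (K₀ : H →ₗ.[ℂ] H) (r : ℝ) :
    (0 : H →L[ℂ] H) ≤ boundedInverse K₀ ^ r := CFC.rpow_nonneg

namespace IsTameFamily

variable (hh : IsTameFamily hK₀ h)
include hh

theorem star_propagator (t s : ℝ) : star (hh.propagator t s) = hh.propagator s t := by
  refine ContinuousLinearMap.ext fun ψ => ext_inner_left ℂ fun φ => ?_
  rw [ContinuousLinearMap.star_eq_adjoint, ContinuousLinearMap.adjoint_inner_right,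
    hh.inner_propagator]

theorem propagator_mem_unitary (t s : ℝ) : hh.propagator t s ∈ unitary (H →L[ℂ] H) := by
  rw [Unitary.mem_iff, star_propagator, propagator_comp, propagator_comp, propagator_self,
    propagator_self]
  exact ⟨rfl, rfl⟩

/-- Duality: a bound for U(t, s) on ℋ^R is a bound for its adjoint U(s, t) on the dual scale ℋ^(-R),
where norms are expressed by bounded powers. -/
theorem norm_rpow_propagator_le {R : ℝ} (hR : 0 ≤ R) {M t s : ℝ} (hM : 0 ≤ M)
    (h : ∀ ψ, ‖hh.propagatorConj R t s ψ‖ ≤ M * ‖ψ‖) (φ : H) :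
    ‖(boundedInverse K₀ ^ R) (hh.propagator s t φ)‖ ≤ M * ‖(boundedInverse K₀ ^ R) φ‖ := by
  set η := (boundedInverse K₀ ^ R) (hh.propagator s t φ) with hη
  have h1 : ‖η‖ ^ 2 = (inner ℂ ((boundedInverse K₀ ^ R) φ) (hh.propagatorConj R t s η)).re := by
    rw [inner_rpow hK₀, ← propagator_rpow hh hR, ← inner_propagator, ← inner_rpow hK₀, ← hη]
    exact (inner_self_eq_norm_sq (𝕜 := ℂ) η).symm
  have h2 := (Complex.re_le_norm _).trans (norm_inner_le_norm (𝕜 := ℂ)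
    ((boundedInverse K₀ ^ R) φ) (hh.propagatorConj R t s η))
  rw [← h1] at h2
  have h3 : ‖η‖ * ‖η‖ ≤ M * ‖(boundedInverse K₀ ^ R) φ‖ * ‖η‖ := by
    calc ‖η‖ * ‖η‖ = ‖η‖ ^ 2 := (sq _).symm
      _ ≤ _ := h2
      _ ≤ ‖(boundedInverse K₀ ^ R) φ‖ * (M * ‖η‖) := by gcongr; exact h η
      _ = _ := by ring
  rcases (norm_nonneg η).eq_or_lt with h0 | h0
  · rw [← h0]; positivity
  · exact le_of_mul_le_mul_right h3 h0

theorem norm_propagatorConj_le_of_dual {r : ℝ} (hr : 0 ≤ r) {M t s : ℝ} (hM : 0 ≤ M)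
    (h : ∀ φ, ‖(boundedInverse K₀ ^ r) (hh.propagator s t φ)‖ ≤
      M * ‖(boundedInverse K₀ ^ r) φ‖) (ψ : H) :
    ‖hh.propagatorConj r t s ψ‖ ≤ M * ‖ψ‖ := by
  have h1 : ∀ φ : H, ‖inner ℂ φ (hh.propagatorConj r t s ψ)‖ ≤ M * ‖ψ‖ * ‖φ‖ := by
    intro φ
    refine (dense_smoothVectors hK₀).induction (P := fun φ =>
      ‖inner ℂ φ (hh.propagatorConj r t s ψ)‖ ≤ M * ‖ψ‖ * ‖φ‖) (fun φ hφ => ?_)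
      (isClosed_le (by fun_prop) (by fun_prop)) φ
    obtain ⟨χ, rfl⟩ := mem_smoothVectors'.1 hφ r hr
    rw [inner_rpow hK₀, ← propagator_rpow hh hr, ← inner_propagator, ← inner_rpow hK₀]
    refine (norm_inner_le_norm (𝕜 := ℂ) _ _).trans ?_
    calc _ ≤ M * ‖(boundedInverse K₀ ^ r) χ‖ * ‖ψ‖ := by gcongr; exact h χ
      _ = _ := by ring
  have h2 := (Complex.re_le_norm _).trans (h1 (hh.propagatorConj r t s ψ))
  have h3 := inner_self_eq_norm_sq (𝕜 := ℂ) (hh.propagatorConj r t s ψ)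
  change (inner ℂ _ _).re = _ at h3
  rw [h3, pow_two] at h2
  rcases (norm_nonneg (hh.propagatorConj r t s ψ)).eq_or_lt with h0 | h0
  · rw [← h0]; positivity
  · exact le_of_mul_le_mul_right h2 h0

/-- Interpolation between `H` and `ℋ^R`, by the Löwner–Heinz inequality. -/
theorem norm_propagatorConj_interpolate {r R : ℝ} (hr : 0 ≤ r) (hrR : r ≤ R) (hR : 0 < R) {M t s : ℝ}
    (hM : 0 ≤ M) (h : ∀ ψ, ‖hh.propagatorConj R t s ψ‖ ≤ M * ‖ψ‖) (ψ : H) :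
    ‖hh.propagatorConj r t s ψ‖ ≤ M ^ (r / R) * ‖ψ‖ := by
  refine hh.norm_propagatorConj_le_of_dual hr (Real.rpow_nonneg hM _) (fun φ => ?_) ψ
  set T := boundedInverse K₀ with hT
  set U := hh.propagator t s with hU
  have hp : 0 ≤ r / R := by positivity
  have hp1 : r / R ≤ 1 := (div_le_one hR).2 hrR
  have e : ∀ {q : ℝ}, 0 ≤ q → ∀ x, (inner ℂ ((U * T ^ (2 * q) * star U) x) x).re =
      ‖(T ^ q) (hh.propagator s t x)‖ ^ 2 := by
    intro q hq x
    rw [← re_inner_rpow hK₀ hq, star_propagator]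
    change (inner ℂ (U ((T ^ (2 * q)) (hh.propagator s t x))) x).re = _
    rw [hU, inner_propagator]
  -- The dual bound as an operator inequality. Raising it to the power r/R ∈ [0, 1] is allowed by
  -- Löwner–Heinz, and unitary conjugation commutes with powers, so the inequality with exponent 2r
  -- results.
  have h1 : U * T ^ (2 * R) * star U ≤ (M ^ 2) • T ^ (2 * R) := by
    rw [ContinuousLinearMap.le_def, ContinuousLinearMap.isPositive_iff_complex]
    have hsa : IsSelfAdjoint ((M ^ 2) • T ^ (2 * R) - U * T ^ (2 * R) * star U) :=
      (IsSelfAdjoint.of_nonneg (smul_nonneg (sq_nonneg M) (nonneg_rpow K₀ _))).sub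
        (IsSelfAdjoint.of_nonneg (star_right_conjugate_nonneg (nonneg_rpow K₀ _) U))
    intro x
    have hre : 0 ≤ (inner ℂ (((M ^ 2) • T ^ (2 * R) - U * T ^ (2 * R) * star U) x) x).re := by
      rw [sub_apply, inner_sub_left, Complex.sub_re, e hR.le, smul_apply, inner_smul_left_eq_smul,
        Complex.smul_re, smul_eq_mul, re_inner_rpow hK₀ hR.le, sub_nonneg, ← mul_pow]
      have := hh.norm_rpow_propagator_le hR.le hM h x
      gcongr
    refine ⟨?_, hre⟩
    have := (ContinuousLinearMap.isSelfAdjoint_iff_isSymmetric.1 hsa).conj_inner_sym x x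
    exact Complex.conj_eq_iff_re.1 this
  have h2 := CFC.rpow_le_rpow ⟨hp, hp1⟩ h1
  have h3 : 2 * R * (r / R) = 2 * r := by field_simp
  rw [conj_rpow (hh.propagator_mem_unitary t s) (nonneg_rpow K₀ _) hp,
    smul_rpow (nonneg_rpow K₀ _) (sq_nonneg M) hp,
    CFC.rpow_rpow_of_exponent_nonneg _ _ _ (by positivity) hp (boundedInverse_nonneg hK₀), h3] at h2
  have h4 := ((ContinuousLinearMap.le_def _ _).1 h2).re_inner_nonneg_left φ
  change 0 ≤ (inner ℂ _ _).re at h4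
  rw [sub_apply, inner_sub_left, Complex.sub_re, e hr, smul_apply, inner_smul_left_eq_smul,
    Complex.smul_re, smul_eq_mul, re_inner_rpow hK₀ hr, sub_nonneg] at h4
  have h5 : (M ^ 2) ^ (r / R) = (M ^ (r / R)) ^ 2 := by
    rw [← Real.rpow_natCast, ← Real.rpow_natCast, ← Real.rpow_mul hM, ← Real.rpow_mul hM, mul_comm]
  rw [h5, ← mul_pow] at h4
  exact (pow_le_pow_iff_left₀ (norm_nonneg _)
    (mul_nonneg (Real.rpow_nonneg hM _) (norm_nonneg _)) two_ne_zero).1 h4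

/-- If the norm of `ℋ^R` grows at most like the square root of the time for all large `R`, then the
norm of `ℋ^r` grows at most like every power of the time. -/
theorem sobolevNorm_propagator_le (h : ∀ R : ℕ, 0 < R → ∃ C : ℝ, 0 < C ∧
    ∀ t s (u : smoothVectors K₀), ‖(smoothPow hK₀ R (hh.evolution t s u) : H)‖ ^ 2 ≤
      C * (1 + |t - s|) * ‖(smoothPow hK₀ R u : H)‖ ^ 2) {r : ℝ} (hr : 0 < r) {ε : ℝ}
    (hε : 0 < ε) : ∃ C : ℝ, 0 < C ∧ ∀ t s : ℝ, ∀ ψ ∈ (kpow K₀ r).domain,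
      sobolevNorm K₀ r (hh.propagator t s ψ) ≤
        C * Real.sqrt (1 + (t - s) ^ 2) ^ ε * sobolevNorm K₀ r ψ := by
  -- R ≥ r permits the interpolation, and R ≥ r/(2ε) brings the exponent r/(2R) below ε.
  obtain ⟨R, hRr⟩ := exists_nat_ge (max r (r / (2 * ε)))
  have hrR : r ≤ R := (le_max_left _ _).trans hRr
  have hR : (0 : ℝ) < R := hr.trans_le hrR
  have hεR : r / R / 2 ≤ ε := by
    have h1 := (le_max_right _ _).trans hRr
    rw [div_le_iff₀ (by positivity)] at h1
    rw [div_div, div_le_iff₀ (by positivity)]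
    linarith
  obtain ⟨C, hC0, hC⟩ := h R (by exact_mod_cast hR)
  refine ⟨(2 * C) ^ (r / R / 2), by positivity, fun t s ψ hψ => ?_⟩
  obtain ⟨χ, rfl⟩ := (mem_domain_kpow hr.le).1 hψ
  set Y := Real.sqrt (1 + (t - s) ^ 2) with hY
  have hY1 : 1 ≤ Y := Real.one_le_sqrt.2 (by nlinarith [sq_nonneg (t - s)])
  have hYt : |t - s| ≤ Y := Real.abs_le_sqrt (by linarith)
  -- Both 1 and |t - s| are at most Y, so C(1 + |t - s|) ≤ 2CY = M².
  set M := Real.sqrt (2 * C * Y) with hM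
  have hb : ∀ ψ, ‖hh.propagatorConj R t s ψ‖ ≤ M * ‖ψ‖ := by
    refine fun ψ => (dense_smoothVectors hK₀).induction (P := fun ψ =>
      ‖hh.propagatorConj R t s ψ‖ ≤ M * ‖ψ‖) (fun ψ hψ => ?_)
      (isClosed_le (by fun_prop) (by fun_prop)) ψ
    have h1 := hh.propagatorConj_coe R t s ⟨ψ, hψ⟩
    have h2 := hC t s (smoothPow hK₀ (-R) ⟨ψ, hψ⟩)
    rw [← h1, smoothPow_add_apply, add_neg_cancel, smoothPow_zero] at h2
    change ‖hh.propagatorConj R t s ψ‖ ^ 2 ≤ _ * ‖ψ‖ ^ 2 at h2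
    refine (pow_le_pow_iff_left₀ (norm_nonneg _) (by positivity) two_ne_zero).1 (h2.trans ?_)
    rw [mul_pow, hM, Real.sq_sqrt (by positivity)]
    have : C * (1 + |t - s|) ≤ 2 * C * Y := by nlinarith
    gcongr
  have h3 := hh.norm_propagatorConj_interpolate hr.le hrR hR (Real.sqrt_nonneg _) hb χ
  rw [sobolevNorm, sobolevNorm, hh.propagator_rpow hr.le, kpowApply_rpow hK₀ hr.le,
    kpowApply_rpow hK₀ hr.le]
  refine h3.trans (mul_le_mul_of_nonneg_right ?_ (norm_nonneg _))
  have h4 : M ^ (r / R) = (2 * C) ^ (r / R / 2) * Y ^ (r / R / 2) := by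
    rw [hM, Real.sqrt_eq_rpow, ← Real.rpow_mul (by positivity), Real.mul_rpow (by positivity)
      (by positivity), one_div, inv_mul_eq_div]
  rw [h4]
  exact mul_le_mul_of_nonneg_left (Real.rpow_le_rpow_of_exponent_le hY1 hεR) (by positivity)

end IsTameFamily

end Interpolation
end SobolevGrowth
end

noncomputable section
namespace SobolevGrowth
variable {H : Type*} [NormedAddCommGroup H] [InnerProductSpace ℂ H] [CompleteSpace H]

/-! ### Growth of Sobolev norms -/

section Growth

variable {K₀ : H →ₗ.[ℂ] H} {𝒜 : OperatorClasses K₀} {n : ℕ} {hK₀ : IsPositiveSelfAdjoint K₀}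

/-- Lipschitz dependence on time comes from the bounded derivative of W in the direction ω. -/
theorem OperatorClasses.IsGradedLieAlgebra.isTameFamily_quasiperiodic (h𝒜 : 𝒜.IsGradedLieAlgebra)
    (hK₀ : IsPositiveSelfAdjoint K₀) {a : SmoothEnd K₀} (ha : a ∈ 𝒜.cls 1) (hsymm : IsSymmetricOp a)
    {ρ : ℝ} (hρ : ρ ≤ 1) {W : (Fin n → ℝ) → 𝒜.cls ρ} (hW : IsBoundedSmooth (𝒜.seminorm ρ) W)
    (hWsymm : ∀ θ, IsSymmetricOp (W θ : SmoothEnd K₀)) (ω : Fin n → ℝ) :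
    IsTameFamily hK₀ fun t => a + (W (t • ω) : SmoothEnd K₀) := by
  set V : (Fin n → ℝ) → 𝒜.cls 1 := fun θ => ⟨a, ha⟩ + Submodule.inclusion (h𝒜.cls_mono hρ) (W θ)
  have hV : IsBoundedSmooth (𝒜.seminorm 1) V :=
    (IsBoundedSmooth.const (⟨a, ha⟩ : 𝒜.cls 1)).add (hW.map (h𝒜.isBoundedMap_inclusion hρ))
  obtain ⟨g, hg, hgb⟩ := hV.exists_deriv (fun x => h𝒜.eq_zero hK₀ x) ω
  refine h𝒜.isTameFamily hK₀ (f := fun t => V (t • ω)) (fun j => ?_) (fun j => ?_)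
    fun t => hsymm.add (hWsymm (t • ω))
  · obtain ⟨C, hC⟩ := hV.bounded j
    exact ⟨C, fun t => hC (t • ω)⟩
  · obtain ⟨C, hC0, hC⟩ := hg.lipschitz hV.bounded hgb.bounded j
    refine ⟨C, hC0, fun t t' => ?_⟩
    have h1 := hC (t' • ω) (t - t')
    rwa [← add_smul, add_sub_cancel] at h1

theorem smoothPow_one_pow (hK₀ : IsPositiveSelfAdjoint K₀) (M : ℕ) :
    smoothPow hK₀ 1 ^ M = smoothPow hK₀ M := by
  induction M with
  | zero => rw [pow_zero, Nat.cast_zero, smoothPow_zero]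
  | succ M ih => rw [pow_succ, ih, Nat.cast_succ, smoothPow_add]

theorem IsCommutingSystem.expOp_two_pi {d : ℕ} {K : Fin d → H →ₗ.[ℂ] H} {k : Fin d → SmoothEnd K₀}
    (hk : IsCommutingSystem 𝒜 k) (hkK : ∀ j, IsRestriction (k j) (K j)) {lam : Fin d → ℝ}
    (hspec : jointSpectrum K ⊆ {μ | ∃ a : Fin d → ℕ, ∀ j, μ j = a j + lam j}) {ν : Fin d → ℝ}
    (hν : dotOp ν k = smoothPow hk.pos 1) (j : Fin d) :
    hk.expOp ((2 * Real.pi) • Pi.single j (1 : ℝ)) =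
      Complex.exp (2 * Real.pi * Complex.I * lam j) • 1 := by
  have h1 : dotOp (Pi.single j (1 : ℝ)) k = k j := by
    rw [dotOp, Finset.sum_eq_single j]
    · rw [Pi.single_eq_same, Complex.ofReal_one, one_smul]
    · intro i _ hi
      rw [Pi.single_eq_of_ne hi, Complex.ofReal_zero, zero_smul]
    · exact fun h => absurd (Finset.mem_univ j) h
  have hX := hk.tame (Pi.single j 1)
  rw [h1] at hX
  rw [hk.expOp_smul, ← flow_two_pi hk.pos hkK hk.symm
    (fun i => hasOrder_of_mem hk.graded hk.pos (hk.mem i)) hk.comm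
    (fun i => by rw [← hν]; exact SobolevGrowth.commute_dotOp (fun l => hk.comm i l) ν) hspec j hX]
  congr 1

/-- The normal form is started with Z = 0, V = W and M = 2R. Since ν·K = K₀, the leading part of the
resulting energy is K₀^(2R), as the energy estimate requires. -/
theorem IsCommutingSystem.norm_sq_evolution_le {d : ℕ} {k : Fin d → SmoothEnd K₀}
    (hk : IsCommutingSystem 𝒜 k) {e : ℕ} {ω : Fin n → ℝ}
    {ν' : Fin e → ℝ} (hDio : IsDiophantine ω ν') {v : Fin e → Fin d → ℤ} {ν : Fin d → ℝ}
    (hv : ∀ j, ν j = ∑ i, ν' i * (v i j : ℝ)) {c : Fin d → ℂ}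
    (hper : ∀ j, hk.expOp ((2 * Real.pi) • Pi.single j (1 : ℝ)) = c j • 1)
    (hν : dotOp ν k = smoothPow hk.pos 1) {ρ : ℝ} (hρ : ρ < 1) {W : (Fin n → ℝ) → SmoothEnd K₀}
    (hW : W ∈ symbolClass 𝒜 n ρ) (hh : IsTameFamily hk.pos fun t => dotOp ν k + W (t • ω)) (R : ℕ)
    (hR : 0 < R) : ∃ C : ℝ, 0 < C ∧ ∀ t s (u : smoothVectors K₀),
      ‖(smoothPow hk.pos R (hh.evolution t s u) : H)‖ ^ 2 ≤
        C * (1 + |t - s|) * ‖(smoothPow hk.pos R u : H)‖ ^ 2 := by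
  have hη : 0 < 1 - ρ := sub_pos.2 hρ
  have hpow : dotOp ν k ^ (2 * R) = smoothPow hk.pos (2 * R) := by
    rw [hν, smoothPow_one_pow]
    push_cast
    rfl
  have hM : dotOp ν k ^ (2 * R) ∈ 𝒜.cls ((2 * R : ℕ) : ℝ) := by
    rw [hν, smoothPow_one_pow]
    exact hk.graded.smoothPow_mem hk.pos _
  -- The number of conjugations after which the order ρ has dropped to 1 - 2R.
  obtain ⟨N, hN⟩ := exists_nat_ge ((ρ - 1 + (2 * R : ℕ)) / (1 - ρ))
  rw [div_le_iff₀ hη] at hN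
  set V : symbols hk.graded n := ⟨W, ρ, hW⟩ with hV
  obtain ⟨E, hE, hLE⟩ := exists_normalForm (dotOp_mem hk.mem ν) (hk.isHomological hDio hv hper) hρ hM N
    le_rfl (by linarith) (Submodule.zero_mem (𝒜.cls ρ)) (Commute.zero_left _) (V := V) hW
  have hA : ∀ t : ℝ, ((constSymbol hk.graded n (dotOp_mem hk.mem ν) +
      constSymbol hk.graded n (Submodule.zero_mem (𝒜.cls ρ)) + V : symbols hk.graded n) :
      (Fin n → ℝ) → SmoothEnd K₀) (t • ω) = dotOp ν k + W (t • ω) := fun t => by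
    change dotOp ν k + 0 + W (t • ω) = _
    rw [add_zero]
  have hR' : (0 : ℝ) < R := by exact_mod_cast hR
  have hE' : E - constSymbol hk.graded n (hk.graded.smoothPow_mem hk.pos (2 * R)) ∈
      ofOrder hk.graded n (2 * R - (1 - ρ)) := by
    have h1 : constSymbol hk.graded n (hk.graded.smoothPow_mem hk.pos (2 * R)) =
        constSymbol hk.graded n hM := Subtype.ext (funext fun _ => hpow.symm)
    rw [h1]
    exact_mod_cast hE
  have hh' := hh
  simp only [← hA] at hh'
  obtain ⟨C, hC0, hC⟩ := hh'.norm_sq_evolution_le hk.graded hR' hη hE' hLE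
  refine ⟨C, hC0, fun t s u => ?_⟩
  have h1 := hC t s u
  -- The Hamiltonian with the summand Z = 0 equals the given one only propositionally, so the
  -- evolutions are identified by rewriting.
  have h2 : ∀ {f g : ℝ → SmoothEnd K₀} (hf : IsTameFamily hk.pos f) (hg : IsTameFamily hk.pos g),
      f = g → hf.evolution t s u = hg.evolution t s u := by
    rintro f g hf hg rfl
    rfl
  rwa [h2 hh' hh (funext hA)] at h1

end Growth
end SobolevGrowth
end

/-! ### The growth theorem -/

theorem mainTheorem2 {H : Type*} [NormedAddCommGroup H] [InnerProductSpace ℂ H] [CompleteSpace H]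
    -- the reference operator and the graded algebra
    (K₀ : H →ₗ.[ℂ] H) (hK₀ : SobolevGrowth.IsPositiveSelfAdjoint K₀)
    (𝒜 : SobolevGrowth.OperatorClasses K₀) (h𝒜 : 𝒜.IsGradedLieAlgebra)
    -- commuting positive self-adjoint operators `K j` in `𝒜_1`, with restrictions `k j` to `ℋ^∞`
    {d : ℕ} (K : Fin d → H →ₗ.[ℂ] H) (hK : ∀ j, IsSelfAdjoint (K j))
    (hKpos : ∀ j, ∀ ψ : (K j).domain, 0 ≤ (inner ℂ (ψ : H) (K j ψ)).re)
    (k : Fin d → SobolevGrowth.SmoothEnd K₀)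
    (hk : ∀ j, SobolevGrowth.IsRestriction (k j) (K j))
    (hk1 : ∀ j, k j ∈ 𝒜.cls 1)
    (hcomm : ∀ i j, k i * k j = k j * k i)
    (hEgorov : SobolevGrowth.HasEgorovProperty 𝒜 k)
    (lam : Fin d → ℝ) (hlam : ∀ j, 0 ≤ lam j)
    (hspec : SobolevGrowth.jointSpectrum K ⊆ {μ | ∃ a : Fin d → ℕ, ∀ j, μ j = a j + lam j})
    -- `K₀ = H₀ = ν · K`
    (ν : Fin d → ℝ) (hν : ∀ j, 0 < ν j)
    (hH₀ : SobolevGrowth.IsRestriction (SobolevGrowth.dotOp ν k) K₀)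
    -- `ν` in terms of a rationally independent vector `ν'`
    {e : ℕ} (he : e ≤ d) (ν' : Fin e → ℝ) (hν' : LinearIndependent ℚ ν')
    (v : Fin e → Fin d → ℤ) (hv : ∀ j, ν j = ∑ i, ν' i * (v i j : ℝ))
    -- the quasiperiodic perturbation `V(t) = W(ω t)`, with `W` on the torus `(ℝ/2πℤ)^n`
    {n : ℕ} (ω : Fin n → ℝ) (hDio : SobolevGrowth.IsDiophantine ω ν')
    (ρ : ℝ) (hρ : ρ < 1) (W : (Fin n → ℝ) → 𝒜.cls ρ)
    (hW : SobolevGrowth.IsSmoothBounded (𝒜.seminorm ρ) W)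
    (hWper : ∀ (θ : Fin n → ℝ) (i : Fin n), W (θ + Pi.single i (2 * Real.pi)) = W θ)
    (hWsymm : ∀ θ, SobolevGrowth.IsSymmetricOp (W θ : SobolevGrowth.SmoothEnd K₀)) :
    ∃ U : ℝ → ℝ → H →L[ℂ] H,
      SobolevGrowth.IsPropagator
        (fun t => SobolevGrowth.dotOp ν k + (W (t • ω) : SobolevGrowth.SmoothEnd K₀)) U ∧
      (∀ U' : ℝ → ℝ → H →L[ℂ] H,
        SobolevGrowth.IsPropagator
          (fun t => SobolevGrowth.dotOp ν k + (W (t • ω) : SobolevGrowth.SmoothEnd K₀)) U' →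
        U' = U) ∧
      ∀ r : ℝ, 0 < r → ∀ ε : ℝ, 0 < ε → ∃ C : ℝ, 0 < C ∧
        ∀ t s : ℝ, ∀ ψ ∈ (SobolevGrowth.kpow K₀ r).domain,
          SobolevGrowth.sobolevNorm K₀ r (U t s ψ) ≤
            C * Real.sqrt (1 + (t - s) ^ 2) ^ ε * SobolevGrowth.sobolevNorm K₀ r ψ := by
  have hsymm := fun j => (hk j).isSymmetricOp (hK j)
  have hsys : SobolevGrowth.IsCommutingSystem 𝒜 k := ⟨hK₀, h𝒜, hk1, hsymm, hcomm, hEgorov⟩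
  have hν1 := SobolevGrowth.dotOp_eq_smoothPow_one hK₀ hH₀
  have hWb := hW.isBoundedSmooth
  have hh := h𝒜.isTameFamily_quasiperiodic hK₀ (SobolevGrowth.dotOp_mem hk1 ν)
    (SobolevGrowth.isSymmetricOp_dotOp hsymm ν) hρ.le hWb hWsymm ω
  refine ⟨hh.propagator, hh.isPropagator, fun U' hU' =>
    SobolevGrowth.IsPropagator.unique hh hh.isPropagator hU', fun r hr ε hε =>
    hh.sobolevNorm_propagator_le (fun R hR => ?_) hr hε⟩
  exact hsys.norm_sq_evolution_le hDio hv (hsys.expOp_two_pi hk hspec hν1) hν1 hρ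
    (W := fun θ => (W θ : SobolevGrowth.SmoothEnd K₀))
    ⟨W, hWb, fun _ => rfl, fun θ i => congrArg Subtype.val (hWper θ i)⟩ hh R hR
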